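/- **Setting.** Let $\langle r\rangle\ge 2$ be a smooth radial function on $\mathbb R^3$ with $\langle r\rangle=r$ for large $r$, $r=|x|$. Let $M=\{(t,x):t\ge 0,\ |x|\ge R_0\}\subset\mathbb R^{1+3}$, $R_0\ge 0$, and let $g$ be a smooth Lorentzian metric on $M$ (signature $-+++$, smooth up to the boundary) such that: * (i) the slices $t=\mathrm{const}$ are space-like; * (ii) $g$ is asymptotically flat: $g=m+g_{sr}+g_{lr}$ with $m$ the Minkowski metric, $g_{lr}=h_{tt}(r)\,dt^2+h_{tr}(r)\,dt\,dr+h_{rr}(r)\,dr^2+h_{\omega\omega}(r)\,r^2d\omega^2$ with $h_{\cdot\cdot}\in S^Z(r^{-1})$, and $g_{sr}$ with Cartesian components in $S^Z(r^{-2})$. Here $a\in S^Z(r^k)$ means that $a$ is smooth on $M$ and $|Z_1\cdots Z_l\,a|\le c\,\langle r\rangle^k$ on $M$ for all finite words in $Z=\{\partial_t,\partial_i,\ x_i\partial_j-x_j\partial_i,\ S=t\partial_t+x\cdot\partial_x\}$, with $c$ depending on the word; * (iii) either $R_0=0$, or $R_0>0$ and the lateral boundary $\{r=R_0\}$ is space-like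 and outgoing. For a tensor field $T$ and a triplet $\Lambda=(i,j,k)$ ($i$ a word in the translations $\partial$, $j$ a word in the rotations $\Omega$, $k\in\mathbb N$), put $T^\Lambda=\mathcal L_{\partial^i}\mathcal L_{\Omega^j}\mathcal L_{S}^k T$ and $|\Lambda|=|i|+3|j|+9k$; a norm of $T^{\le m}$ is the sum of the norms of $T^\Lambda$ over $|\Lambda|\le m$. With $A_R=\{R\le\langle r\rangle<2R\}\cap\{|x|\ge R_0\}$, $R=2^n$, $n\ge 0$, and sums over Cartesian components, $$\|T(t_0)\|_{\mathcal{LE}}=\sum_{a}\sup_R\|\langle r\rangle^{-1/2}T_a(t_0,\cdot)\|_{L^2(A_R)},\qquad \|T(t_0)\|_{\mathcal{LE}^*}=\sum_{a}\sum_R\|\langle r\rangle^{1/2}T_a(t_0,\cdot)\|_{L^2(A_R)}.$$ The radial part $\overline F$ of a 2-form (resp. $\overline G$ of a 3-form) keeps only the spherical means of its coefficients along $dt\wedge dr$ and $d\omega^2$ (resp. $dt\wedge d\omega^2$ and $dr\wedge d\omega^2$); $\overline F^{\le m}$ means $(\overline F)^{\le m}$, and likewise for $G$. Let $d^0F=dF-dt\wedge\mathcal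 L_{\partial_t}F$, let $*$ be the Hodge star of $g$, and for a 2-form $F$ on $M$ put $$G^0_1=d^0F,\qquad G^0_2=d^0{*F}.$$ For $m\in\mathbb N$ and $t_0\ge 0$ let $\mathcal A_m(t_0)$ be the set of smooth 2-forms $F$ on $M$ with $$\|F^{\le m}(t_0)\|_{\mathcal{LE}}+\|\langle r\rangle\overline F^{\le m}(t_0)\|_{\mathcal{LE}}<\infty,\qquad \lim_{R\to\infty}\|1_{r>R}\,r\,\overline F^{\le m}(t_0)\|_{\mathcal{LE}}=0 .$$ **Lemma.** The following two estimates for all $F\in\mathcal A_m(t_0)$ are equivalent: $$(1)\quad \|F^{\le m}(t_0)\|_{\mathcal{LE}}+\|\langle r\rangle\overline F^{\le m}(t_0)\|_{\mathcal{LE}}\le C\sum_{i=1}^2\Big(\|G_i^{0,\le m}(t_0)\|_{\mathcal{LE}^*}+\|\langle r\rangle\overline{G^0_i}^{\le m}(t_0)\|_{\mathcal{LE}^*}\Big),$$ $$(2)\quad \|\langle r\rangle^{-1}F^{\le m}(t_0)\|_{\mathcal{LE}}+\|\langle r\rangle\overline F^{\le m}(t_0)\|_{\mathcal{LE}}\le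 C\sum_{i=1}^2\Big(\|\langle r\rangle^{-1}G_i^{0,\le m}(t_0)\|_{\mathcal{LE}^*}+\|\langle r\rangle\overline{G^0_i}^{\le m}(t_0)\|_{\mathcal{LE}^*}\Big).$$ Precisely: given $\langle r\rangle$, $g$ and $R_0$, for every $m$ and $C\geq 0$ there is $C'$ such that for every $t_0\ge 0$, if (1) holds at $t_0$ with constant $C$ for all $F\in\mathcal A_m(t_0)$, then (2) holds at $t_0$ with constant $C'$ for all $F\in\mathcal A_m(t_0)$, and conversely, with (1) and (2) exchanged. -/

import Mathlib

open MeasureTheory Filter Topology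
open scoped ENNReal NNReal ContDiff

noncomputable section

namespace Maxwell

/-! ## Coordinates, vector fields, covariant tensors -/

/-- Space `ℝ³` with the Euclidean norm `r = ‖x‖` and Lebesgue measure. -/
abbrev Space : Type := EuclideanSpace ℝ (Fin 3)

/-- Points `(t, x)` of `ℝ¹⁺³`. -/
abbrev Spacetime : Type := ℝ × Space

/-- The coordinates `x₀ = t, x₁, x₂, x₃`. -/
def coord (α : Fin 4) (p : Spacetime) : ℝ :=
  (Fin.cons p.1 (fun i : Fin 3 => p.2 i) : Fin 4 → ℝ) α

/-- The coordinate vectors of `ℝ¹⁺³`. -/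
def basisVec : Fin 4 → Spacetime :=
  Fin.cons (1, 0) (fun i : Fin 3 => (0, EuclideanSpace.single i 1))

/-- The partial derivative `∂_α f`. -/
def pd (α : Fin 4) (f : Spacetime → ℝ) : Spacetime → ℝ :=
  fun p => fderiv ℝ f p (basisVec α)

/-- The Kronecker symbol. -/
def kron (α β : Fin 4) : ℝ := if α = β then 1 else 0

/-- Vector fields, by their Cartesian components `X^α`. -/
abbrev VField : Type := Fin 4 → Spacetime → ℝ

/-- The translations `∂_μ`. -/
def translation (μ : Fin 4) : VField := fun α _ => kron α μ

/-- The three rotations `x_{k+1} ∂_{k+2} - x_{k+2} ∂_{k+1}` (spatial indices `k` mod 3). -/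
def rotation (k : Fin 3) : VField := fun α p =>
  coord (k + 1).succ p * kron α (k + 2).succ - coord (k + 2).succ p * kron α (k + 1).succ

/-- The scaling `S = t ∂_t + x ∂_x`. -/
def scaling : VField := fun α p => coord α p

/-- `X f = X^α ∂_α f`. -/
def VField.act (X : VField) (f : Spacetime → ℝ) : Spacetime → ℝ :=
  fun p => ∑ α, X α p * pd α f p

/-- Covariant tensor fields of rank `k`, by their Cartesian components. -/
abbrev Cov (k : ℕ) : Type := (Fin k → Fin 4) → Spacetime → ℝ

/-- The Lie derivative of a covariant tensor,
`(𝓛_X T)_a = X^γ ∂_γ T_a + ∑_s T_{a with a_s replaced by γ} ∂_{a_s} X^γ`. -/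
def lie {k : ℕ} (X : VField) (T : Cov k) : Cov k := fun a p =>
  ∑ γ, X γ p * pd γ (T a) p +
    ∑ s, ∑ γ, T (Function.update a s γ) p * pd (a s) (X γ) p

/-- A triplet `Λ = (i, j, k)`: a word `i` of translations, a word `j` of rotations and a power `k`
of the scaling. -/
structure MultiIndex where
  i : List (Fin 4)
  j : List (Fin 3)
  k : ℕ

/-- `|Λ| = |i| + 3 |j| + 9 k`. -/
def MultiIndex.weight (Λ : MultiIndex) : ℕ := Λ.i.length + 3 * Λ.j.length + 9 * Λ.k

/-- `T^Λ = 𝓛_{∂^i} 𝓛_{Ω^j} 𝓛_{S^k} T`. -/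
def lieIter {k : ℕ} (Λ : MultiIndex) (T : Cov k) : Cov k :=
  Λ.i.foldr (fun μ W => lie (translation μ) W)
    (Λ.j.foldr (fun l W => lie (rotation l) W) ((lie scaling)^[Λ.k] T))

/-! ## Forms -/

/-- The Levi-Civita symbol, `ε_{0123} = 1`. -/
def eps (a : Fin 4 → Fin 4) : ℝ := Matrix.det (Matrix.of fun i j => kron (a i) j)

/-- Exterior derivative of a 2-form. -/
def extD (F : Cov 2) : Cov 3 := fun a p =>
  pd (a 0) (F ![a 1, a 2]) p + pd (a 1) (F ![a 2, a 0]) p + pd (a 2) (F ![a 0, a 1]) p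

/-- `dt ∧ W` for a 2-form `W`. -/
def dtWedge (W : Cov 2) : Cov 3 := fun a p =>
  kron (a 0) 0 * W ![a 1, a 2] p + kron (a 1) 0 * W ![a 2, a 0] p +
    kron (a 2) 0 * W ![a 0, a 1] p

/-- The fixed time operator `d⁰ F = dF - dt ∧ 𝓛_{∂_t} F`. -/
def extD0 (F : Cov 2) : Cov 3 := fun a p =>
  extD F a p - dtWedge (lie (translation 0) F) a p

/-- Metrics, by the matrix `(g_{αβ})` in Cartesian coordinates. -/
abbrev Metric4 : Type := Spacetime → Matrix (Fin 4) (Fin 4) ℝ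

/-- The Hodge star on 2-forms,
`(*F)_{αβ} = ½ ε_{αβγδ} √(-det g) g^{γμ} g^{δν} F_{μν}`. -/
def hodge (g : Metric4) (F : Cov 2) : Cov 2 := fun a p =>
  (1 / 2) * ∑ γ, ∑ δ, ∑ μ, ∑ ν, eps ![a 0, a 1, γ, δ] * √(-(g p).det) *
    (g p)⁻¹ γ μ * (g p)⁻¹ δ ν * F ![μ, ν] p

/-! ## Radial parts -/

/-- The components of `∂_r` (equivalently of `dr`): `n_0 = 0`, `n_i = x_i / r`. -/
def normal (α : Fin 4) (p : Spacetime) : ℝ :=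
  (Fin.cons 0 (fun i : Fin 3 => p.2 i / ‖p.2‖) : Fin 4 → ℝ) α

/-- The zero spherical harmonic of `ψ`: its mean over the sphere of radius `r` at fixed `t`. -/
def sphMean (ψ : Spacetime → ℝ) : Spacetime → ℝ := fun p =>
  ⨍ θ : Metric.sphere (0 : Space) 1, ψ (p.1, ‖p.2‖ • (θ : Space))
    ∂((volume : Measure Space).toSphere)

/-- The 2-form `dt ∧ dr`. -/
def dtdr : Cov 2 := fun a p => kron (a 0) 0 * normal (a 1) p - normal (a 0) p * kron (a 1) 0

/-- The 2-form `r² dω²` (area form of the spheres, extended by zero to `∂_t`, `∂_r`), with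
components `ε_{ijk} x_k / r`. -/
def areaForm : Cov 2 := fun a p => ∑ γ, eps ![0, a 0, a 1, γ] * normal γ p

/-- `F_{tr} = F(∂_t, ∂_r)`. -/
def compTR (F : Cov 2) : Spacetime → ℝ := fun p => ∑ β, normal β p * F ![0, β] p

/-- `W(e_A, e_B)` for an oriented orthonormal frame `e_A, e_B` of the sphere of radius `r`. -/
def compAB (W : Cov 2) : Spacetime → ℝ := fun p =>
  (1 / 2) * ∑ α, ∑ β, areaForm ![α, β] p * W ![α, β] p

/-- The radial part of a 2-form: the zero harmonics of its `dt ∧ dr` and `dω²` coefficients. -/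
def radial2 (F : Cov 2) : Cov 2 := fun a p =>
  sphMean (compTR F) p * dtdr a p + sphMean (compAB F) p * areaForm a p

/-- The radial part of a 3-form: the zero harmonics of its `dt ∧ dω²` and `dr ∧ dω²` coefficients
(recall `r² dr ∧ dω² = dx₁ ∧ dx₂ ∧ dx₃`). -/
def radial3 (G : Cov 3) : Cov 3 := fun a p =>
  sphMean (compAB (fun b => G ![0, b 0, b 1])) p * dtWedge areaForm a p +
    sphMean (G ![1, 2, 3]) p * eps ![0, a 0, a 1, a 2]

/-! ## Local energy norms on a time slice -/

/-- `ρ` is an admissible bracket: `⟨r⟩ = ρ r` is a smooth radial function on `ℝ³` with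
`⟨r⟩ ≥ 2` and `⟨r⟩ = r` for large `r`. -/
structure IsBracket (ρ : ℝ → ℝ) : Prop where
  smooth : ContDiff ℝ ∞ (fun x : Space => ρ ‖x‖)
  two_le : ∀ r, 0 ≤ r → 2 ≤ ρ r
  eq_self : ∀ᶠ r in atTop, ρ r = r

/-- The dyadic shells `A_R`, `R = 2^n`, which partition `ℝ³`. -/
def shell (ρ : ℝ → ℝ) (n : ℕ) : Set Space := {x | 2 ^ n ≤ ρ ‖x‖ ∧ ρ ‖x‖ < 2 ^ (n + 1)}

/-- `sup_R ‖⟨r⟩^{-1/2} u‖_{L²(A_R)}`, over the part of the shells in the region `D`. -/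
def scalarLE (ρ : ℝ → ℝ) (D : Set Space) (u : Space → ℝ) : ℝ≥0∞ :=
  ⨆ n : ℕ, eLpNorm (fun x => ρ ‖x‖ ^ (-(1 / 2) : ℝ) * u x) 2 (volume.restrict (shell ρ n ∩ D))

/-- `∑_R ‖⟨r⟩^{1/2} u‖_{L²(A_R)}`, over the part of the shells in the region `D`. -/
def scalarLEstar (ρ : ℝ → ℝ) (D : Set Space) (u : Space → ℝ) : ℝ≥0∞ :=
  ∑' n : ℕ, eLpNorm (fun x => ρ ‖x‖ ^ (1 / 2 : ℝ) * u x) 2 (volume.restrict (shell ρ n ∩ D))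

/-- `‖⟨r⟩^s T^{≤ m}(t₀)‖_{LE}`, summed over components and over all `Λ` with `|Λ| ≤ m`. -/
def normLE {k : ℕ} (ρ : ℝ → ℝ) (D : Set Space) (s : ℤ) (m : ℕ) (t₀ : ℝ) (T : Cov k) : ℝ≥0∞ :=
  ∑' Λ : {Λ : MultiIndex // Λ.weight ≤ m}, ∑ a,
    scalarLE ρ D (fun x => ρ ‖x‖ ^ s * lieIter Λ.1 T a (t₀, x))

/-- `‖⟨r⟩^s T^{≤ m}(t₀)‖_{LE^*}`, summed over components and over all `Λ` with `|Λ| ≤ m`. -/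
def normLEstar {k : ℕ} (ρ : ℝ → ℝ) (D : Set Space) (s : ℤ) (m : ℕ) (t₀ : ℝ) (T : Cov k) :
    ℝ≥0∞ :=
  ∑' Λ : {Λ : MultiIndex // Λ.weight ≤ m}, ∑ a,
    scalarLEstar ρ D (fun x => ρ ‖x‖ ^ s * lieIter Λ.1 T a (t₀, x))

/-! ## The backgrounds -/

/-- The spatial region: `ℝ³ \ B(0, R₀)`, which is `ℝ³` for `R₀ = 0`. -/
def region (R₀ : ℝ) : Set Space := {x | R₀ ≤ ‖x‖}

/-- The space-time manifold `ℝ⁺ × (ℝ³ \ B(0, R₀))`. -/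
def manifold (R₀ : ℝ) : Set Spacetime := {p | 0 ≤ p.1 ∧ R₀ ≤ ‖p.2‖}

/-- The vector fields `Z = {∂, Ω, S}`. -/
inductive ZField where
  | trans (μ : Fin 4)
  | rot (k : Fin 3)
  | scal

/-- The vector field named by a generator. -/
def ZField.field : ZField → VField
  | .trans μ => translation μ
  | .rot k => rotation k
  | .scal => scaling

/-- The class `S^Z(r^s)`: smooth functions on the manifold with `|Z^w a| ≤ c_w ⟨r⟩^s` for all
words `w` in `Z`. -/
def SZ (ρ : ℝ → ℝ) (R₀ : ℝ) (s : ℤ) (a : Spacetime → ℝ) : Prop :=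
  (∀ p ∈ manifold R₀, ContDiffAt ℝ ∞ a p) ∧
    ∀ w : List ZField, ∃ c : ℝ, ∀ p ∈ manifold R₀,
      |w.foldr (fun X f => X.field.act f) a p| ≤ c * ρ ‖p.2‖ ^ s

/-- The Minkowski metric `diag(-1, 1, 1, 1)`. -/
def mink : Matrix (Fin 4) (Fin 4) ℝ := Matrix.diagonal ![-1, 1, 1, 1]

/-- The Cartesian components of
`h_tt(r) dt² + h_tr(r) dt dr + h_rr(r) dr² + h_ωω(r) r² dω²`. -/
def longRange (htt htr hrr hww : ℝ → ℝ) : Metric4 := fun p =>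
  Matrix.of fun α β =>
    htt ‖p.2‖ * (kron α 0 * kron β 0)
    + htr ‖p.2‖ * ((kron α 0 * normal β p + normal α p * kron β 0) / 2)
    + hrr ‖p.2‖ * (normal α p * normal β p)
    + hww ‖p.2‖ * (kron α β - kron α 0 * kron β 0 - normal α p * normal β p)

/-- `g = m + g_sr + g_lr` with `g_lr` stationary, spherically symmetric with `S^Z_rad(r⁻¹)`
coefficients, and `g_sr` with `S^Z(r⁻²)` coefficients. The polar form of `g_lr` has no meaning at
`r = 0`, where the identity is not imposed. -/
def AsymptoticallyFlat (ρ : ℝ → ℝ) (R₀ : ℝ) (g : Metric4) : Prop :=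
  ∃ (htt htr hrr hww : ℝ → ℝ) (gsr : Metric4),
    SZ ρ R₀ (-1) (fun p => htt ‖p.2‖) ∧ SZ ρ R₀ (-1) (fun p => htr ‖p.2‖) ∧
    SZ ρ R₀ (-1) (fun p => hrr ‖p.2‖) ∧ SZ ρ R₀ (-1) (fun p => hww ‖p.2‖) ∧
    (∀ α β, SZ ρ R₀ (-2) (fun p => gsr p α β)) ∧
    ∀ p ∈ manifold R₀, p.2 ≠ 0 → g p = mink + gsr p + longRange htt htr hrr hww p

/-- The lateral boundary `r = R₀` is space-like (`dr` is time-like there) and outgoing (`r`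
decreases along future directed causal curves, `t` being increasing along them). -/
def OutgoingSpacelikeBoundary (R₀ : ℝ) (g : Metric4) : Prop :=
  ∀ p ∈ manifold R₀, ‖p.2‖ = R₀ →
    (∑ α, ∑ β, (g p)⁻¹ α β * normal α p * normal β p) < 0 ∧
      0 < ∑ β, (g p)⁻¹ 0 β * normal β p

/-- The space-times under consideration: a smooth Lorentzian metric on the manifold, with space-like
time slices, asymptotically flat, and either on all of `ℝ⁺ × ℝ³` (`R₀ = 0`) or of black hole type
on the exterior of a ball. -/
structure IsBackground (ρ : ℝ → ℝ) (R₀ : ℝ) (g : Metric4) : Prop where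
  smooth : ∀ α β, ∀ p ∈ manifold R₀, ContDiffAt ℝ ∞ (fun q => g q α β) p
  symm : ∀ p ∈ manifold R₀, (g p).IsSymm
  lorentzian : ∀ p ∈ manifold R₀, ∃ P : Matrix (Fin 4) (Fin 4) ℝ, P.transpose * g p * P = mink
  slices_spacelike : ∀ p ∈ manifold R₀, ((g p).submatrix Fin.succ Fin.succ).PosDef
  asymptotically_flat : AsymptoticallyFlat ρ R₀ g
  regular_or_blackHole : R₀ = 0 ∨ (0 < R₀ ∧ OutgoingSpacelikeBoundary R₀ g)

/-! ## The two families of estimates -/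

/-- Smooth 2-forms on the manifold. -/
structure IsSmoothTwoForm (R₀ : ℝ) (F : Cov 2) : Prop where
  smooth : ∀ a, ∀ p ∈ manifold R₀, ContDiffAt ℝ ∞ (F a) p
  antisymm : ∀ α β, ∀ p ∈ manifold R₀, F ![α, β] p = -F ![β, α] p

/-- `F^{≤ m}(t₀) ∈ LE_Max`, together with the vanishing of the charges at infinity,
`lim_{R → ∞} ‖1_{r > R} r F̄^{≤ m}(t₀)‖_{LE} = 0` (recall that `⟨r⟩ = r` for large `r`). -/
structure Admissible (ρ : ℝ → ℝ) (R₀ : ℝ) (m : ℕ) (t₀ : ℝ) (F : Cov 2) : Prop where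
  finite : normLE ρ (region R₀) 0 m t₀ F < ⊤
  finite_radial : normLE ρ (region R₀) 1 m t₀ (radial2 F) < ⊤
  no_charge : Tendsto (fun R : ℝ => normLE ρ (region R₀ ∩ {x | R < ‖x‖}) 1 m t₀ (radial2 F))
    atTop (𝓝 0)

/-- The estimate, with constant `C`, for the system `d⁰ F = G₁`, `d⁰ * F = G₂` on the slice
`t = t₀`:
`‖⟨r⟩^s F^{≤m}‖_{LE} + ‖⟨r⟩ F̄^{≤m}‖_{LE}
  ≤ C ∑_i (‖⟨r⟩^s G_i^{≤m}‖_{LE^*} + ‖⟨r⟩ Ḡ_i^{≤m}‖_{LE^*})`. -/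
def ZeroResolventBound (ρ : ℝ → ℝ) (R₀ : ℝ) (g : Metric4) (s : ℤ) (m : ℕ) (C : ℝ≥0) (t₀ : ℝ) :
    Prop :=
  ∀ (F : Cov 2) (G : Fin 2 → Cov 3), IsSmoothTwoForm R₀ F → Admissible ρ R₀ m t₀ F →
    G 0 = extD0 F → G 1 = extD0 (hodge g F) →
    normLE ρ (region R₀) s m t₀ F + normLE ρ (region R₀) 1 m t₀ (radial2 F) ≤
      C * ∑ i, (normLEstar ρ (region R₀) s m t₀ (G i) +
        normLEstar ρ (region R₀) 1 m t₀ (radial3 (G i)))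

end Maxwell

end

noncomputable section

namespace Maxwell

open Finset Real
open Metric (sphere ball closedBall)
open Set (EqOn mem_ofPred_eq)
open ENNReal (ofReal ofReal_le_ofReal ofReal_mul ofReal_add)
open Matrix (cons_val_zero cons_val_one)
open Fin (sum_univ_three sum_univ_succ sum_univ_four)
open Function (iterate_succ_apply' update)

local notation "Scalar" => Spacetime → ℝ
local notation "S²" => sphere (0 : Space) 1

variable {b τ : ℝ} {p : Spacetime} {x : Space} {f g : Scalar} {k m n : ℕ} {s s' : ℤ} {F W : Cov 2} {T T' : Cov k}

section

variable {u v w : ℝ}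

lemma mul_le_left (h : u ≤ v) (hw : 0 ≤ w) : w * u ≤ w * v := mul_le_mul_of_nonneg_left h hw

lemma mul_le_right (h : u ≤ v) (hw : 0 ≤ w) : u * w ≤ v * w := mul_le_mul_of_nonneg_right h hw

lemma two_pow_le {i j : ℕ} (h : i ≤ j) : (2 : ℝ) ^ i ≤ 2 ^ j := pow_le_pow_right₀ one_le_two h

lemma le_sum_univ {ι : Type*} [Fintype ι] {u : ι → ℝ} (h : ∀ i, 0 ≤ u i) (i : ι) : u i ≤ ∑ i, u i :=
  single_le_sum (fun i _ => h i) (mem_univ i)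

end

/-! ## Calculus on the exterior region -/

/-- The exterior space-time region `t ≥ 0`, `r > b`. -/
def outer (b : ℝ) : Set Spacetime := Set.Ici 0 ×ˢ {x | b < ‖x‖}

lemma mem_outer : p ∈ outer b ↔ 0 ≤ p.1 ∧ b < ‖p.2‖ := Iff.rfl

/-- Functions which are smooth at every point of the exterior region. -/
def SmoothOuter (b : ℝ) (f : Scalar) : Prop := ∀ p ∈ outer b, ContDiffAt ℝ ∞ f p

lemma isOpen_norm_gt (b : ℝ) : IsOpen {x : Space | b < ‖x‖} := isOpen_lt continuous_const continuous_norm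

lemma uniqueDiffOn_outer (b : ℝ) : UniqueDiffOn ℝ (outer b) :=
  (uniqueDiffOn_Ici 0).prod (isOpen_norm_gt b).uniqueDiffOn

lemma smooth_diff (h : ContDiffAt ℝ ∞ f p) : DifferentiableAt ℝ f p := h.differentiableAt (by simp)

lemma pd_congr_outer (hf : SmoothOuter b f) (hg : SmoothOuter b g) (h : EqOn f g (outer b)) (α : Fin 4) :
    EqOn (pd α f) (pd α g) (outer b) := by
  intro p hp
  have hu := uniqueDiffOn_outer b p hp
  unfold pd
  rw [← fderivWithin_eq_fderiv hu (smooth_diff (hf p hp)),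
    ← fderivWithin_eq_fderiv hu (smooth_diff (hg p hp)),
    fderivWithin_congr h (h hp)]

lemma pd_add (hf : DifferentiableAt ℝ f p) (hg : DifferentiableAt ℝ g p) (α : Fin 4) : pd α (fun q => f q +
    g q) p = pd α f p + pd α g p := by
  simp [pd, fderiv_fun_add hf hg]

lemma pd_sub (hf : DifferentiableAt ℝ f p) (hg : DifferentiableAt ℝ g p) (α : Fin 4) :
    pd α (fun q => f q - g q) p = pd α f p - pd α g p := by
  simp [pd, fderiv_fun_sub hf hg]

lemma pd_mul (hf : DifferentiableAt ℝ f p) (hg : DifferentiableAt ℝ g p) (α : Fin 4) : pd α (fun q => f q *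
    g q) p = pd α f p * g p + f p * pd α g p := by
  simp [pd, fderiv_fun_mul hf hg]; ring

lemma pd_const (α : Fin 4) (c : ℝ) (p : Spacetime) : pd α (fun _ => c) p = 0 := by simp [pd]

lemma pd_const_mul (hg : DifferentiableAt ℝ g p) (c : ℝ) (α : Fin 4) : pd α (fun q => c * g q) p = c *
    pd α g p := by
  rw [pd_mul (by fun_prop) hg, pd_const]; simp

lemma pd_neg (f : Scalar) (p : Spacetime) (α : Fin 4) : pd α (fun q => - f q) p = - pd α f p := by
  simp [pd, fderiv_fun_neg]

lemma pd_sum {ι : Type*} (s : Finset ι) {f : ι → Scalar} (hf : ∀ i ∈ s, DifferentiableAt ℝ (f i) p) (α :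
    Fin 4) : pd α (fun q => ∑ i ∈ s, f i q) p = ∑ i ∈ s, pd α (f i) p := by
  simp [pd, fderiv_fun_sum hf]

lemma pd_congr_nhds (h : f =ᶠ[𝓝 p] g) (α : Fin 4) : pd α f =ᶠ[𝓝 p] pd α g := by
  filter_upwards [h.eventually_nhds] with q hq
  simp [pd, Filter.EventuallyEq.fderiv_eq hq]

lemma smooth_pd (h : ContDiffAt ℝ ∞ f p) (α : Fin 4) : ContDiffAt ℝ ∞ (pd α f) p :=
  (h.fderiv_right (m := ∞) (by simp)).clm_apply contDiffAt_const

lemma pd_comm (h : ContDiffAt ℝ ∞ f p) (α β : Fin 4) : pd α (pd β f) p = pd β (pd α f) p := by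
  have hs : IsSymmSndFDerivAt ℝ f p := h.isSymmSndFDerivAt (by simpa using (mod_cast le_top : ((2 : ℕ∞) : WithTop ℕ∞) ≤ ((⊤ : ℕ∞) : WithTop ℕ∞)))
  have hd : DifferentiableAt ℝ (fderiv ℝ f) p :=
    (h.fderiv_right (m := ∞) (by simp)).differentiableAt (by simp)
  have key : ∀ α β, pd α (pd β f) p = fderiv ℝ (fderiv ℝ f) p (basisVec α) (basisVec β) := by
    intro α β
    change fderiv ℝ (fun q => fderiv ℝ f q (basisVec β)) p (basisVec α) = _
    rw [fderiv_clm_apply hd (by fun_prop)]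
    simp
  rw [key, key, hs.eq]

namespace SmoothOuter

lemma diff (h : SmoothOuter b f) (hp : p ∈ outer b) : DifferentiableAt ℝ f p := smooth_diff (h p hp)

lemma const (c : ℝ) : SmoothOuter b (fun _ => c) := fun _ _ => contDiffAt_const

lemma add (hf : SmoothOuter b f) (hg : SmoothOuter b g) : SmoothOuter b (fun p => f p + g p) :=
  fun p hp => (hf p hp).add (hg p hp)

lemma sub (hf : SmoothOuter b f) (hg : SmoothOuter b g) : SmoothOuter b (fun p => f p - g p) :=
  fun p hp => (hf p hp).sub (hg p hp)

lemma mul (hf : SmoothOuter b f) (hg : SmoothOuter b g) : SmoothOuter b (fun p => f p * g p) :=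
  fun p hp => (hf p hp).mul (hg p hp)

lemma const_mul (c : ℝ) (hg : SmoothOuter b g) : SmoothOuter b (fun p => c * g p) :=
  (SmoothOuter.const c).mul hg

lemma neg (hf : SmoothOuter b f) : SmoothOuter b (fun p => - f p) := fun p hp => (hf p hp).neg

lemma sum {ι : Type*} {s : Finset ι} {f : ι → Scalar} (hf : ∀ i ∈ s, SmoothOuter b (f i)) :
    SmoothOuter b (fun p => ∑ i ∈ s, f i p) :=
  fun p hp => ContDiffAt.sum fun i hi => hf i hi p hp

lemma pd (hf : SmoothOuter b f) (α : Fin 4) : SmoothOuter b (pd α f) := fun p hp => smooth_pd (hf p hp) α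

end SmoothOuter

/-! ## The generators `Z` -/

lemma coord_zero (p : Spacetime) : coord 0 p = p.1 := rfl

lemma coord_succ (i : Fin 3) (p : Spacetime) : coord i.succ p = p.2 i := by simp [coord]

lemma contDiff_coord (α : Fin 4) : ContDiff ℝ ∞ (coord α) := by
  refine Fin.cases ?_ (fun i => ?_) α
  · exact contDiff_fst
  · have : coord i.succ = fun p : Spacetime => p.2 i := funext fun p => coord_succ i p
    rw [this]
    fun_prop

lemma pd_coord (α β : Fin 4) (p : Spacetime) : pd α (coord β) p = kron α β := by
  have h : ∀ v : Spacetime, fderiv ℝ (coord β) p v = coord β v := by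
    intro v
    refine Fin.cases ?_ (fun i => ?_) β
    · have : coord 0 = fun p : Spacetime => ContinuousLinearMap.fst ℝ ℝ Space p := rfl
      rw [this, ContinuousLinearMap.fderiv]
    · have : coord i.succ = fun p : Spacetime =>
          ((EuclideanSpace.proj i : Space →L[ℝ] ℝ).comp (ContinuousLinearMap.snd ℝ ℝ Space)) p :=
        funext fun p => coord_succ i p
      rw [this, ContinuousLinearMap.fderiv]
  rw [pd, h]
  clear h
  refine Fin.cases ?_ (fun i => ?_) β <;> refine Fin.cases ?_ (fun j => ?_) α
  · simp [coord, basisVec, kron]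
  · simp [coord, basisVec, kron]
  · simp [coord, basisVec, kron, (Fin.succ_ne_zero _).symm]
  · simp [coord, basisVec, kron, eq_comm]

/-- The derivative `∂_α X^β` of a generator `X`. -/
def ZField.jac (X : ZField) (α β : Fin 4) : ℝ :=
  match X with
  | .trans _ => 0
  | .rot k => kron α (k + 1).succ * kron β (k + 2).succ - kron α (k + 2).succ * kron β (k + 1).succ
  | .scal => kron α β

lemma ZField.contDiff (X : ZField) (α : Fin 4) : ContDiff ℝ ∞ (X.field α) := by
  cases X with
  | trans μ => exact contDiff_const
  | rot k => exact ((contDiff_coord _).mul contDiff_const).sub ((contDiff_coord _).mul contDiff_const)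
  | scal => exact contDiff_coord α

lemma ZField.pd_field (X : ZField) (α β : Fin 4) (p : Spacetime) : pd α (X.field β) p = X.jac α β := by
  have hc : ∀ α, DifferentiableAt ℝ (coord α) p := fun α => (contDiff_coord α).differentiable (by simp) p
  cases X with
  | trans μ => exact pd_const _ _ _
  | rot k =>
    simp only [ZField.field, ZField.jac]
    unfold rotation
    rw [pd_sub ((hc _).fun_mul (differentiableAt_const _)) ((hc _).fun_mul (differentiableAt_const _)),
      pd_mul (hc _) (differentiableAt_const _), pd_mul (hc _) (differentiableAt_const _), pd_coord, pd_coord, pd_const,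
      pd_const]
    ring
  | scal => exact pd_coord α β p

lemma ZField.jac_zero_succ (X : ZField) (i : Fin 3) : X.jac 0 i.succ = 0 := by
  cases X <;> simp [ZField.jac, kron, (Fin.succ_ne_zero _).symm]

lemma ZField.jac_succ_zero (X : ZField) (i : Fin 3) : X.jac i.succ 0 = 0 := by
  cases X <;> simp [ZField.jac, kron, Fin.succ_ne_zero, (Fin.succ_ne_zero _).symm]

lemma smooth_act (hf : ContDiffAt ℝ ∞ f p) (X : ZField) : ContDiffAt ℝ ∞ (X.field.act f) p := by
  unfold VField.act
  exact ContDiffAt.sum fun α _ => (X.contDiff α).contDiffAt.mul (smooth_pd hf α)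

lemma SmoothOuter.act (hf : SmoothOuter b f) (X : ZField) :
    SmoothOuter b (X.field.act f) := fun p hp => smooth_act (hf p hp) X

lemma ZField.pd_act (X : ZField) (hf : ContDiffAt ℝ ∞ f p) (α : Fin 4) : pd α (X.field.act f) p =
    X.field.act (pd α f) p + ∑ γ, X.jac α γ * pd γ f p := by
  have h1 : ∀ γ, DifferentiableAt ℝ (X.field γ) p := fun γ => (X.contDiff γ).differentiable (by simp) p
  have h2 : ∀ γ, DifferentiableAt ℝ (pd γ f) p := fun γ => smooth_diff (smooth_pd hf γ)
  unfold VField.act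
  rw [pd_sum _ (fun γ _ => (h1 γ).fun_mul (h2 γ)), ← sum_add_distrib]
  refine sum_congr rfl fun γ _ => ?_
  rw [pd_mul (h1 γ) (h2 γ), X.pd_field, pd_comm hf]
  ring

lemma act_congr_outer (hf : SmoothOuter b f) (hg : SmoothOuter b g) (h : EqOn f g (outer b)) (X : VField) :
    EqOn (X.act f) (X.act g) (outer b) := by
  intro p hp
  unfold VField.act
  exact sum_congr rfl fun α _ => by rw [pd_congr_outer hf hg h α hp]

lemma act_add (X : VField) (hf : DifferentiableAt ℝ f p) (hg : DifferentiableAt ℝ g p) : X.act (fun q => f q +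
    g q) p = X.act f p + X.act g p := by
  simp only [VField.act, pd_add hf hg, mul_add, sum_add_distrib]

lemma act_mul (X : VField) (hf : DifferentiableAt ℝ f p) (hg : DifferentiableAt ℝ g p) : X.act (fun q => f q *
    g q) p = X.act f p * g p + f p * X.act g p := by
  simp only [VField.act, pd_mul hf hg, sum_mul, mul_sum, ← sum_add_distrib]
  exact sum_congr rfl fun _ _ => by ring

lemma act_const (X : VField) (c : ℝ) (p : Spacetime) : X.act (fun _ => c) p = 0 := by
  simp [VField.act, pd_const]

lemma act_const_mul (X : VField) (c : ℝ) (hg : DifferentiableAt ℝ g p) : X.act (fun q => c * g q) p = c *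
    X.act g p := by
  rw [act_mul X (by fun_prop) hg, act_const]; simp

lemma act_sum (X : VField) {ι : Type*} (s : Finset ι) {f : ι → Scalar} (hf : ∀ i ∈ s, DifferentiableAt ℝ (f i)
    p) : X.act (fun q => ∑ i ∈ s, f i q) p = ∑ i ∈ s, X.act (f i) p := by
  simp only [VField.act, pd_sum s hf, mul_sum]
  rw [sum_comm]

lemma act_congr_nhds (X : VField) (h : f =ᶠ[𝓝 p] g) : X.act f =ᶠ[𝓝 p] X.act g := by
  have := fun α => pd_congr_nhds h α
  filter_upwards [eventually_all.2 this] with q hq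
  simp [VField.act, hq]

/-! ## Lie derivatives along the generators -/

lemma lie_eq (X : ZField) (T : Cov k) (a : Fin k → Fin 4) (p : Spacetime) : lie X.field T a p =
    X.field.act (T a) p + ∑ s, ∑ γ, T (update a s γ) p * X.jac (a s) γ := by
  simp only [lie, VField.act, X.pd_field]

def SmoothCov (b : ℝ) (T : Cov k) : Prop := ∀ a, SmoothOuter b (T a)

lemma SmoothCov.lie (hT : SmoothCov b T) (X : ZField) : SmoothCov b (lie X.field T) := by
  intro a
  have : Maxwell.lie X.field T a = fun p =>
      X.field.act (T a) p + ∑ s, ∑ γ, T (update a s γ) p * X.jac (a s) γ :=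
    funext fun p => lie_eq X T a p
  rw [this]
  exact ((hT a).act X).add (SmoothOuter.sum fun s _ => SmoothOuter.sum fun γ _ =>
    (hT _).mul (SmoothOuter.const _))

lemma lie_congr_outer (hT : SmoothCov b T) (hT' : SmoothCov b T') (h : ∀ a, EqOn (T a) (T' a) (outer b)) (X :
    ZField) (a : Fin k → Fin 4) : EqOn (lie X.field T a) (lie X.field T' a) (outer b) := by
  intro p hp
  rw [lie_eq, lie_eq, act_congr_outer (hT a) (hT' a) (h a) _ hp]
  congr 1
  exact sum_congr rfl fun s _ => sum_congr rfl fun γ _ => by rw [h _ hp]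

lemma lie_congr_nhds (X : ZField) (h : ∀ a, T a =ᶠ[𝓝 p] T' a) (a : Fin k → Fin 4) : lie X.field T a =ᶠ[𝓝 p]
    lie X.field T' a := by
  filter_upwards [act_congr_nhds X.field (h a), eventually_all.2 h] with q h1 h2
  rw [lie_eq, lie_eq, h1]
  simp [h2]

lemma lieIter_induction₂ {l : ℕ} (P : Cov k → Cov l → Prop) (hP : ∀ (X : ZField) T T', P T T' →
    P (lie X.field T) (lie X.field T')) (Λ : MultiIndex) {T' : Cov l} (hT : P T T') : P (lieIter Λ T)
    (lieIter Λ T') := by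
  obtain ⟨i, j, n⟩ := Λ
  have h1 : P ((lie scaling)^[n] T) ((lie scaling)^[n] T') := by
    induction n with
    | zero => exact hT
    | succ n ih => rw [iterate_succ_apply', iterate_succ_apply']; exact hP .scal _ _ ih
  have h2 : P (j.foldr (fun l W => lie (rotation l) W) ((lie scaling)^[n] T))
      (j.foldr (fun l W => lie (rotation l) W) ((lie scaling)^[n] T')) := by
    induction j with
    | nil => exact h1
    | cons l j ih => exact hP (.rot l) _ _ ih
  change P (i.foldr _ _) (i.foldr _ _)
  induction i with
  | nil => exact h2
  | cons μ i ih => exact hP (.trans μ) _ _ ih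

lemma lieIter_induction (P : Cov k → Prop) (hP : ∀ (X : ZField) T, P T → P (lie X.field T)) (Λ : MultiIndex)
    (hT : P T) : P (lieIter Λ T) := lieIter_induction₂ (fun T _ => P T) (fun X T _ => hP X T) Λ (T' := T) hT

lemma SmoothCov.lieIter (hT : SmoothCov b T) (Λ : MultiIndex) : SmoothCov b (lieIter Λ T) :=
  lieIter_induction (SmoothCov b) (fun X _ h => h.lie X) Λ hT

lemma lieIter_congr_nhds (h : ∀ a, T a =ᶠ[𝓝 p] T' a) (Λ : MultiIndex) (a : Fin k → Fin 4) :
    lieIter Λ T a =ᶠ[𝓝 p] lieIter Λ T' a :=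
  lieIter_induction₂ (fun T T' : Cov k => ∀ a, T a =ᶠ[𝓝 p] T' a) (fun X _ _ h => lie_congr_nhds X h) Λ h a

/-! ## Coefficient classes -/

/-- The iterated derivative `Z^w f`. -/
def iterAct (w : List ZField) (f : Scalar) : Scalar := w.foldr (fun X f => X.field.act f) f

lemma iterAct_append_singleton (w : List ZField) (X : ZField) (f : Scalar) : iterAct (w ++ [X]) f =
    iterAct w (X.field.act f) := by
  simp [iterAct]

lemma SmoothOuter.iterAct (hf : SmoothOuter b f) (w : List ZField) : SmoothOuter b (iterAct w f) := by
  induction w with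
  | nil => exact hf
  | cons X w ih => exact ih.act X

lemma iterAct_congr_outer (hf : SmoothOuter b f) (hg : SmoothOuter b g) (h : EqOn f g (outer b)) (w :
    List ZField) : EqOn (iterAct w f) (iterAct w g) (outer b) := by
  induction w with
  | nil => exact h
  | cons X w ih => exact act_congr_outer (hf.iterAct w) (hg.iterAct w) ih _

lemma iterAct_add (hf : SmoothOuter b f) (hg : SmoothOuter b g) (w : List ZField) (hp : p ∈ outer b) :
    iterAct w (fun q => f q + g q) p = iterAct w f p + iterAct w g p := by
  induction w generalizing p with
  | nil => rfl
  | cons X w ih =>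
    have : EqOn (iterAct w (fun q => f q + g q)) (fun q => iterAct w f q + iterAct w g q)
        (outer b) := fun q hq => ih hq
    refine (act_congr_outer ((hf.add hg).iterAct w) ((hf.iterAct w).add (hg.iterAct w)) this
      X.field hp).trans ?_
    exact act_add _ ((hf.iterAct w).diff hp) ((hg.iterAct w).diff hp)

/-- The class `S^Z(r^s)` on the exterior region, uniformly for families of functions. -/
def SZu (b : ℝ) (s : ℤ) (a : ℕ → Scalar) : Prop :=
  (∀ n, SmoothOuter b (a n)) ∧
    ∀ w : List ZField, ∃ c : ℝ, ∀ n, ∀ p ∈ outer b, |iterAct w (a n) p| ≤ c * ‖p.2‖ ^ s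

namespace SZu

variable {a a' : ℕ → Scalar}

lemma bound (h : SZu b s a) : ∃ c : ℝ, 0 ≤ c ∧ ∀ n, ∀ p ∈ outer b, |a n p| ≤ c * ‖p.2‖ ^ s := by
  obtain ⟨c, hc⟩ := h.2 []
  refine ⟨|c|, abs_nonneg c, fun n p hp => (hc n p hp).trans ?_⟩
  exact mul_le_right (le_abs_self c) (zpow_nonneg (norm_nonneg _) _)

lemma of_class (P : (ℕ → Scalar) → Prop) (hsm : ∀ a, P a → ∀ n, SmoothOuter b (a n)) (hb : ∀ a, P a → ∃ c : ℝ,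
    ∀ n, ∀ p ∈ outer b, |a n p| ≤ c * ‖p.2‖ ^ s) (hstep : ∀ (X : ZField) a, P a → ∃ a₁ a₂, P a₁ ∧ P a₂ ∧ ∀ n,
    EqOn (X.field.act (a n)) (fun p => a₁ n p + a₂ n p) (outer b)) (ha : P a) : SZu b s a := by
  refine ⟨hsm a ha, fun w => ?_⟩
  induction w using List.reverseRecOn generalizing a with
  | nil => exact hb a ha
  | append_singleton w X ih =>
    obtain ⟨a₁, a₂, h₁, h₂, h⟩ := hstep X a ha
    obtain ⟨c₁, hc₁⟩ := ih h₁
    obtain ⟨c₂, hc₂⟩ := ih h₂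
    refine ⟨c₁ + c₂, fun n p hp => ?_⟩
    rw [iterAct_append_singleton, iterAct_congr_outer ((hsm a ha n).act X)
      ((hsm _ h₁ n).add (hsm _ h₂ n)) (h n) w hp, iterAct_add (hsm _ h₁ n) (hsm _ h₂ n) w hp, add_mul]
    exact (abs_add_le _ _).trans (add_le_add (hc₁ n p hp) (hc₂ n p hp))

lemma act (h : SZu b s a) (X : ZField) : SZu b s (fun n => X.field.act (a n)) := by
  refine ⟨fun n => (h.1 n).act X, fun w => ?_⟩
  obtain ⟨c, hc⟩ := h.2 (w ++ [X])
  exact ⟨c, fun n p hp => by simpa [iterAct_append_singleton] using hc n p hp⟩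

lemma congr (h : SZu b s a) (hs : ∀ n, SmoothOuter b (a' n)) (he : ∀ n, EqOn (a' n) (a n) (outer b)) :
    SZu b s a' := by
  refine ⟨hs, fun w => ?_⟩
  obtain ⟨c, hc⟩ := h.2 w
  exact ⟨c, fun n p hp => by rw [iterAct_congr_outer (hs n) (h.1 n) (he n) w hp]; exact hc n p hp⟩

lemma mono (hb : 1 ≤ b) (h : SZu b s a) (hs : s ≤ s') : SZu b s' a := by
  refine ⟨h.1, fun w => ?_⟩
  obtain ⟨c, hc⟩ := h.2 w
  refine ⟨|c|, fun n p hp => (hc n p hp).trans ?_⟩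
  exact mul_le_mul (le_abs_self c) (zpow_le_zpow_right₀ (hb.trans hp.2.le) hs)
    (zpow_nonneg (norm_nonneg _) _) (abs_nonneg _)

lemma add (h : SZu b s a) (h' : SZu b s a') : SZu b s (fun n p => a n p + a' n p) := by
  refine ⟨fun n => (h.1 n).add (h'.1 n), fun w => ?_⟩
  obtain ⟨c, hc⟩ := h.2 w
  obtain ⟨c', hc'⟩ := h'.2 w
  refine ⟨c + c', fun n p hp => ?_⟩
  rw [iterAct_add (h.1 n) (h'.1 n) w hp, add_mul]
  exact (abs_add_le _ _).trans (add_le_add (hc n p hp) (hc' n p hp))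

lemma mul (hb : 1 ≤ b) (h : SZu b s a) (h' : SZu b s' a') : SZu b (s + s') (fun n p => a n p * a' n p) := by
  refine of_class (fun f => ∃ a a', SZu b s a ∧ SZu b s' a' ∧ f = fun n p => a n p * a' n p)
    ?_ ?_ ?_ ⟨a, a', h, h', rfl⟩
  · rintro _ ⟨a, a', h, h', rfl⟩ n
    exact (h.1 n).mul (h'.1 n)
  · rintro _ ⟨a, a', h, h', rfl⟩
    obtain ⟨c, hc0, hc⟩ := h.bound
    obtain ⟨c', hc0', hc'⟩ := h'.bound
    refine ⟨c * c', fun n p hp => ?_⟩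
    have hr : ‖p.2‖ ≠ 0 := by have := hp.2; simp only [mem_ofPred_eq] at this; linarith
    rw [abs_mul, zpow_add₀ hr, mul_mul_mul_comm]
    exact mul_le_mul (hc n p hp) (hc' n p hp) (abs_nonneg _) (mul_nonneg hc0 (zpow_nonneg (norm_nonneg _) _))
  · rintro X _ ⟨a, a', h, h', rfl⟩
    exact ⟨_, _, ⟨_, _, h.act X, h', rfl⟩, ⟨_, _, h, h'.act X, rfl⟩, fun n p hp =>
      act_mul _ ((h.1 n).diff hp) ((h'.1 n).diff hp)⟩

lemma const (c : ℝ) : SZu b 0 (fun _ _ => c) := by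
  refine of_class (fun f => ∃ c : ℝ, f = fun _ _ => c) ?_ ?_ ?_ ⟨c, rfl⟩
  · rintro _ ⟨c, rfl⟩ n
    exact SmoothOuter.const c
  · rintro _ ⟨c, rfl⟩
    exact ⟨|c|, fun n p _ => by simp⟩
  · rintro X _ ⟨c, rfl⟩
    exact ⟨fun _ _ => 0, fun _ _ => 0, ⟨0, rfl⟩, ⟨0, rfl⟩, fun n p _ => by simp [act_const]⟩

lemma const_mul (hb : 1 ≤ b) (c : ℝ) (h : SZu b s a) : SZu b s (fun n p => c * a n p) := by
  simpa using (SZu.const c).mul hb h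

lemma neg (hb : 1 ≤ b) (h : SZu b s a) : SZu b s (fun n p => - a n p) := by simpa using h.const_mul hb (-1)

lemma sub (hb : 1 ≤ b) (h : SZu b s a) (h' : SZu b s a') : SZu b s (fun n p => a n p - a' n p) := by
  simpa [sub_eq_add_neg] using h.add (h'.neg hb)

lemma zero : SZu b s (fun _ _ => 0) := by
  refine ⟨fun _ => SmoothOuter.const 0, fun w => ⟨0, fun n p _ => ?_⟩⟩
  have : iterAct w (fun _ => 0) = fun _ => 0 := by
    induction w with
    | nil => rfl
    | cons X w ih => exact funext fun q => (congrArg (X.field.act · q) ih).trans (act_const _ _ _)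
  simp [this]

lemma sum {ι : Type*} (t : Finset ι) {a : ι → ℕ → Scalar} (h : ∀ i ∈ t, SZu b s (a i)) :
    SZu b s (fun n p => ∑ i ∈ t, a i n p) := by
  simpa only [sum_fn] using sum_induction a (SZu b s) (fun _ _ => add) zero h

end SZu

lemma pd_comp {φ : ℝ → ℝ} (hφ : DifferentiableAt ℝ φ (f p)) (hf : DifferentiableAt ℝ f p) (α : Fin 4) :
    pd α (fun q => φ (f q)) p = deriv φ (f p) * pd α f p := by
  have := (hφ.hasDerivAt.comp_hasFDerivAt p hf.hasFDerivAt).fderiv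
  simp only [Function.comp_def] at this
  simp only [pd, this]
  simp

lemma act_comp (X : VField) {φ : ℝ → ℝ} (hφ : DifferentiableAt ℝ φ (f p)) (hf : DifferentiableAt ℝ f p) :
    X.act (fun q => φ (f q)) p = deriv φ (f p) * X.act f p := by
  simp only [VField.act, pd_comp hφ hf, mul_left_comm _ (deriv φ _), mul_sum]

lemma SZu.comp (hb : 1 ≤ b) (h : SZu b 0 a) {O I : Set ℝ} (hO : IsOpen O) (hI : IsCompact I) (hsub : I ⊆ O)
    (haI : ∀ n, ∀ p ∈ outer b, a n p ∈ I) {φ : ℝ → ℝ} (hφ : ContDiffOn ℝ ∞ φ O) :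
    SZu b 0 (fun n p => φ (a n p)) := by
  have hat : ∀ {φ : ℝ → ℝ}, ContDiffOn ℝ ∞ φ O → ∀ n, ∀ p ∈ outer b, ContDiffAt ℝ ∞ φ (a n p) :=
    fun hφ n p hp => hφ.contDiffAt (hO.mem_nhds (hsub (haI n p hp)))
  have := SZu.of_class (b := b) (s := 0) (a := fun n p => (1 : ℝ) * φ (a n p))
    (fun f => ∃ h φ, SZu b 0 h ∧ ContDiffOn ℝ ∞ φ O ∧ f = fun n p => h n p * φ (a n p))
    ?_ ?_ ?_ ⟨fun _ _ => 1, φ, SZu.const 1, hφ, rfl⟩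
  · simpa using this
  · rintro _ ⟨k, φ, hk, hφ, rfl⟩ n p hp
    exact (hk.1 n p hp).mul ((hat hφ n p hp).comp p (h.1 n p hp))
  · rintro _ ⟨k, φ, hk, hφ, rfl⟩
    obtain ⟨c, hc0, hc⟩ := hk.bound
    obtain ⟨c', hc'⟩ := hI.exists_bound_of_continuousOn (hφ.continuousOn.mono hsub)
    refine ⟨c * c', fun n p hp => ?_⟩
    have h1 := hc n p hp
    have h2 := hc' _ (haI n p hp)
    simp only [zpow_zero, mul_one, norm_eq_abs] at h1 h2 ⊢
    rw [abs_mul]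
    exact mul_le_mul h1 h2 (abs_nonneg _) hc0
  · rintro X _ ⟨k, φ, hk, hφ, rfl⟩
    have hd : ContDiffOn ℝ ∞ (deriv φ) O := (hφ.deriv_of_isOpen hO (m := ∞) (by simp))
    refine ⟨_, _, ⟨fun n => X.field.act (k n), φ, hk.act X, hφ, rfl⟩,
      ⟨fun n p => k n p * X.field.act (a n) p, deriv φ, by simpa using hk.mul hb (h.act X), hd, rfl⟩,
      fun n p hp => ?_⟩
    have hφd : DifferentiableAt ℝ φ (a n p) := (hat hφ n p hp).differentiableAt (by simp)
    have had := (h.1 n).diff hp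
    have hcomp : DifferentiableAt ℝ (fun q => φ (a n q)) p := hφd.comp p had
    rw [act_mul _ ((hk.1 n).diff hp) hcomp]
    rw [act_comp _ hφd had]
    ring

/-- Symbols of order `s` whose spatial derivatives gain a power of `r`. -/
def Sym (b : ℝ) (s : ℤ) (a : ℕ → Scalar) : Prop :=
  SZu b s a ∧ ∀ i : Fin 3, SZu b (s - 1) (fun n => pd i.succ (a n))

lemma act_translation (μ : Fin 4) (f : Scalar) : (translation μ).act f = pd μ f := by
  funext p
  simp [VField.act, translation, kron]

lemma SZu.pd {a : ℕ → Scalar} (h : SZu b s a) (μ : Fin 4) : SZu b s (fun n => pd μ (a n)) := by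
  simpa [ZField.field, act_translation] using h.act (.trans μ)

namespace Sym

variable {a a' : ℕ → Scalar}

lemma congr (h : Sym b s a) (hs : ∀ n, SmoothOuter b (a' n)) (he : ∀ n, EqOn (a' n) (a n) (outer b)) :
    Sym b s a' :=
  ⟨h.1.congr hs he, fun i => (h.2 i).congr (fun n => (hs n).pd _)
    fun n => pd_congr_outer (hs n) (h.1.1 n) (he n) _⟩

lemma mono (hb : 1 ≤ b) (h : Sym b s a) (hs : s ≤ s') : Sym b s' a :=
  ⟨h.1.mono hb hs, fun i => (h.2 i).mono hb (by lia)⟩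

lemma of_SZu (hb : 1 ≤ b) (h : SZu b (s - 1) a) : Sym b s a := ⟨h.mono hb (by lia), fun i => h.pd _⟩

lemma add (h : Sym b s a) (h' : Sym b s a') : Sym b s (fun n p => a n p + a' n p) :=
  ⟨h.1.add h'.1, fun i => ((h.2 i).add (h'.2 i)).congr
    (fun n => ((h.1.1 n).add (h'.1.1 n)).pd _)
    fun n p hp => pd_add ((h.1.1 n).diff hp) ((h'.1.1 n).diff hp) _⟩

lemma mul (hb : 1 ≤ b) (h : Sym b s a) (h' : Sym b s' a') : Sym b (s + s') (fun n p => a n p * a' n p) := by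
  refine ⟨h.1.mul hb h'.1, fun i => ?_⟩
  have h1 := (h.2 i).mul hb h'.1
  have h2 := h.1.mul hb (h'.2 i)
  rw [show s - 1 + s' = s + s' - 1 by ring] at h1
  rw [show s + (s' - 1) = s + s' - 1 by ring] at h2
  exact (h1.add h2).congr (fun n => ((h.1.1 n).mul (h'.1.1 n)).pd _)
    fun n p hp => pd_mul ((h.1.1 n).diff hp) ((h'.1.1 n).diff hp) _

lemma act (hb : 1 ≤ b) (h : Sym b s a) (X : ZField) : Sym b s (fun n => X.field.act (a n)) := by
  refine ⟨h.1.act X, fun i => ?_⟩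
  have h2 : SZu b (s - 1) (fun n p => ∑ γ : Fin 3, X.jac i.succ γ.succ * pd γ.succ (a n) p) :=
    SZu.sum _ fun γ _ => (h.2 γ).const_mul hb _
  refine (((h.2 i).act X).add h2).congr (fun n => ((h.1.1 n).act X).pd _) fun n p hp => ?_
  simp only
  rw [X.pd_act (h.1.1 n p hp), sum_univ_succ, X.jac_succ_zero]
  ring

lemma const (c : ℝ) : Sym b 0 (fun _ _ => c) :=
  ⟨SZu.const c, fun i => SZu.zero.congr (fun _ => (SmoothOuter.const c).pd _) fun n p _ => pd_const _ _ _⟩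

lemma zero : Sym b s (fun _ _ => 0) :=
  ⟨SZu.zero, fun i => SZu.zero.congr (fun _ => (SmoothOuter.const 0).pd _) fun n p _ => pd_const _ _ _⟩

lemma const_mul (hb : 1 ≤ b) (c : ℝ) (h : Sym b s a) : Sym b s (fun n p => c * a n p) := by
  simpa using (Sym.const c).mul hb h

lemma neg (hb : 1 ≤ b) (h : Sym b s a) : Sym b s (fun n p => - a n p) := by simpa using h.const_mul hb (-1)

lemma sub (hb : 1 ≤ b) (h : Sym b s a) (h' : Sym b s a') : Sym b s (fun n p => a n p - a' n p) := by
  simpa [sub_eq_add_neg] using h.add (h'.neg hb)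

lemma comp (hb : 1 ≤ b) (h : Sym b 0 a) {O I : Set ℝ} (hO : IsOpen O) (hI : IsCompact I) (hsub : I ⊆ O) (haI :
    ∀ n, ∀ p ∈ outer b, a n p ∈ I) {φ : ℝ → ℝ} (hφ : ContDiffOn ℝ ∞ φ O) :
    Sym b 0 (fun n p => φ (a n p)) := by
  have hc := h.1.comp hb hO hI hsub haI hφ
  refine ⟨hc, fun i => ?_⟩
  have hd := h.1.comp hb hO hI hsub haI (hφ.deriv_of_isOpen hO (m := ∞) (by simp))
  have := hd.mul hb (h.2 i)
  rw [zero_add] at this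
  refine this.congr (fun n => (hc.1 n).pd _) fun n p hp => ?_
  have hφd : DifferentiableAt ℝ φ (a n p) :=
    (hφ.contDiffAt (hO.mem_nhds (hsub (haI n p hp)))).differentiableAt (by simp)
  exact pd_comp hφd ((h.1.1 n).diff hp) _

end Sym

/-! ## Homogeneous functions and dilated cutoffs -/

/-- Stationary functions, smooth off the axis and homogeneous of degree `s` in `x`. -/
def HomDeg (s : ℤ) (f : Scalar) : Prop :=
  (∀ p : Spacetime, p.2 ≠ 0 → ContDiffAt ℝ ∞ f p) ∧
    ∀ (t t' : ℝ) (x : Space) (c : ℝ), 0 < c → x ≠ 0 → f (t', c • x) = c ^ s * f (t, x)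

lemma outer_ne_zero (hb : 1 ≤ b) (hp : p ∈ outer b) : p.2 ≠ 0 := by
  have := (mem_outer.1 hp).2
  exact norm_pos_iff.1 (by linarith)

lemma pd_zero_of_const (hd : DifferentiableAt ℝ f p) (h : ∀ t, f (t, p.2) = f p) : pd 0 f p = 0 := by
  have h1 := hd.hasFDerivAt.comp_hasDerivAt (f := fun t => (t, p.2)) p.1
    ((hasDerivAt_id p.1).prodMk (hasDerivAt_const _ p.2))
  rw [show f ∘ (fun t => (t, p.2)) = fun _ => f p from funext h] at h1
  exact h1.unique (hasDerivAt_const _ _)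

lemma normal_sq (hp : p.2 ≠ 0) : ∑ j : Fin 3, normal j.succ p * normal j.succ p = 1 := by
  have h := EuclideanSpace.norm_sq_eq p.2
  have hn : ‖p.2‖ ≠ 0 := norm_ne_zero_iff.2 hp
  simp only [normal, Fin.cons_succ, sum_univ_three, norm_eq_abs, sq_abs] at h ⊢
  field_simp
  linarith

namespace HomDeg

lemma add (hf : HomDeg s f) (hg : HomDeg s g) : HomDeg s (fun p => f p + g p) :=
  ⟨fun p hp => (hf.1 p hp).add (hg.1 p hp), fun t t' x c hc hx => by
    simp only [hf.2 t t' x c hc hx, hg.2 t t' x c hc hx]; ring⟩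

lemma zero : HomDeg s (fun _ => 0) := ⟨fun p hp => contDiffAt_const, fun t t' x c hc hx => by simp⟩

lemma const (c : ℝ) : HomDeg 0 (fun _ => c) := ⟨fun p hp => contDiffAt_const, fun t t' x c hc hx => by simp⟩

lemma mul (hf : HomDeg s f) (hg : HomDeg s' g) : HomDeg (s + s') (fun p => f p * g p) :=
  ⟨fun p hp => (hf.1 p hp).mul (hg.1 p hp), fun t t' x c hc hx => by
    simp only [hf.2 t t' x c hc hx, hg.2 t t' x c hc hx, zpow_add₀ hc.ne']; ring⟩

lemma const_mul (c : ℝ) (hf : HomDeg s f) : HomDeg s (fun p => c * f p) := by simpa using (const c).mul hf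

lemma neg (hf : HomDeg s f) : HomDeg s (fun p => - f p) := by simpa using hf.const_mul (-1)

lemma sub (hf : HomDeg s f) (hg : HomDeg s g) : HomDeg s (fun p => f p - g p) := by
  simpa [sub_eq_add_neg] using hf.add hg.neg

lemma sum {ι : Type*} (t : Finset ι) {f : ι → Scalar} (h : ∀ i ∈ t, HomDeg s (f i)) :
    HomDeg s (fun p => ∑ i ∈ t, f i p) := by
  simpa only [sum_fn] using sum_induction f (HomDeg s) (fun _ _ => add) zero h

lemma congr (hf : HomDeg s f) (h : ∀ p : Spacetime, p.2 ≠ 0 → g p = f p) : HomDeg s g := by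
  refine ⟨fun p hp => (hf.1 p hp).congr_of_eventuallyEq ?_, fun t t' x c hc hx => ?_⟩
  · have : ∀ᶠ q : Spacetime in 𝓝 p, q.2 ≠ 0 := continuous_snd.continuousAt.eventually_ne hp
    exact this.mono h
  · rw [h (t', c • x) (smul_ne_zero hc.ne' hx), h (t, x) hx, hf.2 t t' x c hc hx]

lemma pd_zero (hf : HomDeg s f) (hp : p.2 ≠ 0) : pd 0 f p = 0 :=
  pd_zero_of_const (smooth_diff (hf.1 p hp)) fun t => by simpa using hf.2 p.1 t p.2 1 one_pos hp

lemma pd_succ (hf : HomDeg s f) (i : Fin 3) : HomDeg (s - 1) (pd i.succ f) := by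
  refine ⟨fun p hp => smooth_pd (hf.1 p hp) _, fun t t' x c hc hx => ?_⟩
  have hδ : HasFDerivAt (fun q : Spacetime => (q.1 + (t' - t), c • q.2)) _ (t, x) :=
    ((hasFDerivAt_fst (𝕜 := ℝ)).add_const _).prodMk ((hasFDerivAt_snd (𝕜 := ℝ)).const_smul c)
  have hd : HasFDerivAt f (fderiv ℝ f (t', c • x)) (t + (t' - t), c • x) := by
    rw [add_sub_cancel]
    exact (smooth_diff (hf.1 _ (smul_ne_zero hc.ne' hx))).hasFDerivAt
  have e : (fun q : Spacetime => f (q.1 + (t' - t), c • q.2)) =ᶠ[𝓝 (t, x)] fun q => c ^ s * f q := by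
    filter_upwards [continuousAt_snd.eventually_ne hx] with q hq using hf.2 q.1 _ q.2 c hc hq
  have := congrArg (fun L : Spacetime →L[ℝ] ℝ => L (basisVec i.succ)) ((hd.comp (t, x) hδ).unique
    (((smooth_diff (hf.1 (t, x) hx)).hasFDerivAt.const_mul (c ^ s)).congr_of_eventuallyEq e))
  simp [basisVec] at this
  rw [show ((0 : ℝ), c • EuclideanSpace.single i (1 : ℝ)) = c • basisVec i.succ by simp [basisVec],
    map_smul, smul_eq_mul] at this
  change c * pd i.succ f _ = c ^ s * pd i.succ f _ at this
  rw [zpow_sub_one₀ hc.ne']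
  field_simp
  linarith

lemma coord_succ (i : Fin 3) : HomDeg 1 (coord i.succ) :=
  ⟨fun p hp => (contDiff_coord _).contDiffAt, fun t t' x c hc hx => by simp [Maxwell.coord_succ]⟩

lemma norm_zpow (k : ℤ) : HomDeg k (fun p => ‖p.2‖ ^ k) := by
  refine ⟨fun p hp => ?_, fun t t' x c hc hx => ?_⟩
  · have h1 : ContDiffAt ℝ ∞ (fun q : Spacetime => ‖q.2‖) p := contDiffAt_snd.norm ℝ hp
    have hn : ‖p.2‖ ≠ 0 := norm_ne_zero_iff.2 hp
    cases k with
    | ofNat n => simpa using h1.pow n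
    | negSucc n =>
      simp only [zpow_negSucc]
      exact (h1.pow _).inv (pow_ne_zero _ hn)
  · simp [norm_smul, abs_of_pos hc, mul_zpow]

lemma normal (α : Fin 4) : HomDeg 0 (normal α) := by
  refine Fin.cases ?_ (fun i => ?_) α
  · exact zero
  · have := (coord_succ i).mul (norm_zpow (-1))
    refine this.congr fun p hp => ?_
    simp [Maxwell.normal, Maxwell.coord_succ, div_eq_mul_inv]

lemma act (hf : HomDeg s f) (X : ZField) : ∃ s' ≤ s, HomDeg s' (X.field.act f) := by
  cases X with
  | trans μ =>
    rw [ZField.field, act_translation]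
    refine Fin.cases ?_ (fun i => ?_) μ
    · exact ⟨s, le_rfl, zero.congr fun p hp => hf.pd_zero hp⟩
    · exact ⟨s - 1, by lia, hf.pd_succ i⟩
  | rot k =>
    refine ⟨s, le_rfl, ?_⟩
    have h1 := ((coord_succ (k + 1)).mul (hf.pd_succ (k + 2))).sub
      ((coord_succ (k + 2)).mul (hf.pd_succ (k + 1)))
    rw [show 1 + (s - 1) = s by ring] at h1
    refine h1.congr fun p hp => ?_
    simp only [VField.act, ZField.field, rotation, sub_mul, sum_sub_distrib]
    simp [kron]
  | scal =>
    refine ⟨s, le_rfl, ?_⟩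
    have h1 : HomDeg (1 + (s - 1)) (fun p => ∑ i : Fin 3, coord i.succ p * pd i.succ f p) :=
      HomDeg.sum _ fun i _ => (coord_succ i).mul (hf.pd_succ i)
    rw [show 1 + (s - 1) = s by ring] at h1
    refine h1.congr fun p hp => ?_
    simp only [VField.act, ZField.field, scaling]
    rw [sum_univ_succ, hf.pd_zero hp]
    simp

lemma bound (hf : HomDeg s f) : ∃ c : ℝ, 0 ≤ c ∧ ∀ p : Spacetime, p.2 ≠ 0 → |f p| ≤ c * ‖p.2‖ ^ s := by
  have hK : IsCompact S² := isCompact_sphere _ _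
  have hc : ContinuousOn (fun x : Space => f (0, x)) (sphere 0 1) := by
    intro x hx
    have hx0 : x ≠ 0 := by rintro rfl; simp at hx
    have h1 := (hf.1 (0, x) hx0).continuousAt
    have h2 : Continuous fun x : Space => ((0 : ℝ), x) := by fun_prop
    exact (ContinuousAt.comp (f := fun x : Space => ((0 : ℝ), x)) h1 h2.continuousAt).continuousWithinAt
  obtain ⟨c, hc⟩ := hK.exists_bound_of_continuousOn hc
  refine ⟨|c|, abs_nonneg c, fun p hp => ?_⟩
  have hn : 0 < ‖p.2‖ := norm_pos_iff.2 hp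
  have hu : ‖p.2‖⁻¹ • p.2 ∈ S² := by simp [norm_smul, hn.ne']
  have := hf.2 0 p.1 (‖p.2‖⁻¹ • p.2) ‖p.2‖ hn (smul_ne_zero (inv_ne_zero hn.ne') hp)
  rw [smul_smul, mul_inv_cancel₀ hn.ne', one_smul] at this
  change f (p.1, p.2) = _ at this
  rw [show f p = f (p.1, p.2) from rfl, this, abs_mul, abs_of_pos (zpow_pos hn s), mul_comm]
  exact mul_le_right ((hc _ hu).trans (le_abs_self c)) (zpow_pos hn s).le

lemma smoothOuter (hf : HomDeg s f) (hb : 1 ≤ b) : SmoothOuter b f := fun p hp => hf.1 p (outer_ne_zero hb hp)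

lemma SZu (hf : HomDeg s f) (hb : 1 ≤ b) : SZu b s (fun _ => f) := by
  refine SZu.of_class (fun a => ∃ s' ≤ s, ∃ f, HomDeg s' f ∧ a = fun _ => f) ?_ ?_ ?_ ⟨s, le_rfl, f, hf, rfl⟩
  · rintro _ ⟨s', hs, f, hf, rfl⟩ n
    exact hf.smoothOuter hb
  · rintro _ ⟨s', hs, f, hf, rfl⟩
    obtain ⟨c, hc0, hc⟩ := hf.bound
    refine ⟨c, fun n p hp => (hc p (outer_ne_zero hb hp)).trans ?_⟩
    exact mul_le_left (zpow_le_zpow_right₀ (hb.trans hp.2.le) hs) hc0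
  · rintro X _ ⟨s', hs, f, hf, rfl⟩
    obtain ⟨s'', hs', h⟩ := hf.act X
    exact ⟨fun _ => X.field.act f, fun _ _ => 0, ⟨s'', hs'.trans hs, _, h, rfl⟩,
      ⟨s', hs, _, zero, rfl⟩, fun n p hp => by simp⟩

lemma sym (hf : HomDeg s f) (hb : 1 ≤ b) : Sym b s (fun _ => f) := ⟨hf.SZu hb, fun i => (hf.pd_succ i).SZu hb⟩

end HomDeg

lemma contDiffAt_norm_snd (hp : p.2 ≠ 0) :
    ContDiffAt ℝ ∞ (fun q : Spacetime => ‖q.2‖) p := contDiffAt_snd.norm ℝ hp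

/-- Dilates of a compactly supported function of `r` are symbols of order zero, uniformly. -/
lemma SZu_dilate (hb : 1 ≤ b) {φ : ℝ → ℝ} (hφ : ContDiff ℝ ∞ φ) (hφ2 : ∀ y, 2 ≤ y → φ y = 0) {h : Scalar}
    (hh : HomDeg s h) : SZu b s (fun n p => h p * φ (‖p.2‖ / 2 ^ n)) := by
  refine SZu.of_class (fun a => ∃ s' ≤ s, ∃ h φ, HomDeg s' h ∧ ContDiff ℝ ∞ φ ∧
    (∀ y : ℝ, 2 ≤ y → φ y = 0) ∧ a = fun n p => h p * φ (‖p.2‖ / 2 ^ n)) ?_ ?_ ?_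
    ⟨s, le_rfl, h, φ, hh, hφ, hφ2, rfl⟩
  · rintro _ ⟨s', hs, h, φ, hh, hφ, hφ2, rfl⟩ n p hp
    have h0 := outer_ne_zero hb hp
    exact (hh.1 p h0).mul (hφ.contDiffAt.comp p ((contDiffAt_norm_snd h0).div_const _))
  · rintro _ ⟨s', hs, h, φ, hh, hφ, hφ2, rfl⟩
    obtain ⟨c, hc0, hc⟩ := hh.bound
    obtain ⟨c', hc'⟩ := (isCompact_Icc (a := (0 : ℝ)) (b := 2)).exists_bound_of_continuousOn
      hφ.continuous.continuousOn
    refine ⟨c * |c'|, fun n p hp => ?_⟩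
    have h1 : |φ (‖p.2‖ / 2 ^ n)| ≤ |c'| := by
      by_cases h2 : ‖p.2‖ / 2 ^ n ≤ 2
      · exact (hc' _ ⟨by positivity, h2⟩).trans (le_abs_self _)
      · rw [hφ2 _ (not_le.1 h2).le]; simp
    rw [abs_mul, mul_right_comm]
    refine mul_le_mul ((hc p (outer_ne_zero hb hp)).trans ?_) h1 (abs_nonneg _) (by positivity)
    exact mul_le_left (zpow_le_zpow_right₀ (hb.trans hp.2.le) hs) hc0
  · rintro X _ ⟨s', hs, h, φ, hh, hφ, hφ2, rfl⟩
    obtain ⟨s1, hs1, h1⟩ := hh.act X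
    obtain ⟨s2, hs2, h2⟩ := (HomDeg.norm_zpow 1).act X
    have h3 := (hh.mul h2).mul (HomDeg.norm_zpow (-1))
    have hdφ : ContDiff ℝ ∞ (fun y => y * deriv φ y) := by
      exact contDiff_id.mul ((contDiff_infty_iff_deriv.1 hφ).2)
    have hd2 : ∀ y : ℝ, 2 ≤ y → y * deriv φ y = 0 := fun y hy => by
      rw [(uniqueDiffWithinAt_Ici y).eq_deriv _ (hφ.differentiable (by simp) y).hasDerivAt.hasDerivWithinAt
        ((hasDerivWithinAt_const y _ 0).congr (fun z hz => hφ2 z (hy.trans hz)) (hφ2 y hy)), mul_zero]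
    refine ⟨_, _, ⟨s1, hs1.trans hs, _, φ, h1, hφ, hφ2, rfl⟩,
      ⟨s' + s2 + -1, by lia, _, fun y => y * deriv φ y, h3, hdφ, hd2, rfl⟩, fun n p hp => ?_⟩
    have h0 := outer_ne_zero hb hp
    have hn : ‖p.2‖ ≠ 0 := norm_ne_zero_iff.2 h0
    have hnd : DifferentiableAt ℝ (fun q : Spacetime => ‖q.2‖) p := smooth_diff (contDiffAt_norm_snd h0)
    have hnd' : DifferentiableAt ℝ (fun q : Spacetime => ‖q.2‖ / 2 ^ n) p := by
      simpa only [div_eq_mul_inv] using hnd.mul_const _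
    have hφd : DifferentiableAt ℝ φ (‖p.2‖ / 2 ^ n) := hφ.differentiable (by simp) _
    have hcomp : DifferentiableAt ℝ (fun q : Spacetime => φ (‖q.2‖ / 2 ^ n)) p := hφd.comp p hnd'
    rw [act_mul _ (smooth_diff (hh.1 p h0)) hcomp,
      act_comp (f := fun q : Spacetime => ‖q.2‖ / 2 ^ n) _ hφd hnd']
    have : X.field.act (fun q : Spacetime => ‖q.2‖ / 2 ^ n) p
        = (2 ^ n)⁻¹ * X.field.act (fun q : Spacetime => ‖q.2‖ ^ (1 : ℤ)) p := by
      simp only [zpow_one, div_eq_inv_mul]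
      exact act_const_mul _ _ hnd
    rw [this]
    simp only [zpow_neg, zpow_one]
    field_simp

/-- The profile of the cutoffs: `1` on `(-∞, 1]`, `0` on `[3/2, ∞)`. -/
def cutProfile (y : ℝ) : ℝ := smoothTransition (3 - 2 * y)

lemma contDiff_cutProfile : ContDiff ℝ ∞ cutProfile :=
  smoothTransition.contDiff.comp (contDiff_const.sub (contDiff_const.mul contDiff_id))

lemma cutProfile_of_le {y : ℝ} (h : y ≤ 1) : cutProfile y = 1 := smoothTransition.one_of_one_le (by linarith)

lemma cutProfile_of_three_halves_le {y : ℝ} (h : 3 / 2 ≤ y) : cutProfile y = 0 :=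
  smoothTransition.zero_of_nonpos (by linarith)

lemma cutProfile_of_ge {y : ℝ} (h : 2 ≤ y) : cutProfile y = 0 := cutProfile_of_three_halves_le (by linarith)

lemma cutProfile_nonneg (y : ℝ) : 0 ≤ cutProfile y := smoothTransition.nonneg _

lemma cutProfile_le_one (y : ℝ) : cutProfile y ≤ 1 := smoothTransition.le_one _

/-- The cutoff to `r < 2^{n+1}`, equal to `1` for `r ≤ 2^n`. -/
def cut (n : ℕ) (p : Spacetime) : ℝ := cutProfile (‖p.2‖ / 2 ^ n)

lemma Sym_cut (hb : 1 ≤ b) : Sym b 0 cut := by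
  have h0 : SZu b 0 cut := by
    simpa [cut] using! SZu_dilate hb contDiff_cutProfile (fun y hy => cutProfile_of_ge hy) (HomDeg.const 1)
  refine ⟨h0, fun i => ?_⟩
  have hd : ContDiff ℝ ∞ (fun y => y * deriv cutProfile y) :=
    contDiff_id.mul ((contDiff_infty_iff_deriv.1 contDiff_cutProfile).2)
  have hd2 : ∀ y : ℝ, 2 ≤ y → y * deriv cutProfile y = 0 := by
    intro y hy
    rcases hy.lt_or_eq with hy | rfl
    · have : cutProfile =ᶠ[𝓝 y] fun _ => 0 := by
        filter_upwards [Ioi_mem_nhds hy] with z hz using cutProfile_of_ge (le_of_lt hz)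
      rw [this.deriv_eq]; simp
    · have : IsLocalMin cutProfile 2 := by
        filter_upwards with z
        rw [cutProfile_of_ge le_rfl]; exact cutProfile_nonneg z
      rw [this.deriv_eq_zero, mul_zero]
  have := SZu_dilate hb hd hd2 ((HomDeg.normal i.succ).mul (HomDeg.norm_zpow (-1)))
  rw [zero_add] at this
  refine this.congr (fun n => (h0.1 n).pd _) fun n p hp => ?_
  have hp0 := outer_ne_zero hb hp
  have hn : ‖p.2‖ ≠ 0 := norm_ne_zero_iff.2 hp0
  have hnd : DifferentiableAt ℝ (fun q : Spacetime => ‖q.2‖) p := smooth_diff (contDiffAt_norm_snd hp0)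
  have hnd' : DifferentiableAt ℝ (fun q : Spacetime => ‖q.2‖ / 2 ^ n) p := by
    simpa only [div_eq_mul_inv] using hnd.mul_const _
  have e1 : pd i.succ (fun q : Spacetime => ‖q.2‖) p = normal i.succ p := by
    have h1 := ((hasStrictFDerivAt_norm_sq p.2).hasFDerivAt.comp p
      (hasFDerivAt_snd (𝕜 := ℝ) (E := ℝ) (F := Space) (p := p)))
    have h2 := hnd.hasFDerivAt.pow 2
    have h3 := h1.unique h2
    have h4 := congrArg (fun L => L (basisVec i.succ)) h3
    simp [basisVec, EuclideanSpace.inner_single_right] at h4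
    simp only [pd, normal, basisVec, Fin.cons_succ]
    field_simp
    linarith
  change pd i.succ (fun q : Spacetime => cutProfile (‖q.2‖ / 2 ^ n)) p = _
  rw [pd_comp (f := fun q : Spacetime => ‖q.2‖ / 2 ^ n) (contDiff_cutProfile.differentiable (by simp) _) hnd']
  have : pd i.succ (fun q : Spacetime => ‖q.2‖ / 2 ^ n) p = (2 ^ n)⁻¹ * normal i.succ p := by
    rw [← e1]
    simp only [div_eq_inv_mul]
    exact pd_const_mul hnd _ _
  rw [this]
  simp only [zpow_neg, zpow_one]
  field_simp

/-! ## Leibniz rule for `T ↦ T^Λ` -/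

lemma finite_weight_le (m : ℕ) : {Λ : MultiIndex | Λ.weight ≤ m}.Finite := by
  have h1 := List.finite_length_le (Fin 4) m
  have h2 := List.finite_length_le (Fin 3) m
  have h3 := Set.finite_Iic m
  refine ((h1.prod (h2.prod h3)).image (fun q => (⟨q.1, q.2.1, q.2.2⟩ : MultiIndex))).subset ?_
  rintro ⟨i, j, k⟩ h
  simp only [mem_ofPred_eq, MultiIndex.weight] at h
  exact ⟨(i, j, k), ⟨by simp; lia, by simp; lia, by simp; lia⟩, rfl⟩

/-- The multi-indices of weight at most `m`. -/
abbrev Idx (m : ℕ) : Type := {Λ : MultiIndex // Λ.weight ≤ m}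

instance (m : ℕ) : Fintype (Idx m) := (finite_weight_le m).fintype

/-- The sum of the absolute values of the components of `T^{≤ m}`. -/
def absSum (m : ℕ) (T : Cov k) (p : Spacetime) : ℝ := ∑ Λ : Idx m, ∑ c, |lieIter Λ.1 T c p|

lemma absSum_nonneg (m : ℕ) (T : Cov k) (p : Spacetime) : 0 ≤ absSum m T p :=
  sum_nonneg fun _ _ => sum_nonneg fun _ _ => abs_nonneg _

lemma abs_lieIter_le_absSum (T : Cov k) (p : Spacetime) {Λ : MultiIndex} (hΛ : Λ.weight ≤ m) (c : Fin k →
    Fin 4) : |lieIter Λ T c p| ≤ absSum m T p := by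
  exact (le_sum_univ (u := fun c => |lieIter Λ T c p|) (fun _ => abs_nonneg _) c).trans
    (le_sum_univ (u := fun Λ : Idx m => ∑ c, |lieIter Λ.1 T c p|)
      (fun _ => sum_nonneg fun _ _ => abs_nonneg _) ⟨Λ, hΛ⟩)

/-- The sum of the absolute values of the spatial derivatives of the components of `T^{≤ m}`. -/
def absGradSum (m : ℕ) (T : Cov k) (p : Spacetime) : ℝ :=
  ∑ Λ : Idx m, ∑ c, ∑ i : Fin 3, |pd i.succ (lieIter Λ.1 T c) p|

lemma absGradSum_nonneg (m : ℕ) (T : Cov k) (p : Spacetime) : 0 ≤ absGradSum m T p :=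
  sum_nonneg fun _ _ => sum_nonneg fun _ _ => sum_nonneg fun _ _ => abs_nonneg _

lemma abs_pd_le_absGradSum (T : Cov k) (p : Spacetime) {Λ : MultiIndex}
    (hΛ : Λ.weight ≤ m) (c : Fin k → Fin 4) (i : Fin 3) :
    |pd i.succ (lieIter Λ T c) p| ≤ absGradSum m T p := by
  exact (le_sum_univ (u := fun i : Fin 3 => |pd i.succ (lieIter Λ T c) p|) (fun _ => abs_nonneg _) i).trans
    ((le_sum_univ (u := fun c => ∑ i : Fin 3, |pd i.succ (lieIter Λ T c) p|)
      (fun _ => sum_nonneg fun _ _ => abs_nonneg _) c).trans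
    (le_sum_univ (u := fun Λ : Idx m => ∑ c, ∑ i : Fin 3, |pd i.succ (lieIter Λ.1 T c) p|)
      (fun _ => sum_nonneg fun _ _ => sum_nonneg fun _ _ => abs_nonneg _) ⟨Λ, hΛ⟩))

/-- Classes of coefficients which are stable under the generators. -/
structure CoeffClass (b : ℝ) (𝒞 : (ℕ → Scalar) → Prop) : Prop where
  smooth : ∀ h, 𝒞 h → ∀ n, SmoothOuter b (h n)
  const_mul : ∀ h (c : ℝ), 𝒞 h → 𝒞 (fun n p => c * h n p)
  act : ∀ h (X : ZField), 𝒞 h → 𝒞 (fun n => X.field.act (h n))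

lemma coeffClass_SZu (hb : 1 ≤ b) (s : ℤ) : CoeffClass b (SZu b s) :=
  ⟨fun _ h => h.1, fun _ c h => h.const_mul hb c, fun _ X h => h.act X⟩

lemma coeffClass_Sym (hb : 1 ≤ b) (s : ℤ) : CoeffClass b (Sym b s) :=
  ⟨fun _ h => h.1.1, fun _ c h => h.const_mul hb c, fun _ X h => h.act hb X⟩

/-- Linear combinations of the `T^Λ`, `Λ` satisfying `P`, with coefficients in `𝒞`. -/
inductive Comb (𝒞 : (ℕ → Scalar) → Prop) (P : MultiIndex → Prop) : (ℕ → Cov k → Scalar) → Prop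
  | zero : Comb 𝒞 P (fun _ _ _ => 0)
  | add {Φ Φ' : ℕ → Cov k → Scalar} : Comb 𝒞 P Φ → Comb 𝒞 P Φ' → Comb 𝒞 P (fun n T p => Φ n T p + Φ' n T p)
  | single {h : ℕ → Scalar} {Λ : MultiIndex} (c : Fin k → Fin 4) : 𝒞 h → P Λ →
      Comb 𝒞 P (fun n T p => h n p * lieIter Λ T c p)

namespace Comb

variable {𝒞 : (ℕ → Scalar) → Prop} {P P' : MultiIndex → Prop}
  {Φ : ℕ → Cov k → Scalar}

lemma sum {ι : Type*} (t : Finset ι) {Φ : ι → ℕ → Cov k → Scalar} (h : ∀ i ∈ t, Comb 𝒞 P (Φ i)) :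
    Comb 𝒞 P (fun n T p => ∑ i ∈ t, Φ i n T p) := by
  simpa only [Finset.sum_fn] using sum_induction Φ (Comb 𝒞 P) (fun _ _ => add) zero h

lemma imp (hP : ∀ Λ, P Λ → P' Λ) (h : Comb 𝒞 P Φ) : Comb 𝒞 P' Φ := by
  induction h with
  | zero => exact zero
  | add _ _ h1 h2 => exact h1.add h2
  | single c h hΛ => exact single c h (hP _ hΛ)

lemma smooth (hC : CoeffClass b 𝒞) (h : Comb 𝒞 P Φ) (n : ℕ) (hT : SmoothCov b T) : SmoothOuter b (Φ n T) := by
  induction h with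
  | zero => exact SmoothOuter.const 0
  | add _ _ h1 h2 => exact h1.add h2
  | single c h hΛ => exact (hC.smooth _ h n).mul (hT.lieIter _ c)

lemma const_mul (hC : CoeffClass b 𝒞) (c : ℝ) (h : Comb 𝒞 P Φ) : Comb 𝒞 P (fun n T p => c * Φ n T p) := by
  induction h with
  | zero => simpa using zero
  | add _ _ h1 h2 => simpa only [mul_add] using h1.add h2
  | single d h hΛ => simpa only [mul_assoc] using single d (hC.const_mul _ c h) hΛ

lemma act (hC : CoeffClass b 𝒞) {X : ZField} (hP : ∀ Λ, P Λ → P' Λ) (hX : ∀ Λ, P Λ → ∃ Λ', P' Λ' ∧ ∀ T :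
    Cov k, lie X.field (lieIter Λ T) = lieIter Λ' T) (h : Comb 𝒞 P Φ) : ∃ Φ', Comb 𝒞 P' Φ' ∧ ∀ n T,
    SmoothCov b T → EqOn (X.field.act (Φ n T)) (Φ' n T) (outer b) := by
  induction h with
  | zero => exact ⟨_, zero, fun n T _ p _ => act_const _ _ _⟩
  | add h1 h2 ih1 ih2 =>
    obtain ⟨Φ1, c1, e1⟩ := ih1
    obtain ⟨Φ2, c2, e2⟩ := ih2
    refine ⟨_, c1.add c2, fun n T hT p hp => ?_⟩
    rw [act_add _ ((h1.smooth hC n hT).diff hp) ((h2.smooth hC n hT).diff hp), e1 n T hT hp, e2 n T hT hp]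
  | @single h Λ c hh hΛ =>
    obtain ⟨Λ', hΛ', e⟩ := hX Λ hΛ
    have c1 : Comb (k := k) 𝒞 P' _ := single c (hC.act _ X hh) (hP _ hΛ)
    have c2 : Comb (k := k) 𝒞 P' _ := single c hh hΛ'
    have c3 : Comb (k := k) 𝒞 P' _ := sum univ (fun s _ => sum (ι := Fin 4) univ
      (fun γ _ => single (update c s γ) (hC.const_mul _ (- X.jac (c s) γ) hh) (hP _ hΛ)))
    refine ⟨_, (c1.add c2).add c3, fun n T hT p hp => ?_⟩
    rw [act_mul _ ((hC.smooth _ hh n).diff hp) ((hT.lieIter Λ c).diff hp), ← e T]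
    simp only [lie_eq]
    have : ∑ s, ∑ γ, -X.jac (c s) γ * h n p * lieIter Λ T (update c s γ) p
        = - (h n p * ∑ s, ∑ γ, lieIter Λ T (update c s γ) p * X.jac (c s) γ) := by
      simp only [mul_sum, ← sum_neg_distrib]
      exact sum_congr rfl fun _ _ => sum_congr rfl fun _ _ => by ring
    rw [this]
    ring

/-- `Φ'` expresses the components of `𝓛_X T'` when `Φ` expresses those of `T'`. -/
lemma lie {l : ℕ} (hC : CoeffClass b 𝒞) {X : ZField} (hP : ∀ Λ, P Λ → P' Λ) (hX : ∀ Λ, P Λ → ∃ Λ', P' Λ' ∧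
    ∀ T : Cov k, Maxwell.lie X.field (lieIter Λ T) = lieIter Λ' T) {Φ : (Fin l → Fin 4) → ℕ → Cov k → Scalar}
    (h : ∀ a, Comb 𝒞 P (Φ a)) : ∃ Φ' : (Fin l → Fin 4) → ℕ → Cov k → Scalar, (∀ a, Comb 𝒞 P' (Φ' a)) ∧
    ∀ n T T', SmoothCov b T → SmoothCov b T' → (∀ a, EqOn (T' a) (Φ a n T) (outer b)) → ∀ a,
    EqOn (Maxwell.lie X.field T' a) (Φ' a n T) (outer b) := by
  choose Φ1 c1 e1 using fun a => act hC hP hX (h a)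
  refine ⟨fun a n T p => Φ1 a n T p + ∑ s, ∑ γ, X.jac (a s) γ * Φ (update a s γ) n T p,
    fun a => (c1 a).add (sum _ fun s _ => sum _ fun γ _ => ((h _).imp hP).const_mul hC _),
    fun n T T' hT hT' hE a p hp => ?_⟩
  rw [lie_eq, act_congr_outer (hT' a) ((h a).smooth hC n hT) (hE a) _ hp, e1 a n T hT hp]
  congr 1
  exact sum_congr rfl fun s _ => sum_congr rfl fun γ _ => by rw [hE _ hp, mul_comm]

/-- Leibniz rule: if `T'` is a linear combination of the components of `T`, then so is `T'^Λ` of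
those of `T^{Λ'}`, `|Λ'| ≤ |Λ|`, with coefficients depending on those of `T'` and `Λ` only. -/
lemma lieIter {l : ℕ} (hC : CoeffClass b 𝒞) {Φ : (Fin l → Fin 4) → ℕ → Cov k → Scalar} (h : ∀ a, Comb 𝒞 (· =
    ⟨[], [], 0⟩) (Φ a)) (Λ : MultiIndex) : ∃ Φ' : (Fin l → Fin 4) → ℕ → Cov k → Scalar, (∀ a,
    Comb 𝒞 (fun Λ' => Λ'.weight ≤ Λ.weight) (Φ' a)) ∧ ∀ n T T', SmoothCov b T → SmoothCov b T' → (∀ a,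
    EqOn (T' a) (Φ a n T) (outer b)) → ∀ a, EqOn (Maxwell.lieIter Λ T' a) (Φ' a n T) (outer b) := by
  let P : MultiIndex → MultiIndex → Prop := fun Λ Λ' =>
    Λ'.i.length ≤ Λ.i.length ∧ Λ'.j.length ≤ Λ.j.length ∧ Λ'.k ≤ Λ.k
  let S : MultiIndex → Prop := fun Λ => ∃ Φ' : (Fin l → Fin 4) → ℕ → Cov k → Scalar,
    (∀ a, Comb 𝒞 (P Λ) (Φ' a)) ∧
      ∀ n T T', SmoothCov b T → SmoothCov b T' → (∀ a, EqOn (T' a) (Φ a n T) (outer b)) →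
        ∀ a, EqOn (Maxwell.lieIter Λ T' a) (Φ' a n T) (outer b)
  have step : ∀ {Λ Λ₁ : MultiIndex} (X : ZField),
      (∀ T : Cov l, Maxwell.lieIter Λ₁ T = Maxwell.lie X.field (Maxwell.lieIter Λ T)) →
      (∀ Λ', P Λ Λ' → P Λ₁ Λ') → (∀ Λ', P Λ Λ' → ∃ Λ'', P Λ₁ Λ'' ∧
        ∀ T : Cov k, Maxwell.lie X.field (Maxwell.lieIter Λ' T) = Maxwell.lieIter Λ'' T) →
      S Λ → S Λ₁ := by
    rintro Λ Λ₁ X hl hP hX ⟨Φ1, c1, e1⟩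
    obtain ⟨Φ2, c2, e2⟩ := lie hC hP hX c1
    exact ⟨Φ2, c2, fun n T T' hT hT' hE a p hp =>
      hl T' ▸ e2 n T _ hT (hT'.lieIter Λ) (e1 n T T' hT hT' hE) a hp⟩
  obtain ⟨i, j, r⟩ := Λ
  have hs : S ⟨i, j, r⟩ := by
    induction i with
    | nil =>
      induction j with
      | nil =>
        induction r with
        | zero => exact ⟨Φ, fun a => (h a).imp fun Λ hΛ => by subst hΛ; exact ⟨le_rfl, le_rfl, le_rfl⟩,
            fun n T T' _ _ hE => hE⟩
        | succ r ih =>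
          have e : ∀ {l : ℕ} (r : ℕ) (T : Cov l), Maxwell.lieIter ⟨[], [], r + 1⟩ T =
              Maxwell.lie scaling (Maxwell.lieIter ⟨[], [], r⟩ T) := fun r T => by
            simp only [Maxwell.lieIter, List.foldr_nil, iterate_succ_apply']
          refine step (Λ := ⟨[], [], r⟩) .scal (e r) (fun Λ' ⟨h1, h2, h3⟩ => ⟨h1, h2, Nat.le_succ_of_le h3⟩) ?_ ih
          rintro ⟨i', j', r'⟩ ⟨h1, h2, h3⟩
          obtain rfl := List.length_eq_zero_iff.1 (Nat.le_zero.1 h1)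
          obtain rfl := List.length_eq_zero_iff.1 (Nat.le_zero.1 h2)
          exact ⟨⟨[], [], r' + 1⟩, ⟨h1, h2, Nat.succ_le_succ h3⟩, fun T => (e r' T).symm⟩
      | cons q j ih =>
        refine step (Λ := ⟨[], j, r⟩) (.rot q) (fun _ => rfl) (fun Λ' ⟨h1, h2, h3⟩ => ⟨h1, Nat.le_succ_of_le h2, h3⟩) ?_ ih
        rintro ⟨i', j', r'⟩ ⟨h1, h2, h3⟩
        obtain rfl := List.length_eq_zero_iff.1 (Nat.le_zero.1 h1)
        exact ⟨⟨[], q :: j', r'⟩, ⟨h1, Nat.succ_le_succ h2, h3⟩, fun T => rfl⟩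
    | cons μ i ih =>
      exact step (Λ := ⟨i, j, r⟩) (.trans μ) (fun _ => rfl) (fun Λ' ⟨h1, h⟩ => ⟨Nat.le_succ_of_le h1, h⟩)
        (fun Λ' ⟨h1, h⟩ => ⟨⟨μ :: Λ'.i, Λ'.j, Λ'.k⟩, ⟨Nat.succ_le_succ h1, h⟩, fun T => rfl⟩) ih
  obtain ⟨Φ', c', e'⟩ := hs
  refine ⟨Φ', fun a => (c' a).imp fun Λ hΛ => ?_, e'⟩
  simp only [P, MultiIndex.weight] at hΛ ⊢
  lia

lemma abs_le (hP : ∀ Λ, P Λ → Λ.weight ≤ m) (h : Comb (SZu b s) P Φ) : ∃ C : ℝ, 0 ≤ C ∧ ∀ n T, ∀ p ∈ outer b,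
    |Φ n T p| ≤ C * ‖p.2‖ ^ s * absSum m T p := by
  induction h with
  | zero => exact ⟨0, le_rfl, fun n T p _ => by simp⟩
  | add _ _ h1 h2 =>
    obtain ⟨C1, hC1, e1⟩ := h1
    obtain ⟨C2, hC2, e2⟩ := h2
    refine ⟨C1 + C2, add_nonneg hC1 hC2, fun n T p hp => ?_⟩
    refine (abs_add_le _ _).trans ((add_le_add (e1 n T p hp) (e2 n T p hp)).trans_eq ?_)
    ring
  | single c hh hΛ =>
    obtain ⟨C, hC, e⟩ := hh.bound
    refine ⟨C, hC, fun n T p hp => ?_⟩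
    rw [abs_mul]
    exact mul_le_mul (e n p hp) (abs_lieIter_le_absSum T p (hP _ hΛ) c) (abs_nonneg _)
      (mul_nonneg hC (zpow_nonneg (norm_nonneg _) _))

lemma abs_pd_le (hb : 1 ≤ b) (hP : ∀ Λ, P Λ → Λ.weight ≤ m)
    (h : Comb (Sym b s) P Φ) :
    ∃ C : ℝ, 0 ≤ C ∧ ∀ n T, SmoothCov b T → ∀ p ∈ outer b, ∀ i : Fin 3,
      |pd i.succ (Φ n T) p| ≤ C * (‖p.2‖ ^ s * absGradSum m T p + ‖p.2‖ ^ (s - 1) * absSum m T p) := by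
  induction h with
  | zero => exact ⟨0, le_rfl, fun n T _ p _ i => by simp [pd_const]⟩
  | add d1 d2 h1 h2 =>
    obtain ⟨C1, hC1, e1⟩ := h1
    obtain ⟨C2, hC2, e2⟩ := h2
    refine ⟨C1 + C2, add_nonneg hC1 hC2, fun n T hT p hp i => ?_⟩
    rw [pd_add ((d1.smooth (coeffClass_Sym hb s) n hT).diff hp)
      ((d2.smooth (coeffClass_Sym hb s) n hT).diff hp)]
    refine (abs_add_le _ _).trans ((add_le_add (e1 n T hT p hp i) (e2 n T hT p hp i)).trans_eq ?_)
    ring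
  | single c hh hΛ =>
    obtain ⟨C, hC, e⟩ := hh.1.bound
    choose C' hC' e' using fun i => (hh.2 i).bound
    have hS : 0 ≤ ∑ i, C' i := sum_nonneg fun i _ => hC' i
    refine ⟨C + ∑ i, C' i, add_nonneg hC hS, fun n T hT p hp i => ?_⟩
    rw [pd_mul ((hh.1.1 n).diff hp) ((hT.lieIter _ c).diff hp)]
    refine (abs_add_le _ _).trans ?_
    rw [abs_mul, abs_mul]
    have n1 : 0 ≤ ‖p.2‖ ^ s := zpow_nonneg (norm_nonneg _) _
    have n2 : 0 ≤ ‖p.2‖ ^ (s - 1) := zpow_nonneg (norm_nonneg _) _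
    have a1 := abs_lieIter_le_absSum T p (hP _ hΛ) c
    have a2 := abs_pd_le_absGradSum T p (hP _ hΛ) c i
    have t1 := mul_le_mul (e' i n p hp) a1 (abs_nonneg _) (mul_nonneg (hC' i) n2)
    have t2 := mul_le_mul (e n p hp) a2 (abs_nonneg _) (mul_nonneg hC n1)
    have l1 : C' i ≤ ∑ i, C' i := le_sum_univ hC' i
    have q1 := mul_nonneg n2 (absSum_nonneg m T p)
    have q2 := mul_nonneg n1 (absGradSum_nonneg m T p)
    have t3 := mul_le_right l1 q1
    nlinarith [mul_nonneg hC q1, mul_nonneg hS q2]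

end Comb

/-! ## A weighted inequality for the divergence-curl system on `ℝ³` -/

/-- The partial derivative `∂_j f` of a function on `ℝ³`. -/
def sd (j : Fin 3) (f : Space → ℝ) (x : Space) : ℝ := fderiv ℝ f x (EuclideanSpace.single j 1)

lemma sd_mul {f g : Space → ℝ} (hf : DifferentiableAt ℝ f x) (hg : DifferentiableAt ℝ g x) (j : Fin 3) :
    sd j (fun y => f y * g y) x = sd j f x * g x + f x * sd j g x := by
  simp [sd, fderiv_fun_mul hf hg]; ring

lemma sd_add {f g : Space → ℝ} (hf : DifferentiableAt ℝ f x) (hg : DifferentiableAt ℝ g x) (j : Fin 3) :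
    sd j (fun y => f y + g y) x = sd j f x + sd j g x := by
  simp [sd, fderiv_fun_add hf hg]

lemma sd_sub {f g : Space → ℝ} (hf : DifferentiableAt ℝ f x) (hg : DifferentiableAt ℝ g x) (j : Fin 3) :
    sd j (fun y => f y - g y) x = sd j f x - sd j g x := by
  simp [sd, fderiv_fun_sub hf hg]

lemma sd_sum {ι : Type*} (s : Finset ι) {f : ι → Space → ℝ} (hf : ∀ i ∈ s, DifferentiableAt ℝ (f i) x) (j :
    Fin 3) : sd j (fun q => ∑ i ∈ s, f i q) x = ∑ i ∈ s, sd j (f i) x := by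
  simp [sd, fderiv_fun_sum hf]

lemma sd_proj (i j : Fin 3) (x : Space) : sd j (fun y => y i) x = if i = j then 1 else 0 := by
  have : (fun y : Space => y i) = (EuclideanSpace.proj i : Space →L[ℝ] ℝ) := rfl
  rw [sd, this, ContinuousLinearMap.fderiv]
  simp

lemma sd_norm (hx : x ≠ 0) (j : Fin 3) : sd j (fun y => ‖y‖) x = x j / ‖x‖ := by
  have h1 := (hasStrictFDerivAt_norm_sq x).hasFDerivAt
  have hd : DifferentiableAt ℝ (fun y : Space => ‖y‖) x := differentiableAt_id.norm ℝ hx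
  have h3 := h1.unique (hd.hasFDerivAt.pow 2)
  have h4 := congrArg (fun L => L (EuclideanSpace.single j (1 : ℝ))) h3
  simp [EuclideanSpace.inner_single_right] at h4
  have hn : ‖x‖ ≠ 0 := norm_ne_zero_iff.2 hx
  rw [sd]
  field_simp
  linarith

lemma sd_comp {φ : ℝ → ℝ} {φ' : ℝ} {f : Space → ℝ} (hφ : HasDerivAt φ φ' (f x)) (hf : DifferentiableAt ℝ f x)
    (j : Fin 3) : sd j (fun y => φ (f y)) x = φ' * sd j f x := by
  have := (hφ.comp_hasFDerivAt x hf.hasFDerivAt).fderiv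
  simp only [Function.comp_def] at this
  rw [sd, this]
  simp [sd]

lemma sd_comm {f : Space → ℝ} (hf : ContDiff ℝ ∞ f) (x : Space) (i j : Fin 3) : sd i (sd j f) x =
    sd j (sd i f) x := by
  have hs : IsSymmSndFDerivAt ℝ f x := hf.contDiffAt.isSymmSndFDerivAt
    (by simpa using (mod_cast le_top : ((2 : ℕ∞) : WithTop ℕ∞) ≤ ((⊤ : ℕ∞) : WithTop ℕ∞)))
  have hd : DifferentiableAt ℝ (fderiv ℝ f) x :=
    (hf.fderiv_right (m := ∞) (by simp)).differentiable (by simp) x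
  have key : ∀ i j, sd i (sd j f) x =
      fderiv ℝ (fderiv ℝ f) x (EuclideanSpace.single i 1) (EuclideanSpace.single j 1) := by
    intro i j
    change fderiv ℝ (fun q => fderiv ℝ f q (EuclideanSpace.single j 1)) x (EuclideanSpace.single i 1) = _
    rw [fderiv_clm_apply hd (by fun_prop)]
    simp
  rw [key, key, hs.eq]

lemma contDiff_sd {f : Space → ℝ} (hf : ContDiff ℝ ∞ f) (j : Fin 3) : ContDiff ℝ ∞ (sd j f) :=
  (hf.fderiv_right (m := ∞) (by simp)).clm_apply contDiff_const

lemma hasCompactSupport_sd {f : Space → ℝ} (hf : HasCompactSupport f) (j : Fin 3) :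
    HasCompactSupport (sd j f) := by
  have := hf.fderiv (𝕜 := ℝ)
  exact this.comp_left (g := fun L : Space →L[ℝ] ℝ => L (EuclideanSpace.single j 1)) (by simp)

lemma integral_sd_eq_zero {f : Space → ℝ} (hf : ContDiff ℝ ∞ f) (hc : HasCompactSupport f) (j : Fin 3) : ∫ x,
    sd j f x = 0 := by
  have h1 : Integrable (sd j f) :=
    (contDiff_sd hf j).continuous.integrable_of_hasCompactSupport (hasCompactSupport_sd hc j)
  have h2 : Integrable f := hf.continuous.integrable_of_hasCompactSupport hc
  have := integral_mul_fderiv_eq_neg_fderiv_mul_of_integrable (μ := (volume : Measure Space))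
    (f := fun _ : Space => (1 : ℝ)) (g := f) (v := EuclideanSpace.single j 1)
    (by simp) (by simp only [one_mul]; exact h1) (by simpa using h2) (fun x _ => by fun_prop)
    (fun x _ => hf.differentiable (by simp) x)
  simpa [sd] using this

/-- The sum of the squares of the divergence and curl of `e`, given its gradient
`A i j = ∂_j e_i`. -/
def divCurlSq (A : Fin 3 → Fin 3 → ℝ) : ℝ :=
  (A 0 0 + A 1 1 + A 2 2) ^ 2 + (A 2 1 - A 1 2) ^ 2 + (A 0 2 - A 2 0) ^ 2 + (A 1 0 - A 0 1) ^ 2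

lemma divCurlSq_nonneg (A : Fin 3 → Fin 3 → ℝ) : 0 ≤ divCurlSq A := by unfold divCurlSq; positivity

lemma sq_sum_three_le (x y z : ℝ) : (x + y + z) ^ 2 ≤ 3 * (x ^ 2 + y ^ 2 + z ^ 2) := by
  nlinarith [sq_nonneg (x - y), sq_nonneg (x - z), sq_nonneg (y - z)]

lemma sq_sub_le_two_mul (x y : ℝ) : (x - y) ^ 2 ≤ 2 * (x ^ 2 + y ^ 2) := by nlinarith [sq_nonneg (x + y)]

lemma cauchy_schwarz_four (a b c d x y z w : ℝ) : (a * x + b * y + c * z + d * w) ^ 2 ≤ (a ^ 2 + b ^ 2 +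
    c ^ 2 + d ^ 2) * (x ^ 2 + y ^ 2 + z ^ 2 + w ^ 2) := by
  nlinarith [sq_nonneg (a * y - b * x), sq_nonneg (a * z - c * x), sq_nonneg (a * w - d * x),
    sq_nonneg (b * z - c * y), sq_nonneg (b * w - d * y), sq_nonneg (c * w - d * z)]

set_option maxHeartbeats 1000000 in
/-- The pointwise form of the weighted divergence-curl inequality. The quantity `d` is a
divergence. -/
lemma weighted_pointwise (A : Fin 3 → Fin 3 → ℝ) (e n : Fin 3 → ℝ) {r κ σ d : ℝ} (hr : 0 < r) (hκ : 0 ≤ κ)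
    (hσ : σ = (1 + κ * r)⁻¹) (hn : n 0 ^ 2 + n 1 ^ 2 + n 2 ^ 2 = 1) (hd : d = r * σ ^ 2 * (∑ i, ∑ j, A i j *
    A j i - (∑ i, A i i) ^ 2) + (1 - κ * r) * σ ^ 3 * (∑ j, n j * (∑ i, e i * A j i - e j * ∑ i, A i i)) +
    (∑ i, e i ^ 2) * (σ ^ 2 / r - κ * σ ^ 3) + σ ^ 2 * ∑ j, n j * ∑ i, e i * A i j) : r⁻¹ * σ ^ 3 * (∑ i,
    e i ^ 2) + r * σ ^ 2 * (∑ i, ∑ j, A i j ^ 2) ≤ 32 * d + 38 * (r * σ ^ 2 * divCurlSq A + σ ^ 2 * (√(∑ i,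
    e i ^ 2) * √(divCurlSq A))) := by
  have hk : 0 < 1 + κ * r := by positivity
  have hσ0 : 0 < σ := by rw [hσ]; positivity
  have hσ1 : σ * (1 + κ * r) = 1 := by rw [hσ]; field_simp
  set P : Fin 3 → Fin 3 → ℝ := fun i j => r * σ * A i j + σ ^ 2 * n j * e i with hP
  set D := A 0 0 + A 1 1 + A 2 2 with hD
  set C0 := A 2 1 - A 1 2 with hC0
  set C1 := A 0 2 - A 2 0 with hC1
  set C2 := A 1 0 - A 0 1 with hC2
  set E := ∑ i, e i ^ 2 with hE
  set Q := ∑ i, ∑ j, P i j ^ 2 with hQ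
  set g := divCurlSq A with hg
  have hg' : g = D ^ 2 + C0 ^ 2 + C1 ^ 2 + C2 ^ 2 := rfl
  set m := (n 0 * e 0 + n 1 * e 1 + n 2 * e 2) * D + (n 1 * e 2 - n 2 * e 1) * C0
    + (n 2 * e 0 - n 0 * e 2) * C1 + (n 0 * e 1 - n 1 * e 0) * C2 with hm
  have hE0 : 0 ≤ E := sum_nonneg fun i _ => sq_nonneg _
  have hQ0 : 0 ≤ Q := sum_nonneg fun i _ => sum_nonneg fun j _ => sq_nonneg _
  have hg0 : 0 ≤ g := divCurlSq_nonneg A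
  have hE' : E = e 0 ^ 2 + e 1 ^ 2 + e 2 ^ 2 := by rw [hE, sum_univ_three]
  clear_value P D C0 C1 C2 m g E Q
  have key : d = r⁻¹ * Q + κ * σ ^ 4 * E - r * σ ^ 2 * g - (1 - κ * r) * σ ^ 3 * m := by
    have hQ' : r⁻¹ * Q = r * σ ^ 2 * (∑ i, ∑ j, A i j ^ 2)
        + 2 * σ ^ 3 * (∑ j, n j * ∑ i, e i * A i j) + r⁻¹ * σ ^ 4 * E := by
      rw [hQ, hE']
      simp only [hP, sum_univ_three]
      field_simp
      linear_combination (e 0 ^ 2 + e 1 ^ 2 + e 2 ^ 2) * σ ^ 2 * hn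
    have hz : σ ^ 2 / r - κ * σ ^ 3 = r⁻¹ * σ ^ 4 + κ * σ ^ 4 := by rw [hσ]; field_simp; ring
    have hs : σ ^ 2 = 2 * σ ^ 3 - (1 - κ * r) * σ ^ 3 := by linear_combination (-σ ^ 2) * hσ1
    rw [hd, hQ', hz, hg', hm, hD, hC0, hC1, hC2]
    simp only [sum_univ_three]
    linear_combination (n 0 * (e 0 * A 0 0 + e 1 * A 1 0 + e 2 * A 2 0)
      + n 1 * (e 0 * A 0 1 + e 1 * A 1 1 + e 2 * A 2 1)
      + n 2 * (e 0 * A 0 2 + e 1 * A 1 2 + e 2 * A 2 2)) * hs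
  have htr : (P 0 0 + P 1 1 + P 2 2) = r * σ * D + σ ^ 2 * (n 0 * e 0 + n 1 * e 1 + n 2 * e 2) := by
    simp only [hP, hD, hC0, hC1, hC2]; ring
  have h0 : P 2 1 - P 1 2 = r * σ * C0 + σ ^ 2 * (n 1 * e 2 - n 2 * e 1) := by
    simp only [hP, hD, hC0, hC1, hC2]; ring
  have h1 : P 0 2 - P 2 0 = r * σ * C1 + σ ^ 2 * (n 2 * e 0 - n 0 * e 2) := by
    simp only [hP, hD, hC0, hC1, hC2]; ring
  have h2 : P 1 0 - P 0 1 = r * σ * C2 + σ ^ 2 * (n 0 * e 1 - n 1 * e 0) := by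
    simp only [hP, hD, hC0, hC1, hC2]; ring
  have lag : E = (n 0 * e 0 + n 1 * e 1 + n 2 * e 2) ^ 2 + (n 1 * e 2 - n 2 * e 1) ^ 2
      + (n 2 * e 0 - n 0 * e 2) ^ 2 + (n 0 * e 1 - n 1 * e 0) ^ 2 := by
    rw [hE']; linear_combination (-(e 0 ^ 2 + e 1 ^ 2 + e 2 ^ 2)) * hn
  have two : ∀ x y z : ℝ, x = y + z → z ^ 2 ≤ 2 * x ^ 2 + 2 * y ^ 2 := by
    intro x y z h
    have : z = x - y := by linarith
    rw [this]; nlinarith [sq_nonneg (x + y)]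
  have hQ3 : Q = P 0 0 ^ 2 + P 0 1 ^ 2 + P 0 2 ^ 2 + (P 1 0 ^ 2 + P 1 1 ^ 2 + P 1 2 ^ 2)
      + (P 2 0 ^ 2 + P 2 1 ^ 2 + P 2 2 ^ 2) := by
    rw [hQ]; simp only [sum_univ_three]
  have coer : σ ^ 4 * E ≤ 10 * Q + 2 * (r * σ) ^ 2 * g := by
    have t0 := two _ _ _ htr
    have t1 := two _ _ _ h0
    have t2 := two _ _ _ h1
    have t3 := two _ _ _ h2
    have u0 := sq_sum_three_le (P 0 0) (P 1 1) (P 2 2)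
    have u1 := sq_sub_le_two_mul (P 2 1) (P 1 2)
    have u2 := sq_sub_le_two_mul (P 0 2) (P 2 0)
    have u3 := sq_sub_le_two_mul (P 1 0) (P 0 1)
    have e1 : σ ^ 4 * E = (σ ^ 2 * (n 0 * e 0 + n 1 * e 1 + n 2 * e 2)) ^ 2
        + (σ ^ 2 * (n 1 * e 2 - n 2 * e 1)) ^ 2 + (σ ^ 2 * (n 2 * e 0 - n 0 * e 2)) ^ 2
        + (σ ^ 2 * (n 0 * e 1 - n 1 * e 0)) ^ 2 := by rw [lag]; ring
    have e2 : 2 * (r * σ) ^ 2 * g = 2 * (r * σ * D) ^ 2 + 2 * (r * σ * C0) ^ 2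
        + 2 * (r * σ * C1) ^ 2 + 2 * (r * σ * C2) ^ 2 := by rw [hg']; ring
    rw [e1, e2, hQ3]
    linarith [sq_nonneg (P 0 0), sq_nonneg (P 0 1), sq_nonneg (P 0 2), sq_nonneg (P 1 0),
      sq_nonneg (P 1 1), sq_nonneg (P 1 2), sq_nonneg (P 2 0), sq_nonneg (P 2 1),
      sq_nonneg (P 2 2)]
  have grad : (r * σ) ^ 2 * (∑ i, ∑ j, A i j ^ 2) ≤ 2 * Q + 2 * (σ ^ 4 * E) := by
    have : ∀ i j, (r * σ * A i j) ^ 2 ≤ 2 * P i j ^ 2 + 2 * (σ ^ 2 * n j * e i) ^ 2 :=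
      fun i j => two _ (σ ^ 2 * n j * e i) _ (by simp only [hP]; ring)
    have hs := sum_le_sum fun i (_ : i ∈ univ) => sum_le_sum fun j (_ : j ∈ univ) => this i j
    have e1 : ∑ i, ∑ j, (r * σ * A i j) ^ 2 = (r * σ) ^ 2 * (∑ i, ∑ j, A i j ^ 2) := by
      simp only [mul_sum, mul_pow]
    have e2 : ∑ i : Fin 3, ∑ j : Fin 3, (2 * P i j ^ 2 + 2 * (σ ^ 2 * n j * e i) ^ 2)
        = 2 * Q + 2 * (σ ^ 4 * E) := by
      rw [hQ3, hE']
      simp only [sum_univ_three]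
      linear_combination 2 * σ ^ 4 * (e 0 ^ 2 + e 1 ^ 2 + e 2 ^ 2) * hn
    linarith [e1, e2, hs]
  have hri : r⁻¹ * r = 1 := by field_simp
  have coer' : r⁻¹ * σ ^ 4 * E ≤ 10 * (r⁻¹ * Q) + 2 * (r * σ ^ 2 * g) := by
    have := mul_le_left coer (inv_nonneg.2 hr.le)
    have e1 : r⁻¹ * (10 * Q + 2 * (r * σ) ^ 2 * g) = 10 * (r⁻¹ * Q) + 2 * (r * σ ^ 2 * g) := by field_simp
    linarith [e1]
  have grad' : r * σ ^ 2 * (∑ i, ∑ j, A i j ^ 2) ≤ 2 * (r⁻¹ * Q) + 2 * (r⁻¹ * σ ^ 4 * E) := by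
    have := mul_le_left grad (inv_nonneg.2 hr.le)
    have e1 : r⁻¹ * ((r * σ) ^ 2 * (∑ i, ∑ j, A i j ^ 2)) = r * σ ^ 2 * (∑ i, ∑ j, A i j ^ 2) := by field_simp
    linarith [e1]
  have sig : r⁻¹ * σ ^ 3 * E = r⁻¹ * σ ^ 4 * E + κ * σ ^ 4 * E := by
    have : r⁻¹ * σ ^ 3 = r⁻¹ * σ ^ 4 + κ * σ ^ 4 := by rw [hσ]; field_simp
    rw [this]; ring
  have hm' : |m| ≤ √E * √g := by
    rw [← sqrt_mul hE0]
    refine abs_le_sqrt ?_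
    rw [lag, hg', hm]
    exact cauchy_schwarz_four _ _ _ _ _ _ _ _
  have hmm : (1 - κ * r) * σ ^ 3 * m ≤ σ ^ 2 * (√E * √g) := by
    have h1 : |(1 - κ * r) * σ ^ 3| ≤ σ ^ 2 := by
      have h3 : σ ^ 2 = (1 + κ * r) * σ ^ 3 := by linear_combination (-σ ^ 2) * hσ1
      rw [abs_mul, abs_of_pos (pow_pos hσ0 3), h3]
      refine mul_le_right ?_ (pow_pos hσ0 3).le
      have := mul_nonneg hκ hr.le
      rw [abs_le]; constructor <;> linarith
    calc (1 - κ * r) * σ ^ 3 * m ≤ |(1 - κ * r) * σ ^ 3 * m| := le_abs_self _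
      _ = |(1 - κ * r) * σ ^ 3| * |m| := abs_mul _ _
      _ ≤ σ ^ 2 * (√E * √g) := mul_le_mul h1 hm' (abs_nonneg _) (sq_nonneg _)
  have hQr : 0 ≤ r⁻¹ * Q := mul_nonneg (inv_nonneg.2 hr.le) hQ0
  have hEk : 0 ≤ κ * σ ^ 4 * E := by positivity
  have hgr : 0 ≤ r * σ ^ 2 * g := by positivity
  have hs0 : 0 ≤ σ ^ 2 * (√E * √g) := by positivity
  linarith

/-- The divergence of the vector field behind `weighted_inequality`. -/
def divTerm (κ : ℝ) (e : Fin 3 → Space → ℝ) (x : Space) : ℝ :=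
  ∑ j, sd j (fun y => ‖y‖ * ((1 + κ * ‖y‖)⁻¹) ^ 2 * (∑ i, e i y * sd i (e j) y - e j y * ∑ i, sd i (e i) y)
    + (1 / 2) * ((1 + κ * ‖y‖)⁻¹) ^ 2 * (∑ i, e i y * e i y) * (y j * ‖y‖⁻¹)) x

lemma contDiff_of_eventually_zero {f : Space → ℝ} (h0 : f =ᶠ[𝓝 0] 0) (h : ∀ x ≠ 0, ContDiffAt ℝ ∞ f x) :
    ContDiff ℝ ∞ f := by
  rw [contDiff_iff_contDiffAt]
  intro x
  by_cases hx : x = 0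
  · subst hx
    exact contDiffAt_const.congr_of_eventuallyEq h0
  · exact h x hx

lemma contDiffAt_sigma {κ : ℝ} (hκ : 0 ≤ κ) (hx : x ≠ 0) : ContDiffAt ℝ ∞ (fun y : Space => (1 + κ * ‖y‖)⁻¹)
    x := by
  have : 1 + κ * ‖x‖ ≠ 0 := by positivity
  exact (contDiffAt_const.add (contDiffAt_const.mul (contDiffAt_id.norm ℝ hx))).inv this

/-- For compactly supported fields vanishing near the origin, the weighted quantity is bounded
pointwise by the divergence and curl, up to a term with vanishing integral. -/
lemma weighted_inequality {κ : ℝ} (hκ : 0 ≤ κ) {e : Fin 3 → Space → ℝ} (he : ∀ i, ContDiff ℝ ∞ (e i)) (hc :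
    ∀ i, HasCompactSupport (e i)) (h0 : ∀ i, e i =ᶠ[𝓝 0] 0) : Integrable (divTerm κ e) ∧ ∫ x, divTerm κ e x =
    0 ∧ ∀ x : Space, ‖x‖⁻¹ * ((1 + κ * ‖x‖)⁻¹) ^ 3 * (∑ i, e i x ^ 2) + ‖x‖ * ((1 + κ * ‖x‖)⁻¹) ^ 2 * (∑ i,
    ∑ j, sd j (e i) x ^ 2) ≤ 32 * divTerm κ e x + 38 * (‖x‖ * ((1 + κ * ‖x‖)⁻¹) ^ 2 *
    divCurlSq (fun i j => sd j (e i) x) + ((1 + κ * ‖x‖)⁻¹) ^ 2 * (√(∑ i, e i x ^ 2) *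
    √(divCurlSq (fun i j => sd j (e i) x)))) := by
  have hsd : ∀ i j, ContDiff ℝ ∞ (sd j (e i)) := fun i j => contDiff_sd (he i) j
  have hz : ∀ᶠ y in 𝓝 (0 : Space), ∀ i, e i y = 0 := eventually_all.2 h0
  set V : Fin 3 → Space → ℝ := fun j y => ‖y‖ * ((1 + κ * ‖y‖)⁻¹) ^ 2 *
      (∑ i, e i y * sd i (e j) y - e j y * ∑ i, sd i (e i) y)
    + (1 / 2) * ((1 + κ * ‖y‖)⁻¹) ^ 2 * (∑ i, e i y * e i y) * (y j * ‖y‖⁻¹) with hV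
  have hVzero : ∀ j y, (∀ i, e i y = 0) → V j y = 0 := by intro j y h; simp [hV, h]
  have hVs : ∀ j, ContDiff ℝ ∞ (V j) := by
    intro j
    refine contDiff_of_eventually_zero ?_ fun x hx => ?_
    · filter_upwards [hz] with y hy using hVzero j y hy
    · have h1 := contDiffAt_sigma hκ hx
      have h2 : ContDiffAt ℝ ∞ (fun y : Space => ‖y‖) x := contDiffAt_id.norm ℝ hx
      have h3 : ContDiffAt ℝ ∞ (fun y : Space => y j) x := by fun_prop
      have hx' : ‖x‖ ≠ 0 := norm_ne_zero_iff.2 hx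
      have h4 : ContDiffAt ℝ ∞ (fun y : Space => ‖y‖⁻¹) x := h2.inv hx'
      refine ((h2.mul (h1.pow 2)).mul ((ContDiffAt.sum fun i _ =>
        (he i).contDiffAt.mul (hsd j i).contDiffAt).sub
          ((he j).contDiffAt.mul (ContDiffAt.sum fun i _ => (hsd i i).contDiffAt)))).add
        (((contDiffAt_const.mul (h1.pow 2)).mul (ContDiffAt.sum fun i _ =>
          (he i).contDiffAt.mul (he i).contDiffAt)).mul (h3.mul h4))
  have hVc : ∀ j, HasCompactSupport (V j) := by
    intro j
    refine HasCompactSupport.of_support_subset_isCompact (isCompact_iUnion fun i => (hc i)) (fun y hy => ?_)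
    by_contra hcon
    simp only [Set.mem_iUnion, not_exists] at hcon
    exact hy (hVzero j y fun i => image_eq_zero_of_notMem_tsupport (hcon i))
  have hint : ∀ j, Integrable (sd j (V j)) := fun j =>
    (contDiff_sd (hVs j) j).continuous.integrable_of_hasCompactSupport (hasCompactSupport_sd (hVc j) j)
  have hdiv : divTerm κ e = fun x => ∑ j, sd j (V j) x := rfl
  refine ⟨?_, ?_, fun x => ?_⟩
  · rw [hdiv]; exact integrable_finsetSum _ fun j _ => hint j
  · rw [hdiv, integral_finsetSum _ fun j _ => hint j]
    exact sum_eq_zero fun j _ => integral_sd_eq_zero (hVs j) (hVc j) j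
  by_cases hx : x = 0
  · subst hx
    have e1 : ∀ i, e i 0 = 0 := fun i => (h0 i).self_of_nhds
    have e2 : ∀ i j, sd j (e i) 0 = 0 := fun i j => by rw [sd, (h0 i).fderiv_eq]; simp
    have e3 : divTerm κ e 0 = 0 := by
      rw [hdiv]
      refine sum_eq_zero fun j _ => ?_
      have : V j =ᶠ[𝓝 0] 0 := by filter_upwards [hz] with y hy using hVzero j y hy
      rw [sd, this.fderiv_eq]; simp
    simp [e1, e2, e3]
  have hn : ‖x‖ ≠ 0 := norm_ne_zero_iff.2 hx
  have hr : 0 < ‖x‖ := norm_pos_iff.2 hx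
  have hk : 1 + κ * ‖x‖ ≠ 0 := by positivity
  refine weighted_pointwise (fun i j => sd j (e i) x) (fun i => e i x) (fun i => x i / ‖x‖) hr hκ rfl ?_ ?_
  · have := EuclideanSpace.norm_sq_eq x
    simp only [sum_univ_three, norm_eq_abs, sq_abs] at this
    field_simp
    linarith
  · have dn : DifferentiableAt ℝ (fun y : Space => ‖y‖) x := differentiableAt_id.norm ℝ hx
    have de : ∀ i, DifferentiableAt ℝ (e i) x := fun i => (he i).differentiable (by simp) x
    have dsd : ∀ i j, DifferentiableAt ℝ (sd j (e i)) x := fun i j => (hsd i j).differentiable (by simp) x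
    have hs : HasDerivAt (fun r : ℝ => r * ((1 + κ * r)⁻¹) ^ 2)
        ((1 - κ * ‖x‖) * ((1 + κ * ‖x‖)⁻¹) ^ 3) ‖x‖ := by
      have h1 : HasDerivAt (fun r : ℝ => 1 + κ * r) κ ‖x‖ := by
        simpa using ((hasDerivAt_id ‖x‖).const_mul κ).const_add 1
      have h2 := (hasDerivAt_id ‖x‖).fun_mul ((h1.fun_inv hk).fun_pow 2)
      refine h2.congr_deriv ?_
      norm_num
      field_simp
      ring
    have hs2 : HasDerivAt (fun r : ℝ => (1 / 2) * ((1 + κ * r)⁻¹) ^ 2) (- κ * ((1 + κ * ‖x‖)⁻¹) ^ 3) ‖x‖ := by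
      have h1 : HasDerivAt (fun r : ℝ => 1 + κ * r) κ ‖x‖ := by
        simpa using ((hasDerivAt_id ‖x‖).const_mul κ).const_add 1
      have h2 := ((h1.fun_inv hk).fun_pow 2).const_mul (1 / 2 : ℝ)
      refine h2.congr_deriv ?_
      norm_num
      field_simp
    have hs3 : HasDerivAt (fun r : ℝ => r⁻¹) (- (‖x‖ ^ 2)⁻¹) ‖x‖ := hasDerivAt_inv hn
    have hVj : ∀ j, sd j (V j) x =
        ((1 - κ * ‖x‖) * ((1 + κ * ‖x‖)⁻¹) ^ 3 * (x j / ‖x‖)) *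
          (∑ i, e i x * sd i (e j) x - e j x * ∑ i, sd i (e i) x)
        + ‖x‖ * ((1 + κ * ‖x‖)⁻¹) ^ 2 *
          ((∑ i, (sd j (e i) x * sd i (e j) x + e i x * sd j (sd i (e j)) x))
            - (sd j (e j) x * (∑ i, sd i (e i) x) + e j x * ∑ i, sd j (sd i (e i)) x))
        + ((- κ * ((1 + κ * ‖x‖)⁻¹) ^ 3 * (x j / ‖x‖)) * (∑ i, e i x * e i x) * (x j * ‖x‖⁻¹)
          + (1 / 2) * ((1 + κ * ‖x‖)⁻¹) ^ 2 *
            ((∑ i, (sd j (e i) x * e i x + e i x * sd j (e i) x)) * (x j * ‖x‖⁻¹)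
            + (∑ i, e i x * e i x) * (‖x‖⁻¹ + x j * (- (‖x‖ ^ 2)⁻¹ * (x j / ‖x‖))))) := by
      intro j
      have d1 : DifferentiableAt ℝ (fun y : Space => ‖y‖ * ((1 + κ * ‖y‖)⁻¹) ^ 2) x :=
        hs.differentiableAt.comp (f := fun y : Space => ‖y‖) x dn
      have d2 : DifferentiableAt ℝ (fun y : Space => (1 / 2) * ((1 + κ * ‖y‖)⁻¹) ^ 2) x :=
        hs2.differentiableAt.comp (f := fun y : Space => ‖y‖) x dn
      have d3 : DifferentiableAt ℝ (fun y : Space => ‖y‖⁻¹) x :=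
        hs3.differentiableAt.comp (f := fun y : Space => ‖y‖) x dn
      have d4 : DifferentiableAt ℝ (fun y : Space => y j) x := by fun_prop
      have d5 : ∀ i, DifferentiableAt ℝ (fun y => e i y * sd i (e j) y) x := fun i => (de i).fun_mul (dsd j i)
      have d6 : DifferentiableAt ℝ (fun y => ∑ i, sd i (e i) y) x :=
        DifferentiableAt.fun_sum fun i _ => dsd i i
      have d7 : ∀ i, DifferentiableAt ℝ (fun y => e i y * e i y) x := fun i => (de i).fun_mul (de i)
      have d8 : DifferentiableAt ℝ (fun y => ∑ i, e i y * sd i (e j) y) x :=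
        DifferentiableAt.fun_sum fun i _ => d5 i
      have d9 : DifferentiableAt ℝ (fun y => ∑ i, e i y * e i y) x := DifferentiableAt.fun_sum fun i _ => d7 i
      have d10 := (de j).fun_mul d6
      have d11 := d8.fun_sub d10
      have d12 := d4.fun_mul d3
      have d13 := d2.fun_mul d9
      rw [hV, sd_add (d1.fun_mul d11) (d13.fun_mul d12), sd_mul d1 d11, sd_sub d8 d10,
        sd_sum _ (fun i _ => d5 i), sd_mul (de j) d6, sd_sum _ (fun i _ => dsd i i),
        sd_mul d13 d12, sd_mul d2 d9, sd_sum _ (fun i _ => d7 i), sd_mul d4 d3,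
        sd_comp (f := fun y : Space => ‖y‖) hs dn, sd_comp (f := fun y : Space => ‖y‖) hs2 dn,
        sd_comp (f := fun y : Space => ‖y‖) hs3 dn, sd_norm hx, sd_proj]
      simp only [sd_mul (de _) (dsd _ _), sd_mul (de _) (de _), if_true]
      ring
    rw [hdiv]
    simp only [hVj, sum_univ_three]
    rw [sd_comm (he 0) x 1 0, sd_comm (he 0) x 2 0, sd_comm (he 1) x 1 0, sd_comm (he 1) x 2 1,
      sd_comm (he 2) x 2 0, sd_comm (he 2) x 2 1]
    have hx2 : x 0 ^ 2 + x 1 ^ 2 + x 2 ^ 2 = ‖x‖ ^ 2 := by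
      have := EuclideanSpace.norm_sq_eq x
      simp only [sum_univ_three, norm_eq_abs, sq_abs] at this
      exact this.symm
    set σ := (1 + κ * ‖x‖)⁻¹
    set r := ‖x‖
    field_simp
    set E := e 0 x ^ 2 + e 1 x ^ 2 + e 2 x ^ 2 with hE
    linear_combination (-σ ^ 2 * (2 * κ * σ * r + 1) * E) * hx2

/-! ## The exterior estimate for divergence-curl systems with decaying coefficients -/

lemma absorb_pointwise {r κ σ S G H q w K : ℝ} (hb : 1 ≤ b) (hK : 1 ≤ K) (hbK : 380 * K ≤ b) (hr : b ≤ r)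
    (hκ : 0 ≤ κ) (hκb : κ * b ≤ 1) (hσ : σ = (1 + κ * r)⁻¹) (hS : 0 ≤ S) (hG : 0 ≤ G) (hq : 0 ≤ q) (hw : 0 ≤
    w) (hH0 : 0 ≤ H) (hH : H ^ 2 ≤ K * (q ^ 2 + w ^ 2 + (r⁻¹ * G) ^ 2 + (r⁻¹ * r⁻¹ * S) ^ 2)) : 38 * (r *
    σ ^ 2 * H ^ 2 + σ ^ 2 * (S * H)) ≤ 1 / 2 * (r⁻¹ * σ ^ 3 * S ^ 2 + r * σ ^ 2 * G ^ 2) + 38 * K * (r *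
    σ ^ 2 * (q ^ 2 + w ^ 2) + σ ^ 2 * (S * (q + w))) := by
  have hb0 : 0 < b := by linarith
  have hr0 : 0 < r := by linarith
  have hK0 : 0 < K := by linarith
  have hk : 0 < 1 + κ * r := by positivity
  have hσ0 : 0 < σ := by rw [hσ]; positivity
  have hσ1 : σ * (1 + κ * r) = 1 := by rw [hσ]; field_simp
  have hri : 0 < r⁻¹ := by positivity
  -- `1 + κ r ≤ 2 r / b`
  have hτ : b * (1 + κ * r) ≤ 2 * r := by
    have : κ * b * r ≤ 1 * r := mul_le_right hκb hr0.le
    linarith [this]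
  have hτσ : b * r⁻¹ ≤ 2 * σ := by
    have h1 : b * (1 + κ * r) * (σ * r⁻¹) ≤ 2 * r * (σ * r⁻¹) := mul_le_right hτ (by positivity)
    have h2 : b * (1 + κ * r) * (σ * r⁻¹) = b * r⁻¹ * (σ * (1 + κ * r)) := by ring
    have h3 : 2 * r * (σ * r⁻¹) = 2 * σ := by field_simp
    rw [h2, h3, hσ1, mul_one] at h1
    exact h1
  have hrb : b * r⁻¹ ≤ 1 := by rw [mul_inv_le_iff₀ hr0]; linarith
  have hri1 : r⁻¹ ≤ 1 := inv_le_one_of_one_le₀ (by linarith)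
  set X := r⁻¹ * σ ^ 3 * S ^ 2 with hX
  set Y := r * σ ^ 2 * G ^ 2 with hY
  have hX0 : 0 ≤ X := by positivity
  have hY0 : 0 ≤ Y := by positivity
  have hHle : H ≤ K * (q + w + r⁻¹ * G + r⁻¹ * r⁻¹ * S) := by
    refine (pow_le_pow_iff_left₀ hH0 (by positivity) two_ne_zero).1 (hH.trans ?_)
    have a1 : 0 ≤ r⁻¹ * G := by positivity
    have a2 : 0 ≤ r⁻¹ * r⁻¹ * S := by positivity
    have : q ^ 2 + w ^ 2 + (r⁻¹ * G) ^ 2 + (r⁻¹ * r⁻¹ * S) ^ 2 ≤ (q + w + r⁻¹ * G + r⁻¹ * r⁻¹ * S) ^ 2 := by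
      nlinarith [mul_nonneg hq hw, mul_nonneg hq a1, mul_nonneg hq a2, mul_nonneg hw a1,
        mul_nonneg hw a2, mul_nonneg a1 a2]
    rw [mul_pow K (q + w + r⁻¹ * G + r⁻¹ * r⁻¹ * S) 2]
    exact mul_le_mul (by nlinarith) this (by positivity) (by positivity)
  have i1 : b * (r * σ ^ 2 * (r⁻¹ * G) ^ 2) ≤ Y := by
    have : b * (r * σ ^ 2 * (r⁻¹ * G) ^ 2) = (b * r⁻¹) * r⁻¹ * Y := by rw [hY]; ring
    rw [this]
    have : (b * r⁻¹) * r⁻¹ ≤ 1 := mul_le_one₀ hrb hri.le hri1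
    exact mul_le_of_le_one_left hY0 this
  have i4 : b * (σ ^ 2 * (S * (r⁻¹ * r⁻¹ * S))) ≤ 2 * X := by
    have h1 : b * (σ ^ 2 * (S * (r⁻¹ * r⁻¹ * S))) = (b * r⁻¹) * (σ ^ 2 * r⁻¹ * S ^ 2) := by ring
    have h2 : 2 * X = 2 * σ * (σ ^ 2 * r⁻¹ * S ^ 2) := by rw [hX]; ring
    rw [h1, h2]
    exact mul_le_right hτσ (by positivity)
  have i2 : b * (r * σ ^ 2 * (r⁻¹ * r⁻¹ * S) ^ 2) ≤ 2 * X := by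
    have h1 : b * (r * σ ^ 2 * (r⁻¹ * r⁻¹ * S) ^ 2)
        = r⁻¹ * (b * (σ ^ 2 * (S * (r⁻¹ * r⁻¹ * S)))) := by field_simp
    rw [h1]
    exact (mul_le_of_le_one_left (by positivity) hri1).trans i4
  have i3 : b * (σ ^ 2 * (S * (r⁻¹ * G))) ≤ X + Y := by
    have h1 : 2 * (b * (σ ^ 2 * (S * (r⁻¹ * G)))) ≤ Y + b * r⁻¹ * (b * (σ ^ 2 * (S * (r⁻¹ * r⁻¹ * S)))) := by
      have : Y + b * r⁻¹ * (b * (σ ^ 2 * (S * (r⁻¹ * r⁻¹ * S))))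
          - 2 * (b * (σ ^ 2 * (S * (r⁻¹ * G)))) = r * σ ^ 2 * (G - b * r⁻¹ * r⁻¹ * S) ^ 2 := by
        rw [hY]; field_simp; ring
      have h0 : 0 ≤ r * σ ^ 2 * (G - b * r⁻¹ * r⁻¹ * S) ^ 2 := by positivity
      linarith
    have h2 : b * r⁻¹ * (b * (σ ^ 2 * (S * (r⁻¹ * r⁻¹ * S)))) ≤ 2 * X :=
      (mul_le_of_le_one_left (by positivity) hrb).trans i4
    linarith
  have t1 : r * σ ^ 2 * H ^ 2 ≤ K * (r * σ ^ 2 * (q ^ 2 + w ^ 2)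
      + r * σ ^ 2 * (r⁻¹ * G) ^ 2 + r * σ ^ 2 * (r⁻¹ * r⁻¹ * S) ^ 2) := by
    refine (mul_le_left hH (by positivity : 0 ≤ r * σ ^ 2)).trans_eq ?_
    ring
  have t2 : σ ^ 2 * (S * H) ≤ K * (σ ^ 2 * (S * (q + w)) + σ ^ 2 * (S * (r⁻¹ * G))
      + σ ^ 2 * (S * (r⁻¹ * r⁻¹ * S))) := by
    refine (mul_le_left (mul_le_left hHle hS) (sq_nonneg σ)).trans_eq ?_
    ring
  set Z := r * σ ^ 2 * (r⁻¹ * G) ^ 2 + r * σ ^ 2 * (r⁻¹ * r⁻¹ * S) ^ 2 + σ ^ 2 * (S * (r⁻¹ * G))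
      + σ ^ 2 * (S * (r⁻¹ * r⁻¹ * S)) with hZ
  have hZ0 : 0 ≤ Z := by positivity
  have hbZ : b * Z ≤ 5 * (X + Y) := by rw [hZ]; linarith
  have hKZ : 380 * K * Z ≤ 5 * (X + Y) := (mul_le_right hbK hZ0).trans hbZ
  have : 38 * (r * σ ^ 2 * H ^ 2 + σ ^ 2 * (S * H)) ≤
      38 * K * (r * σ ^ 2 * (q ^ 2 + w ^ 2) + σ ^ 2 * (S * (q + w))) + 38 * K * Z := by
    rw [hZ]; linarith
  linarith

lemma divCurlSq_add_le (A B : Fin 3 → Fin 3 → ℝ) : divCurlSq (fun i j => A i j + B i j) ≤ 2 * divCurlSq A +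
    2 * divCurlSq B := by
  have two : ∀ x y : ℝ, (x + y) ^ 2 ≤ 2 * x ^ 2 + 2 * y ^ 2 := fun x y => by nlinarith [sq_nonneg (x - y)]
  unfold divCurlSq
  have h0 := two (A 0 0 + A 1 1 + A 2 2) (B 0 0 + B 1 1 + B 2 2)
  have h1 := two (A 2 1 - A 1 2) (B 2 1 - B 1 2)
  have h2 := two (A 0 2 - A 2 0) (B 0 2 - B 2 0)
  have h3 := two (A 1 0 - A 0 1) (B 1 0 - B 0 1)
  calc _ = (A 0 0 + A 1 1 + A 2 2 + (B 0 0 + B 1 1 + B 2 2)) ^ 2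
      + (A 2 1 - A 1 2 + (B 2 1 - B 1 2)) ^ 2 + (A 0 2 - A 2 0 + (B 0 2 - B 2 0)) ^ 2
      + (A 1 0 - A 0 1 + (B 1 0 - B 0 1)) ^ 2 := by ring
    _ ≤ _ := by linarith

lemma divCurlSq_const_mul (c : ℝ) (A : Fin 3 → Fin 3 → ℝ) : divCurlSq (fun i j => c * A i j) = c ^ 2 *
    divCurlSq A := by
  unfold divCurlSq; ring

lemma divCurlSq_tensor (f w : Fin 3 → ℝ) : divCurlSq (fun i j => w j * f i) = (∑ j, w j ^ 2) * ∑ i,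
    f i ^ 2 := by
  simp only [divCurlSq, sum_univ_three]; ring

/-- The closed annulus `a ≤ r ≤ c`. -/
def annulus (a c : ℝ) : Set Space := {x | a ≤ ‖x‖ ∧ ‖x‖ ≤ c}

lemma isCompact_annulus (a c : ℝ) : IsCompact (annulus a c) := by
  refine (isCompact_closedBall (0 : Space) c).of_isClosed_subset ?_ fun x hx => ?_
  · exact (isClosed_le continuous_const continuous_norm).inter (isClosed_le continuous_norm continuous_const)
  · simpa using hx.2

lemma measurableSet_annulus (a c : ℝ) : MeasurableSet (annulus a c) :=
  (isCompact_annulus a c).isClosed.measurableSet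

/-- The cutoff supported in `b ≤ r ≤ 2 L`, equal to `1` for `2 b ≤ r ≤ L`. -/
def bump (b L : ℝ) (x : Space) : ℝ := (1 - cutProfile (‖x‖ / b)) * cutProfile (‖x‖ / L)

lemma deriv_cutProfile_of_lt {y : ℝ} (hy : y < 1) : deriv cutProfile y = 0 := by
  have : cutProfile =ᶠ[𝓝 y] fun _ => 1 := by
    filter_upwards [Iio_mem_nhds hy] with z hz using cutProfile_of_le (le_of_lt hz)
  rw [this.deriv_eq]; simp

lemma deriv_cutProfile_of_gt {y : ℝ} (hy : 2 < y) : deriv cutProfile y = 0 := by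
  have : cutProfile =ᶠ[𝓝 y] fun _ => 0 := by
    filter_upwards [Ioi_mem_nhds hy] with z hz using cutProfile_of_ge (le_of_lt hz)
  rw [this.deriv_eq]; simp

lemma exists_bound_deriv_cutProfile : ∃ c : ℝ, 0 ≤ c ∧ ∀ y, |y * deriv cutProfile y| ≤ c := by
  have hc : Continuous (deriv cutProfile) := (contDiff_infty_iff_deriv.1 contDiff_cutProfile).2.continuous
  obtain ⟨c, h⟩ := (isCompact_Icc (a := (1 : ℝ)) (b := 2)).exists_bound_of_continuousOn
    (continuous_id.mul hc).continuousOn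
  refine ⟨|c|, abs_nonneg c, fun y => ?_⟩
  by_cases h1 : y < 1
  · rw [deriv_cutProfile_of_lt h1]; simp
  by_cases h2 : 2 < y
  · rw [deriv_cutProfile_of_gt h2]; simp
  exact (h y ⟨not_lt.1 h1, not_lt.1 h2⟩).trans (le_abs_self c)

section bump

variable {L : ℝ}

lemma bump_nonneg (x : Space) : 0 ≤ bump b L x :=
  mul_nonneg (sub_nonneg.2 (cutProfile_le_one _)) (cutProfile_nonneg _)

lemma bump_le_one (x : Space) : bump b L x ≤ 1 :=
  mul_le_one₀ (by linarith [cutProfile_nonneg (‖x‖ / b)]) (cutProfile_nonneg _) (cutProfile_le_one _)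

lemma bump_of_le (hb : 0 < b) (hx : ‖x‖ ≤ b) : bump b L x = 0 := by
  rw [bump, cutProfile_of_le ((div_le_one hb).2 hx)]; simp

lemma bump_of_ge (hL : 0 < L) (hx : 2 * L ≤ ‖x‖) : bump b L x = 0 := by
  rw [bump, cutProfile_of_ge (y := ‖x‖ / L) ((le_div_iff₀ hL).2 hx)]; simp

lemma bump_eq_one (hb : 0 < b) (hL : 0 < L) (hx : 2 * b ≤ ‖x‖) (hx' : ‖x‖ ≤ L) : bump b L x = 1 := by
  rw [bump, cutProfile_of_ge ((le_div_iff₀ hb).2 hx), cutProfile_of_le ((div_le_one hL).2 hx')]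
  simp

lemma contDiff_bump (hb : 0 < b) : ContDiff ℝ ∞ (bump b L) := by
  rw [contDiff_iff_contDiffAt]
  intro x
  by_cases hx : x = 0
  · subst hx
    have : bump b L =ᶠ[𝓝 0] fun _ => 0 := by
      have hm : ball (0 : Space) b ∈ 𝓝 0 := Metric.ball_mem_nhds _ hb
      filter_upwards [hm] with y hy
      exact bump_of_le hb (by simpa using (Metric.mem_ball.1 hy).le)
    exact contDiffAt_const.congr_of_eventuallyEq this
  · have hn : ContDiffAt ℝ ∞ (fun y : Space => ‖y‖) x := contDiffAt_id.norm ℝ hx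
    exact (contDiffAt_const.sub (contDiff_cutProfile.contDiffAt.comp x (hn.div_const b))).mul
      (contDiff_cutProfile.contDiffAt.comp x (hn.div_const L))

end bump

lemma exists_sd_bump_bound : ∃ c : ℝ, 0 ≤ c ∧ ∀ b L : ℝ, 0 < b → 0 < L → ∀ x : Space, (∑ k, sd k (bump b L)
    x ^ 2 ≤ (c * ‖x‖⁻¹) ^ 2) ∧ (x ∉ annulus b (2 * b) → x ∉ annulus L (2 * L) → ∑ k, sd k (bump b L) x ^ 2 =
    0) := by
  obtain ⟨c, hc0, hc⟩ := exists_bound_deriv_cutProfile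
  refine ⟨2 * c, by positivity, fun b L hb hL x => ?_⟩
  by_cases hx : x = 0
  · subst hx
    have : bump b L =ᶠ[𝓝 0] fun _ => 0 := by
      have hm : ball (0 : Space) b ∈ 𝓝 0 := Metric.ball_mem_nhds _ hb
      filter_upwards [hm] with y hy
      exact bump_of_le hb (by simpa using (Metric.mem_ball.1 hy).le)
    have : ∀ k, sd k (bump b L) 0 = 0 := fun k => by rw [sd, this.fderiv_eq]; simp
    simp [this]
  have hn : ‖x‖ ≠ 0 := norm_ne_zero_iff.2 hx
  have hr : 0 < ‖x‖ := norm_pos_iff.2 hx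
  have dn : DifferentiableAt ℝ (fun y : Space => ‖y‖) x := differentiableAt_id.norm ℝ hx
  have hφ : Differentiable ℝ cutProfile := contDiff_cutProfile.differentiable (by simp)
  have hcomp : ∀ a : ℝ, HasDerivAt (fun r : ℝ => cutProfile (r / a))
      (deriv cutProfile (‖x‖ / a) / a) ‖x‖ := fun a => by
    have h1 : HasDerivAt (fun r : ℝ => r / a) (1 / a) ‖x‖ := (hasDerivAt_id ‖x‖).div_const a
    have := (hφ (‖x‖ / a)).hasDerivAt.comp ‖x‖ h1
    simpa [Function.comp_def, div_eq_mul_inv] using this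
  set u := ‖x‖ / b * deriv cutProfile (‖x‖ / b) with hu
  set v := ‖x‖ / L * deriv cutProfile (‖x‖ / L) with hv
  have hsd : ∀ k, sd k (bump b L) x =
      (- u * cutProfile (‖x‖ / L) + (1 - cutProfile (‖x‖ / b)) * v) * ‖x‖⁻¹ * (x k / ‖x‖) := by
    intro k
    have h := ((hcomp b).const_sub 1).fun_mul (hcomp L)
    have := sd_comp (f := fun y : Space => ‖y‖) h dn k
    rw [sd_norm hx] at this
    rw [show bump b L = fun y : Space => (1 - cutProfile (‖y‖ / b)) * cutProfile (‖y‖ / L) from rfl,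
      this, hu, hv]
    field_simp
  have hx2 : ∑ k, (x k / ‖x‖) ^ 2 = 1 := by
    have := EuclideanSpace.norm_sq_eq x
    simp only [norm_eq_abs, sq_abs] at this
    simp only [div_pow, ← sum_div, ← this]
    field_simp
  have hsum : ∑ k, sd k (bump b L) x ^ 2 =
      ((- u * cutProfile (‖x‖ / L) + (1 - cutProfile (‖x‖ / b)) * v) * ‖x‖⁻¹) ^ 2 := by
    simp only [hsd, mul_pow _ (x _ / ‖x‖), ← mul_sum, hx2, mul_one]
  rw [hsum]
  constructor
  · refine sq_le_sq' ?_ ?_ <;>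
    · have hu' := hc (‖x‖ / b)
      have hv' := hc (‖x‖ / L)
      rw [← hu] at hu'
      rw [← hv] at hv'
      have h1 := cutProfile_nonneg (‖x‖ / L)
      have h2 := cutProfile_le_one (‖x‖ / L)
      have h3 := cutProfile_nonneg (‖x‖ / b)
      have h4 := cutProfile_le_one (‖x‖ / b)
      have hab : |- u * cutProfile (‖x‖ / L) + (1 - cutProfile (‖x‖ / b)) * v| ≤ 2 * c := by
        refine (abs_add_le _ _).trans ?_
        rw [abs_mul, abs_mul, abs_neg, abs_of_nonneg h1, abs_of_nonneg (sub_nonneg.2 h4)]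
        have e1 : |u| * cutProfile (‖x‖ / L) ≤ c * 1 := mul_le_mul hu' h2 h1 hc0
        have e2 : (1 - cutProfile (‖x‖ / b)) * |v| ≤ 1 * c :=
          mul_le_mul (by linarith) hv' (abs_nonneg _) zero_le_one
        linarith
      have := abs_le.1 hab
      first
      | (rw [← neg_mul]; exact mul_le_right this.1 (inv_nonneg.2 hr.le))
      | exact mul_le_right this.2 (inv_nonneg.2 hr.le)
  · intro h1 h2
    have key : ∀ a : ℝ, 0 < a → x ∉ annulus a (2 * a) → deriv cutProfile (‖x‖ / a) = 0 := by
      intro a ha h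
      by_cases h1 : ‖x‖ < a
      · exact deriv_cutProfile_of_lt ((div_lt_one ha).2 h1)
      · refine deriv_cutProfile_of_gt ((lt_div_iff₀ ha).2 ?_)
        by_contra h2
        exact h ⟨not_lt.1 h1, not_lt.1 h2⟩
    rw [hu, hv, key b hb h1, key L hL h2]
    simp

variable {ι : Type*} [Fintype ι]

/-- The squared size of a finite family of vector fields. -/
def fieldSq (f : ι → Fin 3 → Space → ℝ) (x : Space) : ℝ := ∑ i, ∑ j, f i j x ^ 2

/-- The squared size of the gradient of a finite family of vector fields. -/
def gradSq (f : ι → Fin 3 → Space → ℝ) (x : Space) : ℝ := ∑ i, ∑ j, ∑ k, sd k (f i j) x ^ 2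

lemma fieldSq_nonneg (f : ι → Fin 3 → Space → ℝ) (x : Space) : 0 ≤ fieldSq f x :=
  sum_nonneg fun _ _ => sum_nonneg fun _ _ => sq_nonneg _

lemma gradSq_nonneg (f : ι → Fin 3 → Space → ℝ) (x : Space) : 0 ≤ gradSq f x :=
  sum_nonneg fun _ _ => sum_nonneg fun _ _ => sum_nonneg fun _ _ => sq_nonneg _

lemma sum_sqrt_mul_sqrt_le {u v : ι → ℝ} (hu : ∀ i, 0 ≤ u i) (hv : ∀ i, 0 ≤ v i) : ∑ i, √(u i) * √(v i) ≤
    √(∑ i, u i) * √(∑ i, v i) :=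
  Real.sum_sqrt_mul_sqrt_le _ hu hv

/-- The gradient and the divergence-curl of a localized family. -/
lemma localized_bounds {f : ι → Fin 3 → Space → ℝ} {v : Space → ℝ} {K Q s : ℝ} (hf : ∀ i j,
    DifferentiableAt ℝ (f i j) x) (hv : DifferentiableAt ℝ v x) (hK : 0 ≤ K) (hr : 1 ≤ ‖x‖) (h : ∀ i,
    divCurlSq (fun j k => sd k (f i j) x) ≤ K * (Q ^ 2 + (‖x‖⁻¹) ^ 2 * gradSq f x + s ^ 2 * fieldSq f x)) :
    ∑ i, divCurlSq (fun j k => sd k (fun y => v y * f i j y) x) ≤ (Fintype.card ι * (4 * K) + 4 * K *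
    Fintype.card ι + 2) * ((v x * Q) ^ 2 + (∑ k, sd k v x ^ 2) * fieldSq f x + (‖x‖⁻¹) ^ 2 *
    gradSq (fun i j y => v y * f i j y) x + s ^ 2 * fieldSq (fun i j y => v y * f i j y) x) := by
  set W := ∑ k, sd k v x ^ 2 with hW
  have hW0 : 0 ≤ W := sum_nonneg fun _ _ => sq_nonneg _
  have hsd : ∀ i j k, sd k (fun y => v y * f i j y) x = v x * sd k (f i j) x + sd k v x * f i j x :=
    fun i j k => by rw [sd_mul hv (hf i j)]; ring
  have hS : fieldSq (fun i j y => v y * f i j y) x = v x ^ 2 * fieldSq f x := by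
    simp only [fieldSq, mul_pow, mul_sum]
  have hG : v x ^ 2 * gradSq f x ≤ 2 * gradSq (fun i j y => v y * f i j y) x + 2 * (W * fieldSq f x) := by
    have e1 : W * fieldSq f x = ∑ i, ∑ j, ∑ k, (sd k v x * f i j x) ^ 2 := by
      rw [fieldSq, mul_sum]
      refine sum_congr rfl fun i _ => ?_
      rw [mul_sum]
      refine sum_congr rfl fun j _ => ?_
      rw [hW, sum_mul]
      simp only [mul_pow]
    rw [e1]
    simp only [gradSq, hsd, mul_sum, ← sum_add_distrib]
    refine sum_le_sum fun i _ => sum_le_sum fun j _ => sum_le_sum fun k _ => ?_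
    nlinarith [sq_nonneg (v x * sd k (f i j) x + 2 * (sd k v x * f i j x))]
  have h1 : ∀ i, divCurlSq (fun j k => sd k (fun y => v y * f i j y) x) ≤
      2 * (v x ^ 2 * (K * (Q ^ 2 + (‖x‖⁻¹) ^ 2 * gradSq f x + s ^ 2 * fieldSq f x)))
        + 2 * (W * ∑ j, f i j x ^ 2) := fun i => by
    simp only [hsd]
    refine (divCurlSq_add_le _ _).trans ?_
    rw [divCurlSq_const_mul, divCurlSq_tensor]
    have := mul_le_left (h i) (sq_nonneg (v x))
    linarith
  refine (sum_le_sum fun i _ => h1 i).trans ?_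
  rw [sum_add_distrib, sum_const, ← mul_sum, ← mul_sum, card_univ, nsmul_eq_mul]
  change _ + 2 * (W * fieldSq f x) ≤ _
  rw [hS]
  have hr2 : (‖x‖⁻¹) ^ 2 ≤ 1 := pow_le_one₀ (by positivity) (inv_le_one_of_one_le₀ hr)
  have hr20 : 0 ≤ (‖x‖⁻¹) ^ 2 := sq_nonneg _
  have hF := fieldSq_nonneg f x
  have hGe := gradSq_nonneg (fun i j y => v y * f i j y) x
  have hN : (0 : ℝ) ≤ Fintype.card ι := Nat.cast_nonneg _
  have hNK : 0 ≤ Fintype.card ι * K := mul_nonneg hN hK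
  have a1 := mul_le_left hG hr20
  have a2 : (‖x‖⁻¹) ^ 2 * (W * fieldSq f x) ≤ W * fieldSq f x := mul_le_of_le_one_left (mul_nonneg hW0 hF) hr2
  have a3 := mul_le_left (show (‖x‖⁻¹) ^ 2 * (v x ^ 2 * gradSq f x) ≤
    2 * ((‖x‖⁻¹) ^ 2 * gradSq (fun i j y => v y * f i j y) x) + 2 * (W * fieldSq f x) by linarith) hNK
  have p1 : 0 ≤ (v x * Q) ^ 2 := sq_nonneg _
  have p2 := mul_nonneg hW0 hF
  have p3 := mul_nonneg hr20 hGe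
  have p4 : 0 ≤ s ^ 2 * (v x ^ 2 * fieldSq f x) := by positivity
  nlinarith [mul_nonneg hNK p1, mul_nonneg hNK p2, mul_nonneg hNK p3, mul_nonneg hNK p4]

/-- The weight `(1 + κ r)⁻¹`. -/
def sigma (κ : ℝ) (x : Space) : ℝ := (1 + κ * ‖x‖)⁻¹

lemma sigma_pos {κ : ℝ} (hκ : 0 ≤ κ) (x : Space) : 0 < sigma κ x := by unfold sigma; positivity

lemma continuous_sigma {κ : ℝ} (hκ : 0 ≤ κ) : Continuous (sigma κ) := by
  unfold sigma
  exact (continuous_const.add (continuous_const.mul continuous_norm)).inv₀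
    fun x => (by positivity : (0 : ℝ) < 1 + κ * ‖x‖).ne'

lemma continuousOn_inv_norm {a : ℝ} (ha : 0 < a) : ContinuousOn (fun x : Space => ‖x‖⁻¹) {x | a ≤ ‖x‖} :=
  continuous_norm.continuousOn.inv₀ fun _ hx => (ha.trans_le hx).ne'

lemma integrableOn_annulus {u : Space → ℝ} {a c d : ℝ} (h : ContinuousOn u {x | a ≤ ‖x‖}) (had : a ≤ d) :
    IntegrableOn u (annulus d c) :=
  (h.mono fun _ hx => had.trans hx.1).integrableOn_compact (isCompact_annulus d c)

set_option maxHeartbeats 1000000 in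
lemma exterior_pointwise (K : ℝ) (hK : 0 ≤ K) : ∃ b₀ C : ℝ, 1 ≤ b₀ ∧ 0 ≤ C ∧ ∀ b L κ : ℝ, b₀ ≤ b → b ≤ L → 0 ≤
    κ → κ * b ≤ 1 → ∀ (f : ι → Fin 3 → Space → ℝ) (q : Space → ℝ), (∀ i j x, b ≤ ‖x‖ → ContDiffAt ℝ ∞ (f i j)
    x) → (∀ x, b ≤ ‖x‖ → 0 ≤ q x) → (∀ x, b ≤ ‖x‖ → ∀ i, divCurlSq (fun j k => sd k (f i j) x) ≤ K *
    (q x ^ 2 + (‖x‖⁻¹) ^ 2 * gradSq f x + (‖x‖⁻¹ * ‖x‖⁻¹) ^ 2 * fieldSq f x)) → ∃ d : Space → ℝ,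
    Integrable d ∧ ∫ x, d x = 0 ∧ ∀ x, (annulus (2 * b) L).indicator (fun x => ‖x‖⁻¹ * sigma κ x ^ 3 *
    fieldSq f x) x ≤ d x + C * ((annulus b (2 * L)).indicator (fun x => ‖x‖ * sigma κ x ^ 2 * q x ^ 2 +
    sigma κ x ^ 2 * (√(fieldSq f x) * q x)) x + (annulus b (2 * b)).indicator (fun x => ‖x‖⁻¹ *
    sigma κ x ^ 2 * fieldSq f x) x + (annulus L (2 * L)).indicator (fun x => ‖x‖⁻¹ * sigma κ x ^ 2 *
    fieldSq f x) x) := by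
  obtain ⟨c, hc0, hc⟩ := exists_sd_bump_bound
  set K1 : ℝ := Fintype.card ι * (4 * K) + 4 * K * Fintype.card ι + 2 with hK1
  have hK1' : 1 ≤ K1 := by
    have : (0 : ℝ) ≤ Fintype.card ι := Nat.cast_nonneg _
    have := mul_nonneg this hK
    rw [hK1]; nlinarith
  refine ⟨380 * K1, 76 * K1 * (1 + c + c ^ 2), by linarith, by positivity, ?_⟩
  intro b L κ hb hL hκ hκb f q hf hq hdc
  have hb1 : 1 ≤ b := by linarith
  have hb0 : 0 < b := by linarith
  have hL0 : 0 < L := by linarith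
  set v := bump b L with hv
  have hvs : ContDiff ℝ ∞ v := contDiff_bump hb0
  set e : ι → Fin 3 → Space → ℝ := fun i j y => v y * f i j y with he
  have hes0 : ∀ i j x, ‖x‖ ≤ b → e i j x = 0 := fun i j x hx => by simp [he, hv, bump_of_le hb0 hx]
  have hez : ∀ i j x, ‖x‖ < b → e i j =ᶠ[𝓝 x] 0 := fun i j x hx => by
    filter_upwards [(isOpen_lt continuous_norm continuous_const).mem_nhds hx] with y hy
    exact hes0 i j y (le_of_lt hy)
  have hes : ∀ i j, ContDiff ℝ ∞ (e i j) := fun i j => by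
    rw [contDiff_iff_contDiffAt]
    intro x
    by_cases hx : b ≤ ‖x‖
    · exact hvs.contDiffAt.mul (hf i j x hx)
    · exact contDiffAt_const.congr_of_eventuallyEq (hez i j x (not_le.1 hx))
  have hec : ∀ i j, HasCompactSupport (e i j) := fun i j =>
    HasCompactSupport.of_support_subset_isCompact (isCompact_annulus b (2 * L)) fun x hx => by
      constructor
      · by_contra h; exact hx (hes0 i j x (le_of_lt (not_le.1 h)))
      · by_contra h
        exact hx (by simp [he, hv, bump_of_ge hL0 (le_of_lt (not_le.1 h))])
  have hw := fun i => weighted_inequality hκ (hes i) (hec i) fun j => hez i j 0 (by simpa using hb0)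
  refine ⟨fun x => 64 * ∑ i, divTerm κ (e i) x,
    (integrable_finsetSum _ fun i _ => (hw i).1).const_mul _, ?_, fun x => ?_⟩
  · rw [integral_const_mul, integral_finsetSum _ fun i _ => (hw i).1]
    simp [fun i => (hw i).2.1]
  -- the pointwise inequality
  have hσ := sigma_pos hκ x
  have hrn := norm_nonneg x
  have hSf := fieldSq_nonneg f x
  have hsum : ‖x‖⁻¹ * sigma κ x ^ 3 * fieldSq e x + ‖x‖ * sigma κ x ^ 2 * gradSq e x ≤
      32 * ∑ i, divTerm κ (e i) x + 38 * (‖x‖ * sigma κ x ^ 2 *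
        (∑ i, divCurlSq (fun j k => sd k (e i j) x)) + sigma κ x ^ 2 *
          (√(fieldSq e x) * √(∑ i, divCurlSq (fun j k => sd k (e i j) x)))) := by
    have h1 := sum_le_sum fun i (_ : i ∈ univ) => (hw i).2.2 x
    simp only [sum_add_distrib, ← mul_sum] at h1
    have h2 := sum_sqrt_mul_sqrt_le (u := fun i => ∑ j, e i j x ^ 2)
      (v := fun i => divCurlSq (fun j k => sd k (e i j) x))
      (fun i => sum_nonneg fun _ _ => sq_nonneg _) (fun i => divCurlSq_nonneg _)
    have h3 := mul_le_left h2 (sq_nonneg (sigma κ x))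
    refine h1.trans ?_
    change _ + 38 * (_ + sigma κ x ^ 2 * _) ≤ _
    change _ ≤ _ + 38 * (_ + sigma κ x ^ 2 * (√(∑ i, ∑ j, e i j x ^ 2) * _))
    simp only [sigma] at h3 ⊢
    linarith
  have ind0 : ∀ (A : Set Space) (u : Space → ℝ), (∀ y, y ∈ A → b ≤ ‖y‖ → 0 ≤ u y) →
      (∀ y, y ∈ A → b ≤ ‖y‖) → 0 ≤ A.indicator u x := fun A u h1 h2 =>
    Set.indicator_apply_nonneg fun hx => h1 x hx (h2 x hx)
  have n1 : 0 ≤ (annulus b (2 * L)).indicator (fun x => ‖x‖ * sigma κ x ^ 2 * q x ^ 2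
      + sigma κ x ^ 2 * (√(fieldSq f x) * q x)) x :=
    ind0 _ _ (fun y _ hy => by have := hq y hy; positivity) fun y hy => hy.1
  have n2 : 0 ≤ (annulus b (2 * b)).indicator (fun x => ‖x‖⁻¹ * sigma κ x ^ 2 * fieldSq f x) x :=
    ind0 _ _ (fun y _ hy => by have := fieldSq_nonneg f y; positivity) fun y hy => hy.1
  have n3 : 0 ≤ (annulus L (2 * L)).indicator (fun x => ‖x‖⁻¹ * sigma κ x ^ 2 * fieldSq f x) x :=
    ind0 _ _ (fun y _ hy => by have := fieldSq_nonneg f y; positivity) fun y hy => hL.trans hy.1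
  have hgS := gradSq_nonneg e x
  have heS := fieldSq_nonneg e x
  by_cases hx : b ≤ ‖x‖
  swap
  · have z1 : fieldSq e x = 0 := by simp [fieldSq, fun i j => hes0 i j x (le_of_lt (not_le.1 hx))]
    have z2 : ∀ i j k, sd k (e i j) x = 0 := fun i j k => by
      rw [sd, (hez i j x (not_le.1 hx)).fderiv_eq]; simp
    have z3 : ∑ i, divCurlSq (fun j k => sd k (e i j) x) = 0 := by simp [z2, divCurlSq]
    rw [z3, z1] at hsum
    have : ‖x‖⁻¹ * sigma κ x ^ 3 * 0 + ‖x‖ * sigma κ x ^ 2 * gradSq e x ≥ 0 := by positivity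
    have hl : x ∉ annulus (2 * b) L := fun h => hx (by linarith [h.1])
    rw [Set.indicator_of_notMem hl]
    have : 0 ≤ 76 * K1 * (1 + c + c ^ 2) * ((annulus b (2 * L)).indicator
      (fun x => ‖x‖ * sigma κ x ^ 2 * q x ^ 2 + sigma κ x ^ 2 * (√(fieldSq f x) * q x)) x
          + (annulus b (2 * b)).indicator (fun x => ‖x‖⁻¹ * sigma κ x ^ 2 * fieldSq f x) x
          + (annulus L (2 * L)).indicator (fun x => ‖x‖⁻¹ * sigma κ x ^ 2 * fieldSq f x) x) := by
      positivity
    simp only [mul_zero, add_zero, zero_add, sqrt_zero] at hsum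
    have hY : 0 ≤ ‖x‖ * sigma κ x ^ 2 * gradSq e x := by positivity
    change 0 ≤ 64 * ∑ i, divTerm κ (e i) x + _
    linarith only [hsum, hY, this]
  have hr0 : 0 < ‖x‖ := by linarith
  have hqx := hq x hx
  set W := ∑ k, sd k v x ^ 2 with hW
  have hW0 : 0 ≤ W := sum_nonneg fun _ _ => sq_nonneg _
  have hloc := localized_bounds (fun i j => (hf i j x hx).differentiableAt (by simp))
    (hvs.differentiable (by simp) x) hK (hb1.trans hx) (hdc x hx)
  have hv0 : 0 ≤ v x := bump_nonneg x
  have hv1 : v x ≤ 1 := bump_le_one x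
  have hDC : 0 ≤ ∑ i, divCurlSq (fun j k => sd k (e i j) x) := sum_nonneg fun _ _ => divCurlSq_nonneg _
  have habs := absorb_pointwise (r := ‖x‖) (b := b) (κ := κ) (σ := sigma κ x) (S := √(fieldSq e x))
    (G := √(gradSq e x)) (H := √(∑ i, divCurlSq (fun j k => sd k (e i j) x))) (q := v x * q x)
    (w := √W * √(fieldSq f x)) (K := K1) hb1 hK1' hb hx hκ hκb rfl (sqrt_nonneg _)
    (sqrt_nonneg _) (by positivity) (by positivity) (sqrt_nonneg _) (by
      rw [sq_sqrt hDC, mul_pow (√W), mul_pow (‖x‖⁻¹), mul_pow (‖x‖⁻¹ * ‖x‖⁻¹), sq_sqrt hW0,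
        sq_sqrt hSf, sq_sqrt hgS, sq_sqrt heS]
      exact hloc)
  rw [sq_sqrt hDC, sq_sqrt hgS, sq_sqrt heS, mul_pow (√W), sq_sqrt hW0, sq_sqrt hSf] at habs
  have hW' := hc b L hb0 hL0 x
  have heq : fieldSq e x = v x ^ 2 * fieldSq f x := by simp only [fieldSq, he, mul_pow, mul_sum]
  have heq' : √(fieldSq e x) = v x * √(fieldSq f x) := by rw [heq, sqrt_mul (sq_nonneg _), sqrt_sq hv0]
  -- left side
  have hleft : (annulus (2 * b) L).indicator (fun x => ‖x‖⁻¹ * sigma κ x ^ 3 * fieldSq f x) x ≤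
      ‖x‖⁻¹ * sigma κ x ^ 3 * fieldSq e x := by
    refine Set.indicator_le' (g := fun x => ‖x‖⁻¹ * sigma κ x ^ 3 * fieldSq e x)
      (fun y hy => ?_) (fun y _ => ?_) x
    · have : v y = 1 := bump_eq_one hb0 hL0 hy.1 hy.2
      have : fieldSq e y = fieldSq f y := by simp [fieldSq, he, this]
      rw [this]
    · have := fieldSq_nonneg e y
      have := sigma_pos hκ y
      positivity
  -- the source terms
  have hsrc : ‖x‖ * sigma κ x ^ 2 * (v x * q x) ^ 2 + sigma κ x ^ 2 * (√(fieldSq e x) * (v x * q x))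
      ≤ (annulus b (2 * L)).indicator (fun x => ‖x‖ * sigma κ x ^ 2 * q x ^ 2
      + sigma κ x ^ 2 * (√(fieldSq f x) * q x)) x := by
    by_cases hx2 : ‖x‖ ≤ 2 * L
    · rw [Set.indicator_of_mem (show x ∈ annulus b (2 * L) from ⟨hx, hx2⟩), heq']
      have s1 : (v x * q x) ^ 2 ≤ q x ^ 2 := pow_le_pow_left₀ (by positivity) (mul_le_of_le_one_left hqx hv1) 2
      have s2 : v x * √(fieldSq f x) * (v x * q x) ≤ √(fieldSq f x) * q x :=
        mul_le_mul (mul_le_of_le_one_left (sqrt_nonneg _) hv1)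
          (mul_le_of_le_one_left hqx hv1) (by positivity) (sqrt_nonneg _)
      gcongr
    · have : v x = 0 := bump_of_ge hL0 (le_of_lt (not_le.1 hx2))
      rw [heq', this]
      simpa using n1
  -- the cutoff terms
  have hcut : ‖x‖ * sigma κ x ^ 2 * (W * fieldSq f x)
        + sigma κ x ^ 2 * (√(fieldSq e x) * (√W * √(fieldSq f x))) ≤
      (c + c ^ 2) * ((annulus b (2 * b)).indicator (fun x => ‖x‖⁻¹ * sigma κ x ^ 2 * fieldSq f x) x
          + (annulus L (2 * L)).indicator (fun x => ‖x‖⁻¹ * sigma κ x ^ 2 * fieldSq f x) x) := by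
    by_cases hz : W = 0
    · rw [hz]; simp only [zero_mul, mul_zero, sqrt_zero, add_zero]; positivity
    have hlow : ‖x‖⁻¹ * sigma κ x ^ 2 * fieldSq f x ≤
        (annulus b (2 * b)).indicator (fun x => ‖x‖⁻¹ * sigma κ x ^ 2 * fieldSq f x) x
          + (annulus L (2 * L)).indicator (fun x => ‖x‖⁻¹ * sigma κ x ^ 2 * fieldSq f x) x := by
      by_cases m1 : x ∈ annulus b (2 * b)
      · rw [Set.indicator_of_mem m1]; linarith
      by_cases m2 : x ∈ annulus L (2 * L)
      · rw [Set.indicator_of_mem m2]; linarith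
      exact absurd (hW'.2 m1 m2) hz
    refine le_trans ?_ (mul_le_left hlow (by positivity))
    have hWs : √W ≤ c * ‖x‖⁻¹ := sqrt_le_iff.2 ⟨by positivity, hW'.1⟩
    have s1 : ‖x‖ * sigma κ x ^ 2 * (W * fieldSq f x) ≤ c ^ 2 * (‖x‖⁻¹ * sigma κ x ^ 2 * fieldSq f x) := by
      calc _ ≤ ‖x‖ * sigma κ x ^ 2 * ((c * ‖x‖⁻¹) ^ 2 * fieldSq f x) := by have := hW'.1; gcongr
        _ = _ := by field_simp
    have s2 : sigma κ x ^ 2 * (√(fieldSq e x) * (√W * √(fieldSq f x))) ≤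
        c * (‖x‖⁻¹ * sigma κ x ^ 2 * fieldSq f x) := by
      have h1 : √(fieldSq e x) ≤ √(fieldSq f x) := by
        rw [heq']; exact mul_le_of_le_one_left (sqrt_nonneg _) hv1
      calc _ ≤ sigma κ x ^ 2 * (√(fieldSq f x) * (c * ‖x‖⁻¹ * √(fieldSq f x))) := by gcongr
        _ = c * (‖x‖⁻¹ * sigma κ x ^ 2 * (√(fieldSq f x) * √(fieldSq f x))) := by ring
        _ = _ := by rw [mul_self_sqrt hSf]
    linarith
  set I1 := (annulus b (2 * L)).indicator (fun x => ‖x‖ * sigma κ x ^ 2 * q x ^ 2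
      + sigma κ x ^ 2 * (√(fieldSq f x) * q x)) x
  set I2 := (annulus b (2 * b)).indicator (fun x => ‖x‖⁻¹ * sigma κ x ^ 2 * fieldSq f x) x
  set I3 := (annulus L (2 * L)).indicator (fun x => ‖x‖⁻¹ * sigma κ x ^ 2 * fieldSq f x) x
  have hYe : 0 ≤ ‖x‖ * sigma κ x ^ 2 * gradSq e x := by positivity
  have hK38 : 0 ≤ 38 * K1 := by positivity
  have f1 := mul_le_left (add_le_add hsrc hcut) hK38
  have f2 : 38 * K1 * (I1 + (c + c ^ 2) * (I2 + I3)) ≤ 38 * K1 * ((1 + c + c ^ 2) * (I1 + I2 + I3)) := by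
    refine mul_le_left ?_ hK38
    have : 0 ≤ c ^ 2 := sq_nonneg c
    nlinarith only [mul_nonneg hc0 n1, mul_nonneg this n1, n2, n3]
  change _ ≤ 64 * ∑ i, divTerm κ (e i) x + _
  linarith only [hleft, hsum, habs, f1, f2, hYe]

/-! ## Dyadic form of the exterior estimate -/

/-- The spherical shell `2^a ≤ r < 2^c`. -/
def dyadicRange (a c : ℕ) : Set Space := {x | 2 ^ a ≤ ‖x‖ ∧ ‖x‖ < 2 ^ c}

/-- The dyadic shell `2^n ≤ r < 2^(n+1)`. -/
abbrev dyadic (n : ℕ) : Set Space := dyadicRange n (n + 1)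

lemma measurableSet_dyadicRange (a c : ℕ) : MeasurableSet (dyadicRange a c) :=
  (measurableSet_le measurable_const measurable_norm).inter
    (measurableSet_lt measurable_norm measurable_const)

lemma dyadicRange_subset_annulus (a c : ℕ) : dyadicRange a c ⊆ annulus (2 ^ a) (2 ^ c) :=
  fun _ hx => ⟨hx.1, hx.2.le⟩

lemma setIntegral_annulus (u : Space → ℝ) (a c : ℕ) : ∫ x in annulus (2 ^ a) (2 ^ c), u x =
    ∫ x in dyadicRange a c, u x := by
  refine setIntegral_congr_set ?_
  have h0 : volume (sphere (0 : Space) (2 ^ c)) = 0 := Measure.addHaar_sphere _ _ _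
  have : ∀ᵐ x ∂(volume : Measure Space), x ∉ sphere (0 : Space) (2 ^ c) := measure_eq_zero_iff_ae_notMem.1 h0
  filter_upwards [this] with x hx
  simp only [mem_sphere_iff_norm, sub_zero] at hx
  refine propext ⟨fun h => ⟨h.1, lt_of_le_of_ne h.2 hx⟩, fun h => ⟨h.1, h.2.le⟩⟩

lemma setIntegral_dyadicRange {u : Space → ℝ} {a c : ℕ} (hac : a ≤ c) (hu : ContinuousOn u {x | 2 ^ a ≤
    ‖x‖}) : ∫ x in dyadicRange a c, u x = ∑ n ∈ Ico a c, ∫ x in dyadic n, u x := by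
  induction c, hac using Nat.le_induction with
  | base =>
    have : dyadicRange a a = ∅ := Set.eq_empty_of_forall_notMem fun x hx => (not_lt.2 hx.1) hx.2
    simp [this]
  | succ c hac ih =>
    rw [sum_Ico_succ_top hac, ← ih]
    have hun : dyadicRange a (c + 1) = dyadicRange a c ∪ dyadic c := by
      ext x
      simp only [dyadicRange, Set.mem_union, mem_ofPred_eq]
      constructor
      · rintro ⟨h1, h2⟩
        rcases lt_or_ge ‖x‖ (2 ^ c) with h | h
        · exact Or.inl ⟨h1, h⟩
        · exact Or.inr ⟨h, h2⟩
      · rintro (⟨h1, h2⟩ | ⟨h1, h2⟩)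
        · exact ⟨h1, h2.trans_le (two_pow_le (by lia))⟩
        · exact ⟨(two_pow_le hac).trans h1, h2⟩
    have hint : ∀ i j, a ≤ i → IntegrableOn u (dyadicRange i j) := fun i j hi =>
      (integrableOn_annulus hu (two_pow_le hi)).mono_set (dyadicRange_subset_annulus i j)
    rw [hun, setIntegral_union ?_ (measurableSet_dyadicRange _ _) (hint a c le_rfl) (hint c _ hac)]
    exact Set.disjoint_left.2 fun x h1 h2 => not_lt.2 h2.1 h1.2

lemma integral_mul_le_sqrt {α : Type*} [MeasurableSpace α] {μ : Measure α} {u v : α → ℝ} (hu :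
    Integrable (fun x => u x ^ 2) μ) (hv : Integrable (fun x => v x ^ 2) μ) (huv : Integrable (fun x => u x *
    v x) μ) : ∫ x, u x * v x ∂μ ≤ √(∫ x, u x ^ 2 ∂μ) * √(∫ x, v x ^ 2 ∂μ) := by
  have hA : 0 ≤ ∫ x, u x ^ 2 ∂μ := integral_nonneg fun _ => sq_nonneg _
  have key : ∀ t : ℝ, 0 ≤ (∫ x, v x ^ 2 ∂μ) * (t * t) + (-(2 * ∫ x, u x * v x ∂μ)) * t
      + ∫ x, u x ^ 2 ∂μ := fun t => by
    have h0 : 0 ≤ ∫ x, (u x - t * v x) ^ 2 ∂μ := integral_nonneg fun _ => sq_nonneg _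
    have h1 : ∫ x, (u x - t * v x) ^ 2 ∂μ = ∫ x, (u x ^ 2 - 2 * t * (u x * v x)) + t ^ 2 * v x ^ 2 ∂μ :=
      integral_congr_ae (.of_forall fun x => by ring)
    have hu2 : Integrable (fun x => 2 * t * (u x * v x)) μ := huv.const_mul _
    have h2 : Integrable (fun x => u x ^ 2 - 2 * t * (u x * v x)) μ := hu.sub hu2
    rw [h1, integral_add h2 (hv.const_mul _),
      integral_sub hu hu2, integral_const_mul, integral_const_mul] at h0
    linarith
  have := discrim_le_zero key
  rw [discrim] at this
  rw [← sqrt_mul hA]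
  exact le_sqrt_of_sq_le (by linarith)

section dyadic

variable {ι : Type*} [Fintype ι]

lemma sigma_le_one {κ : ℝ} (hκ : 0 ≤ κ) (x : Space) : sigma κ x ≤ 1 :=
  inv_le_one_of_one_le₀ (by have := norm_nonneg x; nlinarith [mul_nonneg hκ this])

lemma sigma_sq_le (hx : x ∈ dyadic n) : sigma ((2 ^ k)⁻¹) x ^ 2 ≤ min 1 (4 ^ k / 4 ^ n) := by
  have h0 := sigma_pos (κ := (2 ^ k)⁻¹) (by positivity) x
  refine le_min (pow_le_one₀ h0.le (sigma_le_one (by positivity) x)) ?_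
  have h1 : sigma ((2 ^ k)⁻¹) x ≤ 2 ^ k / 2 ^ n := by
    rw [sigma, ← inv_div]
    refine inv_anti₀ (by positivity) ?_
    have : (2 ^ n : ℝ) / 2 ^ k ≤ (2 ^ k)⁻¹ * ‖x‖ := by
      rw [div_eq_inv_mul]; exact mul_le_left hx.1 (by positivity)
    linarith
  refine (pow_le_pow_left₀ h0.le h1 2).trans_eq ?_
  rw [div_pow, ← pow_mul, ← pow_mul, mul_comm k, mul_comm n, pow_mul, pow_mul]
  norm_num

lemma le_sigma (hnk : n ≤ k) (hx : x ∈ dyadic n) : 1 / 3 ≤ sigma ((2 ^ k)⁻¹) x := by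
  rw [sigma, one_div]
  refine inv_anti₀ (by positivity) ?_
  have : ‖x‖ ≤ 2 * 2 ^ k := by
    refine hx.2.le.trans ?_
    rw [pow_succ, mul_comm]
    exact mul_le_left (two_pow_le hnk) zero_le_two
  have : (2 ^ k : ℝ)⁻¹ * ‖x‖ ≤ 2 := by rw [inv_mul_le_iff₀ (by positivity)]; linarith
  linarith

lemma exterior_dyadic (K : ℝ) (hK : 0 ≤ K) : ∃ (n1 : ℕ) (C : ℝ), 1 ≤ C ∧ ∀ n0 ≥ n1, ∀ (f : ι →
    Fin 3 → Space → ℝ) (q : Space → ℝ), (∀ i j x, 2 ^ n0 ≤ ‖x‖ → ContDiffAt ℝ ∞ (f i j) x) → (∀ x, 2 ^ n0 ≤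
    ‖x‖ → 0 ≤ q x) → ContinuousOn q {x | 2 ^ n0 ≤ ‖x‖} → (∀ x, 2 ^ n0 ≤ ‖x‖ → ∀ i,
    divCurlSq (fun j k => sd k (f i j) x) ≤ K * (q x ^ 2 + (‖x‖⁻¹) ^ 2 * gradSq f x + (‖x‖⁻¹ * ‖x‖⁻¹) ^ 2 *
    fieldSq f x)) → ∀ k l, n0 ≤ k → k < l → ∑ n ∈ Ico (n0 + 1) (k + 1), (2 ^ n)⁻¹ * ∫ x in dyadic n,
    fieldSq f x ≤ C * (∑ n ∈ Ico n0 (l + 1), min 1 (4 ^ k / 4 ^ n) * (2 ^ n * (∫ x in dyadic n, q x ^ 2) +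
    √(∫ x in dyadic n, fieldSq f x) * √(∫ x in dyadic n, q x ^ 2)) + (2 ^ n0)⁻¹ * (∫ x in dyadic n0,
    fieldSq f x) + 4 ^ k / 4 ^ l * ((2 ^ l)⁻¹ * ∫ x in dyadic l, fieldSq f x)) := by
  obtain ⟨b₀, C, hb₀, hC, hext⟩ := exterior_pointwise (ι := ι) K hK
  obtain ⟨n1, hn1⟩ := pow_unbounded_of_one_lt b₀ (one_lt_two)
  refine ⟨n1, 108 * C + 1, by linarith, ?_⟩
  intro n0 hn0 f q hf hq hqc hdc k l hk hl
  set κ : ℝ := (2 ^ k)⁻¹ with hκ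
  have hκ0 : 0 ≤ κ := by positivity
  obtain ⟨d, hd, hd0, hdp⟩ := hext (2 ^ n0) (2 ^ l) κ (hn1.le.trans (two_pow_le hn0)) (two_pow_le (by lia)) hκ0
    (by rw [hκ, inv_mul_le_iff₀ (by positivity), mul_one]; exact two_pow_le hk) f q hf hq hdc
  have hSc : ContinuousOn (fieldSq f) {x | 2 ^ n0 ≤ ‖x‖} := by
    unfold fieldSq
    exact continuousOn_finsetSum _ fun i _ => continuousOn_finsetSum _ fun j _ =>
      (continuousOn_of_forall_continuousAt fun x hx => (hf i j x hx).continuousAt).pow 2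
  have hrc : ContinuousOn (fun x : Space => ‖x‖⁻¹) {x | 2 ^ n0 ≤ ‖x‖} := continuousOn_inv_norm (by positivity)
  have hσc : ContinuousOn (sigma κ) {x | 2 ^ n0 ≤ ‖x‖} := (continuous_sigma hκ0).continuousOn
  have c1 : ContinuousOn (fun x => ‖x‖⁻¹ * sigma κ x ^ 3 * fieldSq f x) {x | 2 ^ n0 ≤ ‖x‖} :=
    (hrc.mul (hσc.pow 3)).mul hSc
  have c2 : ContinuousOn (fun x => ‖x‖ * sigma κ x ^ 2 * q x ^ 2
      + sigma κ x ^ 2 * (√(fieldSq f x) * q x)) {x | 2 ^ n0 ≤ ‖x‖} :=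
    ((continuous_norm.continuousOn.mul (hσc.pow 2)).mul (hqc.pow 2)).add ((hσc.pow 2).mul (hSc.sqrt.mul hqc))
  have c3 : ContinuousOn (fun x => ‖x‖⁻¹ * sigma κ x ^ 2 * fieldSq f x) {x | 2 ^ n0 ≤ ‖x‖} :=
    (hrc.mul (hσc.pow 2)).mul hSc
  have i1 := integrableOn_annulus (c := 2 ^ l) c1 (d := 2 * 2 ^ n0)
    (by linarith [pow_pos (two_pos (α := ℝ)) n0])
  have i2 := integrableOn_annulus (c := 2 * 2 ^ l) c2 le_rfl
  have i3 := integrableOn_annulus (c := 2 * 2 ^ n0) c3 le_rfl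
  have i4 := integrableOn_annulus (c := 2 * 2 ^ l) c3 (d := 2 ^ l) (two_pow_le (by lia))
  have m := measurableSet_annulus
  have j1 := (integrable_indicator_iff (m _ _)).2 i1
  have j2 := (integrable_indicator_iff (m _ _)).2 i2
  have j3 := (integrable_indicator_iff (m _ _)).2 i3
  have j4 := (integrable_indicator_iff (m _ _)).2 i4
  have j := ((j2.add j3).add j4).const_mul C
  have hmain := integral_mono j1 (hd.add j) hdp
  rw [integral_add' hd j, hd0, zero_add, integral_const_mul, integral_add' (j2.add j3) j4,
    integral_add' j2 j3] at hmain
  simp only [integral_indicator (m _ _)] at hmain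
  have e2 : ∀ n : ℕ, (2 : ℝ) * 2 ^ n = 2 ^ (n + 1) := fun n => by rw [pow_succ, mul_comm]
  rw [e2, e2, setIntegral_annulus, setIntegral_annulus, setIntegral_annulus, setIntegral_annulus,
    setIntegral_dyadicRange (by lia) (c1.mono fun x hx => (two_pow_le (by lia)).trans hx),
    setIntegral_dyadicRange (by lia) c2] at hmain
  have hin : ∀ n ≥ n0, ∀ {u : Space → ℝ}, ContinuousOn u {x | 2 ^ n0 ≤ ‖x‖} →
      IntegrableOn u (dyadic n) := fun n hn u hu =>
    (integrableOn_annulus hu (two_pow_le hn)).mono_set (dyadicRange_subset_annulus n _)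
  have mem0 : ∀ {n : ℕ} {x : Space}, x ∈ dyadic n → 0 < ‖x‖ := fun hx => lt_of_lt_of_le (by positivity) hx.1
  have hleft : ∑ n ∈ Ico (n0 + 1) (k + 1), (2 ^ n)⁻¹ * ∫ x in dyadic n, fieldSq f x ≤
      54 * ∑ n ∈ Ico (n0 + 1) l, ∫ x in dyadic n, ‖x‖⁻¹ * sigma κ x ^ 3 * fieldSq f x := by
    rw [mul_sum]
    refine (sum_le_sum fun n hn => ?_).trans (sum_le_sum_of_subset_of_nonneg
      (Ico_subset_Ico_right (by lia : k + 1 ≤ l)) fun n hn _ => ?_)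
    · obtain ⟨hn1, hn2⟩ := mem_Ico.1 hn
      rw [← integral_const_mul, ← integral_const_mul]
      refine setIntegral_mono_on ((hin n (by lia) hSc).const_mul _) ((hin n (by lia) c1).const_mul _)
        (measurableSet_dyadicRange _ _) fun x hx => ?_
      have h1 : (1 / 3) ^ 3 ≤ sigma κ x ^ 3 := pow_le_pow_left₀ (by norm_num) (le_sigma (by lia : n ≤ k) hx) 3
      have h2 : (2 ^ n)⁻¹ * (1 / 2) ≤ ‖x‖⁻¹ := by
        have := inv_anti₀ (mem0 hx) hx.2.le
        rw [pow_succ, mul_inv] at this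
        linarith
      have h3 : (2 ^ n)⁻¹ * (1 / 2) * (1 / 3) ^ 3 ≤ ‖x‖⁻¹ * sigma κ x ^ 3 :=
        mul_le_mul h2 h1 (by norm_num) (inv_nonneg.2 (mem0 hx).le)
      have := mul_le_right h3 (fieldSq_nonneg f x)
      linarith
    · refine mul_nonneg (by norm_num) (setIntegral_nonneg (measurableSet_dyadicRange _ _) ?_)
      intro x hx
      have := fieldSq_nonneg f x
      have := sigma_pos hκ0 x
      positivity
  have hsrc : ∀ n ∈ Ico n0 (l + 1), ∫ x in dyadic n, (‖x‖ * sigma κ x ^ 2 * q x ^ 2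
      + sigma κ x ^ 2 * (√(fieldSq f x) * q x)) ≤ 2 * (min 1 (4 ^ k / 4 ^ n) *
              (2 ^ n * (∫ x in dyadic n, q x ^ 2) +
                √(∫ x in dyadic n, fieldSq f x) * √(∫ x in dyadic n, q x ^ 2))) := by
    intro n hn
    obtain ⟨hn1, -⟩ := mem_Ico.1 hn
    set μ : ℝ := min 1 (4 ^ k / 4 ^ n) with hμ
    have hμ0 : 0 ≤ μ := le_min zero_le_one (by positivity)
    have k1 : IntegrableOn (fun x => μ * (2 * 2 ^ n) * q x ^ 2) (dyadic n) := (hin n hn1 (hqc.pow 2)).const_mul _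
    have k2 : IntegrableOn (fun x => μ * (√(fieldSq f x) * q x)) (dyadic n) :=
      (hin n hn1 (hSc.sqrt.mul hqc)).const_mul _
    have hS2 : (fun x => √(fieldSq f x) ^ 2) = fieldSq f := funext fun x => sq_sqrt (fieldSq_nonneg f x)
    have hcs := integral_mul_le_sqrt (μ := volume.restrict (dyadic n))
      (u := fun x => √(fieldSq f x)) (v := q) (by rw [hS2]; exact hin n hn1 hSc)
      (hin n hn1 (hqc.pow 2)) (hin n hn1 (hSc.sqrt.mul hqc))
    rw [hS2] at hcs
    have hstep : ∫ x in dyadic n, (‖x‖ * sigma κ x ^ 2 * q x ^ 2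
      + sigma κ x ^ 2 * (√(fieldSq f x) * q x)) ≤ ∫ x in dyadic n,
        (μ * (2 * 2 ^ n) * q x ^ 2 + μ * (√(fieldSq f x) * q x)) := by
      refine setIntegral_mono_on (hin n hn1 c2) (k1.add k2) (measurableSet_dyadicRange _ _) fun x hx => ?_
      have h1 := sigma_sq_le (k := k) hx
      have h2 : ‖x‖ ≤ 2 * 2 ^ n := by rw [e2]; exact hx.2.le
      have hqx := hq x ((two_pow_le hn1).trans hx.1)
      have : ‖x‖ * sigma κ x ^ 2 ≤ μ * (2 * 2 ^ n) := by
        rw [mul_comm]; exact mul_le_mul h1 h2 (norm_nonneg _) hμ0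
      gcongr
    refine hstep.trans ?_
    rw [integral_add k1 k2, integral_const_mul, integral_const_mul]
    have := mul_le_left hcs hμ0
    have hp : 0 ≤ μ * (√(∫ x in dyadic n, fieldSq f x) * √(∫ x in dyadic n, q x ^ 2)) := by positivity
    linarith
  have hbd : ∀ n ≥ n0, ∫ x in dyadic n, ‖x‖⁻¹ * sigma κ x ^ 2 * fieldSq f x ≤
      min 1 (4 ^ k / 4 ^ n) * ((2 ^ n)⁻¹ * ∫ x in dyadic n, fieldSq f x) := by
    intro n hn
    rw [← integral_const_mul, ← integral_const_mul]
    refine setIntegral_mono_on (hin n hn c3) (((hin n hn hSc).const_mul _).const_mul _)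
      (measurableSet_dyadicRange _ _) fun x hx => ?_
    have h1 := sigma_sq_le (k := k) hx
    have h2 : ‖x‖⁻¹ ≤ (2 ^ n)⁻¹ := inv_anti₀ (by positivity) hx.1
    have h3 := mul_le_mul h1 h2 (inv_nonneg.2 (norm_nonneg _)) (le_min zero_le_one (by positivity))
    have := mul_le_right h3 (fieldSq_nonneg f x)
    linarith
  have nn : ∀ n, 0 ≤ ∫ x in dyadic n, fieldSq f x := fun n => integral_nonneg (fieldSq_nonneg f)
  have nq : ∀ n, 0 ≤ ∫ x in dyadic n, q x ^ 2 := fun n => integral_nonneg fun _ => sq_nonneg _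
  have b1 := (hbd n0 le_rfl).trans (mul_le_of_le_one_left
    (mul_nonneg (by positivity) (nn n0)) (min_le_left _ _))
  have b2 := (hbd l (by lia)).trans (mul_le_right (min_le_right _ _)
    (mul_nonneg (by positivity) (nn l)))
  have b3 := sum_le_sum hsrc
  rw [← mul_sum] at b3
  have p1 : 0 ≤ ∑ n ∈ Ico n0 (l + 1), min 1 (4 ^ k / 4 ^ n) *
              (2 ^ n * (∫ x in dyadic n, q x ^ 2) +
                √(∫ x in dyadic n, fieldSq f x) * √(∫ x in dyadic n, q x ^ 2)) :=
    sum_nonneg fun n _ => mul_nonneg (le_min zero_le_one (by positivity)) (by have := nq n; positivity)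
  have p2 : 0 ≤ (2 ^ n0)⁻¹ * (∫ x in dyadic n0, fieldSq f x) := mul_nonneg (by positivity) (nn n0)
  have p3 : 0 ≤ (4 : ℝ) ^ k / 4 ^ l * ((2 ^ l)⁻¹ * ∫ x in dyadic l, fieldSq f x) :=
    mul_nonneg (by positivity) (mul_nonneg (by positivity) (nn l))
  have hfin := mul_le_left (add_le_add (add_le_add b3 b1) b2) hC
  refine hleft.trans ?_
  have := mul_le_left (hmain.trans hfin) (by norm_num : (0 : ℝ) ≤ 54)
  refine this.trans ?_
  nlinarith only [p1, p2, p3, mul_nonneg hC p1, mul_nonneg hC p2, mul_nonneg hC p3]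

end dyadic

/-! ## Consequences for sequences -/

lemma bounded_of_quadratic {x : ℕ → ℝ} {n0 : ℕ} {C Y D : ℝ} (hx : ∀ n, 0 ≤ x n) (hC : 0 ≤ C) (hY : 0 ≤ Y)
    (hD : 0 ≤ D) (hb : ∃ B, ∀ n ≥ n0, x n ≤ B) (h : ∀ X, (∀ n ≥ n0, x n ≤ X) → ∀ n ≥ n0, x n ^ 2 ≤
    C * (Y ^ 2 + X * Y + D ^ 2)) : ∀ n ≥ n0, x n ≤ 2 * (C + 1) * (Y + D) := by
  obtain ⟨B, hB⟩ := hb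
  set S : Set ℝ := x '' Set.Ici n0 with hS
  have hbd : BddAbove S := ⟨B, by rintro _ ⟨n, hn, rfl⟩; exact hB n hn⟩
  have hne : S.Nonempty := ⟨x n0, n0, Set.mem_Ici.2 le_rfl, rfl⟩
  have hle : ∀ n ≥ n0, x n ≤ sSup S := fun n hn => le_csSup hbd ⟨n, hn, rfl⟩
  have hX0 : 0 ≤ sSup S := (hx n0).trans (hle n0 le_rfl)
  have h1 := h _ hle
  have h2 : sSup S ≤ √(C * (Y ^ 2 + sSup S * Y + D ^ 2)) := by
    refine csSup_le hne ?_
    rintro _ ⟨n, hn, rfl⟩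
    exact le_sqrt_of_sq_le (h1 n hn)
  have h3 : sSup S ^ 2 ≤ C * (Y ^ 2 + sSup S * Y + D ^ 2) := by
    have := pow_le_pow_left₀ hX0 h2 2
    rwa [sq_sqrt (by positivity)] at this
  have h4 : sSup S ≤ 2 * (C + 1) * (Y + D) := by
    refine (pow_le_pow_iff_left₀ hX0 (by positivity) two_ne_zero).1 ?_
    have : sSup S ^ 2 ≤ (C ^ 2 + 2 * C) * Y ^ 2 + 2 * C * D ^ 2 := by nlinarith [sq_nonneg (sSup S - C * Y)]
    refine this.trans ?_
    have : 0 ≤ Y * D := mul_nonneg hY hD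
    nlinarith [mul_nonneg hC this, mul_nonneg (mul_nonneg hC hC) this, mul_nonneg hC (sq_nonneg Y),
      mul_nonneg hC (sq_nonneg D), sq_nonneg Y, sq_nonneg D, mul_nonneg (mul_nonneg hC hC) (sq_nonneg Y),
      mul_nonneg (mul_nonneg hC hC) (sq_nonneg D)]
  exact fun n hn => (hle n hn).trans h4

lemma sum_sq_le_sq_of_sum_le {s : Finset ℕ} {y : ℕ → ℝ} {Y : ℝ} (hy : ∀ n, 0 ≤ y n) (h : ∑ n ∈ s, y n ≤ Y) :
    ∑ n ∈ s, y n ^ 2 ≤ Y ^ 2 :=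
  (sum_sq_le_sq_sum_of_nonneg fun n _ => hy n).trans (pow_le_pow_left₀ (sum_nonneg fun n _ => hy n) h 2)

/-- The dyadic inequalities produced by `exterior_dyadic`. -/
def DyadicBound (C : ℝ) (n0 : ℕ) (N y : ℕ → ℝ) : Prop :=
  ∀ k l, n0 ≤ k → k < l → ∑ n ∈ Ico (n0 + 1) (k + 1), N n ^ 2 ≤
    C * (∑ n ∈ Ico n0 (l + 1), min 1 (4 ^ k / 4 ^ n) * (y n ^ 2 + N n * y n) + N n0 ^ 2
      + 4 ^ k / 4 ^ l * N l ^ 2)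

lemma tendsto_four_pow_div (k : ℕ) : Tendsto (fun l : ℕ => (4 : ℝ) ^ k / 4 ^ l) atTop (𝓝 0) := by
  have := (tendsto_pow_atTop_nhds_zero_of_lt_one (r := (1 / 4 : ℝ)) (by norm_num)
    (by norm_num)).const_mul ((4 : ℝ) ^ k)
  simpa [div_eq_mul_inv] using this

section sequences

variable {C : ℝ} {n0 : ℕ} {N y : ℕ → ℝ}

lemma DyadicBound.limit (hC : 1 ≤ C) (hN : ∀ n, 0 ≤ N n) (hM : DyadicBound C n0 N y) (hb : ∃ B, ∀ n ≥ n0,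
    N n ≤ B) (hk : n0 ≤ k) {A : ℝ} (hA : ∀ l, ∑ n ∈ Ico n0 (l + 1), min 1 (4 ^ k / 4 ^ n) * (y n ^ 2 + N n *
    y n) ≤ A) : ∑ n ∈ Ico (n0 + 1) (k + 1), N n ^ 2 ≤ C * (A + N n0 ^ 2) := by
  obtain ⟨B, hB⟩ := hb
  have hlim : Tendsto (fun l : ℕ => C * (A + N n0 ^ 2 + (4 : ℝ) ^ k / 4 ^ l * B ^ 2)) atTop
      (𝓝 (C * (A + N n0 ^ 2 + 0 * B ^ 2))) :=
    (((tendsto_four_pow_div k).mul_const _).const_add _).const_mul _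
  rw [zero_mul, add_zero] at hlim
  refine ge_of_tendsto hlim ?_
  filter_upwards [eventually_gt_atTop k] with l hl
  refine (hM k l hk hl).trans (mul_le_left ?_ (by linarith))
  have h1 : N l ^ 2 ≤ B ^ 2 := pow_le_pow_left₀ (hN l) (hB l (by lia)) 2
  have h2 := mul_le_left h1 (by positivity : (0 : ℝ) ≤ 4 ^ k / 4 ^ l)
  linarith [hA l]

lemma DyadicBound.sup_le (hC : 1 ≤ C) (hN : ∀ n, 0 ≤ N n) (hy : ∀ n, 0 ≤ y n) (hM : DyadicBound C n0 N y)
    (hb : ∃ B, ∀ n ≥ n0, N n ≤ B) {Y : ℝ} (hY : ∀ l, ∑ n ∈ Ico n0 l, y n ≤ Y) : ∀ n ≥ n0, N n ≤ 2 *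
    (C + 1) * (Y + N n0) := by
  have hY0 : 0 ≤ Y := by simpa using hY n0
  refine bounded_of_quadratic hN (by linarith) hY0 (hN n0) hb fun X hX k hk => ?_
  have hX0 : 0 ≤ X := (hN n0).trans (hX n0 le_rfl)
  have hA : ∀ l, ∑ n ∈ Ico n0 (l + 1), min 1 ((4 : ℝ) ^ k / 4 ^ n) *
      (y n ^ 2 + N n * y n) ≤ Y ^ 2 + X * Y := by
    intro l
    calc _ ≤ ∑ n ∈ Ico n0 (l + 1), (y n ^ 2 + X * y n) := by
          refine sum_le_sum fun n hn => ?_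
          have h1 := mul_le_right (hX n (mem_Ico.1 hn).1) (hy n)
          have h2 : 0 ≤ y n ^ 2 + N n * y n := by have := hy n; have := hN n; positivity
          exact (mul_le_of_le_one_left h2 (min_le_left _ _)).trans (by linarith)
      _ = ∑ n ∈ Ico n0 (l + 1), y n ^ 2 + X * ∑ n ∈ Ico n0 (l + 1), y n := by rw [sum_add_distrib, mul_sum]
      _ ≤ _ := add_le_add (sum_sq_le_sq_of_sum_le hy (hY _)) (mul_le_left (hY _) hX0)
  rcases hk.eq_or_lt with rfl | hk'
  · have : 0 ≤ Y ^ 2 + X * Y := by positivity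
    nlinarith [sq_nonneg (N n0)]
  · refine le_trans ?_ (hM.limit hC hN hb hk hA)
    exact single_le_sum (f := fun n => N n ^ 2) (fun _ _ => sq_nonneg _) (mem_Ico.2 ⟨hk', by lia⟩)

lemma DyadicBound.weighted_sum_le (hC : 1 ≤ C) (hN : ∀ n, 0 ≤ N n) (hy : ∀ n, 0 ≤ y n) (hM :
    DyadicBound C n0 N y) (hb : ∃ B, ∀ n ≥ n0, N n ≤ B) {Y : ℝ} (hY : ∀ l, ∑ n ∈ Ico n0 l, (2 ^ n)⁻¹ *
    y n ≤ Y) {X : ℝ} (hX : ∀ n ≥ n0, (2 ^ n)⁻¹ * N n ≤ X) (hk : n0 ≤ k) : ∑ n ∈ Ico (n0 + 1) (k + 1),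
    N n ^ 2 ≤ C * (4 ^ k * (Y ^ 2 + X * Y) + N n0 ^ 2) := by
  have hX0 : 0 ≤ X := (mul_nonneg (by positivity) (hN n0)).trans (hX n0 le_rfl)
  have hy' : ∀ n, 0 ≤ (2 ^ n : ℝ)⁻¹ * y n := fun n => mul_nonneg (by positivity) (hy n)
  refine hM.limit hC hN hb hk fun l => ?_
  calc _ ≤ ∑ n ∈ Ico n0 (l + 1),
        (4 : ℝ) ^ k * (((2 ^ n)⁻¹ * y n) ^ 2 + X * ((2 ^ n)⁻¹ * y n)) := by
        refine sum_le_sum fun n hn => ?_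
        have h1 := mul_le_right (hX n (mem_Ico.1 hn).1) (hy' n)
        have h2 : 0 ≤ y n ^ 2 + N n * y n := by have := hy n; have := hN n; positivity
        refine (mul_le_right (min_le_right _ _) h2).trans ?_
        rw [div_eq_mul_inv, mul_assoc]
        refine mul_le_left ?_ (by positivity)
        have h4 : ((4 : ℝ) ^ n)⁻¹ = (2 ^ n)⁻¹ * (2 ^ n)⁻¹ := by rw [← mul_inv, ← mul_pow]; norm_num
        rw [h4]
        linarith
    _ = 4 ^ k * (∑ n ∈ Ico n0 (l + 1), ((2 ^ n : ℝ)⁻¹ * y n) ^ 2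
          + X * ∑ n ∈ Ico n0 (l + 1), (2 ^ n : ℝ)⁻¹ * y n) := by
        rw [← mul_sum, sum_add_distrib, ← mul_sum]
    _ ≤ _ := mul_le_left (add_le_add (sum_sq_le_sq_of_sum_le hy' (hY _))
          (mul_le_left (hY _) hX0)) (by positivity)

lemma DyadicBound.weighted_sup_le (hC : 1 ≤ C) (hN : ∀ n, 0 ≤ N n) (hy : ∀ n, 0 ≤ y n) (hM :
    DyadicBound C n0 N y) (hb : ∃ B, ∀ n ≥ n0, N n ≤ B) {Y : ℝ} (hY : ∀ l, ∑ n ∈ Ico n0 l, (2 ^ n)⁻¹ *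
    y n ≤ Y) : ∀ n ≥ n0, (2 ^ n)⁻¹ * N n ≤ 2 * (C + 1) * (Y + N n0) := by
  have hY0 : 0 ≤ Y := by simpa using hY n0
  have hinv : ∀ n, (2 ^ n : ℝ)⁻¹ ≤ 1 := fun n => inv_le_one_of_one_le₀ (one_le_pow₀ one_le_two)
  refine bounded_of_quadratic (x := fun n => (2 ^ n)⁻¹ * N n)
    (fun n => mul_nonneg (by positivity) (hN n)) (by linarith) hY0 (hN n0) ?_ fun X hX k hk => ?_
  · obtain ⟨B, hB⟩ := hb
    exact ⟨B, fun n hn => (mul_le_of_le_one_left (hN n) (hinv n)).trans (hB n hn)⟩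
  have hX0 : 0 ≤ X := (mul_nonneg (by positivity) (hN n0)).trans (hX n0 le_rfl)
  have hA : 0 ≤ Y ^ 2 + X * Y := by positivity
  have h4 : ((2 ^ k : ℝ)⁻¹ * N k) ^ 2 = (4 ^ k)⁻¹ * N k ^ 2 := by
    rw [mul_pow, inv_pow, ← pow_mul, mul_comm k, pow_mul]; norm_num
  have hN2 : N k ^ 2 ≤ C * (4 ^ k * (Y ^ 2 + X * Y) + N n0 ^ 2) := by
    rcases hk.eq_or_lt with rfl | hk'
    · have : 0 ≤ 4 ^ n0 * (Y ^ 2 + X * Y) := by positivity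
      nlinarith [sq_nonneg (N n0)]
    · refine le_trans ?_ (hM.weighted_sum_le hC hN hy hb hY hX hk)
      exact single_le_sum (f := fun n => N n ^ 2) (fun _ _ => sq_nonneg _) (mem_Ico.2 ⟨hk', by lia⟩)
  rw [h4]
  have h5 : ((4 : ℝ) ^ k)⁻¹ ≤ 1 := inv_le_one_of_one_le₀ (one_le_pow₀ (by norm_num))
  calc (4 ^ k : ℝ)⁻¹ * N k ^ 2 ≤ (4 ^ k)⁻¹ * (C * (4 ^ k * (Y ^ 2 + X * Y) + N n0 ^ 2)) :=
        mul_le_left hN2 (by positivity)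
    _ = C * ((Y ^ 2 + X * Y) + (4 ^ k)⁻¹ * N n0 ^ 2) := by field_simp
    _ ≤ _ := by
        refine mul_le_left ?_ (by linarith)
        have := mul_le_of_le_one_left (sq_nonneg (N n0)) h5
        linarith

end sequences

/-- Some shell beyond the first one carries a small part of the energy. -/
lemma DyadicBound.exists_small {C : ℝ} (hC : 1 ≤ C) (n0 : ℕ) {ε : ℝ} (hε : 0 < ε) : ∃ (J : ℕ) (D : ℝ), 0 ≤ D ∧
    ∀ N y : ℕ → ℝ, (∀ n, 0 ≤ N n) → (∀ n, 0 ≤ y n) → DyadicBound C n0 N y → (∃ B, ∀ n ≥ n0, N n ≤ B) →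
    ∀ Y : ℝ, (∀ l, ∑ n ∈ Ico n0 l, (2 ^ n)⁻¹ * y n ≤ Y) → ∃ n, n0 < n ∧ n ≤ n0 + J ∧ N n ≤ ε * N n0 + D *
    Y := by
  obtain ⟨J, hJ⟩ := exists_nat_gt (2 * C / ε ^ 2)
  have hε2 : 0 < ε ^ 2 := by positivity
  have hJ0 : (0 : ℝ) < J := lt_of_le_of_lt (by positivity) hJ
  set P : ℝ := 4 ^ (n0 + J) with hP
  have hP0 : 0 < P := by positivity
  set E : ℝ := C * (P * (1 + 2 * (C + 1)) + (P * (2 * (C + 1))) ^ 2) with hE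
  have hE0 : 0 ≤ E := by positivity
  refine ⟨J, √E, sqrt_nonneg _, fun N y hN hy hM hb Y hY => ?_⟩
  have hY0 : 0 ≤ Y := by simpa using hY n0
  have h1 := hM.weighted_sum_le hC hN hy hb hY (hM.weighted_sup_le hC hN hy hb hY) (k := n0 + J) (by lia)
  have h2 : C * (P * (Y ^ 2 + 2 * (C + 1) * (Y + N n0) * Y) + N n0 ^ 2) ≤ 2 * C * N n0 ^ 2 + E * Y ^ 2 := by
    have : P * (2 * (C + 1)) * (N n0 * Y) ≤ N n0 ^ 2 + (P * (2 * (C + 1))) ^ 2 * Y ^ 2 := by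
      nlinarith [sq_nonneg (N n0 - (P * (2 * (C + 1))) * Y), sq_nonneg (N n0),
        sq_nonneg ((P * (2 * (C + 1))) * Y)]
    have := mul_le_left this (by linarith : 0 ≤ C)
    rw [hE]
    linarith
  have hlast : ∀ n, N n ^ 2 ≤ ε ^ 2 * N n0 ^ 2 + E * Y ^ 2 → N n ≤ ε * N n0 + √E * Y := by
    intro n hn
    have a1 : 0 ≤ ε * N n0 := mul_nonneg hε.le (hN _)
    have a2 : 0 ≤ √E * Y := by positivity
    refine (pow_le_pow_iff_left₀ (hN n) (add_nonneg a1 a2) two_ne_zero).1 (hn.trans ?_)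
    have : (√E * Y) ^ 2 = E * Y ^ 2 := by rw [mul_pow, sq_sqrt hE0]
    nlinarith [mul_nonneg a1 a2]
  by_contra hcon
  push Not at hcon
  have h3 : ∀ n ∈ Ico (n0 + 1) (n0 + J + 1), ε ^ 2 * N n0 ^ 2 + E * Y ^ 2 ≤ N n ^ 2 := by
    intro n hn
    obtain ⟨a, c⟩ := mem_Ico.1 hn
    by_contra h
    exact absurd (hlast n (not_le.1 h).le) (not_le.2 (hcon n (by lia) (by lia)))
  have h4 := card_nsmul_le_sum _ _ _ h3
  rw [Nat.card_Ico, show n0 + J + 1 - (n0 + 1) = J by lia, nsmul_eq_mul] at h4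
  have h5 := (h4.trans h1).trans h2
  have hJ2 : 2 * C < J * ε ^ 2 := (div_lt_iff₀ hε2).1 hJ
  have hJ1 : (1 : ℝ) ≤ J := by exact_mod_cast hJ0
  have hNp : N n0 ^ 2 = 0 := by
    by_contra h
    have : 0 < N n0 ^ 2 := lt_of_le_of_ne (sq_nonneg _) (Ne.symm h)
    have := mul_lt_mul_of_pos_right hJ2 this
    have : E * Y ^ 2 ≤ J * (E * Y ^ 2) := le_mul_of_one_le_left (by positivity) hJ1
    linarith
  rcases Nat.eq_zero_or_pos J with h | hJpos
  · rw [h] at hJ1; norm_num at hJ1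
  have h7 : N (n0 + 1) ^ 2 ≤ C * (P * (Y ^ 2 + 2 * (C + 1) * (Y + N n0) * Y) + N n0 ^ 2) :=
    (single_le_sum (f := fun n => N n ^ 2) (fun _ _ => sq_nonneg _) (mem_Ico.2 ⟨le_rfl, by lia⟩)).trans h1
  have := hcon (n0 + 1) (by lia) (by lia)
  refine absurd (hlast (n0 + 1) ?_) (not_le.2 this)
  have := h7.trans h2
  rw [hNp] at this ⊢
  linarith

/-! ## Commutation of `d⁰` and of the flat Hodge star with the generators -/

/-- The spatial part of a partial derivative. -/
def sp (α : Fin 4) (f : Scalar) (p : Spacetime) : ℝ := pd α f p - kron α 0 * pd 0 f p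

lemma sp_zero (f : Scalar) (p : Spacetime) : sp 0 f p = 0 := by simp [sp, kron]

lemma sp_succ (i : Fin 3) (f : Scalar) (p : Spacetime) : sp i.succ f p = pd i.succ f p := by
  simp [sp, kron, Fin.succ_ne_zero]

lemma lie_translation (μ : Fin 4) (T : Cov k) (a : Fin k → Fin 4) : lie (translation μ) T a = pd μ (T a) := by
  funext p
  have := lie_eq (.trans μ) T a p
  simp only [ZField.field, ZField.jac, mul_zero, sum_const_zero, add_zero, act_translation] at this
  exact this

lemma extD0_eq (F : Cov 2) (a : Fin 3 → Fin 4) (p : Spacetime) : extD0 F a p = sp (a 0) (F ![a 1, a 2]) p +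
    sp (a 1) (F ![a 2, a 0]) p + sp (a 2) (F ![a 0, a 1]) p := by
  simp only [extD0, extD, dtWedge, lie_translation, sp]
  ring

lemma sp_congr_outer (hf : SmoothOuter b f) (hg : SmoothOuter b g) (h : EqOn f g (outer b)) (α : Fin 4) :
    EqOn (sp α f) (sp α g) (outer b) :=
  fun p hp => by rw [sp, sp, pd_congr_outer hf hg h _ hp, pd_congr_outer hf hg h _ hp]

lemma SmoothOuter.sp (hf : SmoothOuter b f) (α : Fin 4) : SmoothOuter b (sp α f) :=
  (hf.pd α).sub ((SmoothOuter.const _).mul (hf.pd 0))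

lemma sp_add (hf : DifferentiableAt ℝ f p) (hg : DifferentiableAt ℝ g p) (α : Fin 4) : sp α (fun q => f q +
    g q) p = sp α f p + sp α g p := by
  simp only [sp, pd_add hf hg]; ring

lemma sp_mul_const (hf : DifferentiableAt ℝ f p) (c : ℝ) (α : Fin 4) : sp α (fun q => f q * c) p = sp α f p *
    c := by
  have := fun β => pd_mul hf (differentiableAt_const c) β (p := p)
  simp only [sp, this, pd_const]; ring

lemma sp_sum {ι : Type*} (s : Finset ι) {f : ι → Scalar} (hf : ∀ i ∈ s, DifferentiableAt ℝ (f i) p) (α :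
    Fin 4) : sp α (fun q => ∑ i ∈ s, f i q) p = ∑ i ∈ s, sp α (f i) p := by
  simp only [sp, pd_sum s hf, mul_sum, sum_sub_distrib]

lemma ZField.sp_act (X : ZField) (hf : SmoothOuter b f) (hp : p ∈ outer b) (α : Fin 4) : sp α (X.field.act f)
    p = X.field.act (sp α f) p + ∑ γ, X.jac α γ * sp γ f p := by
  refine Fin.cases ?_ (fun i => ?_) α
  · have h0 : sp 0 f = fun _ => 0 := funext fun p => sp_zero f p
    rw [sp_zero, h0, act_const]
    simp [sum_univ_succ, sp_zero, X.jac_zero_succ]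
  · have h0 : sp i.succ f = pd i.succ f := funext fun p => sp_succ i f p
    rw [sp_succ, h0, X.pd_act (hf p hp)]
    simp [sum_univ_succ (n := 3), X.jac_succ_zero, sp_succ]

lemma lie_two (X : ZField) (F : Cov 2) (α β : Fin 4) (p : Spacetime) : lie X.field F ![α, β] p =
    X.field.act (F ![α, β]) p + (∑ γ, F ![γ, β] p * X.jac α γ + ∑ γ, F ![α, γ] p * X.jac β γ) := by
  have h0 : ∀ γ, update ![α, β] 0 γ = ![γ, β] := fun γ => by ext i; fin_cases i <;> rfl
  have h1 : ∀ γ, update ![α, β] 1 γ = ![α, γ] := fun γ => by ext i; fin_cases i <;> rfl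
  rw [lie_eq, Fin.sum_univ_two]
  simp [h0, h1]

lemma smooth_extD0 (hF : SmoothCov b F) : SmoothCov b (extD0 F) := by
  intro a
  have : extD0 F a = fun p => sp (a 0) (F ![a 1, a 2]) p + sp (a 1) (F ![a 2, a 0]) p
      + sp (a 2) (F ![a 0, a 1]) p := funext fun p => extD0_eq F a p
  rw [this]
  exact (((hF _).sp _).add ((hF _).sp _)).add ((hF _).sp _)

lemma sp_lie (hF : SmoothCov b F) (X : ZField) (δ α β : Fin 4) (hp : p ∈ outer b) : sp δ (lie X.field F ![α,
    β]) p = X.field.act (sp δ (F ![α, β])) p + ∑ γ, X.jac δ γ * sp γ (F ![α, β]) p + (∑ γ, sp δ (F ![γ, β])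
    p * X.jac α γ + ∑ γ, sp δ (F ![α, γ]) p * X.jac β γ) := by
  have h : lie X.field F ![α, β] = fun p => X.field.act (F ![α, β]) p +
      (∑ γ, F ![γ, β] p * X.jac α γ + ∑ γ, F ![α, γ] p * X.jac β γ) :=
    funext fun p => lie_two X F α β p
  have hd : ∀ c, DifferentiableAt ℝ (F c) p := fun c => (hF c).diff hp
  have hd1 : ∀ c (r : ℝ), DifferentiableAt ℝ (fun q => F c q * r) p := fun c r => (hd c).mul_const r
  rw [h, sp_add (((hF _).act X).diff hp) ((DifferentiableAt.fun_sum fun γ _ => hd1 _ _).fun_add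
    (DifferentiableAt.fun_sum fun γ _ => hd1 _ _)),
    sp_add (DifferentiableAt.fun_sum fun γ _ => hd1 _ _) (DifferentiableAt.fun_sum fun γ _ => hd1 _ _),
    sp_sum _ fun γ _ => hd1 _ _, sp_sum _ fun γ _ => hd1 _ _, X.sp_act (hF _) hp]
  simp only [sp_mul_const (hd _)]

lemma extD0_lie (hF : SmoothCov b F) (X : ZField) (a : Fin 3 → Fin 4) : EqOn (extD0 (lie X.field F) a)
    (lie X.field (extD0 F) a) (outer b) := by
  intro p hp
  have h : extD0 F a = fun p => (sp (a 0) (F ![a 1, a 2]) p + sp (a 1) (F ![a 2, a 0]) p)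
      + sp (a 2) (F ![a 0, a 1]) p := funext fun p => extD0_eq F a p
  have hs : ∀ δ c, DifferentiableAt ℝ (sp δ (F c)) p := fun δ c => ((hF c).sp δ).diff hp
  rw [extD0_eq, sp_lie hF X _ _ _ hp, sp_lie hF X _ _ _ hp, sp_lie hF X _ _ _ hp, lie_eq, h,
    act_add X.field ((hs _ _).fun_add (hs _ _)) (hs _ _), act_add X.field (hs _ _) (hs _ _), sum_univ_three]
  simp only [extD0_eq, Function.update_self, ne_eq, Fin.reduceEq, not_false_eq_true,
    Function.update_of_ne, add_mul, sum_add_distrib]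
  simp only [mul_comm (X.jac _ _)]
  ring

lemma extD0_lieIter (hF : SmoothCov b F) (Λ : MultiIndex) (a : Fin 3 → Fin 4) : EqOn (extD0 (lieIter Λ F) a)
    (lieIter Λ (extD0 F) a) (outer b) :=
  (lieIter_induction₂ (fun (T : Cov 2) (T' : Cov 3) => SmoothCov b T ∧ SmoothCov b T' ∧
      ∀ a, EqOn (extD0 T a) (T' a) (outer b))
    (fun X T T' h => ⟨h.1.lie X, h.2.1.lie X, fun a p hp => by
      rw [extD0_lie h.1 X a hp, lie_congr_outer (smooth_extD0 h.1) h.2.1 h.2.2 X a hp]⟩) Λ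
      ⟨hF, smooth_extD0 hF, fun _ _ _ => rfl⟩).2.2 a

/-- Antisymmetry on the exterior region. -/
def AntiOuter (b : ℝ) (F : Cov 2) : Prop := ∀ α β, EqOn (F ![α, β]) (fun p => - F ![β, α] p) (outer b)

lemma AntiOuter.lie (hF : SmoothCov b F) (h : AntiOuter b F) (X : ZField) : AntiOuter b (lie X.field F) := by
  intro α β p hp
  have h1 : X.field.act (F ![α, β]) p = - X.field.act (F ![β, α]) p := by
    rw [act_congr_outer (hF _) (hF _).neg (h α β) _ hp]
    have := act_const_mul X.field (-1) ((hF ![β, α]).diff hp)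
    simpa using this
  simp only [lie_two, h1]
  rw [show (∑ γ, F ![γ, β] p * X.jac α γ) = - ∑ γ, F ![β, γ] p * X.jac α γ by
    rw [← sum_neg_distrib]; exact sum_congr rfl fun γ _ => by rw [h γ β hp]; ring,
    show (∑ γ, F ![α, γ] p * X.jac β γ) = - ∑ γ, F ![γ, α] p * X.jac β γ by
    rw [← sum_neg_distrib]; exact sum_congr rfl fun γ _ => by rw [h α γ hp]; ring]
  ring

lemma AntiOuter.lieIter (hF : SmoothCov b F) (h : AntiOuter b F) (Λ : MultiIndex) :
    AntiOuter b (lieIter Λ F) :=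
  (lieIter_induction (fun T : Cov 2 => SmoothCov b T ∧ AntiOuter b T)
    (fun X _ h => ⟨h.1.lie X, h.2.lie h.1 X⟩) Λ ⟨hF, h⟩).2

lemma AntiOuter.sp (hF : SmoothCov b F) (h : AntiOuter b F) (δ α β : Fin 4) (hp : p ∈ outer b) :
    Maxwell.sp δ (F ![α, β]) p = - Maxwell.sp δ (F ![β, α]) p := by
  rw [sp_congr_outer (hF _) (hF _).neg (h α β) _ hp]
  simp only [Maxwell.sp, pd_neg]
  ring

/-- The Hodge star of the Minkowski metric. -/
def flatStar (F : Cov 2) : Cov 2 := fun a p =>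
  ∑ k : Fin 3, (kron (a 0) 0 * kron (a 1) k.succ - kron (a 1) 0 * kron (a 0) k.succ) *
      ((F ![(k + 1).succ, (k + 2).succ] p - F ![(k + 2).succ, (k + 1).succ] p) / 2)
  - ∑ k : Fin 3, (kron (a 0) (k + 1).succ * kron (a 1) (k + 2).succ
      - kron (a 1) (k + 1).succ * kron (a 0) (k + 2).succ) *
      ((F ![0, k.succ] p - F ![k.succ, 0] p) / 2)

/-- The Levi-Civita symbol as an integer. -/
def epsZ (a b c d : Fin 4) : ℤ :=
  ((b.val : ℤ) - a.val) * (c.val - a.val) * (d.val - a.val) * (c.val - b.val) * (d.val - b.val) *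
    (d.val - c.val) / 12

lemma eps_eq (a b c d : Fin 4) : eps ![a, b, c, d] = epsZ a b c d := by
  have h : (Matrix.of fun i j => kron (![a, b, c, d] i) j) =
      (Matrix.of fun i j : Fin 4 => if (![a, b, c, d] i) = j then (1 : ℤ) else 0).map
        (Int.castRingHom ℝ) := by
    ext i j; simp [kron]
  rw [eps, h, ← RingHom.mapMatrix_apply, ← RingHom.map_det]
  simp only [eq_intCast, Int.cast_inj]
  clear h
  simp only [Matrix.det_succ_row_zero, Matrix.det_fin_zero, sum_univ_succ, Finset.univ_eq_empty,
    sum_empty]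
  revert a b c d
  decide +kernel

lemma mink_inv : mink⁻¹ = mink := by
  refine Matrix.inv_eq_left_inv ?_
  rw [mink, Matrix.diagonal_mul_diagonal, ← Matrix.diagonal_one]
  congr 1
  ext i; fin_cases i <;> simp

lemma det_mink : mink.det = -1 := by simp [mink, Matrix.det_diagonal, Fin.prod_univ_four]

lemma hodge_mink (F : Cov 2) : hodge (fun _ => mink) F = flatStar F := by
  funext a p
  simp only [hodge, flatStar, mink_inv, det_mink, eps_eq]
  generalize a 0 = α
  generalize a 1 = β
  simp only [mink, Matrix.diagonal_apply]
  fin_cases α <;> fin_cases β <;> simp [sum_univ_four, sum_univ_three, epsZ, kron] <;> ring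

lemma smooth_flatStar (hF : SmoothCov b F) : SmoothCov b (flatStar F) := by
  intro a
  have h : ∀ c d (r : ℝ), SmoothOuter b (fun p => r * ((F c p - F d p) / 2)) := fun c d r => by
    have := (SmoothOuter.const (b := b) (r / 2)).mul ((hF c).sub (hF d))
    exact (funext fun p => by ring : (fun p => r * ((F c p - F d p) / 2)) =
      fun p => r / 2 * (F c p - F d p)) ▸ this
  exact (SmoothOuter.sum fun k _ => h _ _ _).sub (SmoothOuter.sum fun k _ => h _ _ _)

set_option maxHeartbeats 2000000 in
lemma flatStar_lie (hF : SmoothCov b F) (X : ZField) (a : Fin 2 → Fin 4) : EqOn (flatStar (lie X.field F) a)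
    (lie X.field (flatStar F) a) (outer b) := by
  intro p hp
  have hd : ∀ c, DifferentiableAt ℝ (F c) p := fun c => (hF c).diff hp
  have hact : ∀ c d (r : ℝ), X.field.act (fun p => r * ((F c p - F d p) / 2)) p =
      r * ((X.field.act (F c) p - X.field.act (F d) p) / 2) := fun c d r => by
    have h1 : (fun p => r * ((F c p - F d p) / 2)) = fun p => r / 2 * F c p + (- r / 2) * F d p :=
      funext fun p => by ring
    rw [h1, act_add X.field ((hd c).const_mul _) ((hd d).const_mul _), act_const_mul X.field _ (hd c),
      act_const_mul X.field _ (hd d)]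
    ring
  have hd2 : ∀ c d (r : ℝ), DifferentiableAt ℝ (fun p => r * ((F c p - F d p) / 2)) p :=
    fun c d r => by
      simpa only [div_eq_mul_inv] using (((hd c).fun_sub (hd d)).mul_const (2⁻¹ : ℝ)).const_mul r
  have hX : X.field.act (flatStar F a) p = flatStar (fun c => X.field.act (F c)) a p := by
    unfold flatStar
    simp only [sub_eq_add_neg _ (∑ k : Fin 3, _), ← sum_neg_distrib, ← neg_mul]
    rw [act_add X.field (DifferentiableAt.fun_sum fun k _ => hd2 _ _ _)
      (DifferentiableAt.fun_sum fun k _ => hd2 _ _ _), act_sum _ _ fun k _ => hd2 _ _ _,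
      act_sum _ _ fun k _ => hd2 _ _ _]
    simp only [hact]
  obtain ⟨α, β, rfl⟩ : ∃ α β, a = ![α, β] := ⟨a 0, a 1, by ext i; fin_cases i <;> rfl⟩
  rw [lie_two, hX]
  simp only [flatStar, lie_two, cons_val_zero, cons_val_one]
  cases X with
  | trans μ => simp [ZField.jac]
  | scal =>
    fin_cases α <;> fin_cases β <;> simp [sum_univ_four, sum_univ_three, kron, ZField.jac] <;> ring
  | rot k =>
    fin_cases k <;> fin_cases α <;> fin_cases β <;>
      simp [sum_univ_four, sum_univ_three, kron, ZField.jac] <;> ring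

lemma flatStar_lieIter (hF : SmoothCov b F) (Λ : MultiIndex) (a : Fin 2 → Fin 4) :
    EqOn (flatStar (lieIter Λ F) a) (lieIter Λ (flatStar F) a) (outer b) :=
  (lieIter_induction₂ (fun T T' : Cov 2 => SmoothCov b T ∧ SmoothCov b T' ∧
      ∀ a, EqOn (flatStar T a) (T' a) (outer b))
    (fun X T T' h => ⟨h.1.lie X, h.2.1.lie X, fun a p hp => by
      rw [flatStar_lie h.1 X a hp, lie_congr_outer (smooth_flatStar h.1) h.2.1 h.2.2 X a hp]⟩) Λ
      ⟨hF, smooth_flatStar hF, fun _ _ _ => rfl⟩).2.2 a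

/-! ## The divergence-curl system -/

/-- The electric (`0`) and magnetic (`1`) fields of a 2-form on the slice `t = τ`. -/
def emField (τ : ℝ) (F : Cov 2) (e : Fin 2) (j : Fin 3) (x : Space) : ℝ :=
  if e = 0 then F ![0, j.succ] (τ, x) else F ![(j + 1).succ, (j + 2).succ] (τ, x)

lemma sd_slice (hf : DifferentiableAt ℝ f (τ, x)) (j : Fin 3) : sd j (fun y => f (τ, y)) x = pd j.succ f (τ,
    x) := by
  have h := hf.hasFDerivAt.comp x (hasFDerivAt_prodMk_right τ x)
  have : (fun y => f (τ, y)) = f ∘ Prod.mk τ := rfl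
  rw [sd, this, h.fderiv]
  simp [pd, basisVec]

lemma flatStar_zero_succ (hA : AntiOuter b F) (j : Fin 3) : EqOn (flatStar F ![0, j.succ]) (F ![(j + 1).succ,
    (j + 2).succ]) (outer b) := by
  intro p hp
  have h := hA (j + 2).succ (j + 1).succ hp
  simp only [flatStar, cons_val_zero, cons_val_one]
  fin_cases j <;> simp [kron, sum_univ_three] at h ⊢ <;> rw [h] <;> ring

lemma flatStar_succ_succ (hA : AntiOuter b F) (j : Fin 3) : EqOn (flatStar F ![(j + 1).succ, (j + 2).succ])
    (fun p => - F ![0, j.succ] p) (outer b) := by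
  intro p hp
  have h := hA j.succ 0 hp
  simp only [flatStar, cons_val_zero, cons_val_one]
  fin_cases j <;> simp [kron, sum_univ_three] at h ⊢ <;> rw [h] <;> ring

lemma AntiOuter.flatStar (F : Cov 2) : AntiOuter b (flatStar F) := by
  intro α β p hp
  simp only [Maxwell.flatStar, cons_val_zero, cons_val_one, sum_univ_three]
  ring

lemma emField_divCurl (hF : SmoothCov b F) (hA : AntiOuter b F) (hx : (τ, x) ∈ outer b) (e : Fin 2) :
    divCurlSq (fun j k => sd k (emField τ F e j) x) ≤ 4 * (∑ a, |extD0 F a (τ, x)| + ∑ a, |extD0 (flatStar F)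
    a (τ, x)|) ^ 2 := by
  have hd : ∀ c, DifferentiableAt ℝ (F c) (τ, x) := fun c => (hF c).diff hx
  have n1 : 0 ≤ ∑ a, |extD0 F a (τ, x)| := sum_nonneg fun _ _ => abs_nonneg _
  have n2 : 0 ≤ ∑ a, |extD0 (flatStar F) a (τ, x)| := sum_nonneg fun _ _ => abs_nonneg _
  set Q := ∑ a, |extD0 F a (τ, x)| + ∑ a, |extD0 (flatStar F) a (τ, x)| with hQ
  have hE : ∀ W : Cov 2, ∑ a, |extD0 W a (τ, x)| ≤ Q → ∀ a, extD0 W a (τ, x) ^ 2 ≤ Q ^ 2 := fun W h a =>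
    sq_le_sq.2 (((le_sum_univ (fun _ => abs_nonneg _) a).trans h).trans (le_abs_self Q))
  have hG := hE F (by linarith)
  have hH := hE (flatStar F) (by linarith)
  have hsp : ∀ (k : Fin 3) (c : Fin 2 → Fin 4), sp k.succ (F c) (τ, x) = pd k.succ (F c) (τ, x) :=
    fun k c => sp_succ _ _ _
  have hst := smooth_flatStar hF
  have hSA := AntiOuter.flatStar (b := b) F
  have s1 : ∀ k j : Fin 3, sp k.succ (flatStar F ![0, j.succ]) (τ, x) =
      pd k.succ (F ![(j + 1).succ, (j + 2).succ]) (τ, x) := fun k j => by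
    rw [sp_congr_outer (hst _) (hF _) (flatStar_zero_succ hA j) _ hx, hsp]
  have s2 : ∀ k j : Fin 3, sp k.succ (flatStar F ![(j + 1).succ, (j + 2).succ]) (τ, x) =
      - pd k.succ (F ![0, j.succ]) (τ, x) := fun k j => by
    rw [sp_congr_outer (hst _) (hF _).neg (flatStar_succ_succ hA j) _ hx, sp_succ, pd_neg]
  have curl : ∀ (W : Cov 2), SmoothCov b W → AntiOuter b W → ∀ i j : Fin 3,
      extD0 W ![0, i.succ, j.succ] (τ, x) =
        sp j.succ (W ![0, i.succ]) (τ, x) - sp i.succ (W ![0, j.succ]) (τ, x) := by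
    intro W hW hWA i j
    rw [extD0_eq]
    simp only [cons_val_zero, cons_val_one, Matrix.cons_val, sp_zero]
    rw [hWA.sp hW i.succ j.succ 0 hx]
    ring
  have dive : ∀ (W : Cov 2), extD0 W ![1, 2, 3] (τ, x) = sp 1 (W ![2, 3]) (τ, x)
      + sp 2 (W ![3, 1]) (τ, x) + sp 3 (W ![1, 2]) (τ, x) := fun W => by
    rw [extD0_eq]; simp
  unfold divCurlSq
  fin_cases e
  · have hs : ∀ j k : Fin 3, sd k (emField τ F 0 j) x = pd k.succ (F ![0, j.succ]) (τ, x) :=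
      fun j k => sd_slice (hd _) k
    simp only [Fin.zero_eta, hs]
    have d := hH ![1, 2, 3]
    have c0 := hG ![0, (1 : Fin 3).succ, (2 : Fin 3).succ]
    have c1 := hG ![0, (2 : Fin 3).succ, (0 : Fin 3).succ]
    have c2 := hG ![0, (0 : Fin 3).succ, (1 : Fin 3).succ]
    rw [curl F hF hA] at c0 c1 c2
    rw [dive] at d
    have t0 := s2 0 0
    have t1 := s2 1 1
    have t2 := s2 2 2
    simp only [hsp] at c0 c1 c2
    simp at t0 t1 t2 c0 c1 c2 ⊢
    rw [t0, t1, t2] at d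
    nlinarith only [d, c0, c1, c2]
  · have hs : ∀ j k : Fin 3, sd k (emField τ F 1 j) x = pd k.succ (F ![(j + 1).succ, (j + 2).succ]) (τ, x) :=
      fun j k => sd_slice (hd _) k
    simp only [Fin.mk_one, hs]
    have d := hG ![1, 2, 3]
    have c0 := hH ![0, (1 : Fin 3).succ, (2 : Fin 3).succ]
    have c1 := hH ![0, (2 : Fin 3).succ, (0 : Fin 3).succ]
    have c2 := hH ![0, (0 : Fin 3).succ, (1 : Fin 3).succ]
    rw [curl _ hst hSA] at c0 c1 c2
    rw [dive] at d
    simp only [s1] at c0 c1 c2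
    have t0 := hsp 0 ![2, 3]
    have t1 := hsp 1 ![3, 1]
    have t2 := hsp 2 ![1, 2]
    simp at t0 t1 t2 c0 c1 c2 ⊢
    rw [t0, t1, t2] at d
    nlinarith only [d, c0, c1, c2]

lemma AntiOuter.component (hA : AntiOuter b F) (c : Fin 2 → Fin 4) : (∃ (e : Fin 2) (j : Fin 3) (s : ℝ), |s| ≤
    1 ∧ ∀ τ x, (τ, x) ∈ outer b → F c (τ, x) = s * emField τ F e j x) := by
  obtain ⟨α, β, rfl⟩ : ∃ α β, c = ![α, β] := ⟨c 0, c 1, by ext i; fin_cases i <;> rfl⟩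
  have z : ∀ α, ∀ p ∈ outer b, F ![α, α] p = 0 := fun α p hp => by have := hA α α hp; simp only at this; linarith
  let P (c : Fin 2 → Fin 4) : Prop := ∃ (e : Fin 2) (j : Fin 3) (s : ℝ), |s| ≤ 1 ∧
    ∀ τ x, (τ, x) ∈ outer b → F c (τ, x) = s * emField τ F e j x
  have pos : ∀ {c} e j, (∀ τ x, F c (τ, x) = emField τ F e j x) → P c := fun e j h =>
    ⟨e, j, 1, by simp, fun τ x _ => by rw [h, one_mul]⟩
  have neg : ∀ {α β} e j, (∀ τ x, F ![β, α] (τ, x) = emField τ F e j x) → P ![α, β] := fun {α β} e j h =>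
    ⟨e, j, -1, by simp, fun τ x hx => by rw [hA α β hx]; simp [h]⟩
  have zer : ∀ α, P ![α, α] := fun α => ⟨0, 0, 0, by simp, fun τ x hx => by rw [z α _ hx, zero_mul]⟩
  change P _
  fin_cases α <;> fin_cases β
  exacts [zer _, pos 0 0 fun _ _ => rfl, pos 0 1 fun _ _ => rfl, pos 0 2 fun _ _ => rfl, neg 0 0 fun _ _ => rfl,
    zer _, pos 1 2 fun _ _ => rfl, neg 1 1 fun _ _ => rfl, neg 0 1 fun _ _ => rfl, neg 1 2 fun _ _ => rfl,
    zer _, pos 1 0 fun _ _ => rfl, neg 0 2 fun _ _ => rfl, pos 1 1 fun _ _ => rfl, neg 1 0 fun _ _ => rfl,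
    zer _]

/-- The electromagnetic fields of all `F^Λ`, `|Λ| ≤ m`. -/
def emSystem (m : ℕ) (τ : ℝ) (F : Cov 2) (i : Idx m × Fin 2) (j : Fin 3) (x : Space) : ℝ :=
  emField τ (lieIter i.1.1 F) i.2 j x

lemma contDiffAt_emField (hF : SmoothCov b F) (hx : (τ, x) ∈ outer b) (e : Fin 2) (j : Fin 3) :
    ContDiffAt ℝ ∞ (emField τ F e j) x := by
  have h : ∀ c, ContDiffAt ℝ ∞ (fun y => F c (τ, y)) x := fun c =>
    (hF c (τ, x) hx).comp x (contDiffAt_const.prodMk contDiffAt_id)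
  unfold emField
  split_ifs <;> exact h _

lemma absSum_le_fieldSq (m : ℕ) : ∃ N : ℝ, 0 ≤ N ∧ ∀ (b : ℝ) (F : Cov 2), SmoothCov b F → AntiOuter b F →
    ∀ τ x, (τ, x) ∈ outer b → absSum m F (τ, x) ≤ N * √(fieldSq (emSystem m τ F) x) ∧ absGradSum m F (τ, x) ≤
    N * √(gradSq (emSystem m τ F) x) := by
  refine ⟨∑ _ : Idx m, ∑ _ : Fin 2 → Fin 4, ∑ _ : Fin 3, 1, by positivity, fun b F hF hA τ x hx => ?_⟩
  have hfield : ∀ i j, |emSystem m τ F i j x| ≤ √(fieldSq (emSystem m τ F) x) := fun i j =>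
    abs_le_sqrt ((le_sum_univ (u := fun j => emSystem m τ F i j x ^ 2) (fun _ => sq_nonneg _) j).trans
      (le_sum_univ (u := fun i => ∑ j, emSystem m τ F i j x ^ 2) (fun _ => sum_nonneg fun _ _ => sq_nonneg _) i))
  have hgrad : ∀ i j k, |sd k (emSystem m τ F i j) x| ≤ √(gradSq (emSystem m τ F) x) := fun i j k =>
    abs_le_sqrt ((le_sum_univ (u := fun k => sd k (emSystem m τ F i j) x ^ 2) (fun _ => sq_nonneg _) k).trans ((le_sum_univ (u := fun j => ∑ k,
      sd k (emSystem m τ F i j) x ^ 2) (fun _ => sum_nonneg fun _ _ => sq_nonneg _) j).trans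
      (le_sum_univ (u := fun i => ∑ j, ∑ k, sd k (emSystem m τ F i j) x ^ 2)
        (fun _ => sum_nonneg fun _ _ => sum_nonneg fun _ _ => sq_nonneg _) i)))
  constructor
  · simp only [absSum, sum_mul, one_mul]
    refine sum_le_sum fun Λ _ => sum_le_sum fun c _ => ?_
    obtain ⟨e, j, s, hs, h⟩ := (hA.lieIter hF Λ.1).component c
    rw [h τ x hx, abs_mul]
    refine ((mul_le_of_le_one_left (abs_nonneg _) hs).trans (hfield (Λ, e) j)).trans ?_
    exact single_le_sum (f := fun _ : Fin 3 => √(fieldSq (emSystem m τ F) x))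
      (fun _ _ => sqrt_nonneg _) (mem_univ 0)
  · simp only [absGradSum, sum_mul, one_mul]
    refine sum_le_sum fun Λ _ => sum_le_sum fun c _ => sum_le_sum fun k _ => ?_
    obtain ⟨e, j, s, hs, h⟩ := (hA.lieIter hF Λ.1).component c
    have hS := hF.lieIter Λ.1
    have hnear : (fun y => lieIter Λ.1 F c (τ, y)) =ᶠ[𝓝 x] fun y => s * emSystem m τ F (Λ, e) j y := by
      have : {y : Space | b < ‖y‖} ∈ 𝓝 x := (isOpen_norm_gt b).mem_nhds hx.2
      filter_upwards [this] with y hy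
      exact h τ y ⟨hx.1, hy⟩
    rw [← sd_slice ((hS c).diff hx) k, sd, hnear.fderiv_eq, ← sd,
      sd_mul (g := emSystem m τ F (Λ, e) j) (differentiableAt_const s) ((contDiffAt_emField hS hx e j).differentiableAt (by simp))]
    have : sd k (fun _ : Space => s) x = 0 := by simp [sd]
    rw [this, zero_mul, zero_add, abs_mul]
    exact (mul_le_of_le_one_left (abs_nonneg _) hs).trans (hgrad (Λ, e) j k)

lemma fieldSq_le_absSum (m : ℕ) (F : Cov 2) (τ : ℝ) (x : Space) : fieldSq (emSystem m τ F) x ≤ (∑ _ :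
    Idx m × Fin 2, ∑ _ : Fin 3, 1) * absSum m F (τ, x) ^ 2 := by
  simp only [fieldSq, sum_mul, one_mul]
  refine sum_le_sum fun i _ => sum_le_sum fun j _ => ?_
  have : |emSystem m τ F i j x| ≤ absSum m F (τ, x) := by
    unfold emSystem emField
    split_ifs
    · exact abs_lieIter_le_absSum F _ i.1.2 _
    · exact abs_lieIter_le_absSum F _ i.1.2 _
  rw [← sq_abs]
  exact pow_le_pow_left₀ (abs_nonneg _) this 2

/-! ## Asymptotics of the coefficients of the Hodge star -/

/-- A class of smooth coefficients together with an ideal of negligible ones. -/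
structure CoefClass (b : ℝ) (A I : Scalar → Prop) : Prop where
  smooth : ∀ f, A f → SmoothOuter b f
  const : ∀ c : ℝ, A fun _ => c
  add : ∀ f g, A f → A g → A fun p => f p + g p
  mul : ∀ f g, A f → A g → A fun p => f p * g p
  comp : ∀ f, A f → ∀ (O K : Set ℝ), IsOpen O → IsCompact K → K ⊆ O → (∀ p ∈ outer b, f p ∈ K) →
    ∀ φ : ℝ → ℝ, ContDiffOn ℝ ∞ φ O → A fun p => φ (f p)
  zero : I fun _ => 0
  ideal_add : ∀ f g, I f → I g → I fun p => f p + g p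
  ideal_mul : ∀ f g, I f → A g → I fun p => f p * g p
  ideal_congr : ∀ f g, I f → SmoothOuter b g → EqOn g f (outer b) → I g

lemma coefClass_sym (hb : 1 ≤ b) : CoefClass b (fun f => Sym b 0 fun _ => f) (fun f => Sym b (-1) fun _ => f)
    where
  smooth f hf := hf.1.1 0
  const c := Sym.const c
  add _ _ hf hg := hf.add hg
  mul _ _ hf hg := by simpa using hf.mul hb hg
  comp _ hf _ _ hO hK hKO hfK _ hφ := hf.comp hb hO hK hKO (fun _ => hfK) hφ
  zero := Sym.zero
  ideal_add _ _ hf hg := hf.add hg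
  ideal_mul _ _ hf hg := by simpa using hf.mul hb hg
  ideal_congr _ _ hf hg h := hf.congr (fun _ => hg) fun _ => h

lemma coefClass_SZu (hb : 1 ≤ b) (s : ℤ) : CoefClass b (fun f => SZu b 0 fun _ => f)
    (fun f => SZu b s fun _ => f) where
  smooth f hf := hf.1 0
  const c := SZu.const c
  add _ _ hf hg := hf.add hg
  mul _ _ hf hg := by simpa using hf.mul hb hg
  comp _ hf _ _ hO hK hKO hfK _ hφ := hf.comp hb hO hK hKO (fun _ => hfK) hφ
  zero := SZu.zero
  ideal_add _ _ hf hg := hf.add hg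
  ideal_mul _ _ hf hg := by simpa using hf.mul hb hg
  ideal_congr _ _ hf hg h := hf.congr (fun _ => hg) fun _ => h

/-- Congruence of coefficients modulo negligible ones. -/
def Cong (A I : Scalar → Prop) (f f' : Scalar) : Prop := A f ∧ A f' ∧ I fun p => f p - f' p

namespace Cong

variable {A I : Scalar → Prop} {f' g' : Scalar}

lemma const (h : CoefClass b A I) (c : ℝ) : Cong A I (fun _ => c) (fun _ => c) :=
  ⟨h.const c, h.const c, by simpa using h.zero⟩

lemma add (h : CoefClass b A I) (hf : Cong A I f f') (hg : Cong A I g g') : Cong A I (fun p => f p + g p)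
    (fun p => f' p + g' p) :=
  ⟨h.add _ _ hf.1 hg.1, h.add _ _ hf.2.1 hg.2.1, by
    have := h.ideal_add _ _ hf.2.2 hg.2.2
    exact (funext fun p => by ring : (fun p => f p + g p - (f' p + g' p)) =
      fun p => f p - f' p + (g p - g' p)) ▸ this⟩

lemma mul (h : CoefClass b A I) (hf : Cong A I f f') (hg : Cong A I g g') : Cong A I (fun p => f p * g p)
    (fun p => f' p * g' p) :=
  ⟨h.mul _ _ hf.1 hg.1, h.mul _ _ hf.2.1 hg.2.1, by
    have := h.ideal_add _ _ (h.ideal_mul _ _ hf.2.2 hg.1) (h.ideal_mul _ _ hg.2.2 hf.2.1)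
    exact (funext fun p => by ring : (fun p => f p * g p - (f' p * g' p)) =
      fun p => (f p - f' p) * g p + (g p - g' p) * f' p) ▸ this⟩

lemma const_mul (h : CoefClass b A I) (c : ℝ) (hf : Cong A I f f') :
    Cong A I (fun p => c * f p) (fun p => c * f' p) := mul h (const h c) hf

lemma sum (h : CoefClass b A I) {ι : Type*} (t : Finset ι) {f f' : ι → Scalar} (hf : ∀ i ∈ t, Cong A I (f i)
    (f' i)) : Cong A I (fun p => ∑ i ∈ t, f i p) (fun p => ∑ i ∈ t, f' i p) := by
  simpa only [Prod.fst_sum, Prod.snd_sum, sum_fn] using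
    sum_induction (fun i => (f i, f' i)) (fun q => Cong A I q.1 q.2) (fun _ _ => add h) (const h 0) hf

lemma prod (h : CoefClass b A I) {ι : Type*} (t : Finset ι) {f f' : ι → Scalar} (hf : ∀ i ∈ t, Cong A I (f i)
    (f' i)) : Cong A I (fun p => ∏ i ∈ t, f i p) (fun p => ∏ i ∈ t, f' i p) := by
  simpa only [Prod.fst_prod, Prod.snd_prod, prod_fn] using
    prod_induction (fun i => (f i, f' i)) (fun q => Cong A I q.1 q.2) (fun _ _ => mul h) (const h 1) hf

/-- Values bounded and bounded away from zero, of the sign of `s`. -/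
def Range (b s : ℝ) (f : Scalar) : Prop := ∀ p ∈ outer b, s * f p ∈ Set.Icc (1 / 2 : ℝ) 2

lemma Range.ne_zero {s : ℝ} (hR : Range b s f) (hp : p ∈ outer b) : f p ≠ 0 := by
  intro h0
  have := (hR p hp).1
  rw [h0] at this
  norm_num at this

lemma class_inv (h : CoefClass b A I) {s : ℝ} (hs : s * s = 1) (hf : A f) (hR : Range b s f) :
    A fun p => (f p)⁻¹ := by
  have h1 : A fun p => s * f p := h.mul _ _ (h.const s) hf
  have h2 := h.comp _ h1 (Set.Ioi 0) (Set.Icc (1 / 2 : ℝ) 2) isOpen_Ioi isCompact_Icc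
    (fun x hx => lt_of_lt_of_le (by norm_num) hx.1) hR (fun x => x⁻¹)
    (fun x hx => (contDiffAt_inv ℝ (ne_of_gt hx)).contDiffWithinAt)
  have h3 := h.mul _ _ (h.const s) h2
  have hs' : s⁻¹ = s := by
    have : s ≠ 0 := by rintro rfl; simp at hs
    field_simp; linarith
  have : (fun p => s * (s * f p)⁻¹) = fun p => (f p)⁻¹ := funext fun p => by
    rw [mul_inv, hs', ← mul_assoc, hs, one_mul]
  rwa [this] at h3

lemma inv (h : CoefClass b A I) {s : ℝ} (hs : s * s = 1) (hf : Cong A I f f') (hR : Range b s f) (hR' :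
    Range b s f') : Cong A I (fun p => (f p)⁻¹) (fun p => (f' p)⁻¹) := by
  have h1 := class_inv h hs hf.1 hR
  have h2 := class_inv h hs hf.2.1 hR'
  refine ⟨h1, h2, h.ideal_congr _ _ (h.ideal_mul _ _ (h.ideal_mul _ _ hf.2.2 h1)
    (h.mul _ _ (h.const (-1)) h2)) ((h.smooth _ h1).sub (h.smooth _ h2)) fun p hp => ?_⟩
  have n1 := hR.ne_zero hp
  have n2 := hR'.ne_zero hp
  simp only
  field_simp
  ring

lemma class_sqrt (h : CoefClass b A I) (hf : A f) (hR : Range b 1 f) : A fun p => √(f p) :=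
  h.comp _ hf (Set.Ioi 0) (Set.Icc (1 / 2 : ℝ) 2) isOpen_Ioi isCompact_Icc
    (fun x hx => lt_of_lt_of_le (by norm_num) hx.1) (fun p hp => by simpa using hR p hp) _
    (fun x hx => (contDiffAt_sqrt (ne_of_gt hx)).contDiffWithinAt)

lemma Range.sqrt (hR : Range b 1 f) : Range b 1 fun p => √(f p) := fun p hp => by
  have := hR p hp
  rw [one_mul] at this ⊢
  exact ⟨le_sqrt_of_sq_le (by nlinarith [this.1]), sqrt_le_iff.2 ⟨by norm_num, by nlinarith [this.2]⟩⟩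

lemma sqrt (h : CoefClass b A I) (hf : Cong A I f f') (hR : Range b 1 f) (hR' : Range b 1 f') :
    Cong A I (fun p => √(f p)) (fun p => √(f' p)) := by
  have h1 := class_sqrt h hf.1 hR
  have h2 := class_sqrt h hf.2.1 hR'
  have hp := fun p hp => And.intro (hR.sqrt p hp) (hR'.sqrt p hp)
  simp only [one_mul, Set.mem_Icc] at hp
  have h3 : A fun p => ((√(f p) + √(f' p)) * (1 / 2))⁻¹ :=
    class_inv h (s := 1) (by norm_num) (h.mul _ _ (h.add _ _ h1 h2) (h.const _)) fun p hq => by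
      constructor <;> linarith [(hp p hq).1.1, (hp p hq).1.2, (hp p hq).2.1, (hp p hq).2.2]
  refine ⟨h1, h2, h.ideal_congr _ _ (h.ideal_mul _ _ (h.ideal_mul _ _ hf.2.2 h3)
    (h.const (1 / 2))) ((h.smooth _ h1).sub (h.smooth _ h2)) fun p hq => ?_⟩
  have hs : √(f p) + √(f' p) ≠ 0 := by linarith [(hp p hq).1.1, (hp p hq).2.1]
  have e1 : √(f p) ^ 2 = f p := sq_sqrt (by linarith [(hR p hq).1])
  have e2 : √(f' p) ^ 2 = f' p := sq_sqrt (by linarith [(hR' p hq).1])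
  simp only
  rw [show f p - f' p = (√(f p) - √(f' p)) * (√(f p) + √(f' p)) by rw [← sub_eq_zero]; linear_combination e2 - e1]
  field_simp

section matrix

variable {M M' : Metric4}

lemma det (h : CoefClass b A I) (hM : ∀ i j, Cong A I (fun p => M p i j) (fun p => M' p i j)) :
    Cong A I (fun p => (M p).det) (fun p => (M' p).det) := by
  simp only [Matrix.det_apply']
  exact sum h _ fun σ _ => const_mul h _ (prod h _ fun i _ => hM _ _)

lemma adjugate (h : CoefClass b A I) (hM : ∀ i j, Cong A I (fun p => M p i j) (fun p => M' p i j)) (i j :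
    Fin 4) : Cong A I (fun p => (M p).adjugate i j) (fun p => (M' p).adjugate i j) := by
  simp only [Matrix.adjugate_apply]
  refine det h fun k l => ?_
  by_cases hk : k = j
  · subst hk
    simp only [Matrix.updateRow_self]
    exact const h _
  · simp only [Matrix.updateRow_ne hk]
    exact hM k l

lemma inverse (h : CoefClass b A I) (hM : ∀ i j, Cong A I (fun p => M p i j) (fun p => M' p i j)) (hR :
    Range b (-1) fun p => (M p).det) (hR' : Range b (-1) fun p => (M' p).det) (i j : Fin 4) :
    Cong A I (fun p => (M p)⁻¹ i j) (fun p => (M' p)⁻¹ i j) := by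
  simp only [Matrix.inv_def, Matrix.smul_apply, Ring.inverse_eq_inv', smul_eq_mul]
  exact mul h (inv h (by norm_num) (det h hM) hR hR') (adjugate h hM i j)

end matrix

end Cong

/-- The coefficients of the Hodge star of a quadratic form. -/
def hodgeCoef (M : Matrix (Fin 4) (Fin 4) ℝ) (a : Fin 2 → Fin 4) (μ ν : Fin 4) : ℝ :=
  (1 / 2) * ∑ γ, ∑ δ, eps ![a 0, a 1, γ, δ] * √(-M.det) * M⁻¹ γ μ * M⁻¹ δ ν

lemma sum_comm_pairs {ι M : Type*} [Fintype ι] [AddCommMonoid M] (f : ι → ι → ι → ι → M) : ∑ γ, ∑ δ, ∑ μ, ∑ ν,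
    f γ δ μ ν = ∑ μ, ∑ ν, ∑ γ, ∑ δ, f γ δ μ ν :=
  (sum_congr rfl fun _ _ => sum_comm).trans (sum_comm.trans
    (sum_congr rfl fun _ _ => (sum_congr rfl fun _ _ => sum_comm).trans sum_comm))

lemma hodge_eq (g : Metric4) (F : Cov 2) (a : Fin 2 → Fin 4) (p : Spacetime) : hodge g F a p = ∑ μ, ∑ ν,
    hodgeCoef (g p) a μ ν * F ![μ, ν] p := by
  simp only [hodge, hodgeCoef]
  rw [sum_comm_pairs]
  simp only [mul_sum, sum_mul, mul_assoc]

/-- The coefficients of the Hodge star are close to those of Minkowski space. -/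
abbrev NearMink (b : ℝ) (g : Metric4) : Prop :=
  ∀ a μ ν, Sym b (-1) fun _ p => hodgeCoef (g p) a μ ν - hodgeCoef mink a μ ν

lemma Cong.hodgeCoef {A I : Scalar → Prop} {M M' : Metric4} (h : CoefClass b A I) (hM : ∀ i j,
    Cong A I (fun p => M p i j) (fun p => M' p i j)) (hR : Range b (-1) fun p => (M p).det) (hR' :
    Range b (-1) fun p => (M' p).det) (a : Fin 2 → Fin 4) (μ ν : Fin 4) : Cong A I (fun p => hodgeCoef (M p)
    a μ ν) (fun p =>
    Maxwell.hodgeCoef (M' p) a μ ν) := by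
  have hs : Cong A I (fun p => √(-(M p).det)) (fun p => √(-(M' p).det)) := by
    refine sqrt h ?_ (fun p hp => by simpa using hR p hp) (fun p hp => by simpa using hR' p hp)
    simpa using const_mul h (-1) (det h hM)
  exact const_mul h _ (sum h _ fun γ _ => sum h _ fun δ _ =>
    mul h (mul h (const_mul h _ hs) (inverse h hM hR hR' _ _)) (inverse h hM hR hR' _ _))

lemma outer_subset {b' : ℝ} (h : b ≤ b') : outer b' ⊆ outer b := fun _ hp => ⟨hp.1, h.trans_lt hp.2⟩

lemma SmoothOuter.mono {b' : ℝ} (h : b ≤ b') (hf : SmoothOuter b f) :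
    SmoothOuter b' f := fun p hp => hf p (outer_subset h hp)

lemma SZu.restrict {b' : ℝ} (h : b ≤ b') {a : ℕ → Scalar} (ha : SZu b s a) : SZu b' s a :=
  ⟨fun n => (ha.1 n).mono h, fun w => (ha.2 w).imp fun _ hc n p hp => hc n p (outer_subset h hp)⟩

lemma Sym.restrict {b' : ℝ} (h : b ≤ b') {a : ℕ → Scalar} (ha : Sym b s a) :
    Sym b' s a := ⟨ha.1.restrict h, fun i => (ha.2 i).restrict h⟩

/-- Coefficients which tend to `c` at the rate `r⁻¹`. -/
abbrev NearConst (b : ℝ) (f : Scalar) (c : ℝ) : Prop :=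
  Cong (fun f => Sym b 0 fun _ => f) (fun f => Sym b (-1) fun _ => f) f fun _ => c

lemma NearConst.range {c : ℝ} (hc : c * c = 1) (hf : NearConst b f c) : ∀ᶠ b' in atTop,
    Cong.Range b' c f := by
  obtain ⟨K, hK, h⟩ := hf.2.2.1.bound
  filter_upwards [eventually_ge_atTop b, eventually_ge_atTop (2 * K), eventually_gt_atTop 0]
    with b' hb hK' h0 p hp
  have h1 := h 0 p (outer_subset hb hp)
  have hr : b' < ‖p.2‖ := hp.2
  have h2 : |c * f p - 1| ≤ 1 / 2 := by
    have hca : |c| = 1 := by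
      have : |c| * |c| = 1 := by rw [← abs_mul, hc, abs_one]
      nlinarith [abs_nonneg c]
    rw [show c * f p - 1 = c * (f p - c) by rw [mul_sub, hc], abs_mul, hca, one_mul]
    refine h1.trans ?_
    rw [zpow_neg_one, ← div_eq_mul_inv, div_le_iff₀ (h0.trans hr)]
    linarith
  exact ⟨by linarith [(abs_le.1 h2).1], by linarith [(abs_le.1 h2).2]⟩

lemma SZ.SZu {ρ : ℝ → ℝ} {R0 : ℝ} {a : Scalar} (h : SZ ρ R0 s a) (hb : R0 ≤ b) (hρ : ∀ r, b ≤ r → ρ r = r) :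
    SZu b s fun _ => a := by
  have hsub : ∀ p ∈ outer b, p ∈ manifold R0 := fun p hp => ⟨hp.1, hb.trans hp.2.le⟩
  refine ⟨fun _ p hp => h.1 p (hsub p hp), fun w => ?_⟩
  obtain ⟨c, hc⟩ := h.2 w
  refine ⟨c, fun _ p hp => ?_⟩
  have := hc p (hsub p hp)
  rwa [hρ _ hp.2.le] at this

lemma Sym_of_stationary (hb : 1 ≤ b) (hf : SZu b s fun _ => f) (h0 : ∀ p ∈ outer b, pd 0 f p = 0) :
    Sym b s fun _ => f := by
  refine ⟨hf, fun i => ?_⟩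
  have hc : ∀ j : Fin 3, Maxwell.SZu b (-1) fun _ p => coord j.succ p * ‖p.2‖ ^ (-2 : ℤ) := fun j =>
    ((HomDeg.coord_succ j).mul (HomDeg.norm_zpow (-2))).SZu hb
  have hsum := (((hc i).mul hb (hf.act .scal)).sub hb ((hc (i + 1)).mul hb (hf.act (.rot (i + 2))))).add
    ((hc (i + 2)).mul hb (hf.act (.rot (i + 1))))
  rw [show s - 1 = -1 + s by ring]
  refine hsum.congr (fun _ => (hf.1 0).pd _) fun _ p hp => ?_
  have hn : ‖p.2‖ ≠ 0 := norm_ne_zero_iff.2 (outer_ne_zero hb hp)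
  have hsq : ‖p.2‖ ^ 2 = p.2 0 ^ 2 + p.2 1 ^ 2 + p.2 2 ^ 2 := by
    rw [EuclideanSpace.norm_sq_eq]; simp [sum_univ_three]
  have h2 : ‖p.2‖ ^ (-2 : ℤ) = (‖p.2‖ ^ 2)⁻¹ := by rw [zpow_neg]; norm_cast
  have hne : p.2 0 ^ 2 + p.2 1 ^ 2 + p.2 2 ^ 2 ≠ 0 := by rw [← hsq]; positivity
  simp only [VField.act, sum_univ_succ (n := 3), h0 p hp, h2, hsq]
  simp only [ZField.field, scaling, rotation, Maxwell.coord_succ, sum_univ_three, kron]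
  fin_cases i <;> simp [Fin.succ_ne_zero] <;> field_simp <;> ring

/-- The model metric to leading and subleading order. -/
def modelMetric (htt htr hrr hww : ℝ → ℝ) : Metric4 := fun p => mink + longRange htt htr hrr hww p

lemma Sym_radial (hb : 1 ≤ b) {φ : ℝ → ℝ} (h : SZu b s fun _ p => φ ‖p.2‖) : Sym b s fun _ p => φ ‖p.2‖ :=
  Sym_of_stationary hb h fun _ hp => pd_zero_of_const ((h.1 0).diff hp) fun _ => rfl

lemma longRange_sym (hb : 1 ≤ b) {htt htr hrr hww : ℝ → ℝ} (h1 : SZu b (-1) fun _ p => htt ‖p.2‖) (h2 :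
    SZu b (-1) fun _ p => htr ‖p.2‖) (h3 : SZu b (-1) fun _ p => hrr ‖p.2‖) (h4 : SZu b (-1)
    fun _ p => hww ‖p.2‖) (α β : Fin 4) : Sym b (-1) fun _ p => longRange htt htr hrr hww p α β := by
  have hn : ∀ α, Sym b 0 fun _ => normal α := fun α => (HomDeg.normal α).sym hb
  have m : ∀ {f g : Scalar}, (Sym b (-1) fun _ => f) → (Sym b 0 fun _ => g) →
      Sym b (-1) fun _ p => f p * g p := fun hf hg => by simpa using hf.mul hb hg
  have n0 : ∀ {f g : Scalar}, (Sym b 0 fun _ => f) → (Sym b 0 fun _ => g) →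
      Sym b 0 fun _ p => f p * g p := fun hf hg => by simpa using hf.mul hb hg
  have e2 : Sym b 0 fun _ p => (kron α 0 * normal β p + normal α p * kron β 0) / 2 := by
    simpa only [div_eq_mul_inv] using n0 ((n0 (Sym.const (kron α 0)) (hn β)).add
      (n0 (hn α) (Sym.const (kron β 0)))) (Sym.const 2⁻¹)
  exact (((m (Sym_radial hb h1) (Sym.const _)).add (m (Sym_radial hb h2) e2)).add (m (Sym_radial hb h3) (n0 (hn α) (hn β)))).add
    (m (Sym_radial hb h4) ((Sym.const (kron α β - kron α 0 * kron β 0)).sub hb (n0 (hn α) (hn β))))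

/-- The ratio of the angular component of the dual to the radial component. -/
def radialFactor (htt htr hrr hww : ℝ → ℝ) (r : ℝ) : ℝ :=
  √(-(((-1 + htt r) * (1 + hrr r) - (htr r / 2) ^ 2) * (1 + hww r) ^ 2)) *
    ((-1 + htt r) * (1 + hrr r) - (htr r / 2) ^ 2)⁻¹

section model

open Matrix

/-- The quadratic form with coefficients `A dt² + B (dt n + n dt) + C n² + W (δ - dt² - n²)`. -/
def blockForm (n : Fin 4 → ℝ) (A B C W : ℝ) : Matrix (Fin 4) (Fin 4) ℝ :=
  A • vecMulVec (Pi.single 0 1) (Pi.single 0 1)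
    + B • (vecMulVec (Pi.single 0 1) n + vecMulVec n (Pi.single 0 1)) + C • vecMulVec n n
    + W • (1 - vecMulVec (Pi.single 0 1) (Pi.single 0 1) - vecMulVec n n)

lemma blockForm_inv {n : Fin 4 → ℝ} (hn0 : n 0 = 0) (hn : n ⬝ᵥ n = 1) {A B C W : ℝ} (hD : A * C - B ^ 2 ≠ 0)
    (hW : W ≠ 0) : (blockForm n A B C W)⁻¹ = blockForm n (C / (A * C - B ^ 2)) (-B / (A * C - B ^ 2))
    (A / (A * C - B ^ 2)) W⁻¹ := by
  refine inv_eq_right_inv ?_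
  have d1 : (Pi.single 0 1 : Fin 4 → ℝ) ⬝ᵥ Pi.single 0 1 = 1 := by simp
  have d2 : (Pi.single 0 1 : Fin 4 → ℝ) ⬝ᵥ n = 0 := by simp [hn0]
  have d3 : n ⬝ᵥ (Pi.single 0 1 : Fin 4 → ℝ) = 0 := by simp [hn0]
  generalize hD' : A * C - B ^ 2 = D at hD
  simp only [blockForm, mul_add, add_mul, mul_sub, sub_mul, smul_mul_assoc, mul_smul_comm,
    vecMulVec_mul_vecMulVec, d1, d2, d3, hn, smul_add, smul_sub, one_mul, mul_one, zero_smul,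
    one_smul, smul_zero, smul_smul, vecMulVec_zero]
  match_scalars <;> field_simp <;> (try rw [← hD']) <;> ring

lemma blockForm_apply (n : Fin 4 → ℝ) (A B C W : ℝ) (α β : Fin 4) : blockForm n A B C W α β = A * (kron α 0 *
    kron β 0) + B * (kron α 0 * n β + n α * kron β 0) + C * (n α * n β) + W * (kron α β - kron α 0 *
    kron β 0 - n α * n β) := by
  have h : ∀ γ : Fin 4, (Pi.single 0 1 : Fin 4 → ℝ) γ = kron γ 0 := fun γ => by simp [Pi.single_apply, kron]
  simp [blockForm, vecMulVec_apply, h, Matrix.one_apply, kron]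
  split_ifs <;> ring

lemma det_blockForm {n : Fin 4 → ℝ} (hn0 : n 0 = 0) (hn : n ⬝ᵥ n = 1) (A B C W : ℝ) :
    (blockForm n A B C W).det = (A * C - B ^ 2) * W ^ 2 := by
  have hn' : n 1 ^ 2 + n 2 ^ 2 + n 3 ^ 2 = 1 := by rw [← hn]; simp [dotProduct, sum_univ_four, hn0]; ring
  rw [show blockForm n A B C W = Matrix.of fun α β => A * (kron α 0 * kron β 0)
      + B * (kron α 0 * n β + n α * kron β 0) + C * (n α * n β)
      + W * (kron α β - kron α 0 * kron β 0 - n α * n β) from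
    Matrix.ext fun α β => blockForm_apply n A B C W α β]
  simp [Matrix.det_succ_row_zero, sum_univ_succ, kron, hn0, Fin.succAbove]
  linear_combination ((A * (C - W) - B ^ 2) * W ^ 2) * hn'

lemma normal_dot (hp : p.2 ≠ 0) : (fun α => normal α p) ⬝ᵥ (fun α => normal α p) = 1 := by
  rw [dotProduct, sum_univ_succ, normal_sq hp]
  simp [normal]

lemma modelMetric_eq (htt htr hrr hww : ℝ → ℝ) (p : Spacetime) : modelMetric htt htr hrr hww p =
    blockForm (fun α => normal α p) (-1 + htt ‖p.2‖) (htr ‖p.2‖ / 2) (1 + hrr ‖p.2‖) (1 + hww ‖p.2‖) := by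
  ext α β
  have hm : mink α β = kron α β - 2 * (kron α 0 * kron β 0) := by
    fin_cases α <;> fin_cases β <;> simp [mink, kron, Matrix.diagonal_apply] <;> norm_num
  rw [blockForm_apply, modelMetric, Matrix.add_apply, hm]
  simp only [longRange, Matrix.of_apply]
  ring

lemma compAB_star (F : Cov 2) (p : Spacetime) (X : Fin 4 → Fin 4 → ℝ) (h : ∀ α β, F ![α, β] p = (1 / 2) * ∑ γ,
    ∑ δ, eps ![α, β, γ, δ] * X γ δ) : compAB F p = (1 / 2) * ∑ δ, normal δ p * (X 0 δ - X δ 0) := by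
  simp only [compAB, h, areaForm, eps_eq, sum_univ_four, show normal 0 p = 0 from rfl]
  simp [epsZ]
  ring

lemma compAB_hodge_model {htt htr hrr hww : ℝ → ℝ} (hp : p.2 ≠ 0) (hD : (-1 + htt ‖p.2‖) * (1 + hrr ‖p.2‖)
    - (htr ‖p.2‖ / 2) ^ 2 ≠ 0) (hW : 1 + hww ‖p.2‖ ≠ 0) (hF : ∀ α β, F ![α, β] p = - F ![β, α] p) :
    compAB (hodge (modelMetric htt htr hrr hww) F) p = radialFactor htt htr hrr hww ‖p.2‖ * compTR F p := by
  have hn0 : normal 0 p = 0 := rfl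
  have hn := normal_dot hp
  set N := (modelMetric htt htr hrr hww p)⁻¹ with hN
  have hN' := hN
  have hdet : (modelMetric htt htr hrr hww p).det =
      ((-1 + htt ‖p.2‖) * (1 + hrr ‖p.2‖) - (htr ‖p.2‖ / 2) ^ 2) * (1 + hww ‖p.2‖) ^ 2 := by
    rw [modelMetric_eq, det_blockForm (n := fun α => normal α p) hn0 hn]
  rw [modelMetric_eq, blockForm_inv (n := fun α => normal α p) hn0 hn hD hW] at hN
  rw [radialFactor, ← hdet]
  set s := √(-(modelMetric htt htr hrr hww p).det) with hs
  set D := (-1 + htt ‖p.2‖) * (1 + hrr ‖p.2‖) - (htr ‖p.2‖ / 2) ^ 2 with hDdef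
  rw [compAB_star _ _ (fun γ δ => s * ∑ μ, ∑ ν, N γ μ * N δ ν * F ![μ, ν] p) fun α β => by
    simp only [hodge, ← hs, ← hN', mul_sum, cons_val_zero, cons_val_one]
    exact sum_congr rfl fun γ _ => sum_congr rfl fun δ _ =>
      sum_congr rfl fun μ _ => sum_congr rfl fun ν _ => by ring]
  simp only [← mul_sub, mul_left_comm _ s, ← mul_sum]
  rw [mul_assoc]
  congr 1
  have hn' : normal 1 p ^ 2 + normal 2 p ^ 2 + normal 3 p ^ 2 = 1 := by
    rw [← hn]; simp [dotProduct, sum_univ_four, hn0]; ring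
  have hNt : ∀ μ, N 0 μ = (1 + hrr ‖p.2‖) / D * kron μ 0 + -(htr ‖p.2‖ / 2) / D * normal μ p := by
    intro μ
    rw [hN, blockForm_apply]
    refine Fin.cases ?_ (fun i => ?_) μ <;> simp [kron, hn0, Fin.succ_ne_zero, (Fin.succ_ne_zero _).symm]
  have hNn : ∀ μ, ∑ δ, normal δ p * N δ μ =
      -(htr ‖p.2‖ / 2) / D * kron μ 0 + (-1 + htt ‖p.2‖) / D * normal μ p := by
    intro μ
    simp only [hN, blockForm_apply, sum_univ_four, hn0]
    set A' := (1 + hrr ‖p.2‖) / D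
    set B' := -(htr ‖p.2‖ / 2) / D
    set C' := (-1 + htt ‖p.2‖) / D
    set W' := (1 + hww ‖p.2‖)⁻¹
    fin_cases μ
    · simp [kron, hn0]; linear_combination B' * hn'
    · simp [kron]; linear_combination ((C' - W') * normal 1 p) * hn'
    · simp [kron]; linear_combination ((C' - W') * normal 2 p) * hn'
    · simp [kron]; linear_combination ((C' - W') * normal 3 p) * hn'
  have hX : ∑ δ, normal δ p * (∑ μ, ∑ ν, N 0 μ * N δ ν * F ![μ, ν] p
      - ∑ μ, ∑ ν, N δ μ * N 0 ν * F ![μ, ν] p) =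
      2 * ∑ μ, ∑ ν, N 0 μ * (∑ δ, normal δ p * N δ ν) * F ![μ, ν] p := by
    have hsw : ∀ δ, ∑ μ, ∑ ν, N δ μ * N 0 ν * F ![μ, ν] p =
        - ∑ μ, ∑ ν, N 0 μ * N δ ν * F ![μ, ν] p := fun δ => by
      rw [sum_comm, ← sum_neg_distrib]
      refine sum_congr rfl fun μ _ => ?_
      rw [← sum_neg_distrib]
      exact sum_congr rfl fun ν _ => by rw [hF ν μ]; ring
    simp only [hsw, sub_neg_eq_add, ← two_mul, mul_sum, sum_mul]
    rw [sum_comm]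
    refine sum_congr rfl fun μ _ => ?_
    rw [sum_comm]
    exact sum_congr rfl fun ν _ => sum_congr rfl fun δ _ => by ring
  rw [hX]
  simp only [hNn, hNt, compTR, sum_univ_four, hn0]
  have z : ∀ α, F ![α, α] p = 0 := fun α => by linarith [hF α α]
  rw [hF 1 0, hF 2 0, hF 3 0, hF 2 1, hF 3 1, hF 3 2, z 0, z 1, z 2, z 3]
  simp only [kron]
  simp
  field_simp
  rw [hDdef]
  ring

end model

/-- The hypotheses on the Hodge star: it is close to that of Minkowski space, and agrees with that of
a spherically symmetric model, for which the angular component of `*F` is a radial multiple of the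
radial component of `F`, up to terms of size `r^{-2}`. -/
structure StarAsymptotics (b : ℝ) (g g0 : Metric4) (α : ℝ → ℝ) : Prop where
  one_le : 1 ≤ b
  near_mink : NearMink b g
  near_model : ∀ a μ ν, SZu b (-2) fun _ p => hodgeCoef (g p) a μ ν - hodgeCoef (g0 p) a μ ν
  factor : SZu b 0 fun _ p => α ‖p.2‖
  factor_inv : SZu b 0 fun _ p => (α ‖p.2‖)⁻¹
  factor_ne : ∀ p ∈ outer b, α ‖p.2‖ ≠ 0
  model : ∀ (F : Cov 2), ∀ p ∈ outer b, (∀ α β, F ![α, β] p = -F ![β, α] p) →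
    compAB (hodge g0 F) p = α ‖p.2‖ * compTR F p

lemma IsBackground.exists_asymptotics {ρ : ℝ → ℝ} (hρ : IsBracket ρ) {R0 : ℝ} {g : Metric4} (hg :
    IsBackground ρ R0 g) : ∃ (b : ℝ) (α : ℝ → ℝ) (g0 : Metric4), R0 ≤ b ∧ (∀ r, b ≤ r → ρ r = r) ∧
    StarAsymptotics b g g0 α := by
  obtain ⟨htt, htr, hrr, hww, gsr, k1, k2, k3, k4, ksr, hgeq⟩ := hg.asymptotically_flat
  obtain ⟨b₁, hb₁⟩ := eventually_atTop.1 hρ.eq_self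
  set b := max (max 1 R0) b₁ with hb
  have hb1 : 1 ≤ b := (le_max_left _ _).trans (le_max_left _ _)
  have hbR : R0 ≤ b := (le_max_right _ _).trans (le_max_left _ _)
  have hbρ : ∀ r, b ≤ r → ρ r = r := fun r hr => hb₁ r ((le_max_right _ _).trans hr)
  have s1 := k1.SZu hbR hbρ
  have s2 := k2.SZu hbR hbρ
  have s3 := k3.SZu hbR hbρ
  have s4 := k4.SZu hbR hbρ
  have hCS := coefClass_sym hb1
  set g0 := modelMetric htt htr hrr hww with hg0
  have hlr := longRange_sym hb1 s1 s2 s3 s4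
  have hgs : ∀ α β, SmoothOuter b fun p => g p α β := fun α β p hp =>
    hg.smooth α β p ⟨hp.1, hbR.trans hp.2.le⟩
  have hsr : ∀ α β, SZu b (-2) fun _ p => gsr p α β := fun α β => (ksr α β).SZu hbR hbρ
  have hge : ∀ p ∈ outer b, g p = mink + gsr p + longRange htt htr hrr hww p := fun p hp =>
    hgeq p ⟨hp.1, hbR.trans hp.2.le⟩ (outer_ne_zero hb1 hp)
  have hg0S : ∀ α β, Sym b 0 fun _ p => g0 p α β := fun α β =>
    (Sym.const (mink α β)).add ((hlr α β).mono hb1 (by norm_num))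
  have hsrS : ∀ α β, Sym b (-1) fun _ p => gsr p α β := fun α β => Sym.of_SZu hb1 (by simpa using hsr α β)
  have hgdiff : ∀ α β, Sym b (-1) fun _ p => g p α β - mink α β := fun α β => by
    refine ((hsrS α β).add (hlr α β)).congr (fun _ => (hgs α β).sub (SmoothOuter.const _)) fun _ p hp => ?_
    simp only [hge p hp, Matrix.add_apply]; ring
  have hgS : ∀ α β, Sym b 0 fun _ p => g p α β := fun α β => by
    have := (Sym.const (b := b) (mink α β)).add ((hgdiff α β).mono hb1 (by norm_num : (-1 : ℤ) ≤ 0))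
    simpa using this
  have c1 : ∀ α β, Cong (fun f => Sym b 0 fun _ => f) (fun f => Sym b (-1) fun _ => f)
      (fun p => g p α β) fun p => (fun _ => mink) p α β := fun α β =>
    ⟨hgS α β, Sym.const _, hgdiff α β⟩
  have c2 : ∀ α β, Cong (fun f => Sym b 0 fun _ => f) (fun f => Sym b (-1) fun _ => f)
      (fun p => g0 p α β) fun p => (fun _ => mink) p α β := fun α β =>
    ⟨hg0S α β, Sym.const _, by simpa [hg0, modelMetric] using hlr α β⟩
  have c3 : ∀ α β, Cong (fun f => SZu b 0 fun _ => f) (fun f => SZu b (-2) fun _ => f)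
      (fun p => g p α β) fun p => g0 p α β := fun α β =>
    ⟨(hgS α β).1, (hg0S α β).1, (hsr α β).congr (fun _ => (hgs α β).sub ((hg0S α β).1.1 0))
      fun _ p hp => by simp only [hge p hp, hg0, modelMetric, Matrix.add_apply]; ring⟩
  have d1 : NearConst b (fun p => (g p).det) (-1) := by simpa only [det_mink] using Cong.det hCS c1
  have d2 : NearConst b (fun p => (g0 p).det) (-1) := by simpa only [det_mink] using Cong.det hCS c2
  have near : ∀ {φ : ℝ → ℝ}, (SZu b (-1) fun _ p => φ ‖p.2‖) → NearConst b (fun p => φ ‖p.2‖) 0 :=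
    fun h => ⟨(Sym_radial hb1 h).mono hb1 (by norm_num), Sym.const 0, by simpa using Sym_radial hb1 h⟩
  have eC : NearConst b (fun p => 1 + hrr ‖p.2‖) 1 := by simpa using Cong.add hCS (Cong.const hCS 1) (near s3)
  have eW : NearConst b (fun p => 1 + hww ‖p.2‖) 1 := by simpa using Cong.add hCS (Cong.const hCS 1) (near s4)
  have eA : NearConst b (fun p => -1 + htt ‖p.2‖) (-1) := by
    simpa using Cong.add hCS (Cong.const hCS (-1)) (near s1)
  have eB : NearConst b (fun p => htr ‖p.2‖ * (1 / 2)) 0 := by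
    simpa using Cong.mul hCS (near s2) (Cong.const hCS (1 / 2))
  have eD : NearConst b (fun p => (-1 + htt ‖p.2‖) * (1 + hrr ‖p.2‖) - (htr ‖p.2‖ / 2) ^ 2) (-1) := by
    have := Cong.add hCS (Cong.mul hCS eA eC) (Cong.const_mul hCS (-1) (Cong.mul hCS eB eB))
    convert this using 1
    · funext p; ring
    · norm_num
  have eU : NearConst b (fun p => -(((-1 + htt ‖p.2‖) * (1 + hrr ‖p.2‖) - (htr ‖p.2‖ / 2) ^ 2) *
      (1 + hww ‖p.2‖) ^ 2)) 1 := by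
    have := Cong.const_mul hCS (-1) (Cong.mul hCS eD (Cong.mul hCS eW eW))
    convert this using 1
    · funext p; ring
    · norm_num
  obtain ⟨b', r1, r2, r3, r4, r5, lb⟩ := ((d1.range (by norm_num)).and ((d2.range (by norm_num)).and
    ((eD.range (by norm_num)).and ((eU.range (by norm_num)).and ((eW.range (by norm_num)).and
    (eventually_ge_atTop b)))))).exists
  have hb' := hb1.trans lb
  have hS := coefClass_sym hb'
  have hZ := coefClass_SZu hb' (-2)
  have uU := Cong.class_sqrt hZ (eU.1.restrict lb).1 r4
  refine ⟨b', radialFactor htt htr hrr hww, g0, hbR.trans lb, fun r hr => hbρ r (lb.trans hr), hb',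
    fun a μ ν => ?_, fun a μ ν => ?_, ?_, ?_, fun p hp => ?_, fun F p hp hF => ?_⟩
  · exact (Cong.hodgeCoef hS (M' := fun _ => mink)
      (fun i j => ⟨(c1 i j).1.restrict lb, (c1 i j).2.1.restrict lb, (c1 i j).2.2.restrict lb⟩)
      r1 (fun p _ => by rw [det_mink]; norm_num) a μ ν).2.2
  · exact (Cong.hodgeCoef hZ
      (fun i j => ⟨(c3 i j).1.restrict lb, (c3 i j).2.1.restrict lb, (c3 i j).2.2.restrict lb⟩)
      r1 r2 a μ ν).2.2
  · exact hZ.mul _ _ uU (Cong.class_inv hZ (by norm_num) (eD.1.restrict lb).1 r3)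
  · simp only [radialFactor, mul_inv, inv_inv]
    exact hZ.mul _ _ (Cong.class_inv hZ (by norm_num) uU r4.sqrt) (eD.1.restrict lb).1
  · exact mul_ne_zero (r4.sqrt.ne_zero hp) (inv_ne_zero (r3.ne_zero hp))
  · exact compAB_hodge_model (outer_ne_zero hb' hp) (r3.ne_zero hp) (r5.ne_zero hp) hF

lemma lie_add (hT : SmoothCov b T) (hT' : SmoothCov b T') (X : ZField) (a : Fin k → Fin 4) :
    EqOn (lie X.field (fun a p => T a p + T' a p) a) (fun p => lie X.field T a p + lie X.field T' a p)
    (outer b) := by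
  intro p hp
  simp only [lie_eq, add_mul, sum_add_distrib]
  rw [act_add X.field ((hT a).diff hp) ((hT' a).diff hp)]
  ring

lemma SmoothCov.add (hT : SmoothCov b T) (hT' : SmoothCov b T') :
    SmoothCov b (fun a p => T a p + T' a p) := fun a => (hT a).add (hT' a)

lemma foldr_lie_add {ι : Type*} (X : ι → ZField) (l : List ι) {W : Cov k} (hT : SmoothCov b T) (hT' :
    SmoothCov b T') (hW : SmoothCov b W) (h : ∀ a, EqOn (W a) (fun p => T a p + T' a p) (outer b)) :
    SmoothCov b (l.foldr (fun i W => lie (X i).field W) T) ∧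
    SmoothCov b (l.foldr (fun i W => lie (X i).field W) T') ∧
    SmoothCov b (l.foldr (fun i W => lie (X i).field W) W) ∧ ∀ a, EqOn (l.foldr (fun i W => lie (X i).field W)
    W a) (fun p => l.foldr (fun i W => lie (X i).field W) T a p + l.foldr (fun i W => lie (X i).field W)
    T' a p) (outer b) := by
  induction l with
  | nil => exact ⟨hT, hT', hW, h⟩
  | cons i l ih =>
    obtain ⟨h1, h2, h3, h4⟩ := ih
    refine ⟨h1.lie _, h2.lie _, h3.lie _, fun a p hp => ?_⟩
    simp only [List.foldr_cons]
    rw [lie_congr_outer h3 (h1.add h2) h4 (X i) a hp, lie_add h1 h2 (X i) a hp]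

lemma iterate_eq_foldr {α : Type*} (f : α → α) (n : ℕ) (x : α) : f^[n] x =
    (List.replicate n ()).foldr (fun _ y => f y) x := by
  induction n with
  | zero => rfl
  | succ n ih => rw [iterate_succ_apply', ih]; rfl

lemma lieIter_add {W : Cov k} (hT : SmoothCov b T) (hT' : SmoothCov b T') (hW : SmoothCov b W) (h : ∀ a,
    EqOn (W a) (fun p => T a p + T' a p) (outer b)) (Λ : MultiIndex) (a : Fin k → Fin 4) :
    EqOn (lieIter Λ W a) (fun p => lieIter Λ T a p + lieIter Λ T' a p) (outer b) := by
  obtain ⟨i, j, n⟩ := Λ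
  have h1 := foldr_lie_add (fun _ : Unit => ZField.scal) (List.replicate n ()) hT hT' hW h
  have h2 := foldr_lie_add ZField.rot j h1.1 h1.2.1 h1.2.2.1 h1.2.2.2
  have h3 := foldr_lie_add ZField.trans i h2.1 h2.2.1 h2.2.2.1 h2.2.2.2
  have := h3.2.2.2 a
  simp only [lieIter, iterate_eq_foldr]
  exact this

/-! ## The exterior estimate for 2-forms -/

/-- The difference of the Hodge stars of `g` and of Minkowski space. -/
def starDiff (g : Metric4) (F : Cov 2) : Cov 2 := fun a p =>
  ∑ μ, ∑ ν, (hodgeCoef (g p) a μ ν - hodgeCoef mink a μ ν) * F ![μ, ν] p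

lemma hodge_eq_add (g : Metric4) (F : Cov 2) (a : Fin 2 → Fin 4) (p : Spacetime) : hodge g F a p =
    flatStar F a p + starDiff g F a p := by
  rw [← hodge_mink, hodge_eq, hodge_eq, starDiff]
  simp only [← sum_add_distrib]
  exact sum_congr rfl fun μ _ => sum_congr rfl fun ν _ => by ring

section

variable {g : Metric4}

lemma comb_starDiff (hc : NearMink b g)
    (a : Fin 2 → Fin 4) : Comb (k := 2) (Sym b (-1))
    (· = ⟨[], [], 0⟩) (fun _ T p => starDiff g T a p) :=
  Comb.sum _ fun μ _ => Comb.sum _ fun ν _ => Comb.single (Λ := ⟨[], [], 0⟩) ![μ, ν] (hc a μ ν) rfl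

lemma smooth_starDiff (hc : NearMink b g) (hF : SmoothCov b F) : SmoothCov b (starDiff g F) := fun a =>
  SmoothOuter.sum fun μ _ => SmoothOuter.sum fun ν _ => ((hc a μ ν).1.1 0).mul (hF _)

lemma smooth_hodge (hc : NearMink b g) (hF : SmoothCov b F) : SmoothCov b (hodge g F) := fun a => by
  have := (smooth_flatStar hF a).add (smooth_starDiff hc hF a)
  exact (funext fun p => hodge_eq_add g F a p : hodge g F a = _) ▸ this

lemma antiOuter_hodge : AntiOuter b (hodge g F) := by
  intro α β p _
  have hZ : ∀ a b c d : Fin 4, epsZ a b c d = -epsZ b a c d := by decide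
  have hε : ∀ γ δ, eps ![α, β, γ, δ] = - eps ![β, α, γ, δ] := fun γ δ => by
    rw [eps_eq, eps_eq, hZ]; push_cast; ring
  simp only [hodge, cons_val_zero, cons_val_one, hε, neg_mul, sum_neg_distrib, mul_neg]

lemma absGrad_starDiff (hc : NearMink b g) (hb : 1 ≤ b) (m : ℕ) : ∃ C : ℝ, 0 ≤ C ∧ ∀ (Λ : Idx m) (F : Cov 2),
    SmoothCov b F → ∀ p ∈ outer b, ∀ a (i : Fin 3), |pd i.succ (lieIter Λ.1 (starDiff g F) a) p| ≤ C *
    (‖p.2‖⁻¹ * absGradSum m F p + ‖p.2‖⁻¹ * ‖p.2‖⁻¹ * absSum m F p) := by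
  choose Φ hΦ hΦe using fun Λ : Idx m => Comb.lieIter (coeffClass_Sym hb (-1)) (comb_starDiff hc) Λ.1
  choose C hC0 hC using fun (Λ : Idx m) a => Comb.abs_pd_le hb (fun Λ' h => h.trans Λ.2) (hΦ Λ a)
  refine ⟨∑ Λ, ∑ a, C Λ a, sum_nonneg fun Λ _ => sum_nonneg fun a _ => hC0 Λ a, fun Λ F hF p hp a i => ?_⟩
  have hs := smooth_starDiff hc hF
  have hE := hΦe Λ 0 F (starDiff g F) hF hs (fun a p _ => rfl) a
  rw [pd_congr_outer (hs.lieIter Λ.1 a) ((hΦ Λ a).smooth (coeffClass_Sym hb (-1)) 0 hF) hE _ hp]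
  have := hC Λ a 0 F hF p hp i
  have e2 : ‖p.2‖ ^ (-1 - 1 : ℤ) = ‖p.2‖⁻¹ * ‖p.2‖⁻¹ := by
    rw [show (-1 - 1 : ℤ) = -1 + -1 by norm_num, zpow_add₀ (norm_ne_zero_iff.2 (outer_ne_zero hb hp)),
      zpow_neg_one]
  rw [zpow_neg_one, e2] at this
  refine this.trans (mul_le_right ?_ ?_)
  · exact (le_sum_univ (hC0 Λ) a).trans (le_sum_univ (u := fun Λ => ∑ a, C Λ a)
      (fun Λ => sum_nonneg fun a _ => hC0 Λ a) Λ)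
  · have := absSum_nonneg m F p
    have := absGradSum_nonneg m F p
    positivity

end

lemma extD0_add {F' : Cov 2} (hF : SmoothCov b F) (hF' : SmoothCov b F') (a : Fin 3 → Fin 4) (hp :
    p ∈ outer b) : extD0 (fun c q => F c q + F' c q) a p = extD0 F a p + extD0 F' a p := by
  have hd : ∀ c, DifferentiableAt ℝ (F c) p := fun c => (hF c).diff hp
  have hd' : ∀ c, DifferentiableAt ℝ (F' c) p := fun c => (hF' c).diff hp
  simp only [extD0_eq]
  rw [sp_add (hd _) (hd' _), sp_add (hd _) (hd' _), sp_add (hd _) (hd' _)]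
  ring

lemma extD0_congr_outer {F' : Cov 2} (hF : SmoothCov b F) (hF' : SmoothCov b F')
    (h : ∀ a, EqOn (F a) (F' a) (outer b)) (a : Fin 3 → Fin 4) :
    EqOn (extD0 F a) (extD0 F' a) (outer b) := fun p hp => by
  simp only [extD0_eq]
  rw [sp_congr_outer (hF _) (hF' _) (h _) _ hp, sp_congr_outer (hF _) (hF' _) (h _) _ hp,
    sp_congr_outer (hF _) (hF' _) (h _) _ hp]

lemma abs_sp_le {C : ℝ} (hC : 0 ≤ C) (h : ∀ i : Fin 3, |pd i.succ f p| ≤ C) (α : Fin 4) : |sp α f p| ≤ C := by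
  refine Fin.cases ?_ (fun i => ?_) α
  · rw [sp_zero]; simpa using hC
  · rw [sp_succ]; exact h i

lemma sum_abs_lieIter_le (T : Cov k) (p : Spacetime) (Λ : Idx m) : ∑ a, |lieIter Λ.1 T a p| ≤ absSum m T p :=
  le_sum_univ (u := fun Λ : Idx m => ∑ a, |lieIter Λ.1 T a p|) (fun _ => sum_nonneg fun _ _ => abs_nonneg _) Λ

/-- The size of the sources on a slice. -/
def sourceSum (m : ℕ) (g : Metric4) (F : Cov 2) (p : Spacetime) : ℝ :=
  absSum m (extD0 F) p + absSum m (extD0 (hodge g F)) p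

lemma emSystem_divCurl (hb : 1 ≤ b) {g : Metric4} (hc : NearMink b g) (m : ℕ) : ∃ K : ℝ, 0 ≤ K ∧ ∀ (F : Cov 2)
    (τ : ℝ) (x : Space), SmoothCov b F → AntiOuter b F → (τ, x) ∈ outer b → ∀ i,
    divCurlSq (fun j k => sd k (emSystem m τ F i j) x) ≤ K * (sourceSum m g F (τ, x) ^ 2 + (‖x‖⁻¹) ^ 2 *
    gradSq (emSystem m τ F) x + (‖x‖⁻¹ * ‖x‖⁻¹) ^ 2 * fieldSq (emSystem m τ F) x) := by
  obtain ⟨C, hC, hstar⟩ := absGrad_starDiff hc hb m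
  obtain ⟨N, hN, hcomp⟩ := absSum_le_fieldSq m
  set M : ℝ := ∑ _ : Fin 3 → Fin 4, 3 * C * N with hM
  have hM0 : 0 ≤ M := sum_nonneg fun _ _ => by positivity
  refine ⟨12 * (1 + M ^ 2), by positivity, fun F τ x hF hA hx i => ?_⟩
  obtain ⟨Λ, e⟩ := i
  have hFΛ := hF.lieIter Λ.1
  have hst := smooth_starDiff hc hF
  have hho := smooth_hodge hc hF
  have hfl := smooth_flatStar hF
  have hx0 : 0 ≤ ‖x‖⁻¹ := by positivity
  set u := ‖x‖⁻¹ * √(gradSq (emSystem m τ F) x) with hu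
  set w := ‖x‖⁻¹ * ‖x‖⁻¹ * √(fieldSq (emSystem m τ F) x) with hw
  have hu0 : 0 ≤ u := by positivity
  have hw0 : 0 ≤ w := by positivity
  have hpd : ∀ a (i : Fin 3), |pd i.succ (lieIter Λ.1 (starDiff g F) a) (τ, x)| ≤ C * N * (u + w) := by
    intro a i
    refine (hstar Λ F hF _ hx a i).trans ?_
    obtain ⟨h1, h2⟩ := hcomp b F hF hA τ x hx
    rw [mul_assoc C N]
    refine mul_le_left ?_ hC
    have a1 := mul_le_left h2 hx0
    have a2 := mul_le_left h1 (mul_nonneg hx0 hx0)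
    rw [hu, hw]
    simp only at a1 a2 ⊢
    linarith
  have hE : ∀ a, |extD0 (lieIter Λ.1 (starDiff g F)) a (τ, x)| ≤ 3 * C * N * (u + w) := by
    intro a
    rw [extD0_eq]
    have h0 : 0 ≤ C * N * (u + w) := by positivity
    have s := fun α c => abs_sp_le h0 (hpd c) α
    refine (abs_add_three _ _ _).trans ((add_le_add (add_le_add (s _ _) (s _ _)) (s _ _)).trans_eq ?_)
    ring
  have hsplit : ∀ a, extD0 (flatStar (lieIter Λ.1 F)) a (τ, x) =
      lieIter Λ.1 (extD0 (hodge g F)) a (τ, x) - extD0 (lieIter Λ.1 (starDiff g F)) a (τ, x) := by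
    intro a
    have e1 := lieIter_add hfl hst hho (fun a p _ => hodge_eq_add g F a p) Λ.1
    have e2 := extD0_congr_outer (hho.lieIter Λ.1) ((hfl.lieIter Λ.1).add (hst.lieIter Λ.1)) e1 a hx
    rw [extD0_add (hfl.lieIter Λ.1) (hst.lieIter Λ.1) a hx] at e2
    have e3 := extD0_congr_outer (smooth_flatStar hFΛ) (hfl.lieIter Λ.1) (flatStar_lieIter hF Λ.1) a hx
    rw [e3, ← extD0_lieIter hho Λ.1 a hx, e2]
    ring
  have hQ1 : ∑ a, |extD0 (lieIter Λ.1 F) a (τ, x)| ≤ absSum m (extD0 F) (τ, x) := by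
    refine le_trans (le_of_eq ?_) (sum_abs_lieIter_le (extD0 F) (τ, x) Λ)
    exact sum_congr rfl fun a _ => by rw [extD0_lieIter hF Λ.1 a hx]
  have hQ2 : ∑ a, |extD0 (flatStar (lieIter Λ.1 F)) a (τ, x)| ≤
      absSum m (extD0 (hodge g F)) (τ, x) + M * (u + w) := by
    calc _ ≤ ∑ a, (|lieIter Λ.1 (extD0 (hodge g F)) a (τ, x)| + 3 * C * N * (u + w)) :=
          sum_le_sum fun a _ => by
            rw [hsplit]
            exact (abs_sub _ _).trans (add_le_add le_rfl (hE a))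
      _ = ∑ a, |lieIter Λ.1 (extD0 (hodge g F)) a (τ, x)| + M * (u + w) := by
          rw [sum_add_distrib, hM, sum_mul]
      _ ≤ _ := add_le_add (sum_abs_lieIter_le _ _ Λ) le_rfl
  refine (emField_divCurl hFΛ (hA.lieIter hF Λ.1) hx e).trans ?_
  have hn1 : 0 ≤ ∑ a, |extD0 (lieIter Λ.1 F) a (τ, x)| := sum_nonneg fun _ _ => abs_nonneg _
  have hn2 : 0 ≤ ∑ a, |extD0 (flatStar (lieIter Λ.1 F)) a (τ, x)| := sum_nonneg fun _ _ => abs_nonneg _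
  have hle : ∑ a, |extD0 (lieIter Λ.1 F) a (τ, x)| +
      ∑ a, |extD0 (flatStar (lieIter Λ.1 F)) a (τ, x)| ≤ sourceSum m g F (τ, x) + M * u + M * w := by
    unfold sourceSum; linarith
  have hsq := pow_le_pow_left₀ (add_nonneg hn1 hn2) hle 2
  have eu : u ^ 2 = (‖x‖⁻¹) ^ 2 * gradSq (emSystem m τ F) x := by
    rw [hu, mul_pow, sq_sqrt (gradSq_nonneg _ _)]
  have ew : w ^ 2 = (‖x‖⁻¹ * ‖x‖⁻¹) ^ 2 * fieldSq (emSystem m τ F) x := by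
    rw [hw, mul_pow, sq_sqrt (fieldSq_nonneg _ _)]
  rw [← eu, ← ew]
  set q := sourceSum m g F (τ, x)
  have h3 := sq_sum_three_le q (M * u) (M * w)
  have : 0 ≤ M ^ 2 * q ^ 2 := by positivity
  nlinarith [sq_nonneg u, sq_nonneg w]

lemma continuousOn_absSum (hT : SmoothCov b T) (m : ℕ) (ht : 0 ≤ τ) : ContinuousOn (fun x => absSum m T (τ,
    x)) {x | b < ‖x‖} := by
  unfold absSum
  refine continuousOn_finsetSum _ fun Λ _ => continuousOn_finsetSum _ fun c _ => ?_
  refine (continuousOn_of_forall_continuousAt fun x hx => ?_).abs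
  exact (hT.lieIter Λ.1 c (τ, x) ⟨ht, hx⟩).continuousAt.comp (by fun_prop)

/-- The `L²` norm on a dyadic shell. -/
def shellNorm (n : ℕ) (u : Space → ℝ) : ℝ := √(∫ x in dyadic n, u x ^ 2)

local notation "shell[" m "," t "," n "]" T:max => shellNorm n fun x => absSum m T (t, x)

lemma shellNorm_nonneg (n : ℕ) (u : Space → ℝ) : 0 ≤ shellNorm n u := sqrt_nonneg _

lemma exterior_forms (hb : 1 ≤ b) {g : Metric4} (hc : NearMink b g) (m : ℕ) : ∃ (n1 : ℕ) (C : ℝ), 1 ≤ C ∧ b <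
    2 ^ n1 ∧ ∀ n0 ≥ n1, ∀ (F : Cov 2) (τ : ℝ), 0 ≤ τ → SmoothCov b F → AntiOuter b F →
    DyadicBound C n0 (fun n => √((2 ^ n)⁻¹ * ∫ x in dyadic n, fieldSq (emSystem m τ F) x)) (fun n => √(2 ^ n *
    ∫ x in dyadic n, sourceSum m g F (τ, x) ^ 2)) := by
  obtain ⟨K, hK, hdc⟩ := emSystem_divCurl hb hc m
  obtain ⟨n1, C, hC, hext⟩ := exterior_dyadic (ι := Idx m × Fin 2) K hK
  obtain ⟨n₂, hn₂⟩ := pow_unbounded_of_one_lt b (one_lt_two)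
  refine ⟨max n1 n₂, C, hC, hn₂.trans_le (two_pow_le (le_max_right _ _)),
    fun n0 hn0 F τ ht hF hA => ?_⟩
  have hb0 : b < 2 ^ n0 := hn₂.trans_le (two_pow_le ((le_max_right _ _).trans hn0))
  have hmem : ∀ {x : Space}, 2 ^ n0 ≤ ‖x‖ → (τ, x) ∈ outer b := fun hx => ⟨ht, hb0.trans_le hx⟩
  have hq : ContinuousOn (fun x => sourceSum m g F (τ, x)) {x | 2 ^ n0 ≤ ‖x‖} := by
    refine ContinuousOn.mono (s := {x | b < ‖x‖}) ?_ fun x hx => hb0.trans_le hx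
    exact (continuousOn_absSum (smooth_extD0 hF) m ht).add
      (continuousOn_absSum (smooth_extD0 (smooth_hodge hc hF)) m ht)
  have h := hext n0 ((le_max_left _ _).trans hn0) (emSystem m τ F) (fun x => sourceSum m g F (τ, x))
    (fun i j x hx => contDiffAt_emField (hF.lieIter i.1.1) (hmem hx) i.2 j)
    (fun x _ => add_nonneg (absSum_nonneg _ _ _) (absSum_nonneg _ _ _)) hq
    (fun x hx i => hdc F τ x hF hA (hmem hx) i)
  intro k l hk hl
  have nn : ∀ n, 0 ≤ ∫ x in dyadic n, fieldSq (emSystem m τ F) x :=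
    fun n => integral_nonneg (fieldSq_nonneg _)
  have nq : ∀ n, 0 ≤ ∫ x in dyadic n, sourceSum m g F (τ, x) ^ 2 :=
    fun n => integral_nonneg fun _ => sq_nonneg _
  have sN : ∀ n : ℕ, √((2 ^ n)⁻¹ * ∫ x in dyadic n, fieldSq (emSystem m τ F) x) ^ 2 =
      (2 ^ n)⁻¹ * ∫ x in dyadic n, fieldSq (emSystem m τ F) x := fun n =>
    sq_sqrt (mul_nonneg (by positivity) (nn n))
  have sy : ∀ n : ℕ, √(2 ^ n * ∫ x in dyadic n, sourceSum m g F (τ, x) ^ 2) ^ 2 =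
      2 ^ n * ∫ x in dyadic n, sourceSum m g F (τ, x) ^ 2 := fun n =>
    sq_sqrt (mul_nonneg (by positivity) (nq n))
  have sNy : ∀ n : ℕ, √((2 ^ n)⁻¹ * ∫ x in dyadic n, fieldSq (emSystem m τ F) x) *
      √(2 ^ n * ∫ x in dyadic n, sourceSum m g F (τ, x) ^ 2) =
      √(∫ x in dyadic n, fieldSq (emSystem m τ F) x) *
        √(∫ x in dyadic n, sourceSum m g F (τ, x) ^ 2) := fun n => by
    rw [← sqrt_mul (mul_nonneg (by positivity) (nn n)), ← sqrt_mul (nn n)]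
    congr 1
    field_simp
  simp only [sN, sy, sNy]
  exact h k l hk hl

/-! ## Integrals depending on a parameter -/

section ParametricIntegral

variable {E H F K : Type} [NormedAddCommGroup E] [NormedSpace ℝ E] [NormedAddCommGroup H]
  [NormedSpace ℝ H] [NormedAddCommGroup F] [NormedSpace ℝ F] [TopologicalSpace K] [CompactSpace K]
  [MeasurableSpace K] [BorelSpace K] [SecondCountableTopology K]
  {μ : Measure K} [IsFiniteMeasure μ] {c : K → H}

lemma eventually_forall_of_compact (hc : Continuous c) {P : E × H → Prop} {p₀ : E} (h : ∀ θ, ∀ᶠ q in 𝓝 (p₀,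
    c θ), P q) : ∀ᶠ p in 𝓝 p₀, ∀ θ, P (p, c θ) := by
  have := isCompact_univ.eventually_forall_of_forall_eventually (x₀ := p₀) (K := (Set.univ : Set K))
    (P := fun p θ => P (p, c θ)) fun θ _ => by
      have hcont : Tendsto (fun z : E × K => (z.1, c z.2)) (𝓝 (p₀, θ)) (𝓝 (p₀, c θ)) :=
        (by fun_prop : Continuous fun z : E × K => (z.1, c z.2)).tendsto _
      exact hcont.eventually (h θ)
  simpa using this

lemma continuous_slice (hc : Continuous c) {f : E × H → F} {p : E} (h : ∀ θ, ContinuousAt f (p, c θ)) :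
    Continuous fun θ => f (p, c θ) :=
  continuous_iff_continuousAt.2 fun θ => ContinuousAt.comp (f := fun θ => (p, c θ)) (h θ) (by fun_prop)

lemma integrable_slice (hc : Continuous c) {f : E × H → F} {p : E} (h : ∀ θ, ContinuousAt f (p, c θ)) :
    Integrable (fun θ => f (p, c θ)) μ :=
  (continuous_slice hc h).integrable_of_hasCompactSupport (HasCompactSupport.of_compactSpace _)

/-- The derivative in the first variable. -/
def fderivFst (f : E × H → F) (q : E × H) : E →L[ℝ] F := (fderiv ℝ f q).comp (ContinuousLinearMap.inl ℝ E H)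

lemma continuousAt_fderivFst {f : E × H → F} {q : E × H} (h : ContDiffAt ℝ 1 f q) : ContinuousAt (fderivFst f)
    q :=
  ((h.fderiv_right (m := 0) (by simp)).continuousAt).clm_comp continuousAt_const

lemma hasFDerivAt_slice {f : E × H → F} {p : E} {h : H} (hf : DifferentiableAt ℝ f (p, h)) :
    HasFDerivAt (fun e => f (e, h)) (fderivFst f (p, h)) p :=
  hf.hasFDerivAt.comp p (hasFDerivAt_prodMk_left p h)

lemma hasFDerivAt_integral_of_compact (hc : Continuous c) {f : E × H → F} {p₀ : E} (h : ∀ θ,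
    ContDiffAt ℝ 1 f (p₀, c θ)) : HasFDerivAt (fun p => ∫ θ, f (p, c θ) ∂μ) (∫ θ, fderivFst f (p₀, c θ) ∂μ)
    p₀ := by
  have h1 : ∀ᶠ p in 𝓝 p₀, ∀ θ, ContDiffAt ℝ 1 f (p, c θ) :=
    eventually_forall_of_compact hc fun θ => (h θ).eventually (by simp)
  obtain ⟨M, hM⟩ := (isCompact_univ (X := K)).exists_bound_of_continuousOn
    (continuous_slice hc fun θ => continuousAt_fderivFst (h θ)).continuousOn
  have h2 : ∀ᶠ p in 𝓝 p₀, ∀ θ, ‖fderivFst f (p, c θ)‖ < M + 1 :=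
    eventually_forall_of_compact hc (P := fun q => ‖fderivFst f q‖ < M + 1) fun θ =>
      (continuousAt_fderivFst (h θ)).norm.eventually_lt continuousAt_const
        ((hM θ trivial).trans_lt (lt_add_one M))
  refine hasFDerivAt_integral_of_dominated_of_fderiv_le (𝕜 := ℝ) (h1.and h2)
    (F' := fun p θ => fderivFst f (p, c θ)) (bound := fun _ => M + 1) ?_
    (integrable_slice hc fun θ => (h θ).continuousAt)
    (integrable_slice hc fun θ => continuousAt_fderivFst (h θ)).aestronglyMeasurable
    (.of_forall fun θ p hp => (hp.2 θ).le) (integrable_const _)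
    (.of_forall fun θ p hp => hasFDerivAt_slice ((hp.1 θ).differentiableAt (by simp)))
  filter_upwards [h1] with p hp
  exact (integrable_slice hc fun θ => (hp θ).continuousAt).aestronglyMeasurable

lemma fderiv_integral_apply (hc : Continuous c) {f : E × H → F} {p₀ : E} (h : ∀ θ, ContDiffAt ℝ 1 f (p₀, c θ))
    (v : E) : fderiv ℝ (fun p => ∫ θ, f (p, c θ) ∂μ) p₀ v = ∫ θ, fderiv ℝ (fun p => f (p, c θ)) p₀ v ∂μ := by
  rw [(hasFDerivAt_integral_of_compact hc h).fderiv, ContinuousLinearMap.integral_apply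
    (integrable_slice hc fun θ => continuousAt_fderivFst (h θ))]
  exact integral_congr_ae (.of_forall fun θ => by
    simp only [(hasFDerivAt_slice ((h θ).differentiableAt (by simp))).fderiv])

end ParametricIntegral

lemma contDiffAt_integral_of_compact {E H K : Type} [NormedAddCommGroup E] [NormedSpace ℝ E]
    [NormedAddCommGroup H] [NormedSpace ℝ H] [TopologicalSpace K] [CompactSpace K] [MeasurableSpace K]
    [BorelSpace K] [SecondCountableTopology K] {μ : Measure K} [IsFiniteMeasure μ] {c : K → H} (hc :
    Continuous c) {p₀ : E} (n : ℕ) : ∀ {F : Type} [NormedAddCommGroup F] [NormedSpace ℝ F] {f : E × H → F},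
    (∀ θ, ContDiffAt ℝ (n + 1 : ℕ) f (p₀, c θ)) → ContDiffAt ℝ n (fun p => ∫ θ, f (p, c θ) ∂μ) p₀ := by
  induction n generalizing p₀ with
  | zero =>
    intro F _ _ f h
    have hcont : ∀ᶠ p in 𝓝 p₀, ∀ θ, ContDiffAt ℝ 1 f (p, c θ) :=
      eventually_forall_of_compact hc fun θ => (h θ).eventually (by simp)
    refine contDiffAt_zero.2 ⟨_, hcont, fun p hp => ContinuousAt.continuousWithinAt ?_⟩
    exact (hasFDerivAt_integral_of_compact hc hp).continuousAt
  | succ n ih =>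
    intro F _ _ f h
    refine contDiffAt_succ_iff_hasFDerivAt.2 ⟨fun p => ∫ θ, fderivFst f (p, c θ) ∂μ, ?_, ?_⟩
    · have h1 : ∀ᶠ p in 𝓝 p₀, ∀ θ, ContDiffAt ℝ 1 f (p, c θ) :=
        eventually_forall_of_compact hc fun θ =>
          ((h θ).of_le (by exact_mod_cast (by lia : 1 ≤ n + 1 + 1))).eventually (by simp)
      exact ⟨_, h1, fun p hp => hasFDerivAt_integral_of_compact hc hp⟩
    · refine ih (f := fderivFst f) fun θ => ?_
      exact ((h θ).fderiv_right (m := (n + 1 : ℕ)) (by norm_cast)).clm_comp contDiffAt_const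

/-! ## Spherical means -/

/-- The normalized measure of the unit sphere. -/
def sphMeasure : Measure S² :=
  ((volume : Measure Space).toSphere Set.univ)⁻¹ • (volume : Measure Space).toSphere

instance : IsProbabilityMeasure sphMeasure := by
  have : NeZero (volume : Measure Space).toSphere := ⟨Measure.toSphere_ne_zero _⟩
  exact isProbabilityMeasureSMul

lemma sphMean_eq (ψ : Scalar) (p : Spacetime) :
    sphMean ψ p = ∫ θ : S², ψ (p.1, ‖p.2‖ • (θ : Space)) ∂sphMeasure := rfl

lemma norm_smul_sphere (r : ℝ) (hr : 0 ≤ r) (θ : S²) : ‖r • (θ : Space)‖ = r := by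
  rw [norm_smul, norm_eq_of_mem_sphere θ, mul_one, norm_of_nonneg hr]

lemma sphere_mem_outer (hp : p ∈ outer b) (θ : S²) : (p.1, ‖p.2‖ • (θ : Space)) ∈ outer b :=
  ⟨hp.1, by rw [mem_ofPred_eq, norm_smul_sphere _ (norm_nonneg _)]; exact hp.2⟩

/-- The derivative along `∂_r`. -/
def radialDeriv (f : Scalar) : Scalar := fun p => ∑ j : Fin 3, normal j.succ p * pd j.succ f p

lemma SmoothOuter.radialDeriv (hb : 1 ≤ b) (hf : SmoothOuter b f) : SmoothOuter b (radialDeriv f) :=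
  SmoothOuter.sum fun j _ => ((HomDeg.normal j.succ).smoothOuter hb).mul (hf.pd _)

section

variable {ψ φ : Scalar}

/-- The function whose integral over the sphere is the spherical mean. -/
def onSphere (ψ : Scalar) (q : Spacetime × Space) : ℝ := ψ (q.1.1, ‖q.1.2‖ • q.2)

lemma contDiffAt_onSphere (hb : 1 ≤ b) (hψ : SmoothOuter b ψ) (hp : p ∈ outer b) (θ : S²) :
    ContDiffAt ℝ ∞ (onSphere ψ) (p, (θ : Space)) := by
  have h := hψ _ (sphere_mem_outer hp θ)
  have hn : ContDiffAt ℝ ∞ (fun q : Spacetime × Space => ‖q.1.2‖) (p, (θ : Space)) :=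
    ContDiffAt.norm ℝ (contDiff_fst.snd.contDiffAt) (outer_ne_zero hb hp)
  exact ContDiffAt.comp (p, (θ : Space)) (g := ψ)
    (f := fun q : Spacetime × Space => (q.1.1, ‖q.1.2‖ • q.2)) h
    ((contDiff_fst.fst.contDiffAt).prodMk (hn.smul contDiff_snd.contDiffAt))

lemma integrable_sphMean (hψ : SmoothOuter b ψ) (hp : p ∈ outer b) : Integrable (fun θ : S² => ψ (p.1,
    ‖p.2‖ • (θ : Space))) sphMeasure :=
  integrable_slice (c := fun θ : S² => ‖p.2‖ • (θ : Space)) (by fun_prop)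
    fun θ => (hψ _ (sphere_mem_outer hp θ)).continuousAt

lemma SmoothOuter.sphMean (hb : 1 ≤ b) (hψ : SmoothOuter b ψ) : SmoothOuter b (sphMean ψ) :=
  fun _ hp => contDiffAt_infty.2 fun n =>
    contDiffAt_integral_of_compact (c := Subtype.val) (f := onSphere ψ) continuous_subtype_val n
      fun θ => (contDiffAt_onSphere hb hψ hp θ).of_le (by exact_mod_cast le_top)

lemma sphMean_congr (h : EqOn φ ψ (outer b)) : EqOn (sphMean φ) (sphMean ψ) (outer b) :=
  fun p hp => by
    rw [sphMean_eq, sphMean_eq]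
    exact integral_congr_ae (.of_forall fun θ => h (sphere_mem_outer hp θ))

lemma sphMean_add (hψ : SmoothOuter b ψ) (hφ : SmoothOuter b φ) (hp : p ∈ outer b) : sphMean (fun q => ψ q +
    φ q) p = sphMean ψ p + sphMean φ p :=
  integral_add (integrable_sphMean hψ hp) (integrable_sphMean hφ hp)

lemma sphMean_sub (hψ : SmoothOuter b ψ) (hφ : SmoothOuter b φ) (hp : p ∈ outer b) :
    sphMean (fun q => ψ q - φ q) p = sphMean ψ p - sphMean φ p :=
  integral_sub (integrable_sphMean hψ hp) (integrable_sphMean hφ hp)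

lemma sphMean_sum {ι : Type*} (s : Finset ι) {ψ : ι → Scalar} (hψ : ∀ i ∈ s, SmoothOuter b (ψ i)) (hp :
    p ∈ outer b) : sphMean (fun q => ∑ i ∈ s, ψ i q) p = ∑ i ∈ s, sphMean (ψ i) p :=
  integral_finsetSum s fun i hi => integrable_sphMean (hψ i hi) hp

lemma sphMean_radial_mul (h : ℝ → ℝ → ℝ) (ψ : Scalar) (p : Spacetime) : sphMean (fun q => h q.1 ‖q.2‖ * ψ q)
    p = h p.1 ‖p.2‖ * sphMean ψ p := by
  rw [sphMean_eq, sphMean_eq, ← integral_const_mul]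
  simp only [norm_smul_sphere _ (norm_nonneg p.2)]

lemma sphMean_congr_norm (ψ : Scalar) {q : Spacetime} (h1 : p.1 = q.1) (h2 : ‖p.2‖ = ‖q.2‖) :
    sphMean ψ p = sphMean ψ q := by rw [sphMean_eq, sphMean_eq, h1, h2]

lemma normal_sphere {r : ℝ} (hr : 0 < r) (t : ℝ) (θ : S²) (i : Fin 3) : normal i.succ (t, r • (θ : Space)) =
    (θ : Space) i := by
  simp only [normal, Fin.cons_succ, norm_smul_sphere r hr.le, PiLp.smul_apply, smul_eq_mul]
  field_simp

lemma fderiv_space (f : Scalar) (p : Spacetime) (v : Space) : fderiv ℝ f p (0, v) = ∑ j : Fin 3, v j *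
    pd j.succ f p := by
  have hv : ((0 : ℝ), v) = ∑ j : Fin 3, v j • basisVec j.succ := by
    simp only [basisVec, Fin.cons_succ]
    refine Prod.ext ?_ ?_
    · simp [Prod.fst_sum]
    · rw [Prod.snd_sum]
      ext k
      simp [sum_univ_three]
      fin_cases k <;> simp
  rw [hv, map_sum]
  simp [pd]

lemma fderiv_self (f : Scalar) (p : Spacetime) : fderiv ℝ f p p = scaling.act f p := by
  have h : p = p.1 • basisVec 0 + ((0 : ℝ), p.2) := by ext <;> simp [basisVec]
  conv_lhs => rw [h]
  rw [map_add, map_smul, ← h, fderiv_space]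
  simp only [VField.act, scaling, sum_univ_succ (n := 3), coord_zero, coord_succ]
  rfl

/-- Euler's identity. -/
lemma HomDeg.scaling_act (hf : HomDeg s f) (hp : p.2 ≠ 0) : scaling.act f p = s * f p := by
  have h1 : HasDerivAt (fun c : ℝ => c • p) p 1 := by simpa using (hasDerivAt_id (1 : ℝ)).smul_const p
  have h2 : HasFDerivAt f (fderiv ℝ f p) ((1 : ℝ) • p) := by
    rw [one_smul]; exact (smooth_diff (hf.1 p hp)).hasFDerivAt
  have h4 : HasDerivAt (fun c : ℝ => c ^ s * f p) (s * f p) 1 := by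
    simpa using (hasDerivAt_zpow s (1 : ℝ) (Or.inl one_ne_zero)).mul_const (f p)
  have h5 : (f ∘ fun c : ℝ => c • p) =ᶠ[𝓝 1] fun c => c ^ s * f p := by
    filter_upwards [lt_mem_nhds (zero_lt_one' ℝ)] with c hc
    exact hf.2 p.1 (c * p.1) p.2 c hc hp
  rw [← fderiv_self]
  exact (h2.comp_hasDerivAt (1 : ℝ) h1).unique (h4.congr_of_eventuallyEq h5)

lemma pd_sphMean (hb : 1 ≤ b) (hψ : SmoothOuter b ψ) (hp : p ∈ outer b) (α : Fin 4) : pd α (sphMean ψ) p =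
    ∫ θ : S², fderiv ℝ ψ (p.1, ‖p.2‖ • (θ : Space)) ((basisVec α).1, fderiv ℝ (fun y : Space => ‖y‖)
    p.2 (basisVec α).2 • (θ : Space)) ∂sphMeasure := by
  refine (fderiv_integral_apply (μ := sphMeasure) (f := onSphere ψ) continuous_subtype_val
    (fun θ => (contDiffAt_onSphere hb hψ hp θ).of_le (by exact_mod_cast le_top)) _).trans
    (integral_congr_ae (.of_forall fun θ => ?_))
  have hn : HasFDerivAt (fun q : Spacetime => ‖q.2‖) _ p := HasFDerivAt.comp p
    ((contDiffAt_norm ℝ (outer_ne_zero hb hp) (n := 1)).differentiableAt (by simp)).hasFDerivAt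
    hasFDerivAt_snd
  have h := ((hψ _ (sphere_mem_outer hp θ)).differentiableAt (by simp)).hasFDerivAt.comp p
    (hasFDerivAt_fst.prodMk (hn.smul_const (θ : Space)))
  change fderiv ℝ (ψ ∘ fun q => (q.1, ‖q.2‖ • (θ : Space))) p _ = _
  rw [h.fderiv]
  simp

lemma pd_zero_sphMean (hb : 1 ≤ b) (hψ : SmoothOuter b ψ) :
    EqOn (pd 0 (sphMean ψ)) (sphMean (pd 0 ψ)) (outer b) := fun p hp => by
  rw [pd_sphMean hb hψ hp, sphMean_eq]
  simp [basisVec, pd]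

lemma pd_succ_sphMean (hb : 1 ≤ b) (hψ : SmoothOuter b ψ) (i : Fin 3) :
    EqOn (pd i.succ (sphMean ψ)) (fun p => normal i.succ p * sphMean (radialDeriv ψ) p)
      (outer b) := fun p hp => by
  have hp0 := outer_ne_zero hb hp
  simp only [pd_sphMean hb hψ hp, sphMean_eq, ← integral_const_mul]
  refine integral_congr_ae (.of_forall fun θ => ?_)
  simp only [basisVec, Fin.cons_succ, show fderiv ℝ (fun y : Space => ‖y‖) p.2 (EuclideanSpace.single i 1) = _ from
      sd_norm hp0 i, fderiv_space, radialDeriv,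
    normal_sphere (norm_pos_iff.2 hp0), mul_sum]
  refine sum_congr rfl fun j _ => ?_
  simp only [PiLp.smul_apply, smul_eq_mul, normal, Fin.cons_succ]
  ring

lemma coord_eq_normal (hp : p.2 ≠ 0) (j : Fin 3) : coord j.succ p = ‖p.2‖ * normal j.succ p := by
  have hn : ‖p.2‖ ≠ 0 := norm_ne_zero_iff.2 hp
  simp only [coord_succ, normal, Fin.cons_succ]
  field_simp

lemma act_scaling_eq (hp : p.2 ≠ 0) : scaling.act f p = p.1 * pd 0 f p + ‖p.2‖ * radialDeriv f p := by
  simp only [VField.act, scaling, sum_univ_succ (n := 3), coord_eq_normal hp, coord_zero,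
    radialDeriv, mul_sum]
  congr 1
  exact sum_congr rfl fun j _ => by ring

lemma radialDeriv_mul (hf : DifferentiableAt ℝ f p) (hg : DifferentiableAt ℝ g p) :
    radialDeriv (fun q => f q * g q) p = radialDeriv f p * g p + f p * radialDeriv g p := by
  simp only [radialDeriv, pd_mul hf hg, sum_univ_three]
  ring

lemma HomDeg.radialDeriv_eq (hf : HomDeg s f) (hp : p.2 ≠ 0) : ‖p.2‖ * radialDeriv f p = s * f p := by
  rw [← hf.scaling_act hp, act_scaling_eq hp, hf.pd_zero hp, mul_zero, zero_add]

lemma radialDeriv_of_pd (hp : p.2 ≠ 0) {c : ℝ} (h : ∀ j : Fin 3, pd j.succ f p = normal j.succ p * c) :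
    radialDeriv f p = c := by
  simp only [radialDeriv, h, ← mul_assoc, ← sum_mul, normal_sq hp, one_mul]

lemma radialDeriv_sphMean (hb : 1 ≤ b) (hψ : SmoothOuter b ψ) : EqOn (radialDeriv (sphMean ψ))
    (sphMean (radialDeriv ψ)) (outer b) := fun _ hp =>
  radialDeriv_of_pd (outer_ne_zero hb hp) fun j => pd_succ_sphMean hb hψ j hp

lemma scaling_sphMean (hb : 1 ≤ b) (hψ : SmoothOuter b ψ) :
    EqOn (scaling.act (sphMean ψ)) (sphMean (scaling.act ψ)) (outer b) := fun p hp => by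
  have h1 : EqOn (scaling.act ψ) (fun p => p.1 * pd 0 ψ p + ‖p.2‖ * radialDeriv ψ p) (outer b) :=
    fun q hq => act_scaling_eq (outer_ne_zero hb hq)
  have hs0 : SmoothOuter b (fun p : Spacetime => p.1 * pd 0 ψ p) := SmoothOuter.mul
    (fun q _ => contDiff_fst.contDiffAt) (hψ.pd 0)
  have hs1 : SmoothOuter b (fun p : Spacetime => ‖p.2‖ * radialDeriv ψ p) := SmoothOuter.mul
    (fun q hq => contDiffAt_norm_snd (outer_ne_zero hb hq)) (hψ.radialDeriv hb)
  rw [act_scaling_eq (outer_ne_zero hb hp), sphMean_congr h1 hp, sphMean_add hs0 hs1 hp,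
    sphMean_radial_mul (fun t _ => t), sphMean_radial_mul (fun _ r => r),
    pd_zero_sphMean hb hψ hp, radialDeriv_sphMean hb hψ hp]

/-- Functions of `t` and `r`, infinitesimally. -/
def RadialOn (b : ℝ) (f : Scalar) : Prop :=
  ∀ i : Fin 3, EqOn (pd i.succ f) (fun p => normal i.succ p * radialDeriv f p) (outer b)

lemma radialOn_sphMean (hb : 1 ≤ b) (hψ : SmoothOuter b ψ) : RadialOn b (sphMean ψ) :=
  fun i p hp => by rw [pd_succ_sphMean hb hψ i hp]; simp only [radialDeriv_sphMean hb hψ hp]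

end

/-! ### Invariance under rotations -/

/-- The rotation by the angle `φ` about the `k`-th axis. -/
def rotLin (k : Fin 3) (φ : ℝ) : Space →ₗ[ℝ] Space where
  toFun x := WithLp.toLp 2 fun i => if i = k then x k else
    if i = k + 1 then cos φ * x (k + 1) - sin φ * x (k + 2)
    else sin φ * x (k + 1) + cos φ * x (k + 2)
  map_add' x y := by ext i; simp only [PiLp.add_apply]; split_ifs <;> ring
  map_smul' c x := by ext i; simp only [PiLp.smul_apply, smul_eq_mul, RingHom.id_apply]; split_ifs <;> ring

lemma rotLin_apply (k : Fin 3) (φ : ℝ) (x : Space) (i : Fin 3) : rotLin k φ x i =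
    if i = k then x k else
    if i = k + 1 then cos φ * x (k + 1) - sin φ * x (k + 2)
    else sin φ * x (k + 1) + cos φ * x (k + 2) := rfl

lemma norm_rotLin (k : Fin 3) (φ : ℝ) (x : Space) : ‖rotLin k φ x‖ = ‖x‖ := by
  refine (sq_eq_sq₀ (norm_nonneg _) (norm_nonneg _)).1 ?_
  rw [EuclideanSpace.norm_sq_eq, EuclideanSpace.norm_sq_eq]
  have := sin_sq_add_cos_sq φ
  simp only [sum_univ_three, norm_eq_abs, sq_abs, rotLin_apply]
  have h : ∀ y z : ℝ, (cos φ * y - sin φ * z) ^ 2 + (sin φ * y + cos φ * z) ^ 2 =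
      y ^ 2 + z ^ 2 := fun y z => by linear_combination (y ^ 2 + z ^ 2) * this
  fin_cases k
  · simp; linarith [h (x 1) (x 2)]
  · simp; linarith [h (x 2) (x 0)]
  · simp; linarith [h (x 0) (x 1)]

/-- The generator of the rotations about the `k`-th axis. -/
def rotGen (k : Fin 3) (x : Space) : Space := WithLp.toLp 2 fun i => if i = k then 0 else
    if i = k + 1 then - x (k + 2) else x (k + 1)

lemma rotLin_eq (k : Fin 3) (φ : ℝ) (x : Space) : rotLin k φ x = EuclideanSpace.single k (x k) +
    cos φ • (x - EuclideanSpace.single k (x k)) + sin φ • rotGen k x := by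
  ext i
  simp only [rotLin_apply, rotGen, PiLp.add_apply, PiLp.smul_apply, PiLp.sub_apply, smul_eq_mul]
  fin_cases k <;> fin_cases i <;> simp <;> ring

/-- The rotation by the angle `φ` about the `k`-th axis, as an isometry. -/
def rotIso (k : Fin 3) (φ : ℝ) : Space ≃ₗᵢ[ℝ] Space :=
  LinearIsometry.toLinearIsometryEquiv ⟨rotLin k φ, norm_rotLin k φ⟩ rfl

/-- The action of a linear isometry on the unit sphere. -/
def sphereEquiv (U : Space ≃ₗᵢ[ℝ] Space) : S² ≃ₜ S² := U.toHomeomorph.subtype fun x => by simp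

lemma sphereEquiv_coe (U : Space ≃ₗᵢ[ℝ] Space) (θ : S²) : (sphereEquiv U θ : Space) = U θ := rfl

lemma measurePreserving_sphereEquiv (U : Space ≃ₗᵢ[ℝ] Space) : MeasurePreserving (sphereEquiv U)
    sphMeasure sphMeasure := by
  refine MeasurePreserving.smul_measure ⟨(sphereEquiv U).continuous.measurable, ?_⟩ _
  ext s hs
  have hm := (sphereEquiv U).continuous.measurable
  rw [Measure.map_apply hm hs, Measure.toSphere_apply' _ hs, Measure.toSphere_apply' _ (hm hs)]
  congr 1
  refine Eq.trans ?_ (U.measurePreserving.measure_preimage_equiv (f := U.toHomeomorph.toMeasurableEquiv) _)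
  congr 1
  ext y
  simp only [Set.mem_smul, Set.mem_image, Set.mem_preimage]
  constructor
  · rintro ⟨r, hr, _, ⟨θ, hθ, rfl⟩, rfl⟩
    exact ⟨r, hr, _, ⟨_, hθ, rfl⟩, by rw [sphereEquiv_coe, ← map_smul]; rfl⟩
  · rintro ⟨r, hr, _, ⟨θ, hθ, rfl⟩, h⟩
    refine ⟨r, hr, _, ⟨(sphereEquiv U).symm θ, by simpa using hθ, rfl⟩, ?_⟩
    apply U.injective
    rw [map_smul, ← sphereEquiv_coe, Homeomorph.apply_symm_apply]
    exact h

lemma integral_sphere_isometry (U : Space ≃ₗᵢ[ℝ] Space) (f : Space → ℝ) : ∫ θ : S², f (U θ) ∂sphMeasure =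
    ∫ θ : S², f θ ∂sphMeasure :=
  (measurePreserving_sphereEquiv U).integral_comp (sphereEquiv U).measurableEmbedding fun θ : S² => f θ

lemma act_rotation (k : Fin 3) (f : Scalar) (q : Spacetime) : (rotation k).act f q = coord (k + 1).succ q *
    pd (k + 2).succ f q - coord (k + 2).succ q * pd (k + 1).succ f q := by
  simp only [VField.act, rotation, kron, sub_mul, sum_sub_distrib]
  simp

lemma sphMean_rotation (hb : 1 ≤ b) {ψ : Scalar} (hψ : SmoothOuter b ψ) (k : Fin 3) :
    EqOn (sphMean ((rotation k).act ψ)) (fun _ => 0) (outer b) := by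
  intro p hp
  set r := ‖p.2‖ with hr
  have hc : ContDiff ℝ ∞ fun q : ℝ × Space => (p.1, r • rotLin k q.1 q.2) := by
    refine contDiff_const.prodMk (ContDiff.const_smul r ?_)
    refine (contDiff_euclidean).2 fun i => ?_
    simp only [rotLin_apply]
    have h1 : ContDiff ℝ ∞ fun q : ℝ × Space => cos q.1 := contDiff_cos.comp contDiff_fst
    have h2 : ContDiff ℝ ∞ fun q : ℝ × Space => sin q.1 := contDiff_sin.comp contDiff_fst
    have h3 : ∀ j : Fin 3, ContDiff ℝ ∞ fun q : ℝ × Space => q.2 j := fun j =>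
      (EuclideanSpace.proj j : Space →L[ℝ] ℝ).contDiff.comp contDiff_snd
    split_ifs
    · exact h3 k
    · exact (h1.mul (h3 _)).sub (h2.mul (h3 _))
    · exact (h2.mul (h3 _)).add (h1.mul (h3 _))
  have h0 : ∀ x, rotLin k 0 x = x := fun x => by rw [rotLin_eq]; simp
  have hf : ∀ θ : S², ContDiffAt ℝ ∞
      (fun q : ℝ × Space => ψ (p.1, r • rotLin k q.1 q.2)) (0, (θ : Space)) := fun θ => by
    refine ContDiffAt.comp (g := ψ) (f := fun q : ℝ × Space => (p.1, r • rotLin k q.1 q.2)) _ ?_ hc.contDiffAt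
    simp only [h0]
    exact hψ _ (sphere_mem_outer hp θ)
  have h := fderiv_integral_apply (μ := sphMeasure) (f := fun q : ℝ × Space =>
    ψ (p.1, r • rotLin k q.1 q.2)) continuous_subtype_val (p₀ := 0)
    (fun θ => (hf θ).of_le (by exact_mod_cast le_top)) 1
  rw [show (fun φ : ℝ => ∫ θ : S², ψ (p.1, r • rotLin k φ (θ : Space))
    ∂sphMeasure) = fun _ => sphMean ψ p from funext fun φ =>
    integral_sphere_isometry (rotIso k φ) fun x => ψ (p.1, r • x), fderiv_fun_const] at h
  refine Eq.trans (integral_congr_ae (.of_forall fun θ => ?_)) h.symm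
  have h4 : HasDerivAt (fun φ : ℝ => (p.1, r • rotLin k φ (θ : Space)))
      ((0 : ℝ), r • rotGen k (θ : Space)) 0 := by
    refine (hasDerivAt_const _ _).prodMk (HasDerivAt.const_smul r ?_)
    simp only [rotLin_eq]
    have := (((hasDerivAt_cos 0).smul_const ((θ : Space) - EuclideanSpace.single k ((θ : Space) k))).const_add
      (EuclideanSpace.single k ((θ : Space) k))).fun_add ((hasDerivAt_sin 0).smul_const (rotGen k (θ : Space)))
    simpa using this
  have h5 : HasFDerivAt ψ (fderiv ℝ ψ (p.1, r • (θ : Space))) (p.1, r • rotLin k 0 (θ : Space)) := by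
    rw [h0]
    exact ((hψ _ (sphere_mem_outer hp θ)).differentiableAt (by simp)).hasFDerivAt
  have h6 := h5.comp_hasDerivAt (0 : ℝ) h4
  change _ = fderiv ℝ (ψ ∘ fun φ : ℝ => (p.1, r • rotLin k φ (θ : Space))) 0 1
  rw [fderiv_apply_one_eq_deriv, h6.deriv, fderiv_space]
  simp only [act_rotation, coord_succ, rotGen, sum_univ_three, PiLp.smul_apply, smul_eq_mul]
  fin_cases k <;> simp <;> ring

/-! ### The transport equation for the charge -/

lemma compAB_eq (h : ∀ α β, W ![α, β] p = - W ![β, α] p) : compAB W p = ∑ j : Fin 3, normal j.succ p *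
    W ![(j + 1).succ, (j + 2).succ] p := by
  simp only [compAB, areaForm, sum_univ_four, eps_eq]
  simp [epsZ, sum_univ_three]
  rw [h 3 2, h 1 3, h 2 1]
  ring

lemma smooth_areaForm (hb : 1 ≤ b) (a : Fin 2 → Fin 4) : SmoothOuter b (areaForm a) :=
  SmoothOuter.sum fun γ _ => ((HomDeg.normal γ).smoothOuter hb).const_mul _

lemma smooth_compAB (hb : 1 ≤ b) (hW : SmoothCov b W) : SmoothOuter b (compAB W) :=
  SmoothOuter.const_mul _ (SmoothOuter.sum fun α _ => SmoothOuter.sum fun β _ =>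
    (smooth_areaForm hb _).mul (hW _))

lemma pd_coord_mul (hf : DifferentiableAt ℝ f p) (α β : Fin 4) : pd α (fun q => coord β q * f q) p =
    kron α β * f p + coord β p * pd α f p := by
  rw [pd_mul ((contDiff_coord β).differentiable (by simp) p) hf, pd_coord]

lemma sum_act_rotation {B : Fin 3 → Scalar} {q : Spacetime} (hB : ∀ j, DifferentiableAt ℝ (B j) q) : ∑ k,
    (rotation k).act (fun q => coord (k + 1).succ q * B (k + 2) q - coord (k + 2).succ q * B (k + 1) q) q =
    ‖q.2‖ ^ 2 * ∑ j, pd j.succ (B j) q - ∑ j, coord j.succ q * B j q - ∑ j : Fin 3, coord j.succ q *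
    pd j.succ (fun q => ∑ j, coord j.succ q * B j q) q := by
  have hd : ∀ (β : Fin 4) j, DifferentiableAt ℝ (fun q => coord β q * B j q) q := fun β j =>
    ((contDiff_coord β).differentiable (by simp) q).mul (hB j)
  have hs := fun α => pd_sum (f := fun (j : Fin 3) q => coord j.succ q * B j q) univ (fun j _ => hd _ j) α
  simp only [hs]
  simp only [act_rotation, pd_sub (hd _ _) (hd _ _), pd_coord_mul (hB _),
    EuclideanSpace.norm_sq_eq, sum_univ_three, norm_eq_abs, sq_abs, ← coord_succ]
  simp [kron]
  ring

lemma radial_transport (hb : 1 ≤ b) (hW : SmoothCov b W) (hA : AntiOuter b W) :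
    EqOn (radialDeriv (sphMean (compAB W))) (fun p => sphMean (extD0 W ![1, 2, 3]) p - 2 * ‖p.2‖⁻¹ *
    sphMean (compAB W) p) (outer b) := by
  have sψ : SmoothOuter b (compAB W) := smooth_compAB hb hW
  have sc : ∀ β, SmoothOuter b (coord β) := fun β _ _ => (contDiff_coord β).contDiffAt
  have sn : SmoothOuter b (fun q : Spacetime => ‖q.2‖) := fun q hq =>
    contDiffAt_norm_snd (outer_ne_zero hb hq)
  set B : Fin 3 → Scalar := fun j => W ![(j + 1).succ, (j + 2).succ] with hB
  set V : Fin 3 → Scalar := fun k q => coord (k + 1).succ q * B (k + 2) q - coord (k + 2).succ q * B (k + 1) q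
  have sV : ∀ k, SmoothOuter b (V k) := fun k => ((sc _).mul (hW _)).sub ((sc _).mul (hW _))
  have sφ : SmoothOuter b fun q => ∑ j : Fin 3, coord j.succ q * B j q :=
    SmoothOuter.sum fun j _ => (sc _).mul (hW _)
  have hφ : EqOn (fun q => ∑ j : Fin 3, coord j.succ q * B j q) (fun q => ‖q.2‖ * compAB W q)
      (outer b) := fun q hq => by
    simp only [compAB_eq fun α β => hA α β hq, coord_eq_normal (outer_ne_zero hb hq), mul_sum, mul_assoc, hB]
  have key : EqOn (fun q => ∑ k, (rotation k).act (V k) q) (fun q => ‖q.2‖ ^ 2 *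
      (extD0 W ![1, 2, 3] q - radialDeriv (compAB W) q) - 2 * ‖q.2‖ * compAB W q) (outer b) := by
    intro q hq
    have hq0 := outer_ne_zero hb hq
    have hr : radialDeriv (fun q => ‖q.2‖) q = 1 := by
      have := (HomDeg.norm_zpow 1).radialDeriv_eq hq0
      simp only [zpow_one, Int.cast_one, one_mul] at this
      exact mul_left_cancel₀ (norm_ne_zero_iff.2 hq0) (this.trans (mul_one _).symm)
    have hD : ∑ j : Fin 3, coord j.succ q * pd j.succ (fun q => ∑ j, coord j.succ q * B j q) q =
        ‖q.2‖ * (compAB W q + ‖q.2‖ * radialDeriv (compAB W) q) := by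
      rw [← one_mul (compAB W q), ← hr, ← radialDeriv_mul (sn.diff hq) (sψ.diff hq), radialDeriv, mul_sum]
      exact sum_congr rfl fun j _ => by
        rw [pd_congr_outer sφ (sn.mul sψ) hφ _ hq, coord_eq_normal hq0, mul_assoc]
    have hE : extD0 W ![1, 2, 3] q = ∑ j, pd j.succ (B j) q := by
      simp [extD0_eq, sum_univ_three, hB, ← sp_succ]
    simp only
    refine (sum_act_rotation (B := B) fun j => (hW _).diff hq).trans ?_
    rw [hD, hE, show ∑ j : Fin 3, coord j.succ q * B j q = _ from hφ hq]
    ring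
  intro p hp
  have hr : ‖p.2‖ ≠ 0 := norm_ne_zero_iff.2 (outer_ne_zero hb hp)
  have e1 : sphMean (fun q => ∑ k, (rotation k).act (V k) q) p = 0 := by
    rw [sphMean_sum (ψ := fun k => (rotation k).act (V k)) _ (fun k _ => (sV k).act (.rot k)) hp]
    exact sum_eq_zero fun k _ => sphMean_rotation hb (sV k) k hp
  have sE := smooth_extD0 hW ![1, 2, 3]
  have sd := sE.sub (sψ.radialDeriv hb)
  rw [sphMean_congr key hp, sphMean_sub ((by simpa only [sq] using (sn.mul sn).mul sd :
      SmoothOuter b fun q => ‖q.2‖ ^ 2 * (extD0 W ![1, 2, 3] q - radialDeriv (compAB W) q)))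
      ((sn.const_mul 2).mul sψ) hp,
    sphMean_radial_mul (fun _ r => r ^ 2), sphMean_radial_mul (fun _ r => 2 * r),
    sphMean_sub sE (sψ.radialDeriv hb) hp, ← radialDeriv_sphMean hb sψ hp] at e1
  field_simp
  refine mul_left_cancel₀ hr ?_
  linear_combination -e1

/-! ## Norms on dyadic shells -/

section ShellNorm

variable {u v : Space → ℝ}

lemma integrableOn_dyadic (hn : b < 2 ^ n) (hu : ContinuousOn u {x | b < ‖x‖}) : IntegrableOn u (dyadic n) :=
  (integrableOn_annulus (hu.mono fun x (hx : 2 ^ n ≤ ‖x‖) => hn.trans_le hx) le_rfl).mono_set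
    (dyadicRange_subset_annulus n _)

lemma sq_shellNorm (n : ℕ) (u : Space → ℝ) : shellNorm n u ^ 2 = ∫ x in dyadic n, u x ^ 2 :=
  sq_sqrt (integral_nonneg fun _ => sq_nonneg _)

lemma shellNorm_mono (hn : b < 2 ^ n) (hv : ContinuousOn v {x | b < ‖x‖}) (h : ∀ x ∈ dyadic n, |u x| ≤ v x) :
    shellNorm n u ≤ shellNorm n v := by
  refine sqrt_le_sqrt ?_
  refine integral_mono_of_nonneg (.of_forall fun _ => sq_nonneg _)
    (integrableOn_dyadic hn (hv.pow 2)) ?_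
  filter_upwards [ae_restrict_mem (measurableSet_dyadicRange _ _)] with x hx
  have := h x hx
  exact sq_le_sq' (by linarith [(abs_le.1 this).1]) (abs_le.1 this).2

lemma shellNorm_const_mul (c : ℝ) (u : Space → ℝ) : shellNorm n (fun x => c * u x) = |c| * shellNorm n u := by
  unfold shellNorm
  simp only [mul_pow, integral_const_mul]
  rw [sqrt_mul (sq_nonneg c), sqrt_sq_eq_abs]

lemma shellNorm_le_mul (hn : b < 2 ^ n) {c : ℝ} (hc : 0 ≤ c) (hv : ContinuousOn v {x | b < ‖x‖}) (h :
    ∀ x ∈ dyadic n, |u x| ≤ c * v x) : shellNorm n u ≤ c * shellNorm n v := by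
  have := shellNorm_mono (v := fun x => c * v x) hn (continuousOn_const.mul hv) h
  rwa [shellNorm_const_mul, abs_of_nonneg hc] at this

lemma shellNorm_abs (u : Space → ℝ) : shellNorm n (fun x => |u x|) = shellNorm n u := by
  simp only [shellNorm, sq_abs]

lemma shellNorm_add_le (hn : b < 2 ^ n) (hu : ContinuousOn u {x | b < ‖x‖}) (hv : ContinuousOn v {x | b <
    ‖x‖}) : shellNorm n (fun x => u x + v x) ≤ shellNorm n u + shellNorm n v := by
  refine sqrt_le_iff.2 ⟨add_nonneg (shellNorm_nonneg _ _) (shellNorm_nonneg _ _), ?_⟩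
  have iu : IntegrableOn (fun x => u x ^ 2) (dyadic n) := integrableOn_dyadic hn (hu.pow 2)
  have iv : IntegrableOn (fun x => v x ^ 2) (dyadic n) := integrableOn_dyadic hn (hv.pow 2)
  have iuv : IntegrableOn (fun x => u x * v x) (dyadic n) := integrableOn_dyadic hn (hu.mul hv)
  have i2 : IntegrableOn (fun x => u x ^ 2 + 2 * (u x * v x)) (dyadic n) := iu.add (iuv.const_mul 2)
  have h1 : ∫ x in dyadic n, (u x + v x) ^ 2 =
      (∫ x in dyadic n, u x ^ 2) + 2 * (∫ x in dyadic n, u x * v x) + ∫ x in dyadic n, v x ^ 2 := by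
    rw [← integral_const_mul, ← integral_add iu (iuv.const_mul 2), ← integral_add i2 iv]
    exact integral_congr_ae (.of_forall fun x => by ring)
  have h2 := integral_mul_le_sqrt iu iv iuv
  rw [h1, add_sq, sq_shellNorm, sq_shellNorm]
  have : ∫ x in dyadic n, u x * v x ≤ shellNorm n u * shellNorm n v := h2
  linarith

lemma shellNorm_zero : shellNorm n 0 = 0 := by simp [shellNorm]

lemma shellNorm_sum_le {ι : Type*} (s : Finset ι) {u : ι → Space → ℝ} (hn : b < 2 ^ n) (hu : ∀ i ∈ s,
    ContinuousOn (u i) {x | b < ‖x‖}) : shellNorm n (fun x => ∑ i ∈ s, u i x) ≤ ∑ i ∈ s,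
    shellNorm n (u i) := by
  simpa only [sum_fn] using le_sum_of_subadditive_on_pred (shellNorm n) (ContinuousOn · {x | b < ‖x‖})
    shellNorm_zero.le (fun _ _ => shellNorm_add_le hn) (fun _ _ => ContinuousOn.add) u hu

end ShellNorm

/-! ## Polar coordinates -/

lemma SmoothOuter.continuousOn (hf : SmoothOuter b f) (ht : 0 ≤ τ) : ContinuousOn (fun x => f (τ, x)) {x | b <
    ‖x‖} :=
  continuousOn_of_forall_continuousAt fun x hx =>
    (hf (τ, x) ⟨ht, hx⟩).continuousAt.comp (f := fun x => (τ, x)) (by fun_prop)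

lemma integral_polar {f : Space → ℝ} (hf : Integrable f) : ∫ x, f x = ∫ r : Set.Ioi (0 : ℝ), ∫ θ : S²,
    f (r.1 • (θ : Space)) ∂(volume : Measure Space).toSphere ∂(Measure.volumeIoiPow 2) := by
  have hmp := (volume : Measure Space).measurePreserving_homeomorphUnitSphereProd
  have hd : Module.finrank ℝ Space - 1 = 2 := by simp
  rw [hd] at hmp
  have hsymm : ∀ q : S² × Set.Ioi (0 : ℝ),
      ((homeomorphUnitSphereProd Space).symm q : Space) = q.2.1 • (q.1 : Space) := fun q => rfl
  have hcomp : ∀ y : ({0}ᶜ : Set Space), f y =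
      (fun q : S² × Set.Ioi (0 : ℝ) => f (q.2.1 • (q.1 : Space)))
        (homeomorphUnitSphereProd Space y) := fun y => by
    simp only [← hsymm, Homeomorph.symm_apply_apply]
  have hi : Integrable (fun q : S² × Set.Ioi (0 : ℝ) =>
      f (q.2.1 • (q.1 : Space)))
      ((volume : Measure Space).toSphere.prod (Measure.volumeIoiPow 2)) := by
    rw [← hmp.integrable_comp_emb (Homeomorph.measurableEmbedding _)]
    have : IntegrableOn f ({0}ᶜ : Set Space) := hf.integrableOn
    rw [integrableOn_iff_comap_subtypeVal (by measurability)] at this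
    exact this.congr (.of_forall hcomp)
  rw [← integral_prod_symm _ hi, ← hmp.integral_comp (Homeomorph.measurableEmbedding _)]
  rw [← integral_congr_ae (.of_forall hcomp),
    integral_subtype_comap (measurableSet_singleton _).compl fun x => f x, restrict_compl_singleton]

lemma integral_sphMean (hb : 1 ≤ b) {φ : Scalar} (hφ : SmoothOuter b φ) (ht : 0 ≤ τ) (hn : b < 2 ^ n) :
    ∫ x in dyadic n, sphMean φ (τ, x) = ∫ x in dyadic n, φ (τ, x) := by
  have hm : MeasurableSet (dyadic n) := measurableSet_dyadicRange _ _
  have i1 := (integrableOn_dyadic hn ((hφ.sphMean hb).continuousOn ht))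
  have i2 := (integrableOn_dyadic hn (hφ.continuousOn ht))
  rw [← integral_indicator hm, ← integral_indicator hm,
    integral_polar ((integrable_indicator_iff hm).2 i1),
    integral_polar ((integrable_indicator_iff hm).2 i2)]
  congr 1
  ext r
  have hr : (0 : ℝ) ≤ r.1 := r.2.out.le
  have hmem : ∀ θ : S², r.1 • (θ : Space) ∈ dyadic n ↔ 2 ^ n ≤ r.1 ∧ r.1 < 2 ^ (n + 1) := fun θ => by
    simp only [dyadic, dyadicRange, mem_ofPred_eq, norm_smul_sphere _ hr]
  by_cases h : 2 ^ n ≤ r.1 ∧ r.1 < 2 ^ (n + 1)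
  · simp only [Set.indicator_of_mem ((hmem _).2 h)]
    have e : ∀ θ : S², sphMean φ (τ, r.1 • (θ : Space)) =
        ⨍ θ : S², φ (τ, r.1 • (θ : Space)) ∂((volume : Measure Space).toSphere) := fun θ => by
      simp only [sphMean, norm_smul_sphere _ hr]
    simp only [e, integral_average]
  · simp only [Set.indicator_of_notMem (fun hx => h ((hmem _).1 hx))]

lemma shellNorm_sphMean_le (hb : 1 ≤ b) {ψ : Scalar} (hψ : SmoothOuter b ψ) (ht : 0 ≤ τ) (hn : b < 2 ^ n) :
    shellNorm n (fun x => sphMean ψ (τ, x)) ≤ shellNorm n (fun x => ψ (τ, x)) := by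
  have hsq : SmoothOuter b (fun p => ψ p ^ 2) := by simpa only [sq] using hψ.mul hψ
  refine sqrt_le_sqrt ?_
  rw [← integral_sphMean hb hsq ht hn]
  refine setIntegral_mono_on (integrableOn_dyadic hn (((hψ.sphMean hb).continuousOn ht).pow 2))
    (integrableOn_dyadic hn ((hsq.sphMean hb).continuousOn ht)) (measurableSet_dyadicRange _ _)
    fun x hx => ?_
  have hp : (τ, x) ∈ outer b := ⟨ht, hn.trans_le hx.1⟩
  set c := sphMean ψ (τ, x) with hc
  have h0 : 0 ≤ sphMean (fun p => (ψ p - c) * (ψ p - c)) (τ, x) := integral_nonneg fun θ => mul_self_nonneg _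
  have e : (fun p => (ψ p - c) * (ψ p - c)) = fun p => ψ p ^ 2 - (2 * c * ψ p - c ^ 2) := by ext p; ring
  have s1 : SmoothOuter b (fun p => 2 * c * ψ p) := hψ.const_mul _
  have m1 : sphMean (fun p => 2 * c * ψ p) (τ, x) = 2 * c * c :=
    sphMean_radial_mul (fun _ _ => 2 * c) ψ (τ, x)
  have m2 : sphMean (fun _ => c ^ 2) (τ, x) = c ^ 2 := by simp [sphMean_eq]
  rw [e, sphMean_sub hsq (s1.sub (SmoothOuter.const _)) hp, sphMean_sub s1 (SmoothOuter.const _) hp,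
    m1, m2] at h0
  nlinarith

/-- The constant of polar coordinates. -/
def polarConst : ℝ := 3 * (volume : Measure Space).real (ball 0 1)

lemma polarConst_pos : 0 < polarConst := by
  refine mul_pos (by norm_num) (ENNReal.toReal_pos ?_ measure_ball_lt_top.ne)
  exact (Metric.measure_ball_pos volume _ one_pos).ne'

lemma integral_dyadic_norm (h : ℝ → ℝ) (n : ℕ) : ∫ x in dyadic n, h ‖x‖ = polarConst * ∫ y in Set.Ico (2 ^ n)
    (2 ^ (n + 1)), y ^ 2 * h y := by
  have hm : MeasurableSet (dyadic n) := measurableSet_dyadicRange _ _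
  rw [← integral_indicator hm]
  have e : (dyadic n).indicator (fun x => h ‖x‖) =
      fun x => (Set.Ico ((2 : ℝ) ^ n) (2 ^ (n + 1))).indicator h ‖x‖ := by
    ext x
    simp only [Set.indicator, dyadicRange, mem_ofPred_eq, Set.mem_Ico]
  rw [e, integral_fun_norm_addHaar]
  have e2 : ∀ y : ℝ, y ^ (Module.finrank ℝ Space - 1) •
      (Set.Ico ((2 : ℝ) ^ n) (2 ^ (n + 1))).indicator h y =
      (Set.Ico ((2 : ℝ) ^ n) (2 ^ (n + 1))).indicator (fun y => y ^ 2 * h y) y := fun y => by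
    by_cases hy : y ∈ Set.Ico ((2 : ℝ) ^ n) (2 ^ (n + 1)) <;> simp [hy]
  simp only [e2]
  have hsub : Set.Ico ((2 : ℝ) ^ n) (2 ^ (n + 1)) ⊆ Set.Ioi 0 := fun y hy =>
    lt_of_lt_of_le (by positivity : (0 : ℝ) < 2 ^ n) hy.1
  rw [setIntegral_indicator measurableSet_Ico, Set.inter_eq_right.2 hsub]
  simp [polarConst]
  ring

lemma measure_dyadic (n : ℕ) : (volume : Measure Space).real (dyadic n) = polarConst * (7 / 3) * 8 ^ n := by
  have h := integral_dyadic_norm (fun _ => 1) n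
  simp only [mul_one, integral_const, smul_eq_mul, measureReal_restrict_apply_univ] at h
  rw [h, integral_Ico_eq_integral_Ioo, ← integral_Ioc_eq_integral_Ioo, ← intervalIntegral.integral_of_le
    (two_pow_le (Nat.le_succ n)), integral_pow]
  have : (8 : ℝ) ^ n = (2 ^ n) ^ 3 := by rw [← pow_mul, mul_comm, pow_mul]; norm_num
  rw [this, Nat.succ_eq_add_one, pow_succ (2 : ℝ) n]
  push_cast
  ring

/-! ## Decay of the charge -/

lemma hasDerivAt_ray {γ : Scalar} (hγ : SmoothOuter b γ) (ht : 0 ≤ τ) {e : Space} (he : ‖e‖ = 1) {r : ℝ} (hr :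
    0 < r) (hbr : b < r) : HasDerivAt (fun r => γ (τ, r • e)) (radialDeriv γ (τ, r • e)) r := by
  have hn : ‖r • e‖ = r := by rw [norm_smul, he, mul_one, norm_of_nonneg hr.le]
  have hp : (τ, r • e) ∈ outer b := ⟨ht, by rw [mem_ofPred_eq, hn]; exact hbr⟩
  have h1 : HasDerivAt (fun r : ℝ => (τ, r • e)) ((0 : ℝ), e) r := by
    refine (hasDerivAt_const r τ).prodMk ?_
    simpa using (hasDerivAt_id r).smul_const e
  have h2 := (hγ.diff hp).hasFDerivAt.comp_hasDerivAt r h1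
  refine h2.congr_deriv ?_
  rw [fderiv_space, radialDeriv]
  refine sum_congr rfl fun j _ => ?_
  simp only [normal, Fin.cons_succ, hn, PiLp.smul_apply, smul_eq_mul]
  field_simp

/-- Functions of `t` and `r`. -/
def IsRadial (b : ℝ) (f : Scalar) : Prop :=
  ∀ p ∈ outer b, ∀ q ∈ outer b, p.1 = q.1 → ‖p.2‖ = ‖q.2‖ → f p = f q

lemma IsRadial.of_eqOn_sphMean {ψ : Scalar} (h : EqOn f (sphMean ψ) (outer b)) :
    IsRadial b f := fun p hp q hq h1 h2 => by
  rw [h hp, h hq]; exact sphMean_congr_norm ψ h1 h2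

lemma radial_decay : ∃ C : ℝ, 0 ≤ C ∧ ∀ (b : ℝ), 1 ≤ b → ∀ (γ s : Scalar), SmoothOuter b γ → SmoothOuter b s →
    IsRadial b γ → IsRadial b s → EqOn (radialDeriv γ) (fun p => s p - 2 * ‖p.2‖⁻¹ * γ p) (outer b) → ∀ τ, 0 ≤
    τ → Tendsto (fun L : ℕ => √(2 ^ L) * shellNorm L fun x => γ (τ, x)) atTop (𝓝 0) → ∀ (n : ℕ) (Y : ℝ), b <
    2 ^ n → (∀ L, ∑ j ∈ Ico n L, 2 ^ j * √(2 ^ j) * shellNorm j (fun x => s (τ, x)) ≤ Y) → √(2 ^ n) *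
    shellNorm n (fun x => γ (τ, x)) ≤ C * Y := by
  set v := polarConst * (7 / 3) with hv
  have hv0 : 0 < v := mul_pos polarConst_pos (by norm_num)
  refine ⟨v / polarConst, (div_pos hv0 polarConst_pos).le, ?_⟩
  intro b hb γ s hγ hs rγ rs hode τ ht hlim n Y hbn hY
  set e : Space := EuclideanSpace.single 0 1 with he
  have he1 : ‖e‖ = 1 := by simp [he]
  set q : ℝ → ℝ := fun r => r ^ 2 * γ (τ, r • e) with hq
  set K : ℕ → ℝ := fun j => √v / polarConst * (2 ^ j * √(2 ^ j) * shellNorm j fun x => s (τ, x)) with hK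
  have hne : ∀ {r : ℝ}, 0 ≤ r → ‖r • e‖ = r := fun h => by rw [norm_smul, he1, mul_one, norm_of_nonneg h]
  have hval : ∀ (f : Scalar), IsRadial b f → ∀ x, b < ‖x‖ → f (τ, x) = f (τ, ‖x‖ • e) :=
    fun f hf x hx => by
      have hn := hne (norm_nonneg x)
      exact hf (τ, x) ⟨ht, hx⟩ (τ, ‖x‖ • e) ⟨ht, by rw [mem_ofPred_eq, hn]; exact hx⟩ rfl hn.symm
  have hsc : ∀ r, b < r → ContinuousAt (fun r => s (τ, r • e)) r := fun r hr => by
    have hn := hne (by linarith : 0 ≤ r)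
    exact (hs (τ, r • e) ⟨ht, by rw [mem_ofPred_eq, hn]; exact hr⟩).continuousAt.comp
      (f := fun r : ℝ => (τ, r • e)) (by fun_prop)
  have hder : ∀ r, b < r → HasDerivAt q (r ^ 2 * s (τ, r • e)) r := fun r hr => by
    have hn := hne (by linarith : 0 ≤ r)
    have h0 : 0 < r := by linarith
    have hp : (τ, r • e) ∈ outer b := ⟨ht, by rw [mem_ofPred_eq, hn]; exact hr⟩
    have h1 := (hasDerivAt_pow 2 r).fun_mul (hasDerivAt_ray hγ ht he1 h0 hr)
    refine h1.congr_deriv ?_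
    rw [hode hp]
    simp only [hn]
    field_simp
    push_cast
    ring
  have h8 : ∀ j : ℕ, √(v * 8 ^ j) = √v * (2 ^ j * √(2 ^ j)) := fun j => by
    rw [sqrt_mul hv0.le, show (8 : ℝ) ^ j = (2 ^ j) ^ 2 * 2 ^ j by
      rw [← pow_mul, ← pow_add, show j * 2 + j = 3 * j by ring, pow_mul]; norm_num,
      sqrt_mul (sq_nonneg _), sqrt_sq (by positivity)]
  have hKint : ∀ j, n ≤ j → ∫ y in Set.Ico ((2 : ℝ) ^ j) (2 ^ (j + 1)), y ^ 2 * |s (τ, y • e)| ≤ K j := by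
    intro j hj
    have hbj : b < 2 ^ j := hbn.trans_le (two_pow_le hj)
    have h1 := integral_dyadic_norm (fun y => |s (τ, y • e)|) j
    rw [setIntegral_congr_fun (g := fun x => |s (τ, x)|) (measurableSet_dyadicRange _ _) fun x hx => by
      simp only [hval s rs x (hbj.trans_le hx.1)]] at h1
    have sc := hs.continuousOn (τ := τ) ht
    have h2 := integral_mul_le_sqrt (μ := volume.restrict (dyadic j)) (u := fun _ => 1)
      (v := fun x => |s (τ, x)|) (integrableOn_dyadic hbj (by fun_prop))
      (integrableOn_dyadic hbj (sc.abs.pow 2)) (integrableOn_dyadic hbj (continuousOn_const.mul sc.abs))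
    simp only [one_mul, sq_abs, one_pow, integral_const, smul_eq_mul, mul_one,
      measureReal_restrict_apply_univ, measure_dyadic, h1] at h2
    rw [h8] at h2
    have h4 : K j = (√v * (2 ^ j * √(2 ^ j)) * √(∫ x in dyadic j, s (τ, x) ^ 2)) / polarConst := by
      simp only [hK, shellNorm]; ring
    rw [h4, le_div_iff₀ polarConst_pos]
    linarith
  have hvar : ∀ j, n ≤ j → ∀ r r', 2 ^ j ≤ r → r ≤ r' → r' ≤ 2 ^ (j + 1) → |q r' - q r| ≤ K j := by
    intro j hj r r' h1 h2 h3
    have hbj : b < 2 ^ j := hbn.trans_le (two_pow_le hj)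
    have hcont : ContinuousOn (fun r => r ^ 2 * s (τ, r • e)) (Set.Icc (2 ^ j) (2 ^ (j + 1))) :=
      fun y hy => ((continuousAt_id.pow 2).mul (hsc y (hbj.trans_le hy.1))).continuousWithinAt
    have hsub : Set.Icc r r' ⊆ Set.Icc (2 ^ j) (2 ^ (j + 1)) := Set.Icc_subset_Icc h1 h3
    have hint : IntervalIntegrable (fun r => r ^ 2 * s (τ, r • e)) volume r r' :=
      (hcont.mono (by rw [Set.uIcc_of_le h2]; exact hsub)).intervalIntegrable
    rw [← intervalIntegral.integral_eq_sub_of_hasDerivAt (fun y hy => hder y ?_) hint]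
    · refine (intervalIntegral.abs_integral_le_integral_abs h2).trans (le_trans ?_ (hKint j hj))
      rw [intervalIntegral.integral_of_le h2, integral_Ico_eq_integral_Ioo, ← integral_Ioc_eq_integral_Ioo]
      have : ∀ y, |y ^ 2 * s (τ, y • e)| = y ^ 2 * |s (τ, y • e)| := fun y => by
        rw [abs_mul, abs_of_nonneg (sq_nonneg y)]
      simp only [← this]
      refine setIntegral_mono_set ?_ (.of_forall fun _ => abs_nonneg _)
        (Set.Ioc_subset_Ioc h1 h3).eventuallyLE
      exact (hcont.abs.integrableOn_Icc).mono_set Set.Ioc_subset_Icc_self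
    · rw [Set.uIcc_of_le h2] at hy
      exact hbj.trans_le (h1.trans hy.1)
  have hγq : ∀ {j : ℕ} {x : Space}, n ≤ j → x ∈ dyadic j → γ (τ, x) = q ‖x‖ / ‖x‖ ^ 2 := fun {j x} hj hx => by
    have : 0 < ‖x‖ := lt_of_lt_of_le (by positivity) hx.1
    rw [hval γ rγ x (hbn.trans_le ((two_pow_le hj).trans hx.1)), hq]
    field_simp
  have hcon : ∀ j c, shellNorm j (fun _ : Space => c) = |c| * (√v * (2 ^ j * √(2 ^ j))) := fun j c => by
    have := shellNorm_const_mul (n := j) c fun _ => 1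
    simp only [mul_one] at this
    rw [this, ← h8]
    simp only [shellNorm, one_pow, integral_const, smul_eq_mul, mul_one,
      measureReal_restrict_apply_univ, measure_dyadic, hv]
  have hss : ∀ j : ℕ, √((2 : ℝ) ^ j) * √(2 ^ j) = 2 ^ j := fun j => mul_self_sqrt (by positivity)
  have hup : ∀ M, (∀ r, 2 ^ n ≤ r → r ≤ 2 ^ (n + 1) → |q r| ≤ M) →
      √(2 ^ n) * shellNorm n (fun x => γ (τ, x)) ≤ √v * M := by
    intro M hM
    have hM0 : 0 ≤ M := (abs_nonneg _).trans (hM (2 ^ n) le_rfl (two_pow_le (Nat.le_succ n)))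
    have h := shellNorm_mono (n := n) (b := b) (u := fun x => γ (τ, x)) (v := fun _ => M / (2 ^ n) ^ 2) hbn
      continuousOn_const fun x hx => by
        simp only [hγq le_rfl hx]
        rw [abs_div, abs_of_nonneg (sq_nonneg ‖x‖)]
        exact div_le_div₀ hM0 (hM _ hx.1 hx.2.le) (by positivity) (pow_le_pow_left₀ (by positivity) hx.1 2)
    rw [hcon, abs_of_nonneg (by positivity)] at h
    calc _ ≤ √(2 ^ n) * (M / (2 ^ n) ^ 2 * (√v * (2 ^ n * √(2 ^ n)))) :=
          mul_le_left h (sqrt_nonneg _)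
      _ = √v * M * (√(2 ^ n) * √(2 ^ n)) / 2 ^ n := by field_simp
      _ = √v * M := by rw [hss]; field_simp
  have hlow : ∀ L, n ≤ L → √v * (|q (2 ^ L)| - K L) ≤ 4 * (√(2 ^ L) * shellNorm L fun x => γ (τ, x)) := by
    intro L hL
    have hbL : b < 2 ^ L := hbn.trans_le (two_pow_le hL)
    rcases le_total (|q (2 ^ L)| - K L) 0 with h0 | h0
    · refine (mul_nonpos_of_nonneg_of_nonpos (sqrt_nonneg _) h0).trans ?_
      have := shellNorm_nonneg L fun x => γ (τ, x)
      positivity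
    set M := |q (2 ^ L)| - K L
    have h := shellNorm_mono (n := L) (b := b) (u := fun _ => M / (2 ^ (L + 1)) ^ 2)
      (v := fun x => |γ (τ, x)|) hbL (hγ.continuousOn ht).abs fun x hx => by
        have hx0 : 0 < ‖x‖ := lt_of_lt_of_le (by positivity) hx.1
        simp only [hγq hL hx]
        rw [abs_div (q ‖x‖), abs_of_nonneg (sq_nonneg ‖x‖), abs_of_nonneg (by positivity)]
        refine div_le_div₀ (abs_nonneg _) ?_ (by positivity) (pow_le_pow_left₀ hx0.le hx.2.le 2)
        have h1 := hvar L hL (2 ^ L) ‖x‖ le_rfl hx.1 hx.2.le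
        have h2 := abs_sub_abs_le_abs_sub (q (2 ^ L)) (q ‖x‖)
        rw [abs_sub_comm] at h2
        simp only [M]
        linarith
    rw [hcon, abs_of_nonneg (by positivity), shellNorm_abs] at h
    have h5 := mul_le_left h (by positivity : 0 ≤ 4 * √((2 : ℝ) ^ L))
    calc √v * M = √v * M * (√(2 ^ L) * √(2 ^ L)) / 2 ^ L := by rw [hss]; field_simp
      _ = 4 * √(2 ^ L) * (M / (2 ^ (L + 1)) ^ 2 * (√v * (2 ^ L * √(2 ^ L)))) := by
          rw [pow_succ]; field_simp; ring
      _ ≤ _ := h5.trans_eq (by ring)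
  have hsum : ∀ L, ∑ j ∈ Ico n L, K j ≤ √v / polarConst * Y := fun L => by
    simp only [hK, ← mul_sum]
    exact mul_le_left (hY L) (div_nonneg (sqrt_nonneg _) polarConst_pos.le)
  have hfin : ∀ L, n < L → √(2 ^ n) * shellNorm n (fun x => γ (τ, x)) ≤
      √v * (√v / polarConst * Y) + 4 * (√(2 ^ L) * shellNorm L fun x => γ (τ, x)) := by
    intro L hL
    have hM : ∀ r, 2 ^ n ≤ r → r ≤ 2 ^ (n + 1) →
        |q r| ≤ |q (2 ^ L)| + ∑ j ∈ Ico n L, K j := by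
      intro r h1 h2
      have a1 := hvar n le_rfl r (2 ^ (n + 1)) h1 h2 le_rfl
      have a2 := abs_sub_abs_le_abs_sub (q r) (q (2 ^ (n + 1)))
      rw [abs_sub_comm] at a2
      have a3 : |q (2 ^ (n + 1))| ≤ |q (2 ^ L)| + ∑ j ∈ Ico (n + 1) L, K j := by
        induction L, hL using Nat.le_induction with
        | base => simp
        | succ L hL ih =>
          rw [sum_Ico_succ_top hL]
          have h1 := hvar L (by lia) (2 ^ L) (2 ^ (L + 1)) le_rfl (two_pow_le (Nat.le_succ L)) le_rfl
          have h2 := abs_sub_abs_le_abs_sub (q (2 ^ L)) (q (2 ^ (L + 1)))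
          rw [abs_sub_comm] at h2
          linarith
      rw [sum_eq_sum_Ico_succ_bot hL]
      linarith
    have h1 := hup _ hM
    have h2 := hlow L hL.le
    have h3 := hsum (L + 1)
    rw [sum_Ico_succ_top hL.le] at h3
    have h4 := mul_le_left h3 (sqrt_nonneg v)
    nlinarith
  have hlim2 := (hlim.const_mul 4).const_add (√v * (√v / polarConst * Y))
  have := ge_of_tendsto hlim2 ((eventually_gt_atTop n).mono hfin)
  refine this.trans_eq ?_
  rw [mul_zero, add_zero, ← mul_assoc, ← mul_div_assoc, mul_self_sqrt hv0.le]

/-! ## Derivatives of scalars -/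

/-- A function as a tensor of rank zero. -/
def scal (f : Scalar) : Cov 0 := fun _ => f

/-- The word of vector fields of a multi-index. -/
def MultiIndex.word (Λ : MultiIndex) : List ZField :=
  Λ.i.map .trans ++ (Λ.j.map .rot ++ List.replicate Λ.k .scal)

lemma lie_scal (X : VField) (f : Scalar) : lie X (scal f) = scal (X.act f) := by
  funext a p
  simp [lie, scal, VField.act]

lemma lieIter_scal (Λ : MultiIndex) (f : Scalar) : lieIter Λ (scal f) = scal (iterAct Λ.word f) := by
  have h : ∀ {ι : Type} (X : ι → ZField) (l : List ι) (f : Scalar),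
      l.foldr (fun i W => lie (X i).field W) (scal f) = scal (iterAct (l.map X) f) := by
    intro ι X l f
    induction l with
    | nil => rfl
    | cons i l ih => rw [List.foldr_cons, ih, lie_scal]; rfl
  obtain ⟨i, j, k⟩ := Λ
  have h1 := h (fun _ : Unit => ZField.scal) (List.replicate k ()) f
  simp only [lieIter, iterate_eq_foldr, MultiIndex.word]
  rw [show (List.replicate k ()).foldr (fun _ y => lie scaling y) (scal f) = _ from h1,
    show (fun l (W : Cov 0) => lie (rotation l) W) = fun l W => lie (ZField.rot l).field W from rfl, h,
    show (fun l (W : Cov 0) => lie (translation l) W) = fun l W => lie (ZField.trans l).field W from rfl, h]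
  simp [iterAct]

lemma absSum_scal (m : ℕ) (f : Scalar) (p : Spacetime) : absSum m (scal f) p = ∑ Λ : Idx m,
    |iterAct Λ.1.word f p| := by
  simp only [absSum, lieIter_scal, scal, univ_unique, sum_singleton]

lemma abs_iterAct_le_absSum (f : Scalar) (p : Spacetime) {Λ : MultiIndex} (hΛ : Λ.weight ≤ m) :
    |iterAct Λ.word f p| ≤ absSum m (scal f) p := by
  have := abs_lieIter_le_absSum (scal f) p hΛ default
  rwa [lieIter_scal] at this

lemma smoothCov_scal (hf : SmoothOuter b f) : SmoothCov b (scal f) := fun _ => hf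

lemma act_trans (μ : Fin 4) (f : Scalar) : (ZField.trans μ).field.act f = pd μ f := act_translation μ f

/-! ### Translations of products -/

lemma iterAct_sum {ι : Type*} (t : Finset ι) {f : ι → Scalar} (hf : ∀ i ∈ t, SmoothOuter b (f i)) (w :
    List ZField) : EqOn (iterAct w fun q => ∑ i ∈ t, f i q) (fun q => ∑ i ∈ t, iterAct w (f i) q)
    (outer b) := by
  induction w with
  | nil => exact fun _ _ => rfl
  | cons X w ih =>
    exact fun p hp => (act_congr_outer ((SmoothOuter.sum hf).iterAct w)
      (SmoothOuter.sum fun i hi => (hf i hi).iterAct w) ih _ hp).trans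
      (act_sum _ _ fun i hi => ((hf i hi).iterAct w).diff hp)

/-- A family of functions whose first derivatives are combinations of its members. -/
lemma abs_iterAct_le_of_pd (hb : 1 ≤ b) {κ : Type} [Fintype κ] {c : Fin 4 → κ → Scalar}
    (hc : ∀ μ k, SZu b 0 fun _ => c μ k) (i : List (Fin 4)) : ∀ h, SZu b 0 (fun _ => h) →
    ∃ C : ℝ, 0 ≤ C ∧ ∀ (σ : Type) (E : σ → Scalar) (D : κ → σ → σ), (∀ s, SmoothOuter b (E s)) →
      (∀ s μ, EqOn (pd μ (E s)) (fun p => ∑ k, c μ k p * E (D k s) p) (outer b)) →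
      ∀ s, ∀ p ∈ outer b, ∀ M : ℝ,
        (∀ w : List κ, w.length ≤ i.length → |E (w.foldr D s) p| ≤ M) →
        |iterAct (i.map .trans) (fun q => h q * E s q) p| ≤ C * M := by
  induction i using List.reverseRecOn with
  | nil =>
    intro h hh
    obtain ⟨C, hC, e⟩ := hh.bound
    refine ⟨C, hC, fun σ E D _ _ s p hp M hM => (abs_mul _ _).trans_le ?_⟩
    have h1 := e 0 p hp
    rw [zpow_zero, mul_one] at h1
    exact mul_le_mul h1 (hM [] le_rfl) (abs_nonneg _) hC
  | append_singleton i μ ih =>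
    intro h hh
    have hk : ∀ k, SZu b 0 (fun _ p => h p * c μ k p) := fun k => hh.mul hb (hc μ k)
    obtain ⟨C, hC, e⟩ := ih _ (hh.pd μ)
    choose C' hC' e' using fun k => ih _ (hk k)
    refine ⟨C + ∑ k, C' k, add_nonneg hC (sum_nonneg fun k _ => hC' k), fun σ E D hE hD s p hp M hM => ?_⟩
    have s0 := ((hh.pd μ).1 0).mul (hE s)
    have s1 := fun k => ((hk k).1 0).mul (hE (D k s))
    have s2 := SmoothOuter.sum (s := univ) fun k _ => s1 k
    rw [List.map_append, List.map_singleton, iterAct_append_singleton, act_trans,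
      iterAct_congr_outer (((hh.1 0).mul (hE s)).pd μ) (s0.add s2)
        (fun q hq => by
          rw [pd_mul ((hh.1 0).diff hq) ((hE s).diff hq), hD s μ hq, mul_sum]
          simp only [mul_assoc]) _ hp,
      iterAct_add s0 s2 _ hp, iterAct_sum _ (fun k _ => s1 k) _ hp,
      add_mul, sum_mul]
    refine (abs_add_le _ _).trans (add_le_add (e σ E D hE hD s p hp M fun w hw => hM w (by simp; lia))
      ((abs_sum_le_sum_abs _ _).trans (sum_le_sum fun k _ => e' k σ E D hE hD (D k s) p hp M fun w hw => ?_)))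
    simpa using hM (w ++ [k]) (by simpa using hw)

lemma iterAct_trans_mul (hb : 1 ≤ b) (i : List (Fin 4)) (h : Scalar)
    (hh : SZu b 0 fun _ => h) : ∃ C : ℝ, 0 ≤ C ∧ ∀ f, SmoothOuter b f → ∀ p ∈ outer b, ∀ M : ℝ,
      (∀ i' : List (Fin 4), i'.length ≤ i.length → |iterAct (i'.map .trans) f p| ≤ M) →
      |iterAct (i.map .trans) (fun q => h q * f q) p| ≤ C * M := by
  obtain ⟨C, hC, e⟩ := abs_iterAct_le_of_pd hb (fun μ ν : Fin 4 => SZu.const (kron μ ν)) i h hh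
  refine ⟨C, hC, fun f hf p hp M hM => e (List (Fin 4)) (fun l => iterAct (l.map .trans) f)
    List.cons (fun l => hf.iterAct _) (fun l μ p _ => ?_) [] p hp M fun w hw => by simpa using hM w hw⟩
  simp [kron, iterAct, act_trans]

lemma rotation_eq_zero (hp : p.2 ≠ 0) {c : ℝ} (h : ∀ i : Fin 3, pd i.succ f p = normal i.succ p * c) (k :
    Fin 3) : (rotation k).act f p = 0 := by
  rw [act_rotation, h, h, coord_eq_normal hp, coord_eq_normal hp]
  ring

/-- `f` is a radial solution of `∂_r f + 2 f / r = g`. -/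
structure ChargePair (b : ℝ) (f g : Scalar) : Prop where
  smooth : SmoothOuter b f
  smooth' : SmoothOuter b g
  pd_eq : ∀ i : Fin 3, EqOn (pd i.succ f)
    (fun p => normal i.succ p * (g p - 2 * (‖p.2‖ ^ (-1 : ℤ) * f p))) (outer b)

namespace ChargePair

lemma time (hb : 1 ≤ b) (h : ChargePair b f g) : ChargePair b (pd 0 f) (pd 0 g) := by
  refine ⟨h.smooth.pd 0, h.smooth'.pd 0, fun i p hp => ?_⟩
  have hp0 := outer_ne_zero hb hp
  have sn := (HomDeg.normal i.succ).smoothOuter hb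
  have sr := (HomDeg.norm_zpow (-1)).smoothOuter hb
  have s1 := (sr.mul h.smooth).const_mul 2
  rw [pd_comm (h.smooth p hp), pd_congr_outer (h.smooth.pd _) (sn.mul (h.smooth'.sub s1)) (h.pd_eq i)
    0 hp, pd_mul (sn.diff hp) ((h.smooth'.sub s1).diff hp), pd_sub (h.smooth'.diff hp) (s1.diff hp),
    pd_const_mul ((sr.mul h.smooth).diff hp), pd_mul (sr.diff hp) (h.smooth.diff hp),
    (HomDeg.normal i.succ).pd_zero hp0, (HomDeg.norm_zpow (-1)).pd_zero hp0]
  ring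

lemma scaling (hb : 1 ≤ b) (h : ChargePair b f g) : ChargePair b (scaling.act f)
    (fun p => Maxwell.scaling.act g p + g p) := by
  refine ⟨h.smooth.act .scal, (h.smooth'.act .scal).add h.smooth', fun i p hp => ?_⟩
  have hp0 := outer_ne_zero hb hp
  have sn := (HomDeg.normal i.succ).smoothOuter hb
  have sr := (HomDeg.norm_zpow (-1)).smoothOuter hb
  have s1 := (sr.mul h.smooth).const_mul 2
  have hc : pd i.succ (Maxwell.scaling.act f) p = Maxwell.scaling.act (pd i.succ f) p + pd i.succ f p := by
    have := ZField.pd_act .scal (h.smooth p hp) i.succ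
    simpa [ZField.jac, kron, ZField.field] using this
  have ha := act_congr_outer (h.smooth.pd i.succ) (sn.mul (h.smooth'.sub s1)) (h.pd_eq i) Maxwell.scaling hp
  rw [act_mul _ (sn.diff hp) ((h.smooth'.sub s1).diff hp)] at ha
  have h2 : Maxwell.scaling.act (fun p => g p - 2 * (‖p.2‖ ^ (-1 : ℤ) * f p)) p =
      Maxwell.scaling.act g p - 2 * (Maxwell.scaling.act (fun p => ‖p.2‖ ^ (-1 : ℤ)) p * f p +
        ‖p.2‖ ^ (-1 : ℤ) * Maxwell.scaling.act f p) := by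
    have e : (fun p : Spacetime => g p - 2 * (‖p.2‖ ^ (-1 : ℤ) * f p)) =
        fun p => g p + (-2) * (‖p.2‖ ^ (-1 : ℤ) * f p) := by ext; ring
    rw [e, act_add _ (h.smooth'.diff hp) (((sr.mul h.smooth).const_mul (-2)).diff hp),
      act_const_mul _ _ ((sr.mul h.smooth).diff hp), act_mul _ (sr.diff hp) (h.smooth.diff hp)]
    ring
  rw [hc, ha, h2, (HomDeg.normal i.succ).scaling_act hp0, (HomDeg.norm_zpow (-1)).scaling_act hp0,
    h.pd_eq i hp]
  push_cast
  ring

end ChargePair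

lemma sphMean_chargePair (hb : 1 ≤ b) (hW : SmoothCov b W) (hA : AntiOuter b W) :
    ChargePair b (sphMean (compAB W)) (sphMean (extD0 W ![1, 2, 3])) := by
  have s1 := smooth_compAB hb hW
  refine ⟨s1.sphMean hb, (smooth_extD0 hW _).sphMean hb, fun i p hp => ?_⟩
  rw [pd_succ_sphMean hb s1 i hp]
  simp only
  rw [← radialDeriv_sphMean hb s1 hp, radial_transport hb hW hA hp, zpow_neg_one]
  ring

lemma ChargePair.pd_eq' (h : ChargePair b f g) (μ : Fin 4) (hp : p ∈ outer b) : pd μ f p = normal μ p *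
    (g p - 2 * (‖p.2‖ ^ (-1 : ℤ) * f p)) + kron μ 0 * pd 0 f p := by
  refine Fin.cases ?_ (fun j => ?_) μ
  · simp [normal, kron]
  · simp [h.pd_eq j hp, kron, Fin.succ_ne_zero]

lemma ChargePair.abs_iterAct_le (hb : 1 ≤ b) (i : List (Fin 4)) :
    ∀ h : Scalar, SZu b 0 (fun _ => h) → ∃ C : ℝ, 0 ≤ C ∧ ∀ f g, ChargePair b f g → ∀ p ∈ outer b,
      ∀ M : ℝ, (∀ a ≤ i.length, |iterAct (List.replicate a (.trans 0)) f p| ≤ M) →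
      (∀ i' : List (Fin 4), i'.length ≤ i.length → |iterAct (i'.map .trans) g p| ≤ M) →
      |iterAct (i.map .trans) (fun q => h q * f q) p| ≤ C * M := by
  induction i using List.reverseRecOn with
  | nil =>
    intro h hh
    obtain ⟨C, hC, e⟩ := iterAct_trans_mul hb [] h hh
    exact ⟨C, hC, fun f g hf p hp M hM _ => e f hf.smooth p hp M fun i' hi' => by
      simpa [List.length_eq_zero_iff.1 (Nat.le_zero.1 hi')] using hM 0 le_rfl⟩
  | append_singleton i μ ih =>
    intro h hh
    have hlen : (i ++ [μ]).length = i.length + 1 := by simp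
    rw [hlen]
    have hn : SZu b 0 (fun _ p => h p * normal μ p) := hh.mul hb ((HomDeg.normal μ).SZu hb)
    have hr : SZu b 0 (fun _ p => h p * normal μ p * ‖p.2‖ ^ (-1 : ℤ)) :=
      (by simpa using hn.mul hb ((HomDeg.norm_zpow (-1)).SZu hb) : SZu b (-1) _).mono hb (by lia)
    have hk := (hh.pd μ).sub hb (hr.const_mul hb 2)
    have ht := hh.const_mul hb (kron μ 0)
    obtain ⟨C1, hC1, e1⟩ := ih _ hk
    obtain ⟨C2, hC2, e2⟩ := iterAct_trans_mul hb i _ hn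
    obtain ⟨C3, hC3, e3⟩ := ih _ ht
    refine ⟨C1 + C2 + C3, by positivity, fun f g hf p hp M hM hM' => ?_⟩
    have hs1 := (hk.1 0).mul hf.smooth
    have hs2 := (hn.1 0).mul hf.smooth'
    have hs3 := (ht.1 0).mul (hf.smooth.pd 0)
    rw [List.map_append, List.map_singleton, iterAct_append_singleton, act_trans,
      iterAct_congr_outer (((hh.1 0).mul hf.smooth).pd _) ((hs1.add hs2).add hs3) (fun q hq => by
        rw [pd_mul ((hh.1 0).diff hq) (hf.smooth.diff hq), hf.pd_eq' μ hq]
        ring) _ hp,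
      iterAct_add (hs1.add hs2) hs3 _ hp, iterAct_add hs1 hs2 _ hp, add_mul, add_mul]
    refine (abs_add_three _ _ _).trans (add_le_add_three
      (e1 f g hf p hp M (fun a ha => hM a (by lia)) fun i' hi' => hM' i' (by lia))
      (e2 g hf.smooth' p hp M fun i' hi' => hM' i' (by lia))
      (e3 _ _ (hf.time hb) p hp M (fun a ha => ?_) fun i' hi' => ?_))
    · have := hM (a + 1) (by lia)
      rwa [List.replicate_succ', iterAct_append_singleton, act_trans] at this
    · have := hM' (i' ++ [0]) (by simp; lia)
      rwa [List.map_append, List.map_singleton, iterAct_append_singleton, act_trans] at this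

lemma iterAct_append (w w' : List ZField) (f : Scalar) :
    iterAct (w ++ w') f = iterAct w (iterAct w' f) := by simp [iterAct]

lemma iterAct_eq_zero (hf : SmoothOuter b f) (h : EqOn f (fun _ => 0) (outer b)) (w : List ZField) :
    EqOn (iterAct w f) (fun _ => 0) (outer b) := by
  induction w with
  | nil => exact h
  | cons X w ih => exact fun p hp =>
      (act_congr_outer (hf.iterAct w) (SmoothOuter.const 0) ih X.field hp).trans (act_const _ _ _)

lemma iterAct_rot_eq_zero (hf : SmoothOuter b f) (h : ∀ k, EqOn ((rotation k).act f) (fun _ => 0) (outer b))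
    {j : List (Fin 3)} (hj : j ≠ []) (w : List ZField) : EqOn (iterAct (w ++ j.map .rot) f) (fun _ => 0)
    (outer b) := by
  induction j using List.reverseRecOn with
  | nil => exact absurd rfl hj
  | append_singleton j l _ =>
    rw [List.map_append, List.map_singleton, ← List.append_assoc, iterAct_append_singleton]
    exact iterAct_eq_zero (hf.act (.rot l)) (h l) _

/-- The word `∂_t^a S^k`. -/
def timeWord (a k : ℕ) : List ZField := List.replicate a (.trans 0) ++ List.replicate k .scal

/-- The sum of `|∂_t^a S^k f|` over the words of weight at most `m`. -/
def timeSum (m : ℕ) (f : Scalar) (p : Spacetime) : ℝ :=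
  ∑ Λ : Idx m, |iterAct (timeWord Λ.1.i.length Λ.1.k) f p|

lemma timeSum_nonneg (m : ℕ) (f : Scalar) (p : Spacetime) : 0 ≤ timeSum m f p :=
  sum_nonneg fun _ _ => abs_nonneg _

lemma abs_le_timeSum {a : ℕ} (h : a + 9 * k ≤ m) (f : Scalar) (p : Spacetime) :
    |iterAct (timeWord a k) f p| ≤ timeSum m f p := by
  simpa [timeSum] using single_le_sum (f := fun Λ : Idx m =>
    |iterAct (timeWord Λ.1.i.length Λ.1.k) f p|) (fun _ _ => abs_nonneg _)
    (mem_univ ⟨⟨List.replicate a 0, [], k⟩, by simpa [MultiIndex.weight] using h⟩)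

/-- The operator `S + 1`. -/
def scalSucc (f : Scalar) : Scalar := fun p => scaling.act f p + f p

lemma SmoothOuter.scalSucc_iterate (hf : SmoothOuter b f) (k : ℕ) : SmoothOuter b (scalSucc^[k] f) := by
  induction k with
  | zero => exact hf
  | succ k ih =>
    rw [iterate_succ_apply']
    exact (ih.act .scal).add ih

lemma abs_iterAct_scalSucc_le (hf : SmoothOuter b f) (w : List ZField)
    (hp : p ∈ outer b) (k : ℕ) : ∀ (l : ℕ) (M : ℝ),
      (∀ l' ≤ l + k, |iterAct (w ++ List.replicate l' .scal) f p| ≤ M) →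
      |iterAct (w ++ List.replicate l .scal) (scalSucc^[k] f) p| ≤ 2 ^ k * M := by
  induction k with
  | zero => intro l M h; simpa using h l le_rfl
  | succ k ih =>
    intro l M h
    have hs := hf.scalSucc_iterate k
    rw [iterate_succ_apply']
    change |iterAct _ (fun q => ZField.scal.field.act (scalSucc^[k] f) q + (scalSucc^[k] f) q) p| ≤ _
    rw [iterAct_add (hs.act .scal) hs _ hp, pow_succ, mul_two, add_mul]
    refine (abs_add_le _ _).trans (add_le_add ?_ (ih l M fun l' hl' => h l' (by lia)))
    have := ih (l + 1) M fun l' hl' => h l' (by lia)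
    rwa [List.replicate_succ', ← List.append_assoc, iterAct_append_singleton] at this

lemma ChargePair.scaling_iterate (hb : 1 ≤ b) (h : ChargePair b f g) (k : ℕ) :
    ChargePair b (iterAct (List.replicate k .scal) f) (scalSucc^[k] g) := by
  induction k with
  | zero => exact h
  | succ k ih =>
    rw [iterate_succ_apply']
    exact ih.scaling hb

lemma ChargePair.absSum_le (hb : 1 ≤ b) (m : ℕ) : ∃ C : ℝ, 0 ≤ C ∧ ∀ f g, ChargePair b f g → ∀ p ∈ outer b,
    absSum m (scal f) p ≤ C * (timeSum m f p + absSum m (scal g) p) := by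
  have key : ∀ Λ : Idx m, ∃ C : ℝ, 0 ≤ C ∧ ∀ f g, ChargePair b f g → ∀ p ∈ outer b,
      |iterAct Λ.1.word f p| ≤ C * (timeSum m f p + absSum m (scal g) p) := by
    rintro ⟨⟨i, j, k⟩, hΛ⟩
    simp only [MultiIndex.weight] at hΛ
    obtain ⟨C, hC, e⟩ := ChargePair.abs_iterAct_le hb i _ (SZu.const (b := b) 1)
    refine ⟨C * 2 ^ k, by positivity, fun f g h p hp => ?_⟩
    have hk := h.scaling_iterate hb k
    have n1 := timeSum_nonneg m f p
    have n2 := absSum_nonneg m (scal g) p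
    by_cases hj : j = []
    · subst hj
      have := e _ _ hk p hp (2 ^ k * (timeSum m f p + absSum m (scal g) p)) (fun a ha => ?_) fun i' hi' => ?_
      · simp only [one_mul] at this
        simp only [MultiIndex.word, List.map_nil, List.nil_append, iterAct_append]
        exact this.trans_eq (by ring)
      · have h1 := abs_le_timeSum (a := a) (k := k) (m := m) (by simp at hΛ; lia) f p
        rw [timeWord, iterAct_append] at h1
        have : (1 : ℝ) ≤ 2 ^ k := one_le_pow₀ one_le_two
        nlinarith
      · have := abs_iterAct_scalSucc_le h.smooth' (i'.map .trans) hp k 0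
          (timeSum m f p + absSum m (scal g) p) fun l hl => ?_
        · simpa using this
        · have := abs_iterAct_le_absSum (m := m) g p (Λ := ⟨i', [], l⟩)
            (by simp [MultiIndex.weight] at hΛ ⊢; lia)
          simp only [MultiIndex.word, List.map_nil, List.nil_append] at this
          linarith
    · have := iterAct_rot_eq_zero hk.smooth (fun l q hq =>
        rotation_eq_zero (outer_ne_zero hb hq) (fun i => hk.pd_eq i hq) l) hj (i.map .trans) hp
      simp only [MultiIndex.word]
      rw [← List.append_assoc, iterAct_append, this, abs_zero]
      positivity
  choose C hC e using key
  refine ⟨∑ Λ, C Λ, sum_nonneg fun Λ _ => hC Λ, fun f g h p hp => ?_⟩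
  rw [absSum_scal, sum_mul]
  exact sum_le_sum fun Λ _ => e Λ f g h p hp

/-! ### Derivatives of spherical means -/

/-- The product of the components of the normal indexed by the spatial entries of a word. -/
def normalProd (i : List (Fin 4)) (p : Spacetime) : ℝ :=
  i.foldr (fun μ y => (if μ = 0 then 1 else normal μ p) * y) 1

lemma HomDeg.normalProd (i : List (Fin 4)) : HomDeg 0 (normalProd i) := by
  induction i with
  | nil => exact HomDeg.const 1
  | cons μ i ih =>
    refine HomDeg.mul (s := 0) (s' := 0) ?_ ih
    split_ifs
    exacts [HomDeg.const 1, HomDeg.normal μ]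

lemma abs_normalProd_le (i : List (Fin 4)) (p : Spacetime) : |normalProd i p| ≤ 1 := by
  induction i with
  | nil => simp [normalProd]
  | cons μ i ih =>
    refine (abs_mul _ _).trans_le (mul_le_one₀ ?_ (abs_nonneg _) ih)
    split_ifs with h
    · simp
    · obtain ⟨j, rfl⟩ := Fin.exists_succ_eq.2 h
      rw [normal, Fin.cons_succ, abs_div, abs_norm]
      exact div_le_one_of_le₀ (PiLp.norm_apply_le p.2 j) (norm_nonneg _)

lemma HomDeg.radialDeriv_mul (hf : HomDeg 0 f) (hp : p.2 ≠ 0) (hg : DifferentiableAt ℝ g p) :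
    radialDeriv (fun q => f q * g q) p = f p * radialDeriv g p := by
  have : radialDeriv f p = 0 := by simpa [hp] using hf.radialDeriv_eq hp
  rw [Maxwell.radialDeriv_mul (smooth_diff (hf.1 p hp)) hg, this, zero_mul, zero_add]

section

/-- The spherical mean of the derivative `∂^i f` times components of the normal. -/
def meanDeriv (f : Scalar) (i : List (Fin 4)) : Scalar :=
  sphMean fun p => normalProd i p * iterAct (i.map .trans) f p

lemma meanDeriv_nil : meanDeriv f [] = sphMean f := by simp [meanDeriv, normalProd, iterAct]

lemma smooth_normalProd_mul (hb : 1 ≤ b) (hf : SmoothOuter b f) (i i' : List (Fin 4)) : SmoothOuter b fun p =>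
    normalProd i p * iterAct (i'.map .trans) f p :=
  ((HomDeg.normalProd i).smoothOuter hb).mul (hf.iterAct _)

lemma pd_meanDeriv (hb : 1 ≤ b) (hf : SmoothOuter b f) (i : List (Fin 4)) (μ : Fin 4) :
    EqOn (pd μ (meanDeriv f i)) (fun p => ∑ ν, (if μ = 0 then kron ν 0 else
      normal μ p * (1 - kron ν 0)) * meanDeriv f (ν :: i) p) (outer b) := fun p hp => by
  have s := smooth_normalProd_mul hb hf i i
  have key : ∀ ν : Fin 4, ∀ q, normalProd (ν :: i) q * iterAct ((ν :: i).map .trans) f q =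
      (if ν = 0 then 1 else normal ν q) * (normalProd i q * pd ν (iterAct (i.map .trans) f) q) :=
    fun ν q => by
      rw [List.map_cons, iterAct, List.foldr_cons, act_trans]
      exact mul_assoc _ _ _
  refine Fin.cases ?_ (fun j => ?_) μ
  · rw [meanDeriv, pd_zero_sphMean hb s hp]
    simp only [if_true, sum_univ_succ (n := 3), kron, Fin.succ_ne_zero, if_false, zero_mul, one_mul,
      sum_const_zero, add_zero, meanDeriv]
    refine sphMean_congr (b := b) (fun q hq => ?_) hp
    have := (HomDeg.normalProd i).smoothOuter hb
    rw [key, pd_mul (this.diff hq) ((hf.iterAct _).diff hq),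
      (HomDeg.normalProd i).pd_zero (outer_ne_zero hb hq)]
    simp
  · rw [meanDeriv, pd_succ_sphMean hb s j hp]
    simp only [sum_univ_succ (n := 3), kron, Fin.succ_ne_zero, if_true, if_false, sub_self, sub_zero,
      mul_zero, zero_mul, zero_add, mul_one, ← mul_sum, meanDeriv]
    rw [← sphMean_sum _ (fun l _ => smooth_normalProd_mul hb hf _ _) hp]
    congr 1
    refine sphMean_congr (b := b) (fun q hq => ?_) hp
    rw [(HomDeg.normalProd i).radialDeriv_mul (outer_ne_zero hb hq) ((hf.iterAct _).diff hq),
      radialDeriv, mul_sum]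
    refine sum_congr rfl fun l _ => ?_
    rw [key, if_neg (Fin.succ_ne_zero l)]
    ring

end

lemma iterAct_timeWord_sphMean (hb : 1 ≤ b) (hf : SmoothOuter b f) (a k : ℕ) : EqOn (iterAct (timeWord a k)
    (sphMean f)) (sphMean (iterAct (timeWord a k) f)) (outer b) := by
  have h : ∀ w : List ZField, (∀ X ∈ w, X = .trans 0 ∨ X = .scal) →
      EqOn (iterAct w (sphMean f)) (sphMean (iterAct w f)) (outer b) := by
    intro w hw
    induction w with
    | nil => exact fun _ _ => rfl
    | cons X w ih =>
      have ih := ih fun Y hY => hw Y (List.mem_cons_of_mem _ hY)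
      intro p hp
      have h1 := act_congr_outer ((hf.sphMean hb).iterAct w) ((hf.iterAct w).sphMean hb) ih X.field hp
      refine Eq.trans h1 ?_
      rcases hw X List.mem_cons_self with rfl | rfl
      · have := pd_zero_sphMean hb (hf.iterAct w) hp
        simpa only [iterAct, List.foldr_cons, act_trans] using this
      · exact scaling_sphMean hb (hf.iterAct w) hp
  refine h _ fun X hX => ?_
  rcases List.mem_append.1 hX with hX | hX
  · exact Or.inl (List.eq_of_mem_replicate hX)
  · exact Or.inr (List.eq_of_mem_replicate hX)

lemma absSum_sphMean_le (hb : 1 ≤ b) (m : ℕ) : ∃ C : ℝ, 0 ≤ C ∧ ∀ f, SmoothOuter b f → ∀ p ∈ outer b,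
    absSum m (scal (sphMean f)) p ≤ C * ∑ Λ : Idx m, |meanDeriv (iterAct (List.replicate Λ.1.k .scal) f)
    Λ.1.i p| := by
  have key : ∀ Λ : Idx m, ∃ C : ℝ, 0 ≤ C ∧ ∀ f, SmoothOuter b f → ∀ p ∈ outer b,
      |iterAct Λ.1.word (sphMean f) p| ≤
        C * ∑ Λ : Idx m, |meanDeriv (iterAct (List.replicate Λ.1.k .scal) f) Λ.1.i p| := by
    rintro ⟨⟨i, j, k⟩, hΛ⟩
    simp only [MultiIndex.weight] at hΛ
    obtain ⟨C, hC, e⟩ := abs_iterAct_le_of_pd hb (κ := Fin 4) (c := fun μ ν p => if μ = 0 then kron ν 0 else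
      normal μ p * (1 - kron ν 0)) (fun μ ν => by
        split_ifs
        · exact SZu.const _
        · exact ((HomDeg.normal μ).SZu hb).mul hb (SZu.const _)) i _ (SZu.const (b := b) 1)
    refine ⟨C, hC, fun f hf p hp => ?_⟩
    have hk := hf.iterAct (List.replicate k .scal)
    have hSk := iterAct_timeWord_sphMean hb hf 0 k
    simp only [timeWord, List.replicate_zero, List.nil_append] at hSk
    have hsm := (hf.sphMean hb).iterAct (List.replicate k .scal)
    by_cases hj : j = []
    · subst hj
      have h1 := e _ (meanDeriv (iterAct (List.replicate k .scal) f)) List.cons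
        (fun l => (smooth_normalProd_mul hb hk l l).sphMean hb) (pd_meanDeriv hb hk) [] p hp _ fun w hw => by
          rw [List.foldr_cons_nil]
          exact single_le_sum (f := fun Λ : Idx m =>
            |meanDeriv (iterAct (List.replicate Λ.1.k .scal) f) Λ.1.i p|) (fun _ _ => abs_nonneg _)
            (mem_univ (⟨⟨w, [], k⟩, by simp [MultiIndex.weight] at hΛ ⊢; lia⟩ : Idx m))
      simp only [one_mul, meanDeriv_nil] at h1
      simp only [MultiIndex.word, List.map_nil, List.nil_append, iterAct_append]
      rwa [iterAct_congr_outer hsm (hk.sphMean hb) hSk _ hp]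
    · have hrad := radialOn_sphMean hb hk
      have h1 := iterAct_rot_eq_zero (hk.sphMean hb) (fun l q hq =>
        rotation_eq_zero (outer_ne_zero hb hq) (fun i => hrad i hq) l) hj (i.map .trans) hp
      simp only [MultiIndex.word]
      rw [← List.append_assoc, iterAct_append, iterAct_congr_outer hsm (hk.sphMean hb) hSk _ hp, h1, abs_zero]
      positivity
  choose C hC e using key
  refine ⟨∑ Λ, C Λ, sum_nonneg fun Λ _ => hC Λ, fun f h p hp => ?_⟩
  rw [absSum_scal, sum_mul]
  exact sum_le_sum fun Λ _ => e Λ f h p hp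

lemma shellNorm_absSum_sphMean_le (hb : 1 ≤ b) (m : ℕ) : ∃ C : ℝ, 0 ≤ C ∧ ∀ f, SmoothOuter b f → ∀ τ, 0 ≤ τ →
    ∀ n : ℕ, b < 2 ^ n → shell[m, τ, n] (scal (sphMean f)) ≤ C * shell[m, τ, n] (scal f) := by
  obtain ⟨C, hC, e⟩ := absSum_sphMean_le hb m
  refine ⟨C * ∑ _ : Idx m, 1, by positivity, fun f hf τ ht n hn => ?_⟩
  have hs := fun Λ : Idx m => smooth_normalProd_mul hb (hf.iterAct (List.replicate Λ.1.k .scal)) Λ.1.i Λ.1.i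
  have hcont := fun Λ : Idx m => (((hs Λ).sphMean hb).continuousOn ht).abs
  refine (shellNorm_le_mul hn hC (continuousOn_finsetSum univ fun Λ _ => hcont Λ) fun x hx => ?_).trans ?_
  · rw [abs_of_nonneg (absSum_nonneg _ _ _)]
    exact e f hf _ ⟨ht, hn.trans_le hx.1⟩
  rw [mul_assoc, sum_mul]
  refine mul_le_left ((shellNorm_sum_le _ hn fun Λ _ => hcont Λ).trans
    (sum_le_sum fun Λ _ => ?_)) hC
  rw [shellNorm_abs]
  refine (shellNorm_sphMean_le hb (hs Λ) ht hn).trans (shellNorm_le_mul hn zero_le_one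
    (continuousOn_absSum (smoothCov_scal hf) m ht) fun x hx => ?_)
  rw [abs_mul]
  refine mul_le_mul (abs_normalProd_le _ _) ?_ (abs_nonneg _) zero_le_one
  have h := abs_iterAct_le_absSum (m := m) f (τ, x) (Λ := ⟨Λ.1.i, [], Λ.1.k⟩) (by
    have := Λ.2
    simp [MultiIndex.weight] at this ⊢
    lia)
  simpa only [MultiIndex.word, List.map_nil, List.nil_append, iterAct_append] using h

/-! ### Decay of radial solutions -/

lemma ChargePair.radialDeriv_eq (hb : 1 ≤ b) (h : ChargePair b f g) :
    EqOn (radialDeriv f) (fun p => g p - 2 * ‖p.2‖⁻¹ * f p) (outer b) := fun p hp => by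
  rw [radialDeriv_of_pd (outer_ne_zero hb hp) fun j => h.pd_eq j hp, zpow_neg_one]
  ring

lemma ChargePair.time_iterate (hb : 1 ≤ b) (h : ChargePair b f g) (a : ℕ) :
    ChargePair b (iterAct (List.replicate a (.trans 0)) f) (iterAct (List.replicate a (.trans 0)) g) := by
  induction a with
  | zero => exact h
  | succ a ih =>
    simp only [List.replicate_succ, iterAct, List.foldr_cons, act_trans]
    exact ih.time hb

lemma scalSucc_iterate_sphMean (hb : 1 ≤ b) {φ : Scalar} (hφ : SmoothOuter b φ) (k : ℕ) : EqOn (scalSucc^[k]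
    (sphMean φ)) (sphMean (scalSucc^[k] φ)) (outer b) := by
  induction k with
  | zero => exact fun _ _ => rfl
  | succ k ih =>
    intro p hp
    have s1 := hφ.scalSucc_iterate k
    have s2 := (hφ.sphMean hb).scalSucc_iterate k
    rw [iterate_succ_apply', iterate_succ_apply']
    have e1 : sphMean (scalSucc (scalSucc^[k] φ)) p =
        sphMean (scaling.act (scalSucc^[k] φ)) p + sphMean (scalSucc^[k] φ) p :=
      sphMean_add (s1.act .scal) s1 hp
    rw [e1, ← scaling_sphMean hb s1 hp, ← ih hp, ← act_congr_outer s2 (s1.sphMean hb) ih scaling hp]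
    rfl

lemma chargePair_decay (hb : 1 ≤ b) (m : ℕ) : ∃ C : ℝ, 0 ≤ C ∧ ∀ ψ φ : Scalar, SmoothOuter b ψ →
    SmoothOuter b φ → ChargePair b (sphMean ψ) (sphMean φ) → ∀ τ, 0 ≤ τ → Tendsto (fun L : ℕ => √(2 ^ L) *
    shell[m, τ, L] (scal (sphMean ψ))) atTop (𝓝 0) → ∀ (n : ℕ) (Y : ℝ), b < 2 ^ n → (∀ L, ∑ j ∈ Ico n L,
    2 ^ j * √(2 ^ j) * shell[m, τ, j] (scal (sphMean φ)) ≤ Y) → √(2 ^ n) * shell[m, τ, n] (scal (sphMean ψ)) ≤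
    C * Y := by
  obtain ⟨C1, hC1, hsum⟩ := ChargePair.absSum_le hb m
  obtain ⟨C0, hC0, hdec⟩ := radial_decay
  refine ⟨C1 * (∑ Λ : Idx m, C0 * 2 ^ Λ.1.k + 1), by positivity, ?_⟩
  intro ψ φ hψ hφ hpair τ ht hlim n Y hn hY
  have hbn : ∀ {j}, n ≤ j → b < 2 ^ j := fun hj => hn.trans_le (two_pow_le hj)
  have cf := continuousOn_absSum (smoothCov_scal hpair.smooth) m ht
  have cg := continuousOn_absSum (smoothCov_scal hpair.smooth') m ht
  have term : ∀ Λ ∈ (univ : Finset (Idx m)), √(2 ^ n) * shellNorm n (fun x =>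
      iterAct (timeWord Λ.1.i.length Λ.1.k) (sphMean ψ) (τ, x)) ≤ C0 * 2 ^ Λ.1.k * Y := by
    rintro ⟨⟨i, _, k⟩, hak⟩ -
    set a := i.length
    replace hak : a + 9 * k ≤ m := by simp only [MultiIndex.weight] at hak; lia
    have hp := (hpair.scaling_iterate hb k).time_iterate hb a
    rw [← iterAct_append] at hp
    set g := iterAct (List.replicate a (.trans 0)) (scalSucc^[k] (sphMean φ)) with hg
    have rf : IsRadial b (iterAct (timeWord a k) (sphMean ψ)) :=
      IsRadial.of_eqOn_sphMean (iterAct_timeWord_sphMean hb hψ a k)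
    have rg : IsRadial b g := by
      have s1 := hφ.scalSucc_iterate k
      have h1 := iterAct_congr_outer ((hφ.sphMean hb).scalSucc_iterate k) (s1.sphMean hb)
        (scalSucc_iterate_sphMean hb hφ k) (List.replicate a (.trans 0))
      have h2 := iterAct_timeWord_sphMean hb s1 a 0
      simp only [timeWord, List.replicate_zero, List.append_nil] at h2
      exact IsRadial.of_eqOn_sphMean (h1.trans h2)
    have hgb : ∀ p ∈ outer b, |g p| ≤ 2 ^ k * absSum m (scal (sphMean φ)) p := by
      intro p hp
      have := abs_iterAct_scalSucc_le (hφ.sphMean hb) (List.replicate a (.trans 0)) hp k 0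
        (absSum m (scal (sphMean φ)) p) fun l hl => ?_
      · simpa using this
      · have := abs_iterAct_le_absSum (m := m) (sphMean φ) p (Λ := ⟨List.replicate a 0, [], l⟩)
          (by simp [MultiIndex.weight]; lia)
        simpa [MultiIndex.word] using this
    have hlim' : Tendsto (fun L : ℕ => √(2 ^ L) * shellNorm L
        fun x => iterAct (timeWord a k) (sphMean ψ) (τ, x)) atTop (𝓝 0) := by
      refine squeeze_zero' (.of_forall fun L =>
        mul_nonneg (sqrt_nonneg _) (shellNorm_nonneg _ _)) ?_ hlim
      filter_upwards [eventually_ge_atTop n] with L hL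
      refine mul_le_left (shellNorm_mono (hbn hL) cf fun x _ => ?_) (sqrt_nonneg _)
      have := abs_iterAct_le_absSum (m := m) (sphMean ψ) (τ, x) (Λ := ⟨List.replicate a 0, [], k⟩)
        (by simp [MultiIndex.weight]; lia)
      simpa [MultiIndex.word, timeWord] using this
    have := hdec b hb _ g hp.smooth hp.smooth' rf rg (hp.radialDeriv_eq hb) τ ht hlim' n (2 ^ k * Y)
      hn fun L => ?_
    · exact this.trans_eq (by ring)
    · refine le_trans ?_ (mul_le_left (hY L) (by positivity : (0 : ℝ) ≤ 2 ^ k))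
      rw [mul_sum]
      refine sum_le_sum fun j hj => ?_
      have hj := hbn (mem_Ico.1 hj).1
      have h1 := shellNorm_le_mul hj (by positivity : (0 : ℝ) ≤ 2 ^ k) cg fun x hx =>
        hgb _ ⟨ht, hj.trans_le hx.1⟩
      exact (mul_le_left h1 (by positivity)).trans_eq (by ring)
  have ct : ∀ Λ : Idx m, ContinuousOn (fun x =>
      |iterAct (timeWord Λ.1.i.length Λ.1.k) (sphMean ψ) (τ, x)|) {x | b < ‖x‖} := fun Λ =>
    ((hpair.smooth.iterAct _).continuousOn ht).abs
  have h1 := shellNorm_le_mul hn hC1 ((continuousOn_finsetSum _ fun Λ _ => ct Λ).add cg) fun x hx =>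
    (abs_of_nonneg (absSum_nonneg _ _ _)).trans_le (hsum _ _ hpair (τ, x) ⟨ht, hn.trans_le hx.1⟩)
  have h2 := shellNorm_add_le hn (u := fun x => timeSum m (sphMean ψ) (τ, x))
    (continuousOn_finsetSum _ fun Λ _ => ct Λ) cg
  have h3 := shellNorm_sum_le univ hn fun Λ _ => ct Λ
  simp only [shellNorm_abs] at h3
  have h4 : √(2 ^ n) * shell[m, τ, n] (scal (sphMean φ)) ≤ Y := by
    have := hY (n + 1)
    simp only [Nat.Ico_succ_singleton, sum_singleton] at this
    refine le_trans ?_ this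
    exact mul_le_right (le_mul_of_one_le_left (sqrt_nonneg _)
      (one_le_pow₀ one_le_two)) (shellNorm_nonneg _ _)
  have h7 := sum_le_sum term
  rw [← mul_sum, ← sum_mul] at h7
  have h8 := mul_le_left (h1.trans (mul_le_left
    (h2.trans (add_le_add h3 le_rfl)) hC1)) (sqrt_nonneg ((2 : ℝ) ^ n))
  refine h8.trans ?_
  have := mul_le_left (add_le_add h7 h4) hC1
  exact le_trans (le_of_eq (by ring)) (this.trans_eq (by ring))

lemma Comb.absSum_le (hb : 1 ≤ b) {l : ℕ} {Φ : (Fin l → Fin 4) → ℕ → Cov k → Scalar} (h : ∀ a, Comb (SZu b s)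
    (· = ⟨[], [], 0⟩) (Φ a)) (m : ℕ) : ∃ C : ℝ, 0 ≤ C ∧ ∀ n T T', SmoothCov b T → SmoothCov b T' → (∀ a,
    EqOn (T' a) (Φ a n T) (outer b)) → ∀ p ∈ outer b, absSum m T' p ≤ C * ‖p.2‖ ^ s * absSum m T p := by
  choose Φ' hΦ e using fun Λ : Idx m => Comb.lieIter (coeffClass_SZu hb s) h Λ.1
  choose C hC e' using fun Λ a => Comb.abs_le (fun Λ' h => h.trans Λ.2) (hΦ Λ a)
  refine ⟨∑ Λ, ∑ a, C Λ a, sum_nonneg fun Λ _ => sum_nonneg fun a _ => hC Λ a,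
    fun n T T' hT hT' he p hp => ?_⟩
  simp only [absSum, sum_mul]
  refine sum_le_sum fun Λ _ => sum_le_sum fun a _ => ?_
  rw [e Λ n T T' hT hT' he a hp]
  exact e' Λ a n T p hp

lemma Comb.term {h : ℕ → Scalar} (hh : SZu b s h) (c : Fin k → Fin 4) : Comb (SZu b s) (· = ⟨[], [], 0⟩)
    (fun n T p => h n p * T c p) :=
  Comb.single (Λ := ⟨[], [], 0⟩) c hh rfl

lemma absSum_add_le {W : Cov k} (hT : SmoothCov b T) (hT' : SmoothCov b T') (hW : SmoothCov b W) (h : ∀ a,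
    EqOn (W a) (fun p => T a p + T' a p) (outer b)) (m : ℕ) (hp : p ∈ outer b) : absSum m W p ≤ absSum m T p +
    absSum m T' p := by
  simp only [absSum, ← sum_add_distrib]
  refine sum_le_sum fun Λ _ => sum_le_sum fun a _ => ?_
  rw [lieIter_add hT hT' hW h Λ.1 a hp]
  exact abs_add_le _ _

lemma shellNorm_absSum_le {k₁ k₂ : ℕ} {T₁ : Cov k₁} {T₂ : Cov k₂} (h₁ : SmoothCov b T₁) (h₂ : SmoothCov b T₂)
    (ht : 0 ≤ τ) (hn : b < 2 ^ n) {C₁ C₂ : ℝ} (hC₁ : 0 ≤ C₁) (hC₂ : 0 ≤ C₂) (h : ∀ x ∈ dyadic n, (τ, x)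
    ∈ outer b → absSum m T (τ, x) ≤ C₁ * absSum m T₁ (τ, x) + C₂ * absSum m T₂ (τ, x)) : shell[m, τ, n] T ≤
    C₁ * shell[m, τ, n] T₁ + C₂ * shell[m, τ, n] T₂ := by
  have c₁ : ContinuousOn (fun x => C₁ * absSum m T₁ (τ, x)) {x | b < ‖x‖} :=
    continuousOn_const.mul (continuousOn_absSum h₁ m ht)
  have c₂ : ContinuousOn (fun x => C₂ * absSum m T₂ (τ, x)) {x | b < ‖x‖} :=
    continuousOn_const.mul (continuousOn_absSum h₂ m ht)
  refine (shellNorm_mono hn (c₁.add c₂) fun x hx => ?_).trans ((shellNorm_add_le hn c₁ c₂).trans_eq ?_)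
  · rw [abs_of_nonneg (absSum_nonneg _ _ _)]
    exact h x hx ⟨ht, hn.trans_le hx.1⟩
  · rw [shellNorm_const_mul, shellNorm_const_mul, abs_of_nonneg hC₁, abs_of_nonneg hC₂]

lemma zpow_neg_two_le {r : ℝ} (h : 2 ^ n ≤ r) : r ^ (-2 : ℤ) ≤ (2 ^ n)⁻¹ * (2 ^ n)⁻¹ := by
  rw [show (-2 : ℤ) = -1 + -1 by norm_num, zpow_add₀ (lt_of_lt_of_le (by positivity) h).ne', zpow_neg_one]
  have := inv_anti₀ (by positivity) h
  exact mul_le_mul this this (inv_nonneg.2 (le_trans (by positivity) h)) (by positivity)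

/-! ## Radial parts -/

lemma HomDeg.dtdr (a : Fin 2 → Fin 4) : HomDeg 0 (dtdr a) :=
  ((HomDeg.normal (a 1)).const_mul _).sub (((HomDeg.normal (a 0)).const_mul (kron (a 1) 0)).congr
    fun _ _ => mul_comm _ _)

lemma HomDeg.areaForm (a : Fin 2 → Fin 4) : HomDeg 0 (areaForm a) :=
  HomDeg.sum _ fun γ _ => (HomDeg.normal γ).const_mul _

lemma areaForm_eq (α β : Fin 4) (p : Spacetime) : areaForm ![α, β] p = ∑ γ, (epsZ 0 α β γ : ℝ) *
    normal γ p := by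
  simp [areaForm, eps_eq]

lemma compTR_radial2 (F : Cov 2) (hp : p.2 ≠ 0) : compTR (radial2 F) p = sphMean (compTR F) p := by
  have h1 : ∀ β, areaForm ![0, β] p = 0 := fun β => by
    have e : ∀ α γ : Fin 4, epsZ 0 0 α γ = 0 := by decide
    simp [areaForm_eq, e]
  have h2 : ∀ β, normal β p * dtdr ![0, β] p = normal β p * normal β p := fun β => by
    cases β using Fin.cases <;> simp [dtdr, kron, normal]
  have hn : ∑ β, normal β p * normal β p = 1 := by
    rw [sum_univ_succ]
    simpa [normal] using normal_sq hp
  simp only [compTR, radial2, h1, mul_zero, add_zero, mul_left_comm (normal _ p), h2, ← mul_sum, hn, mul_one]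

lemma compAB_radial2 (F : Cov 2) (hp : p.2 ≠ 0) : compAB (radial2 F) p = sphMean (compAB F) p := by
  have hanti : ∀ α β, radial2 F ![α, β] p = - radial2 F ![β, α] p := fun α β => by
    have e : ∀ α β γ : Fin 4, epsZ 0 α β γ = - epsZ 0 β α γ := by decide
    have h1 : areaForm ![α, β] p = - areaForm ![β, α] p := by
      simp only [areaForm_eq, e α β, Int.cast_neg, neg_mul, sum_neg_distrib]
    have h2 : dtdr ![α, β] p = - dtdr ![β, α] p := by simp [dtdr]; ring
    simp only [radial2, h1, h2]
    ring
  have c : ∀ j : Fin 3, areaForm ![(j + 1).succ, (j + 2).succ] p = normal j.succ p := fun j => by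
    have : ∀ (j : Fin 3) γ, epsZ 0 (j + 1).succ (j + 2).succ γ = if γ = j.succ then 1 else 0 := by decide
    simp [areaForm_eq, this]
  have d : ∀ i j : Fin 3, dtdr ![i.succ, j.succ] p = 0 := fun i j => by simp [dtdr, kron]
  simp only [compAB_eq hanti, radial2, c, d, mul_zero, zero_add, mul_left_comm (normal _ p),
    ← mul_sum, normal_sq hp, mul_one]

lemma radial3_spatial (G : Cov 3) (p : Spacetime) : radial3 G ![1, 2, 3] p = sphMean (G ![1, 2, 3]) p := by
  have h : epsZ 0 1 2 3 = 1 := by decide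
  simp [radial3, dtWedge, kron, eps_eq, h]

section

lemma smooth_compTR (hb : 1 ≤ b) (hF : SmoothCov b F) : SmoothOuter b (compTR F) :=
  SmoothOuter.sum fun β _ => ((HomDeg.normal β).smoothOuter hb).mul (hF _)

lemma smooth_radial2 (hb : 1 ≤ b) (hF : SmoothCov b F) : SmoothCov b (radial2 F) := fun a =>
  (((smooth_compTR hb hF).sphMean hb).mul ((HomDeg.dtdr a).smoothOuter hb)).add
    (((smooth_compAB hb hF).sphMean hb).mul ((HomDeg.areaForm a).smoothOuter hb))

lemma smooth_radial3 (hb : 1 ≤ b) {G : Cov 3} (hG : SmoothCov b G) : SmoothCov b (radial3 G) := fun a =>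
  (((smooth_compAB hb fun c => hG ![0, c 0, c 1]).sphMean hb).mul
    ((((smooth_areaForm hb _).const_mul _).add ((smooth_areaForm hb _).const_mul _)).add
      ((smooth_areaForm hb _).const_mul _))).add
    (((hG _).sphMean hb).mul (SmoothOuter.const _))

lemma comb_compTR (hb : 1 ≤ b) : Comb (k := 2) (SZu b 0) (· = ⟨[], [], 0⟩) (fun _ F p => compTR F p) :=
  Comb.sum _ fun β _ => Comb.term ((HomDeg.normal β).SZu hb) ![0, β]

lemma comb_compAB (hb : 1 ≤ b) : Comb (k := 2) (SZu b 0) (· = ⟨[], [], 0⟩) (fun _ F p => compAB F p) :=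
  Comb.const_mul (coeffClass_SZu hb 0) _ (Comb.sum _ fun α _ => Comb.sum _ fun β _ =>
    Comb.term ((HomDeg.areaForm ![α, β]).SZu hb) ![α, β])

lemma absSum_radial2_le (hb : 1 ≤ b) (m : ℕ) : ∃ C : ℝ, 0 ≤ C ∧ ∀ F, SmoothCov b F → ∀ p ∈ outer b,
    absSum m (radial2 F) p ≤ C * (absSum m (scal (sphMean (compTR F))) p +
    absSum m (scal (sphMean (compAB F))) p) := by
  obtain ⟨C1, hC1, e1⟩ := Comb.absSum_le (k := 0) hb (fun a : Fin 2 → Fin 4 =>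
    Comb.term ((HomDeg.dtdr a).SZu hb) default) m
  obtain ⟨C2, hC2, e2⟩ := Comb.absSum_le (k := 0) hb (fun a : Fin 2 → Fin 4 =>
    Comb.term ((HomDeg.areaForm a).SZu hb) default) m
  refine ⟨C1 + C2, add_nonneg hC1 hC2, fun F hF p hp => ?_⟩
  have t1 := (smooth_compTR hb hF).sphMean hb
  have t2 := (smooth_compAB hb hF).sphMean hb
  have s1 : SmoothCov b fun a p => dtdr a p * sphMean (compTR F) p := fun a =>
    ((HomDeg.dtdr a).smoothOuter hb).mul t1
  have s2 : SmoothCov b fun a p => areaForm a p * sphMean (compAB F) p := fun a =>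
    ((HomDeg.areaForm a).smoothOuter hb).mul t2
  have h := absSum_add_le s1 s2 (smooth_radial2 hb hF) (fun a q _ => by simp only [radial2]; ring) m hp
  have h1 := e1 0 _ _ (smoothCov_scal t1) s1 (fun a q _ => rfl) p hp
  have h2 := e2 0 _ _ (smoothCov_scal t2) s2 (fun a q _ => rfl) p hp
  simp only [zpow_zero, mul_one] at h1 h2
  have := absSum_nonneg m (scal (sphMean (compTR F))) p
  have := absSum_nonneg m (scal (sphMean (compAB F))) p
  nlinarith

/-- The difference of the spherical components of the Hodge stars of `g` and of the model. -/
def modelError (g g0 : Metric4) (F : Cov 2) (p : Spacetime) : ℝ :=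
  (1 / 2) * ∑ α, ∑ β, ∑ μ, ∑ ν, areaForm ![α, β] p *
    (hodgeCoef (g p) ![α, β] μ ν - hodgeCoef (g0 p) ![α, β] μ ν) * F ![μ, ν] p

namespace StarAsymptotics

variable {g g0 : Metric4} {α : ℝ → ℝ}

lemma comb_modelError (h : StarAsymptotics b g g0 α) :
    Comb (k := 2) (SZu b (-2)) (· = ⟨[], [], 0⟩)
    (fun _ F p => modelError g g0 F p) := by
  have hb := h.one_le
  refine Comb.const_mul (coeffClass_SZu hb _) _ (Comb.sum _ fun α _ => Comb.sum _ fun β _ =>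
    Comb.sum _ fun μ _ => Comb.sum _ fun ν _ => Comb.term ?_ ![μ, ν])
  simpa using ((HomDeg.areaForm ![α, β]).SZu hb).mul hb (h.near_model ![α, β] μ ν)

lemma smooth_modelError (h : StarAsymptotics b g g0 α) (hF : SmoothCov b F) : SmoothOuter b (modelError g g0 F) :=
  h.comb_modelError.smooth (coeffClass_SZu h.one_le _) 0 hF

lemma compAB_hodge (h : StarAsymptotics b g g0 α) (hA : AntiOuter b F) : EqOn (compAB (hodge g F))
    (fun p => α ‖p.2‖ * compTR F p + modelError g g0 F p) (outer b) := fun p hp => by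
  simp only
  rw [← h.model F p hp fun α β => hA α β hp]
  simp only [compAB, modelError, hodge_eq, ← mul_add, ← sum_add_distrib]
  simp only [mul_sum, ← sum_add_distrib]
  exact sum_congr rfl fun _ _ => sum_congr rfl fun _ _ => sum_congr rfl
    fun _ _ => sum_congr rfl fun _ _ => by ring

lemma sphMean_compAB_hodge (h : StarAsymptotics b g g0 α) (hF : SmoothCov b F) (hA : AntiOuter b F) :
    EqOn (sphMean (compAB (hodge g F))) (fun p => α ‖p.2‖ * sphMean (compTR F) p + sphMean (modelError g g0 F)
    p) (outer b) := by
  intro p hp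
  rw [sphMean_congr (h.compAB_hodge hA) hp, sphMean_add ((h.factor.1 0).mul (smooth_compTR h.one_le hF))
    (h.smooth_modelError hF) hp, sphMean_radial_mul fun _ r => α r]

/-- Bound for the radial part of a solution with no charge at infinity. -/
lemma radial_bound (h : StarAsymptotics b g g0 α) (m : ℕ) : ∃ C : ℝ, 0 ≤ C ∧ ∀ (F : Cov 2) (τ X : ℝ), 0 ≤ τ →
    SmoothCov b F → AntiOuter b F → (∀ᶠ L : ℕ in atTop, shell[m, τ, L] F ≤ √(2 ^ L) * X) → Tendsto (fun L :
    ℕ => √(2 ^ L) * shell[m, τ, L] (radial2 F)) atTop (𝓝 0) → ∀ (n : ℕ) (Y : ℝ), b < 2 ^ n → (∀ L,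
    ∑ j ∈ Ico n L, 2 ^ j * √(2 ^ j) * (shell[m, τ, j] (radial3 (extD0 F)) + shell[m, τ, j]
    (radial3 (extD0 (hodge g F)))) ≤ Y) → √(2 ^ n) * shell[m, τ, n] (radial2 F) ≤ C * (Y + √(2 ^ n) *
    ((2 ^ n)⁻¹ * (2 ^ n)⁻¹) * shell[m, τ, n] F) ∧ √(2 ^ n) * shell[m, τ, n] (scal (sphMean (compAB F))) ≤ C *
    Y ∧ √(2 ^ n) * shell[m, τ, n] (scal (sphMean (compAB (hodge g F)))) ≤ C * Y := by
  have hb := h.one_le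
  obtain ⟨K, hK, decay⟩ := chargePair_decay hb m
  obtain ⟨M, hM, mean⟩ := shellNorm_absSum_sphMean_le hb m
  obtain ⟨Cr, hCr, er⟩ := absSum_radial2_le hb m
  obtain ⟨Ct, hCt, et⟩ := Comb.absSum_le (l := 0) hb (fun _ => comb_compTR hb) m
  obtain ⟨Ca, hCa, ea⟩ := Comb.absSum_le (l := 0) hb (fun _ => comb_compAB hb) m
  obtain ⟨Ce, hCe, ee⟩ := Comb.absSum_le (l := 0) hb (fun _ => h.comb_modelError) m
  obtain ⟨Cf, hCf, ef⟩ := Comb.absSum_le (k := 0) (l := 0) hb (fun _ => Comb.term h.factor default) m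
  obtain ⟨Ci, hCi, ei⟩ := Comb.absSum_le (k := 0) (l := 0) hb (fun _ => Comb.term h.factor_inv default) m
  obtain ⟨Cn, hCn, en⟩ := Comb.absSum_le (k := 0) (l := 0) hb
    (fun _ => Comb.term (SZu.const (b := b) (-1)) default) m
  obtain ⟨Cs, hCs, es⟩ := Comb.absSum_le (k := 3) (l := 0) hb
    (fun _ => Comb.term (SZu.const (b := b) 1) ![1, 2, 3]) m
  refine ⟨Cr * (Ci * (K * Cs) + Ci * (Cn * (M * Ce)) + K * Cs) + K * Cs, by positivity,
    fun F τ X ht hF hA hX hlim n Y hn hY => ?_⟩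
  have hho := smooth_hodge h.near_mink hF
  have aho : AntiOuter b (hodge g F) := antiOuter_hodge
  have sR := smooth_radial2 hb hF
  have sT := smooth_compTR hb hF
  have sE := h.smooth_modelError hF
  have smT := smoothCov_scal (sT.sphMean hb)
  have smE := smoothCov_scal (sE.sphMean hb)
  have smB : SmoothCov b (scal (sphMean (compAB (hodge g F)))) :=
    smoothCov_scal ((smooth_compAB hb hho).sphMean hb)
  have smA : SmoothCov b (scal (sphMean (compAB F))) := smoothCov_scal ((smooth_compAB hb hF).sphMean hb)
  have hbn : ∀ {j}, n ≤ j → b < 2 ^ j := fun hj => hn.trans_le (two_pow_le hj)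
  have one : ∀ {k k' : ℕ} {T : Cov k} {T' : Cov k'} {C : ℝ}, SmoothCov b T' → 0 ≤ C →
      (∀ p ∈ outer b, absSum m T p ≤ C * ‖p.2‖ ^ (0 : ℤ) * absSum m T' p) → ∀ j, b < 2 ^ j →
      shell[m, τ, j] T ≤ C * shell[m, τ, j] T' := by
    intro k k' T T' C hT' hC hle j hj
    have := shellNorm_absSum_le (m := m) (T := T) hT' hT' ht hj hC le_rfl fun x _ hx => by
      simpa using hle _ hx
    simpa using this
  have hmE : ∀ j, b < 2 ^ j → shell[m, τ, j] (scal (sphMean (modelError g g0 F))) ≤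
      M * (Ce * ((2 ^ j)⁻¹ * (2 ^ j)⁻¹) * shell[m, τ, j] F) := fun j hj => by
    refine (mean _ sE τ ht j hj).trans (mul_le_left ?_ hM)
    have := shellNorm_absSum_le (m := m) (T := scal (modelError g g0 F)) hF hF ht hj
      (C₁ := Ce * ((2 ^ j)⁻¹ * (2 ^ j)⁻¹)) (C₂ := 0) (by positivity) le_rfl fun x hx hx' => by
        rw [zero_mul, add_zero]
        refine (ee 0 F _ hF (smoothCov_scal sE) (fun a p _ => rfl) _ hx').trans ?_
        exact mul_le_right (mul_le_left (zpow_neg_two_le hx.1) hCe)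
          (absSum_nonneg _ _ _)
    simpa using this
  have hT := one sR hCt (et 0 (radial2 F) (scal (sphMean (compTR F))) sR smT fun a p hp =>
    (compTR_radial2 F (outer_ne_zero hb hp)).symm)
  have hA' := one sR hCa (ea 0 (radial2 F) (scal (sphMean (compAB F))) sR smA fun a p hp =>
    (compAB_radial2 F (outer_ne_zero hb hp)).symm)
  have hsrc : ∀ {W : Cov 2}, SmoothCov b W → ∀ j, b < 2 ^ j →
      shell[m, τ, j] (scal (sphMean (extD0 W ![1, 2, 3]))) ≤
        Cs * shell[m, τ, j] (radial3 (extD0 W)) := fun {W} hW =>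
    one (smooth_radial3 hb (smooth_extD0 hW)) hCs (es 0 _ _ (smooth_radial3 hb (smooth_extD0 hW))
      (smoothCov_scal ((smooth_extD0 hW _).sphMean hb)) fun a p hp => by
        simp only [one_mul, radial3_spatial]; rfl)
  have hYj : ∀ {W : Cov 2}, SmoothCov b W → (∀ j, shell[m, τ, j] (radial3 (extD0 W)) ≤
      shell[m, τ, j] (radial3 (extD0 F)) +
      shell[m, τ, j] (radial3 (extD0 (hodge g F)))) →
      ∀ L, ∑ j ∈ Ico n L, 2 ^ j * √(2 ^ j) *
        shell[m, τ, j] (scal (sphMean (extD0 W ![1, 2, 3]))) ≤ Cs * Y := by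
    intro W hW hle L
    refine le_trans ?_ (mul_le_left (hY L) hCs)
    rw [mul_sum]
    refine sum_le_sum fun j hj => ?_
    have h1 := (hsrc hW j (hbn (mem_Ico.1 hj).1)).trans (mul_le_left (hle j) hCs)
    exact (mul_le_left h1 (by positivity)).trans_eq (by ring)
  have ev : ∀ᶠ L : ℕ in atTop, b < 2 ^ L := by filter_upwards [eventually_ge_atTop n] with L hL using hbn hL
  have nn : ∀ {k} (T : Cov k) (j : ℕ), 0 ≤ √(2 ^ j) * shell[m, τ, j] T :=
    fun T j => mul_nonneg (sqrt_nonneg _) (shellNorm_nonneg _ _)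
  have dA := decay _ _ (smooth_compAB hb hF) (smooth_extD0 hF _) (sphMean_chargePair hb hF hA) τ ht
    (squeeze_zero' (g := fun L : ℕ => Ca * (√(2 ^ L) * shellNorm L fun x =>
      absSum m (radial2 F) (τ, x))) (.of_forall fun L => nn _ L) (ev.mono fun L hL =>
      (mul_le_left (hA' L hL) (sqrt_nonneg _)).trans_eq (by ring))
      (by simpa using hlim.const_mul Ca)) n (Cs * Y) hn
    (hYj hF fun j => le_add_of_nonneg_right (shellNorm_nonneg _ _))
  have hB : ∀ L, b < 2 ^ L → shell[m, τ, L] (scal (sphMean (compAB (hodge g F)))) ≤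
      Cf * shell[m, τ, L] (scal (sphMean (compTR F))) +
      1 * shell[m, τ, L] (scal (sphMean (modelError g g0 F))) := fun L hL => by
    have s1 : SmoothCov b (scal fun p => α ‖p.2‖ * sphMean (compTR F) p) :=
      smoothCov_scal ((h.factor.1 0).mul (sT.sphMean hb))
    refine shellNorm_absSum_le smT smE ht hL hCf zero_le_one fun x _ hx => ?_
    refine (absSum_add_le s1 smE smB (fun a p hp => h.sphMean_compAB_hodge hF hA hp) m hx).trans ?_
    have := ef 0 _ _ smT s1 (fun a p _ => rfl) _ hx
    simp only [zpow_zero, mul_one] at this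
    rw [one_mul]
    exact add_le_add this le_rfl
  have hlimB : Tendsto (fun L : ℕ => Cf * (Ct * (√(2 ^ L) * shell[m, τ, L] (radial2 F)))
      + M * (Ce * X) * ((2 : ℝ)⁻¹ ^ L)) atTop (𝓝 0) := by
    have h2 := tendsto_pow_atTop_nhds_zero_of_lt_one (r := (2 : ℝ)⁻¹) (by norm_num) (by norm_num)
    simpa using ((hlim.const_mul Ct).const_mul Cf).add (h2.const_mul (M * (Ce * X)))
  have dB := decay _ _ (smooth_compAB hb hho) (smooth_extD0 hho _) (sphMean_chargePair hb hho aho) τ ht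
    (squeeze_zero' (.of_forall fun L => nn _ L) ((ev.and hX).mono fun L ⟨hL, hXL⟩ => by
      have h1 := hB L hL
      have h2 := mul_le_left (hT L hL) hCf
      have h3 := (hmE L hL).trans (mul_le_left (mul_le_left hXL
        (by positivity)) hM)
      rw [one_mul] at h1
      have h4 := mul_le_left (h1.trans (add_le_add h2 h3)) (sqrt_nonneg (2 ^ L))
      refine h4.trans_eq ?_
      have h5 : √((2 : ℝ) ^ L) * √(2 ^ L) = 2 ^ L := mul_self_sqrt (by positivity)
      have h6 : ((2 : ℝ) ^ L)⁻¹ * 2 ^ L = 1 := inv_mul_cancel₀ (by positivity)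
      simp only [inv_pow]
      linear_combination M * Ce * X * (2 ^ L)⁻¹ * (2 ^ L)⁻¹ * h5 + M * Ce * X * (2 ^ L)⁻¹ * h6) hlimB)
    n (Cs * Y) hn (hYj hho fun j => le_add_of_nonneg_left (shellNorm_nonneg _ _))
  have hTB : shell[m, τ, n] (scal (sphMean (compTR F))) ≤
      Ci * shell[m, τ, n] (scal (sphMean (compAB (hodge g F)))) +
      Ci * Cn * shell[m, τ, n] (scal (sphMean (modelError g g0 F))) := by
    have s1 : SmoothCov b (scal fun p => -1 * sphMean (modelError g g0 F) p) :=
      smoothCov_scal ((sE.sphMean hb).const_mul _)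
    have s2 : SmoothCov b (scal fun p => sphMean (compAB (hodge g F)) p +
      -1 * sphMean (modelError g g0 F) p) := fun a => (smB a).add (s1 a)
    refine shellNorm_absSum_le smB smE ht hn hCi (mul_nonneg hCi hCn) fun x _ hx => ?_
    have h1 := ei 0 _ (scal (sphMean (compTR F))) s2 smT (fun a p hp => by
      have := h.factor_ne p hp
      simp only [scal, h.sphMean_compAB_hodge hF hA hp]
      field_simp
      ring) _ hx
    have h2 := en 0 _ _ smE s1 (fun a p _ => rfl) _ hx
    have h3 := absSum_add_le smB s1 s2 (fun a p _ => rfl) m hx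
    simp only [zpow_zero, mul_one] at h1 h2
    refine h1.trans ((mul_le_left (h3.trans (add_le_add le_rfl h2)) hCi).trans_eq (by ring))
  have hfin := shellNorm_absSum_le (m := m) (T := radial2 F) smT smA ht hn hCr hCr fun x _ hx =>
    (er F hF _ hx).trans_eq (mul_add _ _ _)
  have hsq := sqrt_nonneg ((2 : ℝ) ^ n)
  have t1 := mul_le_left (hTB.trans (add_le_add le_rfl
    (mul_le_left (hmE n hn) (mul_nonneg hCi hCn)))) hsq
  have t2 := mul_le_left dB hCi
  have t3 := mul_le_left hfin hsq
  have t4 := mul_le_left t1 hCr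
  have t5 := mul_le_left t2 hCr
  have t6 := mul_le_left dA hCr
  set Q := √((2 : ℝ) ^ n) * ((2 ^ n)⁻¹ * (2 ^ n)⁻¹) * shell[m, τ, n] F with hQ
  have hQ0 : 0 ≤ Q := mul_nonneg (by positivity) (shellNorm_nonneg _ _)
  have hY0 : 0 ≤ Y := by simpa using hY n
  have e1 : 0 ≤ Cr * (Ci * (Cn * (M * Ce))) * Y := by positivity
  have e2 : 0 ≤ Cr * (Ci * (K * Cs) + K * Cs) * Q := by positivity
  have e3 : √(2 ^ n) * (M * (Ce * ((2 ^ n)⁻¹ * (2 ^ n)⁻¹) *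
    shell[m, τ, n] F)) = M * Ce * Q := by rw [hQ]; ring
  have e4 := congrArg (fun z => Cr * (Ci * Cn) * z) e3
  have e5 : 0 ≤ K * Cs * Y := by positivity
  have e6 : 0 ≤ K * Cs * Q := by positivity
  have e7 : 0 ≤ Cr * (Ci * (K * Cs) + Ci * (Cn * (M * Ce)) + K * Cs) * Y := by positivity
  clear_value Q
  exact ⟨by linarith, by linarith, by linarith⟩

end StarAsymptotics

end

/-! ## Local energy norms by shells -/

/-- The `L²` norm of `⟨r⟩^{j/2} T^{≤ m}` over the part in `D` of one shell. -/
def shellSum (ρ : ℝ → ℝ) (D : Set Space) (m : ℕ) (τ : ℝ) (j : ℤ) (n : ℕ) (T : Cov k) : ℝ≥0∞ :=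
  ∑ Λ : Idx m, ∑ a, eLpNorm (fun x => √(ρ ‖x‖) ^ j * lieIter Λ.1 T a (τ, x)) 2
    (volume.restrict (shell ρ n ∩ D))

section

variable {ρ : ℝ → ℝ} {D : Set Space} {j : ℤ}

lemma IsBracket.sqrt_weight (hρ : IsBracket ρ) (s : ℤ) (x : Space) (u : ℝ) : ρ ‖x‖ ^ (-(1 / 2) : ℝ) *
    (ρ ‖x‖ ^ s * u) = √(ρ ‖x‖) ^ (2 * s - 1) * u ∧ ρ ‖x‖ ^ (1 / 2 : ℝ) * (ρ ‖x‖ ^ s * u) = √(ρ ‖x‖) ^ (2 * s +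
    1) * u := by
  have h0 : 0 < ρ ‖x‖ := lt_of_lt_of_le two_pos (hρ.two_le _ (norm_nonneg _))
  have h1 : √(ρ ‖x‖) ≠ 0 := (sqrt_pos.2 h0).ne'
  have h2 : √(ρ ‖x‖) ^ (2 * s) = ρ ‖x‖ ^ s := by rw [zpow_mul, zpow_ofNat, sq_sqrt h0.le]
  rw [zpow_sub₀ h1, zpow_add₀ h1, h2, rpow_neg h0.le, ← sqrt_eq_rpow, zpow_one]
  constructor <;> ring

lemma normLEstar_eq (hρ : IsBracket ρ) (s : ℤ) : normLEstar ρ D s m τ T = ∑' n, shellSum ρ D m τ (2 * s + 1)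
    n T := by
  simp only [normLEstar, scalarLEstar, shellSum, (hρ.sqrt_weight s _ _).2]
  rw [tsum_fintype, Summable.tsum_finsetSum fun _ _ => ENNReal.summable]
  exact sum_congr rfl fun Λ _ => (Summable.tsum_finsetSum fun _ _ => ENNReal.summable).symm

lemma shellSum_le_normLE (hρ : IsBracket ρ) (s : ℤ) : shellSum ρ D m τ (2 * s - 1) n T ≤
    normLE ρ D s m τ T := by
  simp only [normLE, scalarLE, shellSum, (hρ.sqrt_weight s _ _).1]
  rw [tsum_fintype]
  exact sum_le_sum fun Λ _ => sum_le_sum fun a _ => le_iSup (fun n => eLpNorm (fun x =>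
    √(ρ ‖x‖) ^ (2 * s - 1) * lieIter Λ.1 T a (τ, x)) 2 (volume.restrict (shell ρ n ∩ D))) n

/-- The number of components of `T^{≤ m}`. -/
def compCount (m k : ℕ) : ℕ := ∑ _ : Idx m, ∑ _ : Fin k → Fin 4, 1

lemma normLE_le (hρ : IsBracket ρ) (s : ℤ) {A : ℝ≥0∞} (h : ∀ n, shellSum ρ D m τ (2 * s - 1) n T ≤ A) :
    normLE ρ D s m τ T ≤ compCount m k * A := by
  simp only [normLE, scalarLE, (hρ.sqrt_weight s _ _).1, compCount]
  rw [tsum_fintype]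
  push_cast
  simp only [sum_mul, one_mul]
  refine sum_le_sum fun Λ _ => sum_le_sum fun a _ => iSup_le fun n => ?_
  exact ((single_le_sum (f := fun a => eLpNorm (fun x => √(ρ ‖x‖) ^ (2 * s - 1) *
    lieIter Λ.1 T a (τ, x)) 2 (volume.restrict (shell ρ n ∩ D))) (fun _ _ => zero_le)
    (mem_univ a)).trans (single_le_sum (f := fun Λ : Idx m => ∑ a, eLpNorm (fun x =>
    √(ρ ‖x‖) ^ (2 * s - 1) * lieIter Λ.1 T a (τ, x)) 2 (volume.restrict (shell ρ n ∩ D)))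
    (fun _ _ => zero_le) (mem_univ Λ))).trans (h n)

lemma one_le_sqrt_bracket (hρ : IsBracket ρ) (x : Space) : 1 ≤ √(ρ ‖x‖) :=
  one_le_sqrt.2 (one_le_two.trans (hρ.two_le _ (norm_nonneg _)))

lemma shellSum_mono (hρ : IsBracket ρ) {j' : ℤ} (h : j ≤ j') : shellSum ρ D m τ j n T ≤
    shellSum ρ D m τ j' n T :=
  sum_le_sum fun Λ _ => sum_le_sum fun a _ => eLpNorm_mono fun x => by
    have h1 := one_le_sqrt_bracket hρ x
    rw [norm_mul, norm_mul]
    refine mul_le_right ?_ (norm_nonneg _)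
    rw [norm_of_nonneg (by positivity), norm_of_nonneg (by positivity)]
    exact zpow_le_zpow_right₀ h1 h

lemma measurableSet_shell (hρ : IsBracket ρ) (hD : MeasurableSet D) (n : ℕ) :
    MeasurableSet (shell ρ n ∩ D) := by
  have := hρ.smooth.continuous
  exact ((measurableSet_le measurable_const this.measurable).inter
    (measurableSet_lt this.measurable measurable_const)).inter hD

lemma shellSum_add_two_le (hρ : IsBracket ρ) (hD : MeasurableSet D) : shellSum ρ D m τ (j + 2) n T ≤
    ofReal (2 ^ (n + 1)) * shellSum ρ D m τ j n T := by
  simp only [shellSum, mul_sum]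
  refine sum_le_sum fun Λ _ => sum_le_sum fun a _ => ?_
  refine eLpNorm_le_mul_eLpNorm_of_ae_le_mul ?_ 2
  filter_upwards [ae_restrict_mem (measurableSet_shell hρ hD n)] with x hx
  have h0 := one_le_sqrt_bracket hρ x
  have h1 : √(ρ ‖x‖) ^ 2 = ρ ‖x‖ := sq_sqrt (zero_le_two.trans (hρ.two_le _ (norm_nonneg _)))
  have h2 := hx.1.2
  rw [zpow_add₀ (by positivity), zpow_ofNat, h1, mul_comm _ (ρ ‖x‖), mul_assoc, norm_mul]
  refine mul_le_right ?_ (norm_nonneg _)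
  rw [norm_of_nonneg (h1 ▸ sq_nonneg _)]
  exact h2.le

lemma shellSum_congr (hρ : IsBracket ρ) (hD : MeasurableSet D) {O : Set Spacetime} (hO : IsOpen O) (h : ∀ a,
    EqOn (T a) (T' a) O) (hs : ∀ x ∈ shell ρ n ∩ D, (τ, x) ∈ O) : shellSum ρ D m τ j n T =
    shellSum ρ D m τ j n T' :=
  sum_congr rfl fun Λ _ => sum_congr rfl fun a _ => eLpNorm_congr_ae <| by
    filter_upwards [ae_restrict_mem (measurableSet_shell hρ hD n)] with x hx
    rw [(lieIter_congr_nhds (fun c => (h c).eventuallyEq_of_mem (hO.mem_nhds (hs x hx))) Λ.1 a).eq_of_nhds]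

lemma lie_zero (X : VField) : lie X (fun _ _ => 0 : Cov k) = fun _ _ => 0 := by
  funext a p
  simp [lie, pd]

lemma lieIter_zero (Λ : MultiIndex) : lieIter Λ (fun _ _ => 0 : Cov k) = fun _ _ => 0 := by
  have h : ∀ {ι : Type} (X : ι → VField) (l : List ι),
      l.foldr (fun i W => lie (X i) W) (fun _ _ => 0 : Cov k) = fun _ _ => 0 := fun X l => by
    induction l with
    | nil => rfl
    | cons i l ih => rw [List.foldr_cons, ih, lie_zero]
  obtain ⟨i, l, r⟩ := Λ
  simp only [lieIter, iterate_eq_foldr]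
  rw [h (fun _ : Unit => scaling), h rotation, h translation]

lemma shellSum_zero : shellSum ρ D m τ j n (fun _ _ => 0 : Cov k) = 0 := by simp [shellSum, lieIter_zero]

end

/-- For `n ≥ n0` the shells are the dyadic ones. -/
structure FarShells (ρ : ℝ → ℝ) (R0 b : ℝ) (n0 : ℕ) : Prop where
  bracket : IsBracket ρ
  le : R0 ≤ b
  lt : b < 2 ^ n0
  eq_self : ∀ r, b ≤ r → ρ r = r
  near : ∀ r, 0 ≤ r → r ≤ b → ρ r < 2 ^ n0

lemma IsBracket.exists_farShells {ρ : ℝ → ℝ} (hρ : IsBracket ρ) {R0 : ℝ} (hR : R0 ≤ b) (hb : ∀ r, b ≤ r →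
    ρ r = r) : ∃ N, ∀ n0 ≥ N, FarShells ρ R0 b n0 := by
  obtain ⟨B, hB⟩ := (isCompact_closedBall (0 : Space) b).bddAbove_image hρ.smooth.continuous.continuousOn
  obtain ⟨N, hN⟩ := pow_unbounded_of_one_lt (max B b) (one_lt_two (α := ℝ))
  refine ⟨N, fun n hn => ?_⟩
  have h2 := hN.trans_le (two_pow_le hn)
  refine ⟨hρ, hR, (le_max_right _ _).trans_lt h2, hb, fun r hr hrb => ?_⟩
  have hr' : ‖EuclideanSpace.single (0 : Fin 3) r‖ = r := by simp [abs_of_nonneg hr]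
  have := hB ⟨EuclideanSpace.single (0 : Fin 3) r, by simpa [abs_of_nonneg hr] using hrb, rfl⟩
  simp only [hr'] at this
  exact (this.trans (le_max_left _ _)).trans_lt h2

lemma zpow_comparable {σ y : ℝ} (hσ : 0 < σ) (h1 : σ ≤ y) (h2 : y ≤ 2 * σ) (j : ℤ) : y ^ j ≤ 2 ^ j.natAbs *
    σ ^ j ∧ σ ^ j ≤ 2 ^ j.natAbs * y ^ j := by
  have hy := hσ.trans_le h1
  have key : ∀ n : ℕ, y ^ n ≤ 2 ^ n * σ ^ n ∧ σ ^ n ≤ 2 ^ n * y ^ n := fun n => by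
    rw [← mul_pow, ← mul_pow]
    exact ⟨pow_le_pow_left₀ hy.le h2 n, pow_le_pow_left₀ hσ.le (by linarith) n⟩
  cases j with
  | ofNat n => simpa using key n
  | negSucc n =>
    obtain ⟨k1, k2⟩ := key (n + 1)
    simp only [zpow_negSucc, Int.natAbs_negSucc, Nat.succ_eq_add_one]
    have a := pow_pos hσ (n + 1)
    have c := pow_pos hy (n + 1)
    constructor
    · rwa [inv_le_iff_one_le_mul₀ c, mul_right_comm, ← div_eq_mul_inv, one_le_div a]
    · rwa [inv_le_iff_one_le_mul₀ a, mul_right_comm, ← div_eq_mul_inv, one_le_div c]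

lemma eLpNorm_dyadic (hn : b < 2 ^ n) {u : Space → ℝ} (hu : ContinuousOn u {x | b < ‖x‖}) :
    eLpNorm u 2 (volume.restrict (dyadic n)) = ofReal (shellNorm n u) := by
  have hm : MeasurableSet (dyadic n) := measurableSet_dyadicRange _ _
  have hc : ContinuousOn u (dyadic n) := hu.mono fun x hx => hn.trans_le hx.1
  have h2 : MemLp u 2 (volume.restrict (dyadic n)) :=
    (memLp_two_iff_integrable_sq (hc.aestronglyMeasurable hm)).2 (integrableOn_dyadic hn (hu.pow 2))
  rw [h2.eLpNorm_eq_integral_rpow_norm two_ne_zero ENNReal.ofNat_ne_top]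
  simp [shellNorm, sqrt_eq_rpow]

namespace FarShells

variable {ρ : ℝ → ℝ} {R0 : ℝ} {n0 : ℕ}

lemma shell_inter (h : FarShells ρ R0 b n0) (hn : n0 ≤ n) : shell ρ n ∩ region R0 = dyadic n := by
  have h2 : (2 : ℝ) ^ n0 ≤ 2 ^ n := two_pow_le hn
  ext x
  constructor
  · rintro ⟨⟨h3, h4⟩, -⟩
    rcases le_total ‖x‖ b with h5 | h5
    · linarith [h.near _ (norm_nonneg x) h5]
    · rw [h.eq_self _ h5] at h3 h4
      exact ⟨h3, h4⟩
  · rintro ⟨h3, h4⟩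
    have h5 : b ≤ ‖x‖ := h.lt.le.trans (h2.trans h3)
    exact ⟨⟨by rwa [h.eq_self _ h5], by rwa [h.eq_self _ h5]⟩, h.le.trans h5⟩

lemma norm_lt (h : FarShells ρ R0 b n0) {n1 : ℕ} (h1 : n0 ≤ n1) (hn : n < n1) (hx : x ∈ shell ρ n) : ‖x‖ <
    2 ^ n1 := by
  by_contra hc
  have h2 : (2 : ℝ) ^ n0 ≤ 2 ^ n1 := two_pow_le h1
  have h3 : (2 : ℝ) ^ (n + 1) ≤ 2 ^ n1 := two_pow_le hn
  have h4 := hx.2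
  rw [h.eq_self _ (h.lt.le.trans (h2.trans (not_lt.1 hc)))] at h4
  linarith

lemma shellSum_comparable (h : FarShells ρ R0 b n0) (hT : SmoothCov b T) (ht : 0 ≤ τ) (hn : n0 ≤ n) {D :
    Set Space} (hD : shell ρ n ∩ D = dyadic n) (j : ℤ) : shellSum ρ D m τ j n T ≤
    ofReal (compCount m k * 2 ^ j.natAbs * (√(2 ^ n) ^ j * shell[m, τ, n] T)) ∧
    ofReal (√(2 ^ n) ^ j * shell[m, τ, n] T) ≤ ofReal (2 ^ j.natAbs) *
    shellSum ρ D m τ j n T := by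
  have hbn : b < 2 ^ n := h.lt.trans_le (two_pow_le hn)
  have hm : MeasurableSet (dyadic n) := measurableSet_dyadicRange _ _
  have hσ : 0 < √((2 : ℝ) ^ n) := by positivity
  have hw : ∀ x ∈ dyadic n, 0 < √(ρ ‖x‖) ∧ √(ρ ‖x‖) ^ j ≤ 2 ^ j.natAbs * √(2 ^ n) ^ j ∧
      √(2 ^ n) ^ j ≤ 2 ^ j.natAbs * √(ρ ‖x‖) ^ j := fun x hx => by
    rw [h.eq_self _ (hbn.le.trans hx.1)]
    have h1 : √((2 : ℝ) ^ n) ≤ √‖x‖ := sqrt_le_sqrt hx.1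
    refine ⟨hσ.trans_le h1, zpow_comparable hσ h1 ?_ j⟩
    rw [sqrt_le_left (by positivity), mul_pow, sq_sqrt (by positivity)]
    have := hx.2
    rw [pow_succ] at this
    nlinarith [pow_pos (two_pos (α := ℝ)) n]
  have hL := eLpNorm_dyadic hbn (continuousOn_absSum hT m ht)
  rw [shellSum, hD]
  constructor
  · rw [mul_assoc, ofReal_mul (Nat.cast_nonneg _), ENNReal.ofReal_natCast, ← mul_assoc _ (√(2 ^ n) ^ j),
      ofReal_mul (by positivity), ← hL, compCount]
    push_cast
    simp only [sum_mul, one_mul]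
    refine sum_le_sum fun Λ _ => sum_le_sum fun a _ => ?_
    refine eLpNorm_le_mul_eLpNorm_of_ae_le_mul ?_ 2
    filter_upwards [ae_restrict_mem hm] with x hx
    obtain ⟨h0, h1, -⟩ := hw x hx
    rw [norm_mul, norm_of_nonneg (by positivity), norm_of_nonneg (absSum_nonneg _ _ _)]
    exact mul_le_mul h1 (abs_lieIter_le_absSum T _ Λ.2 a) (norm_nonneg _) (by positivity)
  · have hc : ∀ (Λ : Idx m) a, AEStronglyMeasurable (fun x => |lieIter Λ.1 T a (τ, x)|)
        (volume.restrict (dyadic n)) := fun Λ a =>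
      ((((hT.lieIter Λ.1) a).continuousOn ht).abs.mono fun x hx => hbn.trans_le hx.1).aestronglyMeasurable hm
    rw [ofReal_mul (by positivity), ← hL]
    have h1 : eLpNorm (fun x => absSum m T (τ, x)) 2 (volume.restrict (dyadic n)) ≤ ∑ Λ : Idx m, ∑ a,
        eLpNorm (fun x => lieIter Λ.1 T a (τ, x)) 2 (volume.restrict (dyadic n)) := by
      have e : (fun x => absSum m T (τ, x)) = ∑ Λ : Idx m, ∑ a, fun x => |lieIter Λ.1 T a (τ, x)| := by
        funext x; simp [absSum]
      rw [e]
      refine (eLpNorm_sum_le (fun Λ _ => aestronglyMeasurable_sum _ fun a _ => hc Λ a)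
        one_le_two).trans (sum_le_sum fun Λ _ => (eLpNorm_sum_le (fun a _ => hc Λ a)
        one_le_two).trans_eq (sum_congr rfl fun a _ => ?_))
      exact eLpNorm_norm (fun x => lieIter Λ.1 T a (τ, x))
    refine (mul_le_mul_right h1 _).trans ?_
    simp only [mul_sum]
    refine sum_le_sum fun Λ _ => sum_le_sum fun a _ => ?_
    rw [← enorm_of_nonneg (by positivity), ← eLpNorm_const_smul]
    refine eLpNorm_le_mul_eLpNorm_of_ae_le_mul ?_ 2
    filter_upwards [ae_restrict_mem hm] with x hx
    obtain ⟨h0, -, h1⟩ := hw x hx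
    simp only [Pi.smul_apply, smul_eq_mul]
    rw [norm_mul, norm_mul, norm_of_nonneg (by positivity : 0 ≤ √((2 : ℝ) ^ n) ^ j),
      norm_of_nonneg (by positivity : 0 ≤ √(ρ ‖x‖) ^ j), ← mul_assoc]
    exact mul_le_right h1 (norm_nonneg _)

end FarShells

/-! ## Cutting off a form -/

lemma cut_eq_one (h : ‖p.2‖ < 2 ^ n) : cut n p = 1 := cutProfile_of_le ((div_le_one (by positivity)).2 h.le)

lemma cut_eq_zero (h : 3 / 2 * 2 ^ n < ‖p.2‖) : cut n p = 0 :=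
  cutProfile_of_three_halves_le ((le_div_iff₀ (by positivity)).2 h.le)

lemma contDiffAt_cut (n : ℕ) (p : Spacetime) : ContDiffAt ℝ ∞ (cut n) p := by
  by_cases hp : p.2 = 0
  · have : cut n =ᶠ[𝓝 p] fun _ => 1 := by
      have h : ‖p.2‖ < 2 ^ n := by rw [hp, norm_zero]; positivity
      filter_upwards [continuous_snd.norm.continuousAt.eventually_lt continuousAt_const h] with q hq
        using cut_eq_one hq
    exact contDiffAt_const.congr_of_eventuallyEq this
  · exact contDiff_cutProfile.contDiffAt.comp p ((contDiffAt_norm_snd hp).div_const _)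

/-- The product of a tensor with the cutoff to `r < 2^{n+1}`. -/
def cutForm (n : ℕ) (T : Cov k) : Cov k := fun a p => cut n p * T a p

lemma IsSmoothTwoForm.cutForm {R0 : ℝ} (hF : IsSmoothTwoForm R0 F) (n : ℕ) :
    IsSmoothTwoForm R0 (cutForm n F) :=
  ⟨fun a p hp => (contDiffAt_cut n p).mul (hF.smooth a p hp), fun α β p hp => by
    simp only [Maxwell.cutForm, hF.antisymm α β p hp, mul_neg]⟩

lemma sphMean_cut_mul (n : ℕ) (ψ : Scalar) (p : Spacetime) : sphMean (fun q => cut n q * ψ q) p = cut n p *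
    sphMean ψ p :=
  sphMean_radial_mul (fun _ r => cutProfile (r / 2 ^ n)) ψ p

lemma sphMean_cut (n : ℕ) : sphMean (cut n) = cut n := by
  funext p
  have h := sphMean_cut_mul n (fun _ => 1) p
  have h1 : sphMean (fun _ => 1) p = 1 := by simp [sphMean_eq]
  simpa only [mul_one, h1] using h

lemma radial2_cutForm (n : ℕ) (F : Cov 2) : radial2 (cutForm n F) = cutForm n (radial2 F) := by
  funext a p
  have h1 : compTR (cutForm n F) = fun q => cut n q * compTR F q := by
    funext q
    simp only [compTR, cutForm, mul_sum]
    exact sum_congr rfl fun _ _ => by ring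
  have h2 : compAB (cutForm n F) = fun q => cut n q * compAB F q := by
    funext q
    simp only [compAB, cutForm, mul_sum]
    exact sum_congr rfl fun _ _ => sum_congr rfl fun _ _ => by ring
  simp only [radial2, h1, h2, sphMean_cut_mul, cutForm]
  ring

lemma hodge_cutForm (g : Metric4) (n : ℕ) (F : Cov 2) : hodge g (cutForm n F) = cutForm n (hodge g F) := by
  funext a p
  simp only [hodge_eq, cutForm, mul_sum]
  exact sum_congr rfl fun _ _ => sum_congr rfl fun _ _ => by ring

lemma extD0_congr_open {F' : Cov 2} {O : Set Spacetime} (hO : IsOpen O) (h : ∀ a, EqOn (F a) (F' a) O) (a :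
    Fin 3 → Fin 4) : EqOn (extD0 F a) (extD0 F' a) O := by
  intro p hp
  have e : ∀ α c, sp α (F c) p = sp α (F' c) p := fun α c => by
    simp only [sp, pd, ((h c).eventuallyEq_of_mem (hO.mem_nhds hp)).fderiv_eq]
  simp only [extD0_eq, e]

lemma radial3_congr {G G' : Cov 3} (h : ∀ a q, ‖q.2‖ = ‖p.2‖ → G a q = G' a q) (a : Fin 3 → Fin 4) :
    radial3 G a p = radial3 G' a p := by
  have e : ∀ {ψ ψ' : Scalar}, (∀ q, ‖q.2‖ = ‖p.2‖ → ψ q = ψ' q) → sphMean ψ p = sphMean ψ' p :=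
    fun {ψ ψ'} hψ => by
      rw [sphMean_eq, sphMean_eq]
      exact integral_congr_ae (.of_forall fun θ =>
        hψ (p.1, ‖p.2‖ • (θ : Space)) (norm_smul_sphere _ (norm_nonneg _) θ))
  simp only [radial3]
  rw [e (h ![1, 2, 3]), e (ψ := compAB fun b => G ![0, b 0, b 1]) (ψ' := compAB fun b => G' ![0, b 0, b 1])
    fun q hq => by simp only [compAB, h _ q hq]]

lemma isOpen_inner (n : ℕ) : IsOpen {p : Spacetime | ‖p.2‖ < 2 ^ n} :=
  isOpen_lt continuous_snd.norm continuous_const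

lemma isOpen_vanishing (n : ℕ) : IsOpen {p : Spacetime | 3 / 2 * 2 ^ n < ‖p.2‖} :=
  isOpen_lt continuous_const continuous_snd.norm

lemma cutForm_eqOn (n : ℕ) (T : Cov k) (a : Fin k → Fin 4) :
    EqOn (cutForm n T a) (T a) {p | ‖p.2‖ < 2 ^ n} := fun p hp => by
  simp only [cutForm, cut_eq_one hp, one_mul]

lemma cutForm_eqOn_zero (n : ℕ) (T : Cov k) (a : Fin k → Fin 4) :
    EqOn (cutForm n T a) (fun _ => 0) {p | 3 / 2 * 2 ^ n < ‖p.2‖} := fun p hp => by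
  simp only [cutForm, cut_eq_zero hp, zero_mul]

lemma extD0_zero : extD0 (fun _ _ => 0) = fun _ _ => 0 := by
  funext a p
  simp [extD0_eq, sp, pd]

lemma radial3_zero : radial3 (fun _ _ => 0) = fun _ _ => 0 := by
  funext a p
  simp [radial3, sphMean, compAB]

lemma radial3_extD0_cutForm_eqOn (n : ℕ) (W : Cov 2) (a : Fin 3 → Fin 4) : EqOn (radial3 (extD0 (cutForm n W))
    a) (radial3 (extD0 W) a) {p | ‖p.2‖ < 2 ^ n} := fun p hp =>
  radial3_congr (fun c q hq => extD0_congr_open (isOpen_inner n) (cutForm_eqOn n W) c (by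
    rw [mem_ofPred_eq, hq]; exact hp)) a

lemma extD0_cutForm_eqOn_zero (n : ℕ) (W : Cov 2) (a : Fin 3 → Fin 4) : EqOn (extD0 (cutForm n W) a) (fun _ =>
    0) {p | 3 / 2 * 2 ^ n < ‖p.2‖} := by
  have := extD0_congr_open (F' := fun _ _ => 0) (isOpen_vanishing n) (cutForm_eqOn_zero n W) a
  rwa [extD0_zero] at this

lemma radial3_extD0_cutForm_eqOn_zero (n : ℕ) (W : Cov 2) (a : Fin 3 → Fin 4) :
    EqOn (radial3 (extD0 (cutForm n W)) a) (fun _ => 0) {p | 3 / 2 * 2 ^ n < ‖p.2‖} := fun p hp => by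
  rw [radial3_congr (G' := fun _ _ => 0) (fun c q hq => extD0_cutForm_eqOn_zero n W c (by
    rw [mem_ofPred_eq, hq]; exact hp)) a, radial3_zero]

lemma smooth_cut (n : ℕ) : SmoothOuter b (cut n) := fun p _ => contDiffAt_cut n p

lemma SmoothCov.cutForm (hT : SmoothCov b T) (n : ℕ) : SmoothCov b (cutForm n T) :=
  fun a => (smooth_cut n).mul (hT a)

lemma normal_zero (p : Spacetime) : normal 0 p = 0 := rfl

lemma sp_cut (hb : 1 ≤ b) (n : ℕ) (α : Fin 4) : EqOn (sp α (cut n))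
    (fun p => normal α p * radialDeriv (cut n) p) (outer b) := fun p hp => by
  refine Fin.cases ?_ (fun i => ?_) α
  · simp only [sp_zero, normal_zero, zero_mul]
  · have := radialOn_sphMean hb (smooth_cut n) i hp
    rwa [sphMean_cut, ← sp_succ] at this

lemma SZu_radialDeriv_cut (hb : 1 ≤ b) : SZu b (-1) fun n => radialDeriv (cut n) :=
  SZu.sum _ fun i _ => by simpa using ((HomDeg.normal i.succ).SZu hb).mul hb ((Sym_cut hb).2 i)

lemma sphMean_radialDeriv_cut_mul (hb : 1 ≤ b) (n : ℕ) (ψ : Scalar) (hp : p ∈ outer b) : sphMean (fun q =>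
    radialDeriv (cut n) q * ψ q) p = radialDeriv (cut n) p * sphMean ψ p := by
  have h : IsRadial b (radialDeriv (cut n)) := IsRadial.of_eqOn_sphMean (ψ := radialDeriv (cut n)) <| by
    have := radialDeriv_sphMean hb (smooth_cut (b := b) n)
    rwa [sphMean_cut] at this
  rw [sphMean_eq, sphMean_eq, ← integral_const_mul]
  exact integral_congr_ae (.of_forall fun θ => by
    simp only [h _ (sphere_mem_outer hp θ) p hp rfl (norm_smul_sphere _ (norm_nonneg _) θ)])

lemma extD0_cutForm (hb : 1 ≤ b) (hW : SmoothCov b W) (n : ℕ) (a : Fin 3 → Fin 4) :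
    EqOn (extD0 (cutForm n W) a) (fun p => cut n p * extD0 W a p +
      (normal (a 0) p * radialDeriv (cut n) p * W ![a 1, a 2] p +
        normal (a 1) p * radialDeriv (cut n) p * W ![a 2, a 0] p +
        normal (a 2) p * radialDeriv (cut n) p * W ![a 0, a 1] p)) (outer b) := fun p hp => by
  have e : ∀ α c, sp α (cutForm n W c) p =
      normal α p * radialDeriv (cut n) p * W c p + cut n p * sp α (W c) p := fun α c => by
    have h1 := sp_cut hb n α hp
    simp only at h1
    rw [← h1]
    simp only [sp, show cutForm n W c = fun q => cut n q * W c q from rfl]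
    rw [pd_mul ((smooth_cut (b := b) n).diff hp) ((hW c).diff hp),
      pd_mul ((smooth_cut (b := b) n).diff hp) ((hW c).diff hp)]
    ring
  simp only [extD0_eq, e]
  ring

lemma absSum_extD0_cutForm_le (hb : 1 ≤ b) (m : ℕ) : ∃ C : ℝ, 0 ≤ C ∧ ∀ (n : ℕ) (W : Cov 2), SmoothCov b W →
    ∀ p ∈ outer b, absSum m (extD0 (cutForm n W)) p ≤ C * (absSum m (extD0 W) p + ‖p.2‖⁻¹ *
    absSum m W p) := by
  obtain ⟨C1, hC1, e1⟩ := Comb.absSum_le (k := 3) hb (fun a : Fin 3 → Fin 4 => Comb.term (Sym_cut hb).1 a) m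
  have hn : ∀ α, SZu b (-1) fun n p => normal α p * radialDeriv (cut n) p := fun α => by
    simpa using ((HomDeg.normal α).SZu hb).mul hb (SZu_radialDeriv_cut hb)
  obtain ⟨C2, hC2, e2⟩ := Comb.absSum_le (k := 2) hb (fun a : Fin 3 → Fin 4 =>
    ((Comb.term (hn (a 0)) ![a 1, a 2]).add (Comb.term (hn (a 1)) ![a 2, a 0])).add
      (Comb.term (hn (a 2)) ![a 0, a 1])) m
  refine ⟨C1 + C2, add_nonneg hC1 hC2, fun n W hW p hp => ?_⟩
  have s1 : SmoothCov b fun a p => cut n p * extD0 W a p := (smooth_extD0 hW).cutForm n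
  have s2 : SmoothCov b fun (a : Fin 3 → Fin 4) p => normal (a 0) p * radialDeriv (cut n) p * W ![a 1, a 2] p +
      normal (a 1) p * radialDeriv (cut n) p * W ![a 2, a 0] p +
      normal (a 2) p * radialDeriv (cut n) p * W ![a 0, a 1] p := fun a =>
    ((((hn _).1 n).mul (hW _)).add (((hn _).1 n).mul (hW _))).add (((hn _).1 n).mul (hW _))
  have h := absSum_add_le s1 s2 (smooth_extD0 (hW.cutForm n)) (fun a => extD0_cutForm hb hW n a) m hp
  have h1 := e1 n _ _ (smooth_extD0 hW) s1 (fun a q _ => rfl) p hp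
  have h2 := e2 n _ _ hW s2 (fun a q _ => rfl) p hp
  rw [zpow_zero, mul_one] at h1
  rw [zpow_neg_one, mul_assoc] at h2
  have p1 := absSum_nonneg m (extD0 W) p
  have p2 : 0 ≤ ‖p.2‖⁻¹ * absSum m W p := mul_nonneg (by positivity) (absSum_nonneg m W p)
  have := mul_nonneg hC1 p2
  have := mul_nonneg hC2 p1
  linarith

lemma sum_areaForm_mul_normal (β : Fin 4) (p : Spacetime) : ∑ α, areaForm ![α, β] p * normal α p = 0 ∧ ∑ α,
    areaForm ![β, α] p * normal α p = 0 := by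
  have e : ∀ α β γ : Fin 4, epsZ 0 α β γ = - epsZ 0 γ β α := by decide
  have e' : ∀ α β γ : Fin 4, epsZ 0 β α γ = - epsZ 0 β γ α := by decide
  have key : ∀ E : Fin 4 → Fin 4 → ℤ, (∀ α γ, E α γ = - E γ α) →
      ∑ α, (∑ γ, (E α γ : ℝ) * normal γ p) * normal α p = 0 := fun E hE => by
    have h : ∑ α, (∑ γ, (E α γ : ℝ) * normal γ p) * normal α p =
        - ∑ α, (∑ γ, (E α γ : ℝ) * normal γ p) * normal α p := by
      simp only [sum_mul]
      conv_rhs => rw [sum_comm]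
      simp only [← sum_neg_distrib]
      refine sum_congr rfl fun α _ => sum_congr rfl fun γ _ => ?_
      rw [hE α γ]
      push_cast
      ring
    linarith
  simp only [areaForm_eq]
  exact ⟨key _ fun α γ => e α β γ, key _ fun α γ => e' α β γ⟩

lemma radial3_extD0_cutForm (hb : 1 ≤ b) (hW : SmoothCov b W) (hA : AntiOuter b W) (n : ℕ) (a : Fin 3 →
    Fin 4) : EqOn (radial3 (extD0 (cutForm n W)) a) (fun p =>
      cut n p * radial3 (extD0 W) a p +
        eps ![0, a 0, a 1, a 2] * radialDeriv (cut n) p * sphMean (compAB W) p) (outer b) := fun p hp => by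
  have hs := smooth_extD0 hW
  have h1 : EqOn (compAB fun b => extD0 (cutForm n W) ![0, b 0, b 1])
      (fun q => cut n q * compAB (fun b => extD0 W ![0, b 0, b 1]) q) (outer b) := fun q hq => by
    have e : ∀ α β, extD0 (cutForm n W) ![0, α, β] q = cut n q * extD0 W ![0, α, β] q +
        radialDeriv (cut n) q * (normal α q * W ![β, 0] q + normal β q * W ![0, α] q) := fun α β => by
      rw [extD0_cutForm hb hW n _ hq]
      simp [normal_zero]
      ring
    simp only [compAB, cons_val_zero, cons_val_one, e, mul_add, sum_add_distrib]
    have z1 : ∑ α, ∑ β, areaForm ![α, β] q * (radialDeriv (cut n) q * (normal α q * W ![β, 0] q)) = 0 := by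
      rw [sum_comm]
      refine sum_eq_zero fun β _ => ?_
      have := congrArg (· * (radialDeriv (cut n) q * W ![β, 0] q)) (sum_areaForm_mul_normal β q).1
      simp only [sum_mul, zero_mul] at this
      rw [← this]
      exact sum_congr rfl fun _ _ => by ring
    have z2 : ∑ α, ∑ β, areaForm ![α, β] q * (radialDeriv (cut n) q * (normal β q * W ![0, α] q)) = 0 := by
      refine sum_eq_zero fun α _ => ?_
      have := congrArg (· * (radialDeriv (cut n) q * W ![0, α] q)) (sum_areaForm_mul_normal α q).2
      simp only [sum_mul, zero_mul] at this
      rw [← this]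
      exact sum_congr rfl fun _ _ => by ring
    rw [z1, z2]
    simp only [mul_sum, mul_zero, add_zero]
    exact sum_congr rfl fun _ _ => sum_congr rfl fun _ _ => by ring
  have h2 : EqOn (extD0 (cutForm n W) ![1, 2, 3])
      (fun q => cut n q * extD0 W ![1, 2, 3] q + radialDeriv (cut n) q * compAB W q) (outer b) := fun q hq => by
    rw [extD0_cutForm hb hW n _ hq]
    simp only [compAB_eq fun α β => hA α β hq]
    simp [sum_univ_three]
    ring
  have sc := smooth_cut (b := b) n
  simp only [radial3]
  rw [sphMean_congr h1 hp, sphMean_congr h2 hp, sphMean_cut_mul, sphMean_add (sc.mul (hs _))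
    ((sc.radialDeriv hb).mul (smooth_compAB hb hW)) hp, sphMean_cut_mul, sphMean_radialDeriv_cut_mul hb n _ hp]
  ring

lemma absSum_radial3_extD0_cutForm_le (hb : 1 ≤ b) (m : ℕ) : ∃ C : ℝ, 0 ≤ C ∧ ∀ (n : ℕ) (W : Cov 2),
    SmoothCov b W → AntiOuter b W → ∀ p ∈ outer b, absSum m (radial3 (extD0 (cutForm n W))) p ≤ C *
    (absSum m (radial3 (extD0 W)) p + ‖p.2‖⁻¹ * absSum m (scal (sphMean (compAB W))) p) := by
  obtain ⟨C1, hC1, e1⟩ := Comb.absSum_le (k := 3) hb (fun a : Fin 3 → Fin 4 => Comb.term (Sym_cut hb).1 a) m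
  have hn := fun c : ℝ => (SZu_radialDeriv_cut hb).const_mul hb c
  obtain ⟨C2, hC2, e2⟩ := Comb.absSum_le (k := 0) hb (fun a : Fin 3 → Fin 4 =>
    Comb.term (hn (eps ![0, a 0, a 1, a 2])) default) m
  refine ⟨C1 + C2, add_nonneg hC1 hC2, fun n W hW hA p hp => ?_⟩
  have sr := smooth_radial3 hb (smooth_extD0 hW)
  have sm := (smooth_compAB hb hW).sphMean hb
  have s1 : SmoothCov b fun a p => cut n p * radial3 (extD0 W) a p := sr.cutForm n
  have s2 : SmoothCov b fun (a : Fin 3 → Fin 4) p =>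
      eps ![0, a 0, a 1, a 2] * radialDeriv (cut n) p * sphMean (compAB W) p := fun a =>
    ((hn _).1 n).mul sm
  have h := absSum_add_le s1 s2 (smooth_radial3 hb (smooth_extD0 (hW.cutForm n)))
    (fun a => radial3_extD0_cutForm hb hW hA n a) m hp
  have h1 := e1 n _ _ sr s1 (fun a q _ => rfl) p hp
  have h2 := e2 n _ _ (smoothCov_scal sm) s2 (fun a q _ => rfl) p hp
  rw [zpow_zero, mul_one] at h1
  rw [zpow_neg_one, mul_assoc] at h2
  have p1 := absSum_nonneg m (radial3 (extD0 W)) p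
  have p2 : 0 ≤ ‖p.2‖⁻¹ * absSum m (scal (sphMean (compAB W))) p :=
    mul_nonneg (by positivity) (absSum_nonneg m _ p)
  have := mul_nonneg hC1 p2
  have := mul_nonneg hC2 p1
  linarith

lemma StarAsymptotics.absSum_hodge_le {g g0 : Metric4} {α : ℝ → ℝ} (h : StarAsymptotics b g g0 α) (m : ℕ) :
    ∃ C : ℝ, 0 ≤ C ∧ ∀ F, SmoothCov b F → ∀ p ∈ outer b, absSum m (hodge g F) p ≤ C * absSum m F p := by
  have hb := h.one_le
  have hc : ∀ a μ ν, SZu b 0 fun (_ : ℕ) p => hodgeCoef (g p) a μ ν := fun a μ ν => by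
    simpa using ((h.near_mink a μ ν).1.mono hb (by norm_num : (-1 : ℤ) ≤ 0)).add
      (SZu.const (hodgeCoef mink a μ ν))
  obtain ⟨C, hC, e⟩ := Comb.absSum_le (k := 2) hb (fun a : Fin 2 → Fin 4 => Comb.sum univ fun μ _ =>
    Comb.sum univ fun ν _ => Comb.term (hc a μ ν) ![μ, ν]) m
  refine ⟨C, hC, fun F hF p hp => ?_⟩
  simpa using e 0 F (hodge g F) hF (smooth_hodge h.near_mink hF) (fun a q _ => hodge_eq g F a q) p hp

/-! ## Dyadic norms -/

/-- The `L²` norm of `r^{j/2} T^{≤ m}` over one dyadic shell, up to a constant. -/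
def dyadicNorm (m : ℕ) (τ : ℝ) (j : ℤ) (n : ℕ) (T : Cov k) : ℝ := √(2 ^ n) ^ j * shell[m, τ, n] T

section

variable {j : ℤ}

lemma dyadicNorm_nonneg : 0 ≤ dyadicNorm m τ j n T := mul_nonneg (by positivity) (shellNorm_nonneg _ _)

lemma dyadicNorm_add_two : dyadicNorm m τ (j + 2) n T = 2 ^ n * dyadicNorm m τ j n T := by
  have h : √((2 : ℝ) ^ n) ^ 2 = 2 ^ n := sq_sqrt (by positivity)
  rw [dyadicNorm, dyadicNorm, zpow_add₀ (by positivity), zpow_ofNat, h]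
  ring

lemma dyadicNorm_one : dyadicNorm m τ 1 n T = √(2 ^ n) * shell[m, τ, n] T := by rw [dyadicNorm, zpow_one]

lemma dyadicNorm_neg_one : dyadicNorm m τ (-1) n T = (√(2 ^ n))⁻¹ * shell[m, τ, n] T := by
  rw [dyadicNorm, zpow_neg_one]

lemma dyadicNorm_three : dyadicNorm m τ 3 n T = 2 ^ n * √(2 ^ n) * shell[m, τ, n] T := by
  rw [show (3 : ℤ) = 1 + 2 by norm_num, dyadicNorm_add_two, dyadicNorm_one, mul_assoc]

lemma dyadicNorm_neg_three : dyadicNorm m τ (-3) n T = √(2 ^ n) * ((2 ^ n)⁻¹ * (2 ^ n)⁻¹) * shell[m, τ, n]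
    T := by
  have h1 : dyadicNorm m τ 1 n T = 2 ^ n * (2 ^ n * dyadicNorm m τ (-3) n T) := by
    rw [← dyadicNorm_add_two, ← dyadicNorm_add_two]; norm_num
  rw [dyadicNorm_one] at h1
  have h2 : (2 : ℝ) ^ n ≠ 0 := by positivity
  field_simp
  linarith

end

namespace FarShells

variable {ρ : ℝ → ℝ} {R0 : ℝ} {n0 : ℕ}

lemma shellSum_le (h : FarShells ρ R0 b n0) (hT : SmoothCov b T) (ht : 0 ≤ τ) (hn : n0 ≤ n) {j : ℤ} (hj :
    j.natAbs ≤ 3) {x : ℝ} (hx : dyadicNorm m τ j n T ≤ x) : shellSum ρ (region R0) m τ j n T ≤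
    ofReal (compCount m k * 8 * x) := by
  refine (h.shellSum_comparable hT ht hn (h.shell_inter hn) j).1.trans (ofReal_le_ofReal ?_)
  have h1 : (2 : ℝ) ^ j.natAbs ≤ 8 := (two_pow_le hj).trans_eq (by norm_num)
  rw [mul_assoc, mul_assoc]
  exact mul_le_left (mul_le_mul h1 hx dyadicNorm_nonneg (by norm_num)) (Nat.cast_nonneg _)

lemma ofReal_dyadicNorm_le (h : FarShells ρ R0 b n0) (hT : SmoothCov b T) (ht : 0 ≤ τ) (hn : n0 ≤ n) {D :
    Set Space} (hD : shell ρ n ∩ D = dyadic n) {j : ℤ} (hj : j.natAbs ≤ 3) :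
    ofReal (dyadicNorm m τ j n T) ≤ 8 * shellSum ρ D m τ j n T := by
  refine (h.shellSum_comparable hT ht hn hD j).2.trans (mul_le_mul_left ?_ _)
  have h1 : (2 : ℝ) ^ j.natAbs ≤ 8 := (two_pow_le hj).trans_eq (by norm_num)
  exact (ofReal_le_ofReal h1).trans_eq (by simp)

lemma dyadicNorm_le (h : FarShells ρ R0 b n0) (hT : SmoothCov b T) (ht : 0 ≤ τ) (hn : n0 ≤ n) {j : ℤ} (hj :
    j.natAbs ≤ 3) {x : ℝ} (hx0 : 0 ≤ x) (hx : shellSum ρ (region R0) m τ j n T ≤ ofReal x) :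
    dyadicNorm m τ j n T ≤ 8 * x := by
  have h1 := (h.ofReal_dyadicNorm_le (m := m) hT ht hn (h.shell_inter hn) hj).trans (mul_le_mul_right hx 8)
  rwa [show (8 : ℝ≥0∞) = ofReal 8 by simp, ← ofReal_mul (by norm_num),
    ENNReal.ofReal_le_ofReal_iff (by positivity)] at h1

lemma sum_dyadicNorm_le (h : FarShells ρ R0 b n0) (hT : SmoothCov b T) (ht : 0 ≤ τ) (hn : n0 ≤ n) (hj : (2 *
    s + 1).natAbs ≤ 3) {x : ℝ} (hx0 : 0 ≤ x) (hx : normLEstar ρ (region R0) s m τ T ≤ ofReal x) (l :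
    ℕ) : ∑ i ∈ Ico n l, dyadicNorm m τ (2 * s + 1) i T ≤ 8 * x := by
  rw [normLEstar_eq h.bracket] at hx
  have h1 : ofReal (∑ i ∈ Ico n l, dyadicNorm m τ (2 * s + 1) i T) ≤ 8 * ofReal x := by
    rw [ENNReal.ofReal_sum_of_nonneg fun _ _ => dyadicNorm_nonneg]
    refine le_trans ?_ (mul_le_mul_right ((ENNReal.sum_le_tsum (Ico n l)).trans hx) 8)
    rw [mul_sum]
    refine sum_le_sum fun i hi => ?_
    have hi' := hn.trans (mem_Ico.1 hi).1
    exact h.ofReal_dyadicNorm_le hT ht hi' (h.shell_inter hi') hj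
  rwa [show (8 : ℝ≥0∞) = ofReal 8 by simp, ← ofReal_mul (by norm_num),
    ENNReal.ofReal_le_ofReal_iff (by positivity)] at h1

end FarShells

lemma measurableSet_region (R0 : ℝ) : MeasurableSet (region R0) :=
  measurableSet_le measurable_const measurable_norm

/-! ## Cutoffs and norms -/

/-- `T'` agrees with `T` for `r < 2^n` and vanishes for large `r`. -/
structure IsCutoff (n : ℕ) (T T' : Cov k) : Prop where
  inner : ∀ a, EqOn (T' a) (T a) {p | ‖p.2‖ < 2 ^ n}
  vanishing : ∀ a, EqOn (T' a) (fun _ => 0) {p | 3 / 2 * 2 ^ n < ‖p.2‖}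

lemma isCutoff_cutForm (n : ℕ) (T : Cov k) : IsCutoff n T (cutForm n T) :=
  ⟨cutForm_eqOn n T, cutForm_eqOn_zero n T⟩

lemma isCutoff_extD0 (n : ℕ) (W : Cov 2) : IsCutoff n (extD0 W) (extD0 (cutForm n W)) :=
  ⟨extD0_congr_open (isOpen_inner n) (cutForm_eqOn n W), extD0_cutForm_eqOn_zero n W⟩

lemma isCutoff_radial3 (n : ℕ) (W : Cov 2) : IsCutoff n (radial3 (extD0 W)) (radial3 (extD0 (cutForm n W))) :=
  ⟨radial3_extD0_cutForm_eqOn n W, radial3_extD0_cutForm_eqOn_zero n W⟩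

namespace IsCutoff

variable {ρ : ℝ → ℝ} {R0 : ℝ} {n0 n1 : ℕ} {j : ℤ}

lemma shellSum_of_lt (hT : IsCutoff n1 T T') (h : FarShells ρ R0 b n0) (h1 : n0 ≤ n1) (hn : n < n1) :
    shellSum ρ (region R0) m τ j n T' = shellSum ρ (region R0) m τ j n T :=
  shellSum_congr h.bracket (measurableSet_region R0) (isOpen_inner n1) hT.inner
    fun _ hx => h.norm_lt h1 hn hx.1

lemma shellSum_of_gt (hT : IsCutoff n1 T T') (h : FarShells ρ R0 b n0) (h1 : n0 ≤ n1) (hn : n1 < n) :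
    shellSum ρ (region R0) m τ j n T' = 0 := by
  rw [← shellSum_zero (k := k) (ρ := ρ) (D := region R0) (m := m) (n := n) (τ := τ) (j := j)]
  refine shellSum_congr h.bracket (measurableSet_region R0) (isOpen_vanishing n1) hT.vanishing fun x hx => ?_
  rw [h.shell_inter (h1.trans hn.le)] at hx
  have h2 : (2 : ℝ) ^ (n1 + 1) ≤ 2 ^ n := two_pow_le hn
  have h3 := hx.1
  have h4 : (0 : ℝ) < 2 ^ n1 := by positivity
  rw [pow_succ] at h2
  rw [mem_ofPred_eq]
  linarith

lemma normLE_lt_top (hT : IsCutoff n1 T T') (h : FarShells ρ R0 b n0) (h1 : n0 ≤ n1) (hs : SmoothCov b T')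
    (ht : 0 ≤ τ) (hj : (2 * s - 1).natAbs ≤ 3) (hf : normLE ρ (region R0) s m τ T < ⊤) : normLE ρ (region R0)
    s m τ T' < ⊤ := by
  have h2 := h.shellSum_le (m := m) hs ht h1 hj le_rfl
  refine (normLE_le h.bracket s (A := normLE ρ (region R0) s m τ T +
    ofReal (compCount m k * 8 * dyadicNorm m τ (2 * s - 1) n1 T')) fun n => ?_).trans_lt (ENNReal.mul_lt_top (ENNReal.natCast_lt_top _) (ENNReal.add_lt_top.2 ⟨hf, ENNReal.ofReal_lt_top⟩))
  rcases lt_trichotomy n n1 with hn | rfl | hn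
  · rw [hT.shellSum_of_lt h h1 hn]
    exact (shellSum_le_normLE h.bracket s).trans le_self_add
  · exact h2.trans le_add_self
  · rw [hT.shellSum_of_gt h h1 hn]
    exact zero_le

lemma normLEstar_le (hT : IsCutoff n1 T T') (h : FarShells ρ R0 b n0) (h1 : n0 ≤ n1) (hs : SmoothCov b T')
    (ht : 0 ≤ τ) (hj : (2 * s + 1).natAbs ≤ 3) {x : ℝ} (hx : dyadicNorm m τ (2 * s + 1) n1 T' ≤ x) :
    normLEstar ρ (region R0) s m τ T' ≤ ∑ n ∈ range n1, shellSum ρ (region R0) m τ (2 * s + 1) n T +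
    ofReal (compCount m k * 8 * x) := by
  rw [normLEstar_eq h.bracket, tsum_eq_sum (s := range (n1 + 1)) fun n hn =>
    hT.shellSum_of_gt h h1 (by simpa using hn), sum_range_succ]
  exact add_le_add (sum_le_sum fun n hn => (hT.shellSum_of_lt h h1 (mem_range.1 hn)).le)
    (h.shellSum_le hs ht h1 hj hx)

end IsCutoff

lemma FarShells.admissible_cutForm {ρ : ℝ → ℝ} {R0 : ℝ} (hb : 1 ≤ b) {n0 n1 : ℕ} (h : FarShells ρ R0 b n0)
    (h1 : n0 ≤ n1) (hF : SmoothCov b F) (ht : 0 ≤ τ) (hA : Admissible ρ R0 m τ F) :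
    Admissible ρ R0 m τ (cutForm n1 F) := by
  have hr := isCutoff_cutForm n1 (radial2 F)
  refine ⟨(isCutoff_cutForm n1 F).normLE_lt_top h h1 (hF.cutForm n1) ht (by decide) hA.finite, ?_, ?_⟩
  · rw [radial2_cutForm]
    exact hr.normLE_lt_top h h1 ((smooth_radial2 hb hF).cutForm n1) ht (by decide) hA.finite_radial
  · refine tendsto_const_nhds.congr' ?_
    filter_upwards [eventually_ge_atTop (3 / 2 * 2 ^ n1 : ℝ)] with R hR
    rw [radial2_cutForm]
    refine le_antisymm zero_le ((normLE_le h.bracket 1 (A := 0) fun n => ?_).trans_eq (mul_zero _))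
    rw [← shellSum_zero (k := 2) (ρ := ρ) (D := region R0 ∩ {x | R < ‖x‖}) (m := m) (n := n) (τ := τ)
      (j := 2 * 1 - 1)]
    exact (shellSum_congr h.bracket ((measurableSet_region R0).inter
      (measurableSet_lt measurable_const measurable_norm)) (isOpen_vanishing n1) hr.vanishing
      fun x hx => hR.trans_lt hx.2.2).le

lemma FarShells.tendsto_radial {ρ : ℝ → ℝ} {R0 : ℝ} (hb : 1 ≤ b) {n0 : ℕ} (h : FarShells ρ R0 b n0) (hF :
    SmoothCov b F) (ht : 0 ≤ τ) (hA : Admissible ρ R0 m τ F) : Tendsto (fun L : ℕ => √(2 ^ L) * shell[m, τ, L]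
    (radial2 F)) atTop (𝓝 0) := by
  have h1 : Tendsto (fun L : ℕ => (3 / 4 : ℝ) * 2 ^ L) atTop atTop :=
    (tendsto_pow_atTop_atTop_of_one_lt one_lt_two).const_mul_atTop (by norm_num)
  have h2 := ENNReal.Tendsto.const_mul (a := 8) (hA.no_charge.comp h1) (Or.inr (by simp))
  rw [mul_zero] at h2
  have h3 : Tendsto (fun L : ℕ => ofReal (dyadicNorm m τ 1 L (radial2 F))) atTop (𝓝 0) := by
    refine tendsto_of_tendsto_of_tendsto_of_le_of_le' tendsto_const_nhds h2
      (.of_forall fun _ => zero_le) ?_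
    filter_upwards [eventually_ge_atTop n0] with L hL
    have e : shell ρ L ∩ (region R0 ∩ {x | 3 / 4 * 2 ^ L < ‖x‖}) = dyadic L := by
      rw [← Set.inter_assoc, h.shell_inter hL]
      refine Set.inter_eq_left.2 fun x hx => ?_
      have := hx.1
      have : (0 : ℝ) < 2 ^ L := by positivity
      rw [mem_ofPred_eq]
      linarith
    exact (h.ofReal_dyadicNorm_le (smooth_radial2 hb hF) ht hL e (by decide)).trans
      (mul_le_mul_right (shellSum_le_normLE (s := 1) h.bracket) 8)
  have h4 := (ENNReal.tendsto_toReal ENNReal.zero_ne_top).comp h3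
  refine h4.congr fun L => ?_
  rw [Function.comp_apply, ENNReal.toReal_ofReal dyadicNorm_nonneg, dyadicNorm_one]

/-! ## Equivalence of the estimates -/

section

variable {g g0 : Metric4} {α : ℝ → ℝ}

/-- The size of the sources on a dyadic shell. -/
def sourceNorm (m : ℕ) (g : Metric4) (τ : ℝ) (j : ℤ) (n : ℕ) (F : Cov 2) : ℝ :=
  dyadicNorm m τ j n (extD0 F) + dyadicNorm m τ j n (extD0 (hodge g F))

lemma fieldSq_comparable (m : ℕ) : ∃ K : ℝ, 0 < K ∧ ∀ (b : ℝ) (F : Cov 2) (τ : ℝ) (n : ℕ), SmoothCov b F →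
    AntiOuter b F → 0 ≤ τ → b < 2 ^ n → dyadicNorm m τ (-1) n F ≤ K * √((2 ^ n)⁻¹ * ∫ x in dyadic n,
    fieldSq (emSystem m τ F) x) ∧ √((2 ^ n)⁻¹ * ∫ x in dyadic n, fieldSq (emSystem m τ F) x) ≤ K *
    dyadicNorm m τ (-1) n F := by
  obtain ⟨N, hN, hcomp⟩ := absSum_le_fieldSq m
  set K : ℝ := √(∑ _ : Idx m × Fin 2, ∑ _ : Fin 3, 1)
  have hK : 0 ≤ K := sqrt_nonneg _
  refine ⟨N + K + 1, by positivity, fun b F τ n hF hA ht hn => ?_⟩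
  have hmem : ∀ {x : Space}, b < ‖x‖ → (τ, x) ∈ outer b := fun hx => ⟨ht, hx⟩
  have hc : ContinuousOn (fun x => √(fieldSq (emSystem m τ F) x)) {x | b < ‖x‖} :=
    (continuousOn_finsetSum _ fun i _ => continuousOn_finsetSum _ fun j _ =>
      (continuousOn_of_forall_continuousAt fun x hx =>
        (contDiffAt_emField (hF.lieIter i.1.1) (hmem hx) i.2 j).continuousAt).pow 2).sqrt
  have e : √((2 ^ n)⁻¹ * ∫ x in dyadic n, fieldSq (emSystem m τ F) x) =
      (√(2 ^ n))⁻¹ * shellNorm n fun x => √(fieldSq (emSystem m τ F) x) := by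
    rw [sqrt_mul (by positivity), sqrt_inv, shellNorm]
    simp only [sq_sqrt (fieldSq_nonneg _ _)]
  have hσ : (0 : ℝ) ≤ (√(2 ^ n))⁻¹ := by positivity
  have h1 := mul_le_left (shellNorm_le_mul (u := fun x => absSum m F (τ, x)) hn hN hc fun x hx => by
    rw [abs_of_nonneg (absSum_nonneg _ _ _)]
    exact (hcomp b F hF hA τ x (hmem (hn.trans_le hx.1))).1) hσ
  have h2 := mul_le_left (shellNorm_le_mul (u := fun x => √(fieldSq (emSystem m τ F) x)) hn hK
    (continuousOn_absSum hF m ht) fun x _ => by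
      rw [abs_of_nonneg (sqrt_nonneg _)]
      refine (sqrt_le_sqrt (fieldSq_le_absSum m F τ x)).trans_eq ?_
      rw [sqrt_mul (by positivity), sqrt_sq (absSum_nonneg _ _ _)]) hσ
  rw [e, dyadicNorm_neg_one]
  have k1 := mul_nonneg hσ (shellNorm_nonneg n fun x => √(fieldSq (emSystem m τ F) x))
  have k2 := mul_nonneg hσ (shellNorm_nonneg n fun x => absSum m F (τ, x))
  constructor <;> nlinarith

lemma StarAsymptotics.exterior (h : StarAsymptotics b g g0 α) (m : ℕ) : ∃ (N : ℕ) (A : ℝ), 0 ≤ A ∧ ∀ n0, N ≤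
    n0 → ∀ ε : ℝ, 0 < ε → ∃ (J : ℕ) (D : ℝ), 0 ≤ D ∧ ∀ (F : Cov 2) (τ B Y : ℝ), 0 ≤ τ → SmoothCov b F →
    AntiOuter b F → (∀ n ≥ n0, dyadicNorm m τ (-1) n F ≤ B) → ((∀ l, ∑ n ∈ Ico n0 l,
    sourceNorm m g τ 1 n F ≤ Y) → ∀ n ≥ n0, dyadicNorm m τ (-1) n F ≤ A * (Y + dyadicNorm m τ (-1) n0 F))
    ∧ ((∀ l, ∑ n ∈ Ico n0 l, sourceNorm m g τ (-1) n F ≤ Y) → (∀ n ≥ n0, dyadicNorm m τ (-3) n F ≤ A *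
    (Y + dyadicNorm m τ (-1) n0 F)) ∧ ∃ n, n0 < n ∧ n ≤ n0 + J ∧ dyadicNorm m τ (-1) n F ≤ ε *
    dyadicNorm m τ (-1) n0 F + D * Y) := by
  obtain ⟨N, C, hC, hN, hext⟩ := exterior_forms h.one_le h.near_mink m
  obtain ⟨K, hK, hcomp⟩ := fieldSq_comparable m
  refine ⟨N, K * (2 * (C + 1)) * (1 + K), by positivity, fun n0 hn0 ε hε => ?_⟩
  obtain ⟨J, D, hD, hsmall⟩ := DyadicBound.exists_small hC n0 (ε := ε / (K * K)) (by positivity)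
  refine ⟨J, K * D, by positivity, fun F τ B Y ht hF hA hB => ?_⟩
  have hbn : ∀ {n}, n0 ≤ n → b < 2 ^ n := fun hn => hN.trans_le (two_pow_le (hn0.trans hn))
  have hM := hext n0 hn0 F τ ht hF hA
  set Nf : ℕ → ℝ := fun n => √((2 ^ n)⁻¹ * ∫ x in dyadic n, fieldSq (emSystem m τ F) x) with hNf
  set y : ℕ → ℝ := fun n => √(2 ^ n * ∫ x in dyadic n, sourceSum m g F (τ, x) ^ 2) with hy
  have hN0 : ∀ n, 0 ≤ Nf n := fun n => sqrt_nonneg _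
  have hy0 : ∀ n, 0 ≤ y n := fun n => sqrt_nonneg _
  have c1 : ∀ n ≥ n0, dyadicNorm m τ (-1) n F ≤ K * Nf n := fun n hn =>
    (hcomp b F τ n hF hA ht (hbn hn)).1
  have c2 : ∀ n ≥ n0, Nf n ≤ K * dyadicNorm m τ (-1) n F := fun n hn =>
    (hcomp b F τ n hF hA ht (hbn hn)).2
  have hb' : ∃ B, ∀ n ≥ n0, Nf n ≤ B := ⟨K * B, fun n hn =>
    (c2 n hn).trans (mul_le_left (hB n hn) hK.le)⟩
  have hyle : ∀ n ≥ n0, y n ≤ sourceNorm m g τ 1 n F := fun n hn => by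
    have := shellNorm_add_le (hbn hn) (continuousOn_absSum (smooth_extD0 hF) m ht)
      (continuousOn_absSum (smooth_extD0 (smooth_hodge h.near_mink hF)) m ht)
    simp only [hy, sourceNorm, dyadicNorm_one, ← mul_add]
    rw [sqrt_mul (by positivity)]
    exact mul_le_left this (sqrt_nonneg _)
  have shift : ∀ n (T : Cov 3), dyadicNorm m τ 1 n T = 2 ^ n * dyadicNorm m τ (-1) n T := fun n T => by
    rw [← dyadicNorm_add_two]; norm_num
  have key : ∀ {x c : ℝ}, 0 ≤ c → x ≤ c * (Y + Nf n0) → 0 ≤ Y →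
      K * x ≤ K * c * (1 + K) * (Y + dyadicNorm m τ (-1) n0 F) := fun {x c} hc hx hY => by
    have h1 := c2 n0 le_rfl
    have h2 := dyadicNorm_nonneg (m := m) (τ := τ) (j := -1) (n := n0) (T := F)
    have h3 : Y + Nf n0 ≤ (1 + K) * (Y + dyadicNorm m τ (-1) n0 F) := by nlinarith
    have h4 := mul_le_left (hx.trans (mul_le_left h3 hc)) hK.le
    exact h4.trans_eq (by ring)
  refine ⟨fun hY n hn => ?_, fun hY => ?_⟩
  · have hY' : ∀ l, ∑ n ∈ Ico n0 l, y n ≤ Y := fun l =>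
      (sum_le_sum fun n hn => hyle n (mem_Ico.1 hn).1).trans (hY l)
    exact (c1 n hn).trans (key (by linarith) (hM.sup_le hC hN0 hy0 hb' hY' n hn) (by simpa using hY n0))
  have hY0 : 0 ≤ Y := by simpa using hY n0
  have hY' : ∀ l, ∑ n ∈ Ico n0 l, (2 ^ n)⁻¹ * y n ≤ Y := fun l =>
    (sum_le_sum fun n hn => by
      have := hyle n (mem_Ico.1 hn).1
      rw [inv_mul_le_iff₀ (by positivity)]
      refine this.trans_eq ?_
      simp only [sourceNorm, shift, mul_add]).trans (hY l)
  refine ⟨fun n hn => ?_, ?_⟩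
  · refine le_trans ?_ (key (by linarith) (hM.weighted_sup_le hC hN0 hy0 hb' hY' n hn) hY0)
    have h1 := c1 n hn
    rw [show (-1 : ℤ) = -3 + 2 by norm_num, dyadicNorm_add_two] at h1
    have h2 : (0 : ℝ) < 2 ^ n := by positivity
    rw [mul_left_comm, ← div_eq_inv_mul, le_div_iff₀ h2]
    linarith
  · obtain ⟨n, h1, h2, h3⟩ := hsmall Nf y hN0 hy0 hM hb' Y hY'
    refine ⟨n, h1, h2, (c1 n h1.le).trans ((mul_le_left (h3.trans (add_le_add
      (mul_le_left (c2 n0 le_rfl) (by positivity)) le_rfl)) hK.le).trans_eq ?_)⟩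
    field_simp

lemma cut_source (hb : 1 ≤ b) (m : ℕ) : ∃ c : ℝ, 0 ≤ c ∧ ∀ (ρ : ℝ → ℝ) (R0 : ℝ) (n0 n1 : ℕ) (W : Cov 2)
    (τ s M : ℝ), FarShells ρ R0 b n0 → n0 ≤ n1 → 0 ≤ τ → 0 ≤ s → SmoothCov b W → AntiOuter b W →
    normLEstar ρ (region R0) (-1) m τ (extD0 W) ≤ ofReal s → normLEstar ρ (region R0)
    1 m τ (radial3 (extD0 W)) ≤ ofReal s → dyadicNorm m τ (-1) n1 W ≤ M →
    dyadicNorm m τ 1 n1 (scal (sphMean (compAB W))) ≤ M → normLEstar ρ (region R0)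
    0 m τ (extD0 (cutForm n1 W)) + normLEstar ρ (region R0) 1 m τ (radial3 (extD0 (cutForm n1 W))) ≤
    ofReal (c * (2 ^ n1 * s + M)) := by
  obtain ⟨C1, hC1, e1⟩ := absSum_extD0_cutForm_le hb m
  obtain ⟨C2, hC2, e2⟩ := absSum_radial3_extD0_cutForm_le hb m
  set κ : ℝ := compCount m 3 * 8 with hκ
  have hκ0 : 0 ≤ κ := by positivity
  refine ⟨2 + κ * C1 * 8 + κ * C2 * 8, by positivity,
    fun ρ R0 n0 n1 W τ s M h h1 ht hs hW hA hG hR hM hM' => ?_⟩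
  have hbn : b < 2 ^ n1 := h.lt.trans_le (two_pow_le h1)
  have hr : ∀ x ∈ dyadic n1, ‖x‖⁻¹ ≤ (2 ^ n1)⁻¹ := fun x hx => inv_anti₀ (by positivity) hx.1
  have sG := smooth_extD0 hW
  have sR := smooth_radial3 hb sG
  have sM := smoothCov_scal ((smooth_compAB hb hW).sphMean hb)
  have sG' := smooth_extD0 (hW.cutForm n1)
  have hσ : (0 : ℝ) < √(2 ^ n1) := by positivity
  have hP : (1 : ℝ) ≤ 2 ^ n1 := one_le_pow₀ one_le_two
  have single : ∀ {k : ℕ} {T : Cov k} {s' : ℤ}, SmoothCov b T → (2 * s' + 1).natAbs ≤ 3 →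
      normLEstar ρ (region R0) s' m τ T ≤ ofReal s → dyadicNorm m τ (2 * s' + 1) n1 T ≤ 8 * s :=
    fun hT hj hx => by simpa using h.sum_dyadicNorm_le hT ht h1 hj hs hx (n1 + 1)
  have dG : dyadicNorm m τ (2 * 0 + 1) n1 (extD0 (cutForm n1 W)) ≤ C1 * (2 ^ n1 * (8 * s) + M) := by
    have k1 := shellNorm_absSum_le (m := m) sG hW ht hbn hC1 (C₂ := C1 * (2 ^ n1)⁻¹) (by positivity)
      fun x hx hx' => (e1 n1 W hW _ hx').trans (by
        have := mul_le_left (mul_le_right (hr x hx) (absSum_nonneg m W (τ, x))) hC1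
        rw [mul_add, mul_assoc C1]
        exact add_le_add le_rfl this)
    have k2 := mul_le_left k1 hσ.le
    have k3 := single (s' := -1) sG (by decide) hG
    have k4 : dyadicNorm m τ 1 n1 (extD0 W) = 2 ^ n1 * dyadicNorm m τ (2 * -1 + 1) n1 (extD0 W) := by
      rw [← dyadicNorm_add_two]; norm_num
    have k5 : dyadicNorm m τ 1 n1 W = 2 ^ n1 * dyadicNorm m τ (-1) n1 W := by
      rw [← dyadicNorm_add_two]; norm_num
    rw [mul_zero, zero_add, dyadicNorm_one]
    refine k2.trans ?_
    rw [dyadicNorm_one] at k4 k5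
    have k6 : √(2 ^ n1) * (C1 * shell[m, τ, n1] (extD0 W) +
        C1 * (2 ^ n1)⁻¹ * shell[m, τ, n1] W) =
        C1 * (2 ^ n1 * dyadicNorm m τ (2 * -1 + 1) n1 (extD0 W) + dyadicNorm m τ (-1) n1 W) := by
      rw [← k4, (eq_inv_mul_iff_mul_eq₀ (by positivity : (2 : ℝ) ^ n1 ≠ 0)).2 k5.symm]
      ring
    rw [k6]
    exact mul_le_left (add_le_add (mul_le_left k3 (by positivity)) hM) hC1
  have dR : dyadicNorm m τ (2 * 1 + 1) n1 (radial3 (extD0 (cutForm n1 W))) ≤ C2 * (8 * s + M) := by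
    have k1 := shellNorm_absSum_le (m := m) sR sM ht hbn hC2 (C₂ := C2 * (2 ^ n1)⁻¹) (by positivity)
      fun x hx hx' => (e2 n1 W hW hA _ hx').trans (by
        have := mul_le_left (mul_le_right (hr x hx)
          (absSum_nonneg m (scal (sphMean (compAB W))) (τ, x))) hC2
        rw [mul_add, mul_assoc C2]
        exact add_le_add le_rfl this)
    have k3 := single (s' := 1) sR (by decide) hR
    have e3 : ((2 : ℤ) * 1 + 1) = 3 := by norm_num
    rw [e3] at k3 ⊢
    rw [dyadicNorm_three] at k3 ⊢
    rw [dyadicNorm_one] at hM'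
    have k2 := mul_le_left k1 (by positivity : 0 ≤ 2 ^ n1 * √((2 : ℝ) ^ n1))
    refine k2.trans ?_
    have k4 := mul_le_left (add_le_add k3 hM') hC2
    refine le_trans (le_of_eq ?_) k4
    field_simp
  have t1 := (isCutoff_extD0 n1 W).normLEstar_le h h1 sG' ht (s := 0) (by decide) dG
  have t2 := (isCutoff_radial3 n1 W).normLEstar_le h h1 (smooth_radial3 hb sG') ht (s := 1) (by decide) dR
  have q1 : ∑ n ∈ range n1, shellSum ρ (region R0) m τ (2 * 0 + 1) n (extD0 W) ≤
      ofReal (2 ^ n1 * s) := by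
    rw [ofReal_mul (by positivity)]
    refine le_trans ?_ (mul_le_mul_right ((ENNReal.sum_le_tsum (range n1)).trans
      ((normLEstar_eq h.bracket (-1)).symm.le.trans hG)) _)
    rw [mul_sum]
    refine sum_le_sum fun n hn => ?_
    rw [show (2 * 0 + 1 : ℤ) = 2 * -1 + 1 + 2 by norm_num]
    refine (shellSum_add_two_le h.bracket (measurableSet_region R0)).trans ?_
    exact mul_le_mul_left (ofReal_le_ofReal (two_pow_le (mem_range.1 hn))) _
  have q2 : ∑ n ∈ range n1, shellSum ρ (region R0) m τ (2 * 1 + 1) n (radial3 (extD0 W)) ≤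
      ofReal s := (ENNReal.sum_le_tsum _).trans ((normLEstar_eq h.bracket 1).symm.le.trans hR)
  have hM0 : 0 ≤ M := dyadicNorm_nonneg.trans hM
  refine (add_le_add (t1.trans (add_le_add q1 le_rfl)) (t2.trans (add_le_add q2 le_rfl))).trans ?_
  rw [← ofReal_add (by positivity) (by positivity), ← ofReal_add (by positivity) (by positivity),
    ← ofReal_add (by positivity) (by positivity)]
  refine ofReal_le_ofReal ?_
  rw [← hκ]
  have a1 : s ≤ 2 ^ n1 * s := le_mul_of_one_le_left hs hP
  set z := 2 ^ n1 * s with hz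
  have a2 : 2 ^ n1 * (8 * s) = 8 * z := by rw [hz]; ring
  rw [a2]
  have b1 : 0 ≤ κ * C1 := by positivity
  have b2 : 0 ≤ κ * C2 := by positivity
  have a3 := mul_le_left a1 b2
  have a4 := mul_nonneg b1 hM0
  have a5 := mul_nonneg b2 hM0
  linarith

end

lemma le_mul_of_forall_ofReal {X S : ℝ≥0∞} {Q : ℝ} (hQ : 0 ≤ Q) (h : ∀ s : ℝ, 0 ≤ s → S ≤ ofReal s →
    X ≤ ofReal (Q * s)) : X ≤ ((Q + 1).toNNReal : ℝ≥0) * S := by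
  have e : (((Q + 1).toNNReal : ℝ≥0) : ℝ≥0∞) = ofReal (Q + 1) := rfl
  rw [e]
  rcases eq_or_ne S ⊤ with rfl | hS
  · rw [ENNReal.mul_top (by simp; linarith)]
    exact le_top
  · refine (h _ ENNReal.toReal_nonneg (ENNReal.ofReal_toReal hS).ge).trans ?_
    rw [ofReal_mul hQ, ENNReal.ofReal_toReal hS]
    exact mul_le_mul_left (ofReal_le_ofReal (by linarith)) _

lemma ZeroResolventBound.mono {ρ : ℝ → ℝ} {R0 : ℝ} {g : Metric4} {C C' : ℝ≥0} (hC : C ≤ C') (h :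
    ZeroResolventBound ρ R0 g s m C τ) : ZeroResolventBound ρ R0 g s m C' τ :=
  fun F G hF hA h0 h1 => (h F G hF hA h0 h1).trans (mul_le_mul_left (ENNReal.coe_le_coe.2 hC) _)

section

variable {ρ : ℝ → ℝ} {R0 : ℝ} {g g0 : Metric4} {α : ℝ → ℝ} {n0 : ℕ}

lemma IsSmoothTwoForm.smoothCov (hF : IsSmoothTwoForm R0 F) (hR : R0 ≤ b) : SmoothCov b F :=
  fun a p hp => hF.smooth a p ⟨hp.1, hR.trans (le_of_lt hp.2)⟩

lemma IsSmoothTwoForm.antiOuter (hF : IsSmoothTwoForm R0 F) (hR : R0 ≤ b) : AntiOuter b F :=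
  fun α β p hp => hF.antisymm α β p ⟨hp.1, hR.trans (le_of_lt hp.2)⟩

lemma FarShells.exists_dyadicNorm_le (h : FarShells ρ R0 b n0) (hF : SmoothCov b F) (ht : 0 ≤ τ) (hA :
    Admissible ρ R0 m τ F) : ∃ B, ∀ n ≥ n0, dyadicNorm m τ (-1) n F ≤ B :=
  ⟨8 * (normLE ρ (region R0) 0 m τ F).toReal, fun n hn =>
    h.dyadicNorm_le hF ht hn (by decide) ENNReal.toReal_nonneg <| by
      rw [ENNReal.ofReal_toReal hA.finite.ne]
      exact shellSum_le_normLE (s := 0) h.bracket⟩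

lemma FarShells.sum_pair_le (h : FarShells ρ R0 b n0) (hT : SmoothCov b T) (hT' : SmoothCov b T') (ht : 0 ≤ τ)
    (hj : (2 * s + 1).natAbs ≤ 3) {x : ℝ} (hx0 : 0 ≤ x) (hx : normLEstar ρ (region R0) s m τ T ≤
    ofReal x) (hx' : normLEstar ρ (region R0) s m τ T' ≤ ofReal x) (hn : n0 ≤ n) (l : ℕ) :
    ∑ i ∈ Ico n l, (dyadicNorm m τ (2 * s + 1) i T + dyadicNorm m τ (2 * s + 1) i T') ≤ 16 * x := by
  rw [sum_add_distrib]
  have h1 := h.sum_dyadicNorm_le hT ht hn hj hx0 hx l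
  have h2 := h.sum_dyadicNorm_le hT' ht hn hj hx0 hx' l
  linarith

lemma normLEstar_mono (hρ : IsBracket ρ) {D : Set Space} (h : s ≤ s') : normLEstar ρ D s m τ T ≤
    normLEstar ρ D s' m τ T := by
  rw [normLEstar_eq hρ, normLEstar_eq hρ]
  exact ENNReal.tsum_le_tsum fun n => shellSum_mono hρ (by lia)

/-- The estimate with the weight `⟨r⟩⁻¹` implies the one without weight. -/
lemma StarAsymptotics.unweighted_of_weighted (h : StarAsymptotics b g g0 α) (hρ : IsBracket ρ) (hR : R0 ≤ b)
    (hb : ∀ r, b ≤ r → ρ r = r) (m : ℕ) (C : ℝ≥0) : ∃ C' : ℝ≥0, ∀ τ, 0 ≤ τ → ZeroResolventBound ρ R0 g (-1)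
    m C τ → ZeroResolventBound ρ R0 g 0 m C' τ := by
  obtain ⟨N, A, hA0, hext⟩ := h.exterior m
  obtain ⟨N', hfar⟩ := hρ.exists_farShells hR hb
  set n0 := max N N' with hn0
  obtain ⟨J, D, hD, hE⟩ := hext n0 (le_max_left _ _) 1 one_pos
  have hf := hfar n0 (le_max_right _ _)
  set K : ℝ := ((compCount m 2 : ℕ) : ℝ) with hK
  have hK0 : 0 ≤ K := Nat.cast_nonneg _
  set P : ℝ := 2 ^ (n0 + 1) with hP
  have hP0 : 0 ≤ P := by positivity
  set Q : ℝ := P * C + K * 8 * (A * (16 + 8 * (P * C))) with hQ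
  have hQ0 : 0 ≤ Q := by positivity
  refine ⟨_, fun τ ht hw F G hF hA h0 h1 => le_mul_of_forall_ofReal (Q := K * Q + C) (by positivity)
    fun s hs hS => ?_⟩
  have sF := hF.smoothCov hR
  have aF := hF.antiOuter hR
  rw [Fin.sum_univ_two, h0, h1] at hS
  have hG0 := (le_self_add.trans le_self_add).trans hS
  have hG1 := (le_self_add.trans le_add_self).trans hS
  have hU : normLE ρ (region R0) (-1) m τ F + normLE ρ (region R0) 1 m τ (radial2 F) ≤
      ofReal (C * s) := by
    refine (hw F G hF hA h0 h1).trans ?_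
    rw [ofReal_mul C.coe_nonneg, ENNReal.ofReal_coe_nnreal, Fin.sum_univ_two, h0, h1]
    exact mul_le_mul_right ((add_le_add (add_le_add (normLEstar_mono hρ (by norm_num)) le_rfl)
      (add_le_add (normLEstar_mono hρ (by norm_num)) le_rfl)).trans hS) _
  have near : ∀ n, n ≤ n0 → shellSum ρ (region R0) m τ (-1) n F ≤ ofReal (P * (C * s)) :=
    fun n hn => by
      rw [show (-1 : ℤ) = 2 * -1 - 1 + 2 by norm_num]
      refine (shellSum_add_two_le hρ (measurableSet_region R0)).trans ?_
      rw [ofReal_mul hP0]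
      exact mul_le_mul' (ofReal_le_ofReal (two_pow_le (by lia)))
        ((shellSum_le_normLE hρ _).trans (le_self_add.trans hU))
  have hs' : 0 ≤ P * (C * s) := by positivity
  have hN0 := hf.dyadicNorm_le sF ht le_rfl (by decide) hs' (near n0 le_rfl)
  obtain ⟨B, hB⟩ := hf.exists_dyadicNorm_le sF ht hA
  have far := (hE F τ B (16 * s) ht sF aF hB).1 (hf.sum_pair_le (s := 0) (smooth_extD0 sF)
    (smooth_extD0 (smooth_hodge h.near_mink sF)) ht (by decide) hs hG0 hG1 le_rfl)
  have hall : ∀ n, shellSum ρ (region R0) m τ (2 * 0 - 1) n F ≤ ofReal (Q * s) := fun n => by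
    have q1 : P * (C * s) ≤ Q * s := by
      rw [hQ, add_mul, mul_assoc P]
      exact le_add_of_nonneg_right (by positivity)
    rcases le_total n n0 with hn | hn
    · exact (near n hn).trans (ofReal_le_ofReal q1)
    · refine (hf.shellSum_le sF ht hn (by decide) ((far n hn).trans (mul_le_left
        (add_le_add le_rfl hN0) hA0))).trans (ofReal_le_ofReal ?_)
      have : K * 8 * (A * (16 * s + 8 * (P * (C * s)))) = K * 8 * (A * (16 + 8 * (P * C))) * s := by ring
      rw [hQ, add_mul, ← hK, this]
      exact le_add_of_nonneg_left (by positivity)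
  refine (add_le_add (normLE_le hρ 0 hall) (le_add_self.trans hU)).trans ?_
  rw [← ENNReal.ofReal_natCast, ← hK, ← ofReal_mul hK0, ← ofReal_add (by positivity)
    (by positivity)]
  exact ofReal_le_ofReal (by linarith)

set_option maxHeartbeats 1000000 in
/-- The estimate without weight implies the one with the weight `⟨r⟩⁻¹`. -/
lemma StarAsymptotics.weighted_of_unweighted (h : StarAsymptotics b g g0 α) (hρ : IsBracket ρ) (hR : R0 ≤ b)
    (hb : ∀ r, b ≤ r → ρ r = r) (m : ℕ) (C : ℝ≥0) : ∃ C' : ℝ≥0, ∀ τ, 0 ≤ τ →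
    ZeroResolventBound ρ R0 g 0 m C τ → ZeroResolventBound ρ R0 g (-1) m C' τ := by
  obtain ⟨N, A, hA0, hext⟩ := h.exterior m
  obtain ⟨N', hfar⟩ := hρ.exists_farShells hR hb
  obtain ⟨c, hc, hcut⟩ := cut_source h.one_le m
  obtain ⟨ch, hch, hhodge⟩ := h.absSum_hodge_le m
  obtain ⟨Cr, hCr, hrad⟩ := h.radial_bound m
  set n0 := max N N' with hn0
  have hf := hfar n0 (le_max_right _ _)
  set E₁ : ℝ := 16 * C * c * (1 + ch) with hE₁
  have hE₁0 : 0 ≤ E₁ := by positivity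
  obtain ⟨J, D, hD, hE⟩ := hext n0 (le_max_left _ _) (1 / (2 * (E₁ + 1))) (by positivity)
  set K : ℝ := ((compCount m 2 : ℕ) : ℝ) with hK
  have hK0 : 0 ≤ K := Nat.cast_nonneg _
  set P : ℝ := 2 ^ (n0 + J) with hP
  set E₃ : ℝ := 2 * (16 * (E₁ * D) + 16 * C * c * (P + 16 * Cr)) with hE₃
  have hE₃0 : 0 ≤ E₃ := by positivity
  set Q₁ : ℝ := E₃ + K * 8 * (A * (16 + E₃)) with hQ₁
  set Q₂ : ℝ := E₃ + K * 8 * (Cr * (16 + A * (16 + E₃))) with hQ₂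
  have hQ₁0 : 0 ≤ Q₁ := by positivity
  have hQ₂0 : 0 ≤ Q₂ := by positivity
  refine ⟨_, fun τ ht hw F G hF hA h0 h1 => le_mul_of_forall_ofReal (Q := K * Q₁ + K * Q₂) (by positivity)
    fun s hs hS => ?_⟩
  have sF := hF.smoothCov hR
  have aF := hF.antiOuter hR
  have sH := smooth_hodge h.near_mink sF
  have hb1 := h.one_le
  rw [Fin.sum_univ_two, h0, h1] at hS
  have hG0 := (le_self_add.trans le_self_add).trans hS
  have hG1 := (le_self_add.trans le_add_self).trans hS
  have hR0 := (le_add_self.trans le_self_add).trans hS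
  have hR1 := (le_add_self.trans le_add_self).trans hS
  obtain ⟨B, hB⟩ := hf.exists_dyadicNorm_le sF ht hA
  obtain ⟨hfar3, n1, hn1, hnJ, hsmall⟩ := (hE F τ B (16 * s) ht sF aF hB).2 (hf.sum_pair_le (s := -1)
    (smooth_extD0 sF) (smooth_extD0 sH) ht (by decide) hs hG0 hG1 le_rfl)
  have hrad' := fun n (hn : n0 ≤ n) => hrad F τ B ht sF aF (by
    filter_upwards [eventually_ge_atTop n0] with L hL
    have := hB L hL
    rwa [dyadicNorm_neg_one, inv_mul_le_iff₀ (by positivity)] at this) (hf.tendsto_radial hb1 sF ht hA) n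
    (16 * s) (hf.lt.trans_le (two_pow_le hn)) fun l => by
      have := hf.sum_pair_le (s := 1) (smooth_radial3 hb1 (smooth_extD0 sF))
        (smooth_radial3 hb1 (smooth_extD0 sH)) ht (by decide) hs hR0 hR1 hn l
      rw [show (2 * 1 + 1 : ℤ) = 3 by norm_num] at this
      simpa only [dyadicNorm_three, mul_add] using this
  simp only [← dyadicNorm_one, ← dyadicNorm_neg_three] at hrad'
  set N₀ := dyadicNorm m τ (-1) n0 F with hN₀
  set N₁ := dyadicNorm m τ (-1) n1 F with hN₁
  have hN₁0 : 0 ≤ N₁ := dyadicNorm_nonneg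
  have hHodge : dyadicNorm m τ (-1) n1 (hodge g F) ≤ ch * N₁ := by
    have := shellNorm_absSum_le (m := m) (n := n1) (T := hodge g F) sF sF ht
      (hf.lt.trans_le (two_pow_le hn1.le)) hch le_rfl fun x _ hx => by
        simpa using hhodge F sF _ hx
    rw [zero_mul, add_zero] at this
    rw [hN₁, dyadicNorm_neg_one, dyadicNorm_neg_one, mul_left_comm]
    exact mul_le_left this (by positivity)
  set M := (1 + ch) * N₁ + Cr * (16 * s) with hM
  have hM0 : 0 ≤ M := by positivity
  have m1 : N₁ ≤ M ∧ ch * N₁ ≤ M ∧ Cr * (16 * s) ≤ M := by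
    have : 0 ≤ ch * N₁ := by positivity
    have : 0 ≤ Cr * (16 * s) := by positivity
    refine ⟨?_, ?_, ?_⟩ <;> linarith
  have t1 := hcut ρ R0 n0 n1 F τ s M hf hn1.le ht hs sF aF hG0 hR0 m1.1 ((hrad' n1 hn1.le).2.1.trans m1.2.2)
  have t2 := hcut ρ R0 n0 n1 (hodge g F) τ s M hf hn1.le ht hs sH antiOuter_hodge hG1 hR1
    (hHodge.trans m1.2.1) ((hrad' n1 hn1.le).2.2.trans m1.2.2)
  set u : ℝ := C * (2 * (c * (P * s + M))) with hu
  have hP0 : (2 : ℝ) ^ n1 ≤ P := two_pow_le hnJ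
  have hU : normLE ρ (region R0) 0 m τ (cutForm n1 F) +
      normLE ρ (region R0) 1 m τ (radial2 (cutForm n1 F)) ≤ ofReal u := by
    have := hw (cutForm n1 F) ![extD0 (cutForm n1 F), extD0 (hodge g (cutForm n1 F))] (hF.cutForm n1)
      (hf.admissible_cutForm hb1 hn1.le sF ht hA) rfl rfl
    rw [Fin.sum_univ_two] at this
    refine this.trans ?_
    simp only [cons_val_zero, cons_val_one, hodge_cutForm]
    rw [hu, ofReal_mul C.coe_nonneg, ENNReal.ofReal_coe_nnreal, two_mul,
      ofReal_add (by positivity) (by positivity)]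
    have q : c * (2 ^ n1 * s + M) ≤ c * (P * s + M) := by gcongr
    exact mul_le_mul_right (add_le_add (t1.trans (ofReal_le_ofReal q))
      (t2.trans (ofReal_le_ofReal q))) _
  have hu0 : 0 ≤ u := by positivity
  have hcF := isCutoff_cutForm n1 F
  have near : ∀ n, n < n1 → shellSum ρ (region R0) m τ (-1) n F ≤ ofReal u := fun n hn => by
    rw [← hcF.shellSum_of_lt hf hn1.le hn]
    exact (shellSum_le_normLE hρ 0).trans (le_self_add.trans hU)
  have nearR : ∀ n, n < n1 → shellSum ρ (region R0) m τ 1 n (radial2 F) ≤ ofReal u := fun n hn => by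
    rw [← (isCutoff_cutForm n1 (radial2 F)).shellSum_of_lt hf hn1.le hn, ← radial2_cutForm]
    exact (shellSum_le_normLE hρ 1).trans (le_add_self.trans hU)
  have hN0 := hf.dyadicNorm_le sF ht le_rfl (by decide) hu0 (near n0 hn1)
  have e8 : 8 * u = E₁ * N₁ + 16 * C * c * (P + 16 * Cr) * s := by rw [hu, hM, hE₁]; ring
  have hε : E₁ * N₁ ≤ N₀ / 2 + E₁ * (D * (16 * s)) := by
    have h2 := mul_le_left hsmall hE₁0
    have h3 : E₁ * (1 / (2 * (E₁ + 1)) * N₀) ≤ N₀ / 2 := by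
      rw [← mul_assoc, mul_one_div, div_mul_eq_mul_div, div_le_div_iff₀ (by positivity) two_pos]
      have : 0 ≤ N₀ := dyadicNorm_nonneg
      nlinarith
    linarith
  have k1 : N₀ ≤ E₃ * s := by rw [hE₃]; linarith
  have k2 : u ≤ E₃ * s := by
    have : 8 * u ≤ E₃ * s := by rw [hE₃] at k1 ⊢; linarith
    linarith
  have far : ∀ n ≥ n0, dyadicNorm m τ (-3) n F ≤ A * (16 + E₃) * s := fun n hn =>
    (hfar3 n hn).trans ((mul_le_left (add_le_add le_rfl k1) hA0).trans_eq (by ring))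
  have all₁ : ∀ n, shellSum ρ (region R0) m τ (2 * -1 - 1) n F ≤ ofReal (Q₁ * s) := fun n => by
    have e : Q₁ * s = E₃ * s + K * 8 * (A * (16 + E₃) * s) := by rw [hQ₁]; ring
    rw [e]
    rcases lt_or_ge n n0 with hn | hn
    · exact ((shellSum_mono hρ (by norm_num)).trans (near n (hn.trans hn1))).trans
        (ofReal_le_ofReal (k2.trans (le_add_of_nonneg_right (by positivity))))
    · exact (hf.shellSum_le sF ht hn (by decide) (far n hn)).trans
        (ofReal_le_ofReal (le_add_of_nonneg_left (by positivity)))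
  have all₂ : ∀ n, shellSum ρ (region R0) m τ (2 * 1 - 1) n (radial2 F) ≤ ofReal (Q₂ * s) :=
    fun n => by
    have e : Q₂ * s = E₃ * s + K * 8 * (Cr * (16 * s + A * (16 + E₃) * s)) := by rw [hQ₂]; ring
    rw [e]
    rcases lt_or_ge n n0 with hn | hn
    · exact (nearR n (hn.trans hn1)).trans
        (ofReal_le_ofReal (k2.trans (le_add_of_nonneg_right (by positivity))))
    · exact (hf.shellSum_le (smooth_radial2 hb1 sF) ht hn (by decide) ((hrad' n hn).1.trans
        (mul_le_left (add_le_add le_rfl (far n hn)) hCr))).trans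
        (ofReal_le_ofReal (le_add_of_nonneg_left (by positivity)))
  refine (add_le_add (normLE_le hρ (-1) all₁) (normLE_le hρ 1 all₂)).trans ?_
  rw [← ENNReal.ofReal_natCast, ← hK, ← ofReal_mul hK0, ← ofReal_mul hK0,
    ← ofReal_add (by positivity) (by positivity)]
  exact ofReal_le_ofReal (by linarith)

end

end Maxwell

end

/-- For every order `m` and constant `C` there is a constant `C'` such that on every time slice the
zero resolvent bound without weight on the nonradial part (`s = 0`), with constant `C`, implies the
one with weight `⟨r⟩⁻¹` (`s = -1`), with constant `C'`, and conversely. -/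
theorem lemma5p1 (ρ : ℝ → ℝ) (hρ : Maxwell.IsBracket ρ) (R₀ : ℝ) (g : Maxwell.Metric4)
    (hg : Maxwell.IsBackground ρ R₀ g) (m : ℕ) (C : ℝ≥0) :
    ∃ C' : ℝ≥0, ∀ t₀ : ℝ, 0 ≤ t₀ →
      (Maxwell.ZeroResolventBound ρ R₀ g 0 m C t₀ →
        Maxwell.ZeroResolventBound ρ R₀ g (-1) m C' t₀) ∧
      (Maxwell.ZeroResolventBound ρ R₀ g (-1) m C t₀ →
        Maxwell.ZeroResolventBound ρ R₀ g 0 m C' t₀) := by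
  obtain ⟨b, α, g₀, hR, hρb, h⟩ := hg.exists_asymptotics hρ
  obtain ⟨C₁, hC₁⟩ := h.weighted_of_unweighted hρ hR hρb m C
  obtain ⟨C₂, hC₂⟩ := h.unweighted_of_weighted hρ hR hρb m C
  exact ⟨C₁ ⊔ C₂, fun t₀ ht => ⟨fun hw => (hC₁ t₀ ht hw).mono le_sup_left,
    fun hw => (hC₂ t₀ ht hw).mono le_sup_right⟩⟩
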